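/- Let $K$ be a field, $Q$ a finite quiver, and $A=KQ/I$ a graded quiver algebra (paths graded by length, $I$ a graded two-sided ideal contained in $J^2$, $J$ the ideal generated by the arrows). Assume that $A$ is left and right noetherian, Koszul (the graded left module $A_0=A/\mathfrak m$, $\mathfrak m=\bigoplus_{i\ge 1}A_i$, has a linear projective resolution), and Artin–Schelter regular of global dimension $d$: $A$ has global dimension $d$; for every vertex $v$ and every $i\neq d$, $\underline{\mathrm{Ext}}^i_A(K_v,A)=0$ and $\underline{\mathrm{Ext}}^i_{A^{\mathrm{op}}}({}_vK,A)=0$, where $K_v=Ae_v/\mathfrak m e_v$ and ${}_vK=e_vA/e_v\mathfrak m$; and there are a permutation $\delta$ of the vertices and integers $n_v$ with $\underline{\mathrm{Ext}}^d_A(K_v,A)\cong{}_{\delta(v)}K(n_v)$ for all $v$. Let $A^!=KQ^{\mathrm{op}}/I^\perp$ be the quadratic dual, where $I^\perp$ is the two-sided ideal generated by the annihilator of $I_2$ in $(KQ^{\mathrm{op}})_2$ under the pairing with $\langle\alpha\beta,\gamma^{\mathrm{op}}\delta^{\mathrm{op}}\rangle=1$ if $\alpha=\delta$, $\beta=\gamma$,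 and $0$ otherwise; put $\mathfrak n=\bigoplus_{i\ge1}A^!_i$. Write $M(n)_i=M_{n+i}$ for the shift of a graded module. All modules are graded left modules. For a bounded complex $N^\bullet$ of finitely generated graded $A^!$-modules, let $\mathcal F(N^\bullet)=A\otimes_{A_0}N^\bullet$ be the total complex with $$\mathcal F(N^\bullet)^p=\bigoplus_{i+j=p}A\otimes_{A_0}N^i_j\quad(A_l\otimes_{A_0} N^i_j\text{ in degree }l-j),$$ with differential $d''+(-1)^id'$ on the summand $(i,j)$, where $d'(a\otimes x)=\sum_{\alpha}a\alpha\otimes\alpha^{\mathrm{op}}x$ (sum over the arrows) and $d''(a\otimes x)=a\otimes\partial x$. For a bounded complex $M^\bullet$ of finitely generated graded $A$-modules, let $\mathcal G(M^\bullet)=\mathrm{Hom}_{A_0}(A^!,M^\bullet)$ be the total complex with $$\mathcal G(M^\bullet)^p=\bigoplus_{i+j=p}\mathrm{Hom}_{A_0}(A^!,M^i_j)\quad(\mathrm{Hom}_{A_0}(A^!_l,M^i_j)\text{ in degree }-l-j),$$ with $A^!$-action $(bf)(x)=f(xb)$ and differential $d''+(-1)^id'$, where $d'(f)(x)=\sum_\alpha\alpha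 f(\alpha^{\mathrm{op}}x)$ and $d''(f)=\partial\circ f$. A module is regarded as a complex in degree $0$; $\mathcal H(C^\bullet)$ denotes the complex with terms $H^i(C^\bullet)$ and zero differentials; $C^\bullet[-l]^i=C^{i-l}$. Let $C^\bullet$ be a minimal resolution of a complex $X^\bullet$, as follows. For projective resolutions over $A$: a right bounded complex of finitely generated projectives with $d(C^i)\subseteq\mathfrak m C^{i+1}$ and a quasi-isomorphism $C^\bullet\to X^\bullet$. For injective resolutions over $A^!$: a left bounded complex of finitely generated injectives with $d(C^i)\subseteq\mathfrak nC^{i+1}$ and a quasi-isomorphism $X^\bullet\to C^\bullet$. Decompose $C^i=\bigoplus_{j}C^{i,j}$, where every indecomposable summand of $C^{i,j}$ is isomorphic to a summand of $A(-j)$ in the projective case, and of $A^!(d-j)$ (whose socle is concentrated in degree $j$) in the injective case. The $l$-linear strand $\mathrm{proj.lin}_l(X^\bullet)$, respectively $\mathrm{inj.lin}_l(X^\bullet)$, is the complex with terms $C^{i,l-i}$, with differential $C^{i,l-i}\to C^{i+1,l-i-1}$ the corresponding component of the differential of $C^\bullet$; and $\mathrm{proj.lin}=\bigoplus_l\mathrm{proj.lin}_l$,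 $\mathrm{inj.lin}=\bigoplus_l\mathrm{inj.lin}_l$. Proposition. Let $N^\bullet$ be a bounded complex of finitely generated graded $A^!$-modules and $M^\bullet$ a bounded complex of finitely generated graded $A$-modules. Then $\mathcal F(N^\bullet)$ has a minimal projective resolution, $\mathcal G(M^\bullet)$ has a minimal injective resolution, and these admit decompositions as above. For every choice of these resolutions and decompositions, and every integer $l$, there are isomorphisms of complexes of graded modules $$\mathrm{proj.lin}_l(\mathcal F(N^\bullet))\cong\mathcal F(H^l(N^\bullet))[-l],\qquad \mathrm{inj.lin}_l(\mathcal G(M^\bullet))\cong\mathcal G(H^l(M^\bullet))[-l],$$ and there are isomorphisms $$\mathrm{proj.lin}(\mathcal F(N^\bullet))\cong\mathcal F(\mathcal H(N^\bullet)),\qquad \mathrm{inj.lin}(\mathcal G(M^\bullet))\cong\mathcal G(\mathcal H(M^\bullet)).$$ -/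

import Mathlib

set_option linter.unusedSectionVars false

universe u

open CategoryTheory Opposite
open scoped DirectSum TensorProduct

noncomputable section

namespace KoszulDuality

/-! ### Graded modules -/

section GradedModules

variable {K : Type u} [Field K] {B : Type u} [Ring B] [Algebra K B]

/-- `𝓑` is a grading of the algebra `B` with nothing in negative degrees. -/
class NonnegGraded (𝓑 : ℤ → Submodule K B) : Prop extends SetLike.GradedMonoid 𝓑 where
  eq_bot : ∀ l : ℤ, l < 0 → 𝓑 l = ⊥

/-- A graded left module over a graded `K`-algebra `B = ⨁ B_l`: a family of `K`-vector spaces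
`M_i`, `i ∈ ℤ`, with an associative and unital action `B_l × M_i → M_{l + i}`. -/
structure GrMod (𝓑 : ℤ → Submodule K B) [NonnegGraded 𝓑] where
  /-- The homogeneous components. -/
  obj : ℤ → Type u
  [grp : ∀ i, AddCommGroup (obj i)]
  [mod : ∀ i, Module K (obj i)]
  /-- The action of the degree `l` component of `B`. -/
  act : ∀ l i j : ℤ, l + i = j → 𝓑 l →ₗ[K] obj i →ₗ[K] obj j
  one_act : ∀ (i : ℤ) (x : obj i),
    act 0 i i (zero_add i) ⟨1, SetLike.GradedOne.one_mem⟩ x = x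
  mul_act : ∀ (l m i j k : ℤ) (h : m + i = j) (h' : l + j = k) (a : 𝓑 l) (b : 𝓑 m) (x : obj i),
    act (l + m) i k (by omega) ⟨a * b, SetLike.GradedMul.mul_mem a.2 b.2⟩ x =
      act l j k h' a (act m i j h b x)

attribute [instance] GrMod.grp GrMod.mod

variable {𝓑 : ℤ → Submodule K B} [NonnegGraded 𝓑]

namespace GrMod

/-- The degree preserving `B`-linear maps, as a subspace of the families of `K`-linear maps. -/
def homSub (M N : GrMod 𝓑) : Submodule K (∀ i, M.obj i →ₗ[K] N.obj i) where
  carrier := {f | ∀ (l i j : ℤ) (h : l + i = j) (a : 𝓑 l) (x : M.obj i),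
    f j (M.act l i j h a x) = N.act l i j h a (f i x)}
  add_mem' := fun hf hg l i j h a x => by simp [hf l i j h a x, hg l i j h a x]
  zero_mem' := fun l i j h a x => by simp
  smul_mem' := fun c f hf l i j h a x => by simp [hf l i j h a x]

instance : Category (GrMod 𝓑) where
  Hom M N := homSub M N
  id M := ⟨fun _ => LinearMap.id, fun _ _ _ _ _ _ => rfl⟩
  comp f g := ⟨fun i => g.1 i ∘ₗ f.1 i, fun l i j h a x => by simp [f.2 l i j h a x, g.2 l i j h a]⟩

instance (M N : GrMod 𝓑) : AddCommGroup (M ⟶ N) := inferInstanceAs (AddCommGroup (homSub M N))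
instance (M N : GrMod 𝓑) : Module K (M ⟶ N) := inferInstanceAs (Module K (homSub M N))

/-- The component of degree `i` of a morphism. -/
def app {M N : GrMod 𝓑} (f : M ⟶ N) (i : ℤ) : M.obj i →ₗ[K] N.obj i := f.1 i

/-- A morphism from its components. -/
def mkHom {M N : GrMod 𝓑} (f : ∀ i, M.obj i →ₗ[K] N.obj i)
    (hf : ∀ (l i j : ℤ) (h : l + i = j) (a : 𝓑 l) (x : M.obj i),
      f j (M.act l i j h a x) = N.act l i j h a (f i x)) : M ⟶ N := ⟨f, hf⟩

theorem app_act {M N : GrMod 𝓑} (f : M ⟶ N) (l i j : ℤ) (h : l + i = j) (a : 𝓑 l) (x : M.obj i) :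
    app f j (M.act l i j h a x) = N.act l i j h a (app f i x) := f.2 l i j h a x

@[ext]
theorem hom_ext {M N : GrMod 𝓑} {f g : M ⟶ N} (h : ∀ i x, app f i x = app g i x) : f = g :=
  Subtype.ext (funext fun i => LinearMap.ext (h i))

@[simp] theorem app_mkHom {M N : GrMod 𝓑} (f : ∀ i, M.obj i →ₗ[K] N.obj i) (hf) (i : ℤ) :
    app (mkHom (M := M) (N := N) f hf) i = f i := rfl

@[simp] theorem app_id (M : GrMod 𝓑) (i : ℤ) : app (𝟙 M) i = LinearMap.id := rfl
@[simp] theorem app_comp {M N L : GrMod 𝓑} (f : M ⟶ N) (g : N ⟶ L) (i : ℤ) (x : M.obj i) :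
    app (f ≫ g) i x = app g i (app f i x) := rfl
@[simp] theorem app_add {M N : GrMod 𝓑} (f g : M ⟶ N) (i : ℤ) :
    app (f + g) i = app f i + app g i := rfl
@[simp] theorem app_zero {M N : GrMod 𝓑} (i : ℤ) : app (0 : M ⟶ N) i = 0 := rfl
@[simp] theorem app_neg {M N : GrMod 𝓑} (f : M ⟶ N) (i : ℤ) : app (-f) i = -app f i := rfl
@[simp] theorem app_smul {M N : GrMod 𝓑} (c : K) (f : M ⟶ N) (i : ℤ) :
    app (c • f) i = c • app f i := rfl

instance : Preadditive (GrMod 𝓑) where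
  add_comp _ _ _ f f' g := by ext i x; simp
  comp_add _ _ _ f g g' := by ext i x; simp

instance : Linear K (GrMod 𝓑) where
  smul_comp _ _ _ r f g := by ext i x; simp
  comp_smul _ _ _ f r g := by ext i x; simp

variable (𝓑) in
/-- The zero module. -/
def zero : GrMod 𝓑 where
  obj _ := PUnit
  act _ _ _ _ := 0
  one_act _ _ := rfl
  mul_act _ _ _ _ _ _ _ _ _ _ := rfl

instance : Limits.HasZeroObject (GrMod 𝓑) :=
  ⟨zero 𝓑, ⟨fun _ => ⟨⟨⟨0⟩, fun f => hom_ext fun i _ => (map_zero (app f i) :)⟩⟩,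
    fun _ => ⟨⟨⟨0⟩, fun _ => hom_ext fun _ _ => rfl⟩⟩⟩⟩

/-- The shift `M(n)`, with `M(n)_i = M_{n + i}`. -/
def shift (M : GrMod 𝓑) (n : ℤ) : GrMod 𝓑 where
  obj i := M.obj (n + i)
  act l i j h := M.act l (n + i) (n + j) (by omega)
  one_act i x := M.one_act (n + i) x
  mul_act l m i j k h h' a b x :=
    M.mul_act l m (n + i) (n + j) (n + k) (by omega) (by omega) a b x

variable (𝓑) in
/-- The algebra `B` as a graded left module over itself. -/
def regular : GrMod 𝓑 where
  obj i := 𝓑 i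
  act l i j h := LinearMap.mk₂ K
    (fun a x => ⟨a * x, h ▸ SetLike.GradedMul.mul_mem a.2 x.2⟩)
    (fun a a' x => Subtype.ext (by simp [add_mul]))
    (fun c a x => Subtype.ext (by simp))
    (fun a x x' => Subtype.ext (by simp [mul_add]))
    (fun c a x => Subtype.ext (by simp))
  one_act i x := Subtype.ext (by simp)
  mul_act l m i j k h h' a b x := Subtype.ext (by simp [mul_assoc])

/-- The direct sum of a family of graded modules. -/
def dirSum {ι : Type} (M : ι → GrMod 𝓑) : GrMod 𝓑 where
  obj j := ⨁ i, (M i).obj j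
  act l j k h := LinearMap.mk₂ K (fun a x => DirectSum.lmap (fun i => (M i).act l j k h a) x)
    (fun a a' x => DFinsupp.ext fun i => by
      simp only [DirectSum.lmap_apply, DirectSum.add_apply, map_add, LinearMap.add_apply])
    (fun c a x => DFinsupp.ext fun i => by
      simp only [DirectSum.lmap_apply, DirectSum.smul_apply, map_smul, LinearMap.smul_apply])
    (fun a x x' => map_add _ _ _)
    (fun c a x => map_smul _ _ _)
  one_act j x := DFinsupp.ext fun i => (M i).one_act j _
  mul_act l m i j k h h' a b x := DFinsupp.ext fun t => (M t).mul_act l m i j k h h' a b _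

section
variable {ι : Type} [DecidableEq ι]

/-- The inclusion of a summand. -/
def incl (M : ι → GrMod 𝓑) (i : ι) : M i ⟶ dirSum M :=
  mkHom (fun j => DirectSum.lof K ι (fun i => (M i).obj j) i) fun l j k h a x =>
    (DirectSum.lmap_lof (R := K) (fun i => (M i).act l j k h a) i x).symm

/-- The projection to a summand. -/
def proj (M : ι → GrMod 𝓑) (i : ι) : dirSum M ⟶ M i :=
  mkHom (fun j => DirectSum.component K ι (fun i => (M i).obj j) i) fun _ _ _ _ _ _ => rfl

/-- The morphism from a direct sum given by its restrictions to the summands. -/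
def desc (M : ι → GrMod 𝓑) {N : GrMod 𝓑} (f : ∀ i, M i ⟶ N) : dirSum M ⟶ N :=
  mkHom (fun j => DirectSum.toModule K ι (N.obj j) fun i => app (f i) j) fun l j k h a x =>
    LinearMap.congr_fun (f := DirectSum.toModule K ι (N.obj k) (fun i => app (f i) k) ∘ₗ
        DirectSum.lmap (fun i => (M i).act l j k h a))
      (g := N.act l j k h a ∘ₗ DirectSum.toModule K ι (N.obj j) (fun i => app (f i) j))
      (DirectSum.linearMap_ext K fun i => LinearMap.ext fun y => by
        simp [DirectSum.toModule_lof, app_act]) x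

@[simp]
theorem incl_desc (M : ι → GrMod 𝓑) {N : GrMod 𝓑} (f : ∀ i, M i ⟶ N) (i : ι) :
    incl M i ≫ desc M f = f i :=
  hom_ext fun j x => DirectSum.toModule_lof K (φ := fun i => app (f i) j) i x

@[simp]
theorem incl_desc_assoc (M : ι → GrMod 𝓑) {N L : GrMod 𝓑} (f : ∀ i, M i ⟶ N) (i : ι)
    (g : N ⟶ L) : incl M i ≫ desc M f ≫ g = f i ≫ g := by
  rw [← Category.assoc, incl_desc]

theorem dirSum_hom_ext {M : ι → GrMod 𝓑} {N : GrMod 𝓑} {f g : dirSum M ⟶ N}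
    (h : ∀ i, incl M i ≫ f = incl M i ≫ g) : f = g :=
  hom_ext fun j x => LinearMap.congr_fun (DirectSum.linearMap_ext (M := fun i => (M i).obj j)
    (N := N.obj j) (ψ := app f j) (ψ' := app g j)
    K fun i => LinearMap.ext fun y => LinearMap.congr_fun (congrArg (fun t => app t j) (h i)) y) x

/-- The direct sum of a family of morphisms. -/
def dirSumMap {M N : ι → GrMod 𝓑} (f : ∀ i, M i ⟶ N i) : dirSum M ⟶ dirSum N :=
  desc M fun i => f i ≫ incl N i

end

/-! ### Graded submodules, quotients, cohomology -/

/-- A graded submodule of `M`. -/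
structure Sub (M : GrMod 𝓑) where
  /-- The homogeneous components. -/
  carrier : ∀ i, Submodule K (M.obj i)
  act_mem : ∀ (l i j : ℤ) (h : l + i = j) (a : 𝓑 l) (x : M.obj i), x ∈ carrier i →
    M.act l i j h a x ∈ carrier j

namespace Sub

/-- A graded submodule as a graded module. -/
def toMod {M : GrMod 𝓑} (S : Sub M) : GrMod 𝓑 where
  obj i := S.carrier i
  act l i j h := LinearMap.mk₂ K (fun a x => ⟨M.act l i j h a x, S.act_mem l i j h a x x.2⟩)
    (fun a a' x => Subtype.ext (by simp))
    (fun c a x => Subtype.ext (by simp))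
    (fun a x x' => Subtype.ext (by simp))
    (fun c a x => Subtype.ext (by simp))
  one_act i x := Subtype.ext (M.one_act i x)
  mul_act l m i j k h h' a b x := Subtype.ext (M.mul_act l m i j k h h' a b x)

/-- The quotient `M / S`. -/
def quot {M : GrMod 𝓑} (S : Sub M) : GrMod 𝓑 where
  obj i := M.obj i ⧸ S.carrier i
  act l i j h := LinearMap.mk₂ K
    (fun a x => (S.carrier i).mapQ (S.carrier j) (M.act l i j h a)
      (fun x hx => S.act_mem l i j h a x hx) x)
    (fun a a' x => by
      induction x using Submodule.Quotient.induction_on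
      simp only [Submodule.mapQ_apply, map_add, LinearMap.add_apply, Submodule.Quotient.mk_add])
    (fun c a x => by
      induction x using Submodule.Quotient.induction_on
      simp only [Submodule.mapQ_apply, map_smul, LinearMap.smul_apply, Submodule.Quotient.mk_smul])
    (fun a x x' => map_add _ _ _)
    (fun c a x => map_smul _ _ _)
  one_act i x := by
    induction x using Submodule.Quotient.induction_on with
    | H x => exact congrArg (Submodule.Quotient.mk (p := S.carrier i)) (M.one_act i x)
  mul_act l m i j k h h' a b x := by
    induction x using Submodule.Quotient.induction_on with
    | H x =>
      exact congrArg (Submodule.Quotient.mk (p := S.carrier k)) (M.mul_act l m i j k h h' a b x)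

/-- The kernel of a morphism. -/
def ker {M N : GrMod 𝓑} (f : M ⟶ N) : Sub M where
  carrier i := LinearMap.ker (app f i)
  act_mem l i j h a x hx := by
    rw [LinearMap.mem_ker] at hx ⊢
    rw [app_act, hx, map_zero]

/-- The image of a morphism. -/
def range {M N : GrMod 𝓑} (f : M ⟶ N) : Sub N where
  carrier i := LinearMap.range (app f i)
  act_mem l i j h a x hx := by
    obtain ⟨y, rfl⟩ := hx
    exact ⟨M.act l i j h a y, app_act f l i j h a y⟩

/-- The graded submodule `S ∩ T` of `T`. -/
def within {M : GrMod 𝓑} (S T : Sub M) : Sub T.toMod where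
  carrier i := (S.carrier i).submoduleOf (T.carrier i)
  act_mem l i j h a x hx := S.act_mem l i j h a x.1 hx

end Sub

/-- The graded submodule `𝔪 M`, where `𝔪 = ⨁_{l ≥ 1} B_l`. -/
def rad (M : GrMod 𝓑) : Sub M where
  carrier j := Submodule.span K
    {y | ∃ (l i : ℤ) (h : l + i = j) (a : 𝓑 l) (x : M.obj i), 1 ≤ l ∧ y = M.act l i j h a x}
  act_mem l i j h a x hx := by
    refine Submodule.span_induction ?_ ?_ ?_ ?_ hx
    · rintro _ ⟨m, i', h', b, y, hm, rfl⟩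
      rcases lt_or_ge l 0 with hl | hl
      · have ha : a = 0 := Subtype.ext ((Submodule.mem_bot K).1 (NonnegGraded.eq_bot (𝓑 := 𝓑) l hl ▸ a.2))
        rw [ha, map_zero, LinearMap.zero_apply]
        exact Submodule.zero_mem _
      · rw [← M.mul_act l m i' i j h' h a b y]
        exact Submodule.subset_span ⟨l + m, i', _, _, y, by omega, rfl⟩
    · rw [map_zero]; exact Submodule.zero_mem _
    · intro x y _ _ hx hy
      rw [map_add]; exact Submodule.add_mem _ hx hy
    · intro c x _ hx
      rw [map_smul]; exact Submodule.smul_mem _ _ hx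

/-- `M / 𝔪 M`. -/
def top (M : GrMod 𝓑) : GrMod 𝓑 := (rad M).quot

/-- `M` is finitely generated: it is generated by finitely many homogeneous elements. -/
def IsFG (M : GrMod 𝓑) : Prop :=
  ∃ (n : ℕ) (deg : Fin n → ℤ) (g : ∀ t, M.obj (deg t)), ∀ j : ℤ,
    Submodule.span K {y | ∃ (t : Fin n) (l : ℤ) (h : l + deg t = j) (a : 𝓑 l),
      y = M.act l (deg t) j h a (g t)} = ⊤

/-- The cohomology `H^l(C)` of a complex of graded modules. -/
def cohomology (C : CochainComplex (GrMod 𝓑) ℤ) (l : ℤ) : GrMod 𝓑 :=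
  ((Sub.range (C.d (l - 1) l)).within (Sub.ker (C.d l (l + 1)))).quot

/-- The map induced on the degree `j` component of `H^l` by a morphism of complexes. -/
def cohomologyMap {C D : CochainComplex (GrMod 𝓑) ℤ} (f : C ⟶ D) (l j : ℤ) :
    (cohomology C l).obj j →ₗ[K] (cohomology D l).obj j :=
  Submodule.mapQ _ _
    ((app (f.f l) j).restrict (p := LinearMap.ker (app (C.d l (l + 1)) j))
      (q := LinearMap.ker (app (D.d l (l + 1)) j)) fun x hx => by
        rw [LinearMap.mem_ker] at hx ⊢
        rw [← app_comp, f.comm, app_comp, hx, map_zero])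
    (by
      rintro x ⟨y, hy⟩
      refine ⟨app (f.f (l - 1)) j y, ?_⟩
      rw [← app_comp, f.comm, app_comp, hy]
      rfl)

/-- `f` is a quasi-isomorphism. -/
def IsQuasiIso {C D : CochainComplex (GrMod 𝓑) ℤ} (f : C ⟶ D) : Prop :=
  ∀ l j, Function.Bijective (cohomologyMap f l j)

/-- The complex `𝓗(C)` with `𝓗(C)^i = H^i(C)` and zero differentials. -/
def cohomologyComplex (C : CochainComplex (GrMod 𝓑) ℤ) : CochainComplex (GrMod 𝓑) ℤ :=
  CochainComplex.of (cohomology C) (fun _ => 0) (fun _ => Limits.comp_zero)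

/-- A module regarded as a complex concentrated in degree `0`. -/
def inDegZero (M : GrMod 𝓑) : CochainComplex (GrMod 𝓑) ℤ :=
  (HomologicalComplex.single (GrMod 𝓑) (ComplexShape.up ℤ) 0).obj M

/-- `C` is an object of `C^b(gr B)`: a bounded complex of finitely generated graded modules. -/
def IsBoundedFG (C : CochainComplex (GrMod 𝓑) ℤ) : Prop :=
  (∀ i, IsFG (C.X i)) ∧ ∃ a b : ℤ, ∀ i, i < a ∨ b < i → Limits.IsZero (C.X i)

/-- `π : P ⟶ C` is a projective resolution of `C` in `gr B`. -/
structure IsProjRes {P C : CochainComplex (GrMod 𝓑) ℤ} (π : P ⟶ C) : Prop where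
  fg : ∀ i, IsFG (P.X i)
  projective : ∀ i, Projective (P.X i)
  bounded : ∃ b : ℤ, ∀ i, b < i → Limits.IsZero (P.X i)
  quasiIso : IsQuasiIso π

/-- `ι : C ⟶ E` is an injective resolution of `C` in `gr B`. -/
structure IsInjRes {C E : CochainComplex (GrMod 𝓑) ℤ} (ι : C ⟶ E) : Prop where
  fg : ∀ i, IsFG (E.X i)
  injective : ∀ i, Injective (E.X i)
  bounded : ∃ b : ℤ, ∀ i, i < b → Limits.IsZero (E.X i)
  quasiIso : IsQuasiIso ι

/-- `C` is minimal: `d(C^i) ⊆ 𝔪 C^{i+1}`. -/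
def IsMinimal (C : CochainComplex (GrMod 𝓑) ℤ) : Prop :=
  ∀ (i j : ℤ) (x : (C.X i).obj j), app (C.d i (i + 1)) j x ∈ (rad (C.X (i + 1))).carrier j

/-! ### Linear strands -/

/-- A decomposition `C^i = ⨁_j C^{i,j}` of the terms of a complex such that each indecomposable
summand of `C^{i,j}` is a summand of `B(c - j)`; that is, `C^{i,j}` is a direct summand of a finite
direct sum of copies of `B(c - j)`. -/
structure LinDecomp (c : ℤ) (C : CochainComplex (GrMod 𝓑) ℤ) where
  /-- The modules `C^{i,j}`. -/
  part : ℤ → ℤ → GrMod 𝓑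
  /-- The decomposition. -/
  iso : ∀ i, C.X i ≅ dirSum (part i)
  summand : ∀ i j, ∃ n : ℕ,
    Nonempty (Retract (part i j) (dirSum fun _ : Fin n => (regular 𝓑).shift (c - j)))

/-- The component `C^{i,j} ⟶ C^{i+1,j'}` of the differential. -/
def LinDecomp.comp {c : ℤ} {C : CochainComplex (GrMod 𝓑) ℤ} (D : LinDecomp c C) (i j j' : ℤ) :
    D.part i j ⟶ D.part (i + 1) j' :=
  incl _ j ≫ (D.iso i).inv ≫ C.d i (i + 1) ≫ (D.iso (i + 1)).hom ≫ proj _ j'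

/-- A free module `B(m)^n`-retract vanishes in degrees below `-m` and is generated in degree
`-m`. -/
theorem retract_obj_eq_zero {M : GrMod 𝓑} {n : ℕ} {m : ℤ}
    (r : Retract M (dirSum fun _ : Fin n => (regular 𝓑).shift m)) {j : ℤ} (hj : j < -m)
    (x : M.obj j) : x = 0 := by
  have h : app r.i j x = 0 := DFinsupp.ext fun t => by
    refine Subtype.ext ((Submodule.mem_bot K).1 ?_)
    rw [← NonnegGraded.eq_bot (𝓑 := 𝓑) (m + j) (by omega)]
    exact Subtype.property (p := fun z => z ∈ 𝓑 (m + j)) _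
  have h2 := congrArg (fun f => app f j x) r.retract
  simp only [app_comp, app_id, LinearMap.id_apply, h, map_zero] at h2
  exact h2.symm

theorem retract_hom_ext {M N : GrMod 𝓑} {n : ℕ} {m : ℤ}
    (r : Retract M (dirSum fun _ : Fin n => (regular 𝓑).shift m)) {f : M ⟶ N}
    (hf : ∀ x : M.obj (-m), app f (-m) x = 0) : f = 0 := by
  suffices h : r.r ≫ f = 0 by
    rw [← Category.id_comp f, ← r.retract, Category.assoc, h, Limits.comp_zero]
  refine dirSum_hom_ext fun t => hom_ext fun j (x : 𝓑 (m + j)) => ?_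
  let e : ((regular 𝓑).shift m).obj (-m) :=
    ⟨1, by rw [add_neg_cancel]; exact SetLike.GradedOne.one_mem⟩
  have hx : x = ((regular 𝓑).shift m).act (m + j) (-m) j (by omega) x e :=
    Subtype.ext (mul_one x.1).symm
  rw [hx, app_act, app_act]
  simp only [app_comp, hf, map_zero, Limits.comp_zero, app_zero, LinearMap.zero_apply]

theorem app_mem_rad {M N : GrMod 𝓑} (f : M ⟶ N) {j : ℤ} {x : M.obj j}
    (hx : x ∈ (rad M).carrier j) : app f j x ∈ (rad N).carrier j := by
  refine Submodule.span_induction ?_ ?_ ?_ ?_ hx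
  · rintro _ ⟨l, i, h, a, y, hl, rfl⟩
    rw [app_act]
    exact Submodule.subset_span ⟨l, i, h, a, _, hl, rfl⟩
  · rw [map_zero]; exact Submodule.zero_mem _
  · intro x y _ _ hx hy
    rw [map_add]; exact Submodule.add_mem _ hx hy
  · intro c x _ hx
    rw [map_smul]; exact Submodule.smul_mem _ _ hx

theorem rad_eq_zero {M : GrMod 𝓑} {m : ℤ} (hM : ∀ j < m, ∀ x : M.obj j, x = 0) {j : ℤ}
    (hj : j ≤ m) {x : M.obj j} (hx : x ∈ (rad M).carrier j) : x = 0 := by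
  refine Submodule.span_induction ?_ rfl ?_ ?_ hx
  · rintro _ ⟨l, i, h, a, y, hl, rfl⟩
    rw [hM i (by omega) y, map_zero]
  · rintro x y _ _ rfl rfl
    exact add_zero _
  · rintro c x _ rfl
    exact smul_zero _

theorem LinDecomp.comp_eq_zero {c : ℤ} {C : CochainComplex (GrMod 𝓑) ℤ} (hC : IsMinimal C)
    (D : LinDecomp c C) (i j j' : ℤ) (h : j ≤ j') : D.comp i j j' = 0 := by
  obtain ⟨n, ⟨r⟩⟩ := D.summand i j
  obtain ⟨n', ⟨r'⟩⟩ := D.summand (i + 1) j'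
  refine retract_hom_ext r fun x => ?_
  refine rad_eq_zero (m := -(c - j')) (fun k hk => retract_obj_eq_zero r' hk) (by omega) ?_
  have h1 := app_mem_rad ((D.iso (i + 1)).hom ≫ proj _ j')
    (hC i _ (app (incl _ j ≫ (D.iso i).inv) _ x))
  exact h1

theorem eq_sum_incl {M : ℤ → GrMod 𝓑} {N : GrMod 𝓑} (f : dirSum M ⟶ N) (b : ℤ) (j : ℤ)
    (y : (dirSum M).obj j) (hy : ∀ i, i ≠ b → app (incl M i ≫ f) j (app (proj M i) j y) = 0) :
    app f j y = app (incl M b ≫ f) j (app (proj M b) j y) := by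
  classical
  have h : y = ∑ i ∈ DFinsupp.support (show ⨁ i, (M i).obj j from y),
      app (incl M i) j (app (proj M i) j y) :=
    (DirectSum.sum_support_of (show ⨁ i, (M i).obj j from y)).symm
  conv_lhs => rw [h]
  rw [map_sum]
  refine Finset.sum_eq_single b (fun i _ hi => hy i hi) fun hb => ?_
  have h0 : app (proj M b) j y = 0 := DFinsupp.notMem_support_iff.1 hb
  rw [h0, map_zero, map_zero]

theorem LinDecomp.comp_comp {c : ℤ} {C : CochainComplex (GrMod 𝓑) ℤ} (hC : IsMinimal C)
    (D : LinDecomp c C) (i j j' j'' : ℤ) (h : j' = j - 1) (h' : j'' = j' - 1) :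
    D.comp i j j' ≫ D.comp (i + 1) j' j'' = 0 := by
  refine hom_ext fun k x => ?_
  have h1 := eq_sum_incl ((D.iso (i + 1)).inv ≫ C.d (i + 1) (i + 1 + 1) ≫
    (D.iso (i + 1 + 1)).hom ≫ proj _ j'') j' k
    (app (incl _ j ≫ (D.iso i).inv ≫ C.d i (i + 1) ≫ (D.iso (i + 1)).hom) k x) fun b hb => by
      change app (D.comp (i + 1) b j'') k (app (D.comp i j b) k x) = 0
      rcases lt_or_gt_of_ne hb with hb | hb
      · rw [D.comp_eq_zero hC (i + 1) b j'' (by omega)]; rfl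
      · rw [D.comp_eq_zero hC i j b (by omega)]; exact map_zero _
  refine Eq.trans h1.symm ?_
  rw [← app_comp]
  simp

/-- The `l`-linear strand of a minimal complex `C` with a decomposition `C^i = ⨁_j C^{i,j}`: its
term of cohomological degree `i` is `C^{i,l-i}`, and its differential is the component
`C^{i,l-i} ⟶ C^{i+1,l-i-1}` of the differential of `C`. -/
def strand {c : ℤ} {C : CochainComplex (GrMod 𝓑) ℤ} (hC : IsMinimal C) (D : LinDecomp c C)
    (l : ℤ) : CochainComplex (GrMod 𝓑) ℤ :=
  CochainComplex.of (fun i => D.part i (l - i)) (fun i => D.comp i (l - i) (l - (i + 1)))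
    fun i => D.comp_comp hC i _ _ _ (by omega) (by omega)

/-- The direct sum `⨁_l C_l` of a family of complexes. -/
def sumComplex (C : ℤ → CochainComplex (GrMod 𝓑) ℤ) : CochainComplex (GrMod 𝓑) ℤ :=
  CochainComplex.of (fun i => dirSum fun l => (C l).X i)
    (fun i => dirSumMap fun l => (C l).d i (i + 1))
    fun i => dirSum_hom_ext fun l => by simp [dirSumMap]

/-! ### Ext, the Koszul property, Artin-Schelter regularity -/

/-- `Ext^{-i}(M, N)_n`, computed as the cohomology at `P^i` of `Hom(P, N(n))`, for a projective
resolution `P` of `M` and a graded module `N`. -/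
def ExtSpace (P : CochainComplex (GrMod 𝓑) ℤ) (N : GrMod 𝓑) (i n : ℤ) : Type u :=
  LinearMap.ker (Linear.leftComp K (N.shift n) (P.d (i - 1) i)) ⧸
    (LinearMap.range (Linear.leftComp K (N.shift n) (P.d i (i + 1)))).submoduleOf
      (LinearMap.ker (Linear.leftComp K (N.shift n) (P.d (i - 1) i)))

instance (P : CochainComplex (GrMod 𝓑) ℤ) (N : GrMod 𝓑) (i n : ℤ) :
    AddCommGroup (ExtSpace P N i n) := inferInstanceAs (AddCommGroup (_ ⧸ _))
instance (P : CochainComplex (GrMod 𝓑) ℤ) (N : GrMod 𝓑) (i n : ℤ) :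
    Module K (ExtSpace P N i n) := inferInstanceAs (Module K (_ ⧸ _))

variable (𝓑) in
/-- The graded module `B_0 = B / 𝔪`. -/
def degZero : GrMod 𝓑 := top (regular 𝓑)

/-- `β^{i,j}(M) = dim Ext^{-i}(M, B_0)_{-j}`, for a projective resolution `P` of `M`. -/
def betti (P : CochainComplex (GrMod 𝓑) ℤ) (i j : ℤ) : ℕ :=
  Module.finrank K (ExtSpace P (degZero 𝓑) i (-j))

/-- The complex `C` has an `l`-linear projective resolution: `β^{i,j}(C) ≠ 0` only if `i + j = l`.
(The numbers `β^{i,j}(C)` do not depend on the projective resolution.) -/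
def HasLinearRes (C : CochainComplex (GrMod 𝓑) ℤ) (l : ℤ) : Prop :=
  ∃ (P : CochainComplex (GrMod 𝓑) ℤ) (π : P ⟶ C), IsProjRes π ∧
    ∀ i j : ℤ, betti P i j ≠ 0 → i + j = l

variable (𝓑) in
/-- `B` is Koszul: the graded left module `B_0` has a linear resolution. -/
def IsKoszul : Prop := ∃ l : ℤ, HasLinearRes (inDegZero (degZero 𝓑)) l

/-- The projective dimension of the graded module `M` is at most `n`. -/
def ProjDimLE (M : GrMod 𝓑) (n : ℕ) : Prop :=
  ∃ (P : CochainComplex (GrMod 𝓑) ℤ) (π : P ⟶ inDegZero M), IsProjRes π ∧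
    ∀ i : ℤ, i < -n → Limits.IsZero (P.X i)

variable (𝓑) in
/-- The (graded) global dimension of the noetherian graded algebra `B` is `d`. -/
def HasGlobalDim (d : ℕ) : Prop :=
  (∀ M : GrMod 𝓑, IsFG M → ProjDimLE M d) ∧
    ∃ M : GrMod 𝓑, IsFG M ∧ ∀ n : ℕ, ProjDimLE M n → d ≤ n

variable (𝓑) in
/-- The grading of the opposite algebra; graded right `B`-modules are graded left modules over
`B^op`. -/
def opGr (n : ℤ) : Submodule K Bᵐᵒᵖ :=
  (𝓑 n).comap (MulOpposite.opLinearEquiv K (M := B)).symm.toLinearMap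

instance : NonnegGraded (opGr 𝓑) where
  one_mem := SetLike.GradedOne.one_mem (A := 𝓑)
  mul_mem i j x y hx hy := by
    change (x * y).unop ∈ 𝓑 (i + j)
    rw [MulOpposite.unop_mul, add_comm]
    exact SetLike.GradedMul.mul_mem (A := 𝓑) hy hx
  eq_bot l hl := by
    refine (Submodule.eq_bot_iff _).2 fun x hx => ?_
    have hx : x.unop ∈ 𝓑 l := hx
    rw [NonnegGraded.eq_bot (𝓑 := 𝓑) l hl, Submodule.mem_bot] at hx
    exact MulOpposite.unop_injective hx

/-- The graded right module `Hom_B(M, B) = ⨁_j Hom(M, B(j))`, with `(f a)(x) = f(x) a`. -/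
def dual (M : GrMod 𝓑) : GrMod (opGr 𝓑) where
  obj j := M ⟶ (regular 𝓑).shift j
  act l j k h := LinearMap.mk₂ K
    (fun a f => mkHom (M := M) (N := (regular 𝓑).shift k)
      (fun i =>
        { toFun := fun x => (⟨(show 𝓑 (j + i) from app f i x).1 * a.1.unop, by
            have := SetLike.GradedMul.mul_mem (A := 𝓑) (show 𝓑 (j + i) from app f i x).2 a.2
            rwa [show j + i + l = k + i by omega] at this⟩ : 𝓑 (k + i))
          map_add' := fun x y => Subtype.ext (by rw [map_add]; exact add_mul _ _ _)
          map_smul' := fun c x => Subtype.ext (by rw [map_smul]; exact smul_mul_assoc _ _ _) })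
      fun m i i' h b x => Subtype.ext (by
        have := app_act f m i i' h b x
        refine (congrArg (fun z : 𝓑 (j + i') => z.1 * a.1.unop) this).trans ?_
        exact mul_assoc _ _ _))
    (fun a a' f => hom_ext fun i x => Subtype.ext (mul_add _ _ _))
    (fun c a f => hom_ext fun i x => Subtype.ext (mul_smul_comm _ _ _))
    (fun a f f' => hom_ext fun i x => Subtype.ext (add_mul _ _ _))
    (fun c a f => hom_ext fun i x => Subtype.ext (smul_mul_assoc _ _ _))
  one_act j f := hom_ext fun i x => Subtype.ext (mul_one _)
  mul_act l m i j k h h' a b f := hom_ext fun i x => Subtype.ext (mul_assoc _ _ _).symm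

/-- The morphism `Hom_B(N, B) ⟶ Hom_B(M, B)` induced by `f : M ⟶ N`. -/
def dualMap {M N : GrMod 𝓑} (f : M ⟶ N) : dual N ⟶ dual M :=
  mkHom (fun j => Linear.leftComp K ((regular 𝓑).shift j) f) fun _ _ _ _ _ _ => rfl

/-- The complex `Hom_B(P, B)` of graded right modules, with `Hom_B(P^{-i}, B)` in degree `i`. -/
def dualComplex (P : CochainComplex (GrMod 𝓑) ℤ) : CochainComplex (GrMod (opGr 𝓑)) ℤ :=
  CochainComplex.of (fun i => dual (P.X (-i))) (fun i => dualMap (P.d (-(i + 1)) (-i)))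
    fun i => hom_ext fun j f => by
      change P.d (-(i + 1 + 1)) (-(i + 1)) ≫ P.d (-(i + 1)) (-i) ≫ (show _ ⟶ _ from f) = 0
      rw [← Category.assoc, P.d_comp_d, Limits.zero_comp]

/-- The graded right module `Ext_B^i(M, B)` is isomorphic to `E`: this is the `i`-th cohomology of
`Hom_B(P, B)` for a projective resolution `P` of `M` (it does not depend on `P`). -/
def ExtIso (M : GrMod 𝓑) (i : ℤ) (E : GrMod (opGr 𝓑)) : Prop :=
  ∃ (P : CochainComplex (GrMod 𝓑) ℤ) (π : P ⟶ inDegZero M), IsProjRes π ∧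
    Nonempty (cohomology (dualComplex P) i ≅ E)

variable (𝓑) in
/-- The graded left module `B e`, for an idempotent `e` of `B`. -/
def cyclic (e : B) : GrMod 𝓑 :=
  Sub.toMod (M := regular 𝓑)
    { carrier := fun i =>
        { carrier := {a : 𝓑 i | a.1 * e = a.1}
          add_mem' := fun ha hb => (add_mul _ _ _).trans (congrArg₂ _ ha hb)
          zero_mem' := zero_mul _
          smul_mem' := fun _ _ ha => (smul_mul_assoc _ _ _).trans (congrArg _ ha) }
      act_mem := fun _ _ _ _ _ _ hx => (mul_assoc _ _ _).trans (congrArg _ hx) }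

variable (𝓑) in
/-- The graded left module `B e / 𝔪 e`. -/
def simple (e : B) : GrMod 𝓑 := top (cyclic 𝓑 e)

variable (𝓑) in
/-- Artin-Schelter regularity, of dimension `d`, of the graded quiver algebra `B` with the
idempotents `e v` of the vertices. Here `K_v = simple 𝓑 (e v)`, and
`_vK = simple (opGr 𝓑) (op (e v))`. -/
structure IsASRegular {V : Type u} (e : V → B) (d : ℕ) : Prop where
  globalDim : HasGlobalDim 𝓑 d
  ext_left : ∀ (v : V) (i : ℕ), i ≠ d → ExtIso (simple 𝓑 (e v)) i (zero (opGr 𝓑))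
  ext_right : ∀ (v : V) (i : ℕ), i ≠ d →
    ExtIso (simple (opGr 𝓑) (MulOpposite.op (e v))) i (zero (opGr (opGr 𝓑)))
  ext_top : ∃ (δ : Equiv.Perm V) (n : V → ℤ), ∀ v : V,
    ExtIso (simple 𝓑 (e v)) d ((simple (opGr 𝓑) (MulOpposite.op (e (δ v)))).shift (n v))

end GrMod
end GradedModules

/-! ### Path algebras of finite quivers -/

section PathAlgebra

variable (K V : Type u) [Field K] [Quiver.{u} V]

/-- The underlying space of the path algebra `KQ`: it has the set of all paths of `Q` as a basis. -/
def PathAlg : Type u := (Σ a b : V, Quiver.Path a b) →₀ K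

instance : AddCommGroup (PathAlg K V) := inferInstanceAs (AddCommGroup (_ →₀ K))
instance : Module K (PathAlg K V) := inferInstanceAs (Module K (_ →₀ K))

variable {V}

/-- The basis vector of a path. -/
def path (p : Σ a b : V, Quiver.Path a b) : PathAlg K V := Finsupp.single p (1 : K)

/-- The coefficient of a path in an element of `KQ`. -/
def coeff {K : Type u} [Field K] (x : PathAlg K V) (p : Σ a b : V, Quiver.Path a b) : K :=
  (show (Σ a b : V, Quiver.Path a b) →₀ K from x) p

open Classical in
/-- The product of two basis paths: their concatenation if they are composable, else `0`. -/
def pathMul (p q : Σ a b : V, Quiver.Path a b) : PathAlg K V :=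
  if h : p.2.1 = q.1 then path K ⟨p.1, q.2.1, p.2.2.comp (q.2.2.cast h.symm rfl)⟩ else 0

/-- The bilinear multiplication of `KQ`. -/
def mulLin : PathAlg K V →ₗ[K] PathAlg K V →ₗ[K] PathAlg K V :=
  Finsupp.linearCombination K fun p => Finsupp.linearCombination K fun q => pathMul K p q

variable {K}

theorem mulLin_path (p q : Σ a b : V, Quiver.Path a b) :
    mulLin K (path K p) (path K q) = pathMul K p q := by
  unfold mulLin path
  erw [Finsupp.linearCombination_single, one_smul, Finsupp.linearCombination_single, one_smul]

theorem path_induction {C : PathAlg K V → Prop} (x : PathAlg K V) (h0 : C 0)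
    (hadd : ∀ x y, C x → C y → C (x + y)) (hs : ∀ (c : K) p, C (c • path K p)) : C x := by
  refine Finsupp.induction_linear (motive := C) x h0 (fun f g => hadd f g) fun p c => ?_
  have := hs c p
  unfold path at this
  erw [Finsupp.smul_single] at this
  simpa using this

theorem coeff_add (x y : PathAlg K V) (p : Σ a b : V, Quiver.Path a b) :
    coeff (x + y) p = coeff x p + coeff y p := rfl

theorem coeff_smul (c : K) (x : PathAlg K V) (p : Σ a b : V, Quiver.Path a b) :
    coeff (c • x) p = c * coeff x p := rfl

open Classical in
theorem coeff_path (p q : Σ a b : V, Quiver.Path a b) :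
    coeff (path K p) q = if p = q then 1 else 0 := Finsupp.single_apply

theorem pathMul_comp {a b c : V} (p : Quiver.Path a b) (q : Quiver.Path b c) :
    pathMul K ⟨a, b, p⟩ ⟨b, c, q⟩ = path K ⟨a, c, p.comp q⟩ := by
  simp [pathMul]

theorem pathMul_ne {p q : Σ a b : V, Quiver.Path a b} (h : p.2.1 ≠ q.1) :
    pathMul K p q = 0 := by
  simp [pathMul, h]

theorem mulLin_assoc (x y z : PathAlg K V) :
    mulLin K (mulLin K x y) z = mulLin K x (mulLin K y z) := by
  induction x using path_induction with
  | h0 => simp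
  | hadd x x' h h' => simp [h, h']
  | hs k p =>
  induction y using path_induction with
  | h0 => simp
  | hadd y y' h h' => simp only [map_add, LinearMap.add_apply, h, h']
  | hs k' q =>
  induction z using path_induction with
  | h0 => simp
  | hadd z z' h h' => simp only [map_add, h, h']
  | hs k'' r =>
  simp only [map_smul, LinearMap.smul_apply, mulLin_path]
  congr 3
  obtain ⟨a, b, p⟩ := p
  obtain ⟨b', c, q⟩ := q
  obtain ⟨c', d, r⟩ := r
  by_cases h : b = b'
  · subst h
    by_cases h' : c = c'
    · subst h'
      simp only [pathMul_comp, mulLin_path, Quiver.Path.comp_assoc]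
    · rw [pathMul_comp, mulLin_path, pathMul_ne h', pathMul_ne (by exact h'), map_zero]
  · rw [pathMul_ne h, map_zero, LinearMap.zero_apply]
    by_cases h' : c = c'
    · subst h'
      rw [pathMul_comp, mulLin_path, pathMul_ne (by exact h)]
    · rw [pathMul_ne (by exact h'), map_zero]

variable [Fintype V]

theorem one_mulLin (x : PathAlg K V) :
    mulLin K (∑ v : V, path K ⟨v, v, Quiver.Path.nil⟩) x = x := by
  induction x using path_induction with
  | h0 => simp
  | hadd x x' h h' => rw [map_add, h, h']
  | hs k p =>
  obtain ⟨a, b, p⟩ := p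
  rw [map_smul, map_sum, LinearMap.sum_apply, Finset.sum_eq_single a]
  · rw [mulLin_path, pathMul_comp, Quiver.Path.nil_comp]
  · intro v _ hv
    rw [mulLin_path, pathMul_ne (by exact hv)]
  · simp

theorem mulLin_one (x : PathAlg K V) :
    mulLin K x (∑ v : V, path K ⟨v, v, Quiver.Path.nil⟩) = x := by
  induction x using path_induction with
  | h0 => simp
  | hadd x x' h h' => rw [map_add, LinearMap.add_apply, h, h']
  | hs k p =>
  obtain ⟨a, b, p⟩ := p
  rw [map_smul, LinearMap.smul_apply, map_sum, Finset.sum_eq_single b]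
  · rw [mulLin_path, pathMul_comp, Quiver.Path.comp_nil]
  · intro v _ hv
    rw [mulLin_path, pathMul_ne (by exact (Ne.symm hv))]
  · simp

/-- The path algebra `KQ`: the unit is the sum of the trivial paths, and paths are multiplied by
concatenation. -/
instance : Ring (PathAlg K V) :=
  { (inferInstance : AddCommGroup (PathAlg K V)) with
    mul := fun x y => mulLin K x y
    one := ∑ v : V, path K ⟨v, v, Quiver.Path.nil⟩
    left_distrib := fun x y z => map_add (mulLin K x) y z
    right_distrib := fun x y z => by
      change mulLin K (x + y) z = mulLin K x z + mulLin K y z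
      rw [map_add, LinearMap.add_apply]
    zero_mul := fun x => by
      change mulLin K 0 x = 0
      rw [map_zero, LinearMap.zero_apply]
    mul_zero := fun x => map_zero (mulLin K x)
    mul_assoc := mulLin_assoc
    one_mul := one_mulLin
    mul_one := mulLin_one }

theorem mul_def (x y : PathAlg K V) : x * y = mulLin K x y := rfl

theorem one_def : (1 : PathAlg K V) = ∑ v : V, path K ⟨v, v, Quiver.Path.nil⟩ := rfl

instance : Algebra K (PathAlg K V) :=
  Algebra.ofModule
    (fun r x y => by rw [mul_def, mul_def, map_smul, LinearMap.smul_apply])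
    (fun r x y => by rw [mul_def, mul_def, map_smul])

variable (K V)

/-- The degree `n` component `(KQ)_n`, spanned by the paths of length `n` (so it is `0` for
`n < 0`). -/
def pathDeg (n : ℤ) : Submodule K (PathAlg K V) :=
  Submodule.span K {x | ∃ p : Σ a b : V, Quiver.Path a b, (p.2.2.length : ℤ) = n ∧ x = path K p}

variable {K V}

theorem path_mem_pathDeg (p : Σ a b : V, Quiver.Path a b) :
    path K p ∈ pathDeg K V p.2.2.length :=
  Submodule.subset_span ⟨p, rfl, rfl⟩

theorem pathDeg_neg {n : ℤ} (hn : n < 0) : pathDeg K V n = ⊥ := by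
  rw [pathDeg, Submodule.span_eq_bot]
  rintro x ⟨p, hp, -⟩
  omega

theorem mul_mem_pathDeg {m n : ℤ} {x y : PathAlg K V} (hx : x ∈ pathDeg K V m)
    (hy : y ∈ pathDeg K V n) : x * y ∈ pathDeg K V (m + n) := by
  have h : pathDeg K V m * pathDeg K V n ≤ pathDeg K V (m + n) := by
    rw [pathDeg, pathDeg, Submodule.span_mul_span, Submodule.span_le]
    rintro _ ⟨_, ⟨⟨a, b, p⟩, hp, rfl⟩, _, ⟨⟨b', c, q⟩, hq, rfl⟩, rfl⟩
    change path K _ * path K _ ∈ _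
    rw [mul_def, mulLin_path]
    by_cases h : b = b'
    · subst h
      rw [pathMul_comp]
      refine Submodule.subset_span ⟨_, ?_, rfl⟩
      simp only [Quiver.Path.length_comp] at *
      omega
    · rw [pathMul_ne (by exact h)]
      exact Submodule.zero_mem _
  exact h (Submodule.mul_mem_mul hx hy)

theorem one_mem_pathDeg : (1 : PathAlg K V) ∈ pathDeg K V 0 := by
  rw [one_def]
  exact Submodule.sum_mem _ fun v _ => Submodule.subset_span ⟨_, rfl, rfl⟩

variable (K)

/-- The idempotent `e_v` of a vertex. -/
def idem (v : V) : PathAlg K V := path K ⟨v, v, Quiver.Path.nil⟩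

/-- An arrow as an element of the path algebra. -/
def arrow {a b : V} (α : a ⟶ b) : PathAlg K V := path K ⟨a, b, α.toPath⟩

theorem idem_mem (v : V) : idem K v ∈ pathDeg K V 0 :=
  Submodule.subset_span ⟨_, rfl, rfl⟩

theorem arrow_mem {a b : V} (α : a ⟶ b) : arrow K α ∈ pathDeg K V 1 :=
  Submodule.subset_span ⟨_, rfl, rfl⟩

end PathAlgebra

/-! ### Graded quiver algebras and quadratic duals -/

section QuiverAlgebra

variable {K V : Type u} [Field K] [Fintype V] [Quiver.{u} V]

/-- `I` is a graded two-sided ideal contained in `J ^ 2`, where `J` is the ideal of `KQ` generated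
by the arrows: so `KQ / I` is a graded quiver algebra. -/
structure IsQuiverRelations (I : Ideal (PathAlg K V)) : Prop where
  /-- `I` is graded: with an element it contains the homogeneous components. -/
  homogeneous : ∀ x ∈ I, ∀ n : ℕ,
    (show PathAlg K V from Finsupp.filter (fun p => p.2.2.length = n) x) ∈ I
  /-- `I ⊆ J ^ 2`, the span of the paths of length at least two. -/
  le_sq : ∀ x ∈ I, ∀ p : Σ a b : V, Quiver.Path a b, coeff x p ≠ 0 → 2 ≤ p.2.2.length

/-- The grading of `KQ / I` induced by the length of paths. -/
def grd (I : Ideal (PathAlg K V)) [I.IsTwoSided] (n : ℤ) : Submodule K (PathAlg K V ⧸ I) :=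
  (pathDeg K V n).map (Ideal.Quotient.mkₐ K I).toLinearMap

instance (I : Ideal (PathAlg K V)) [I.IsTwoSided] : NonnegGraded (grd I) where
  one_mem := ⟨1, one_mem_pathDeg, map_one (Ideal.Quotient.mkₐ K I)⟩
  mul_mem := by
    rintro i j _ _ ⟨x, hx, rfl⟩ ⟨y, hy, rfl⟩
    exact ⟨x * y, mul_mem_pathDeg hx hy, map_mul (Ideal.Quotient.mkₐ K I) x y⟩
  eq_bot l hl := by rw [grd, pathDeg_neg hl, Submodule.map_bot]

theorem mk_mem_grd (I : Ideal (PathAlg K V)) [I.IsTwoSided] {n : ℤ} {x : PathAlg K V}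
    (hx : x ∈ pathDeg K V n) : (Ideal.Quotient.mk I x) ∈ grd I n :=
  ⟨x, hx, rfl⟩

/-- The idempotent `e_v`, an element of degree `0` of `KQ / I`. -/
def vtx (I : Ideal (PathAlg K V)) [I.IsTwoSided] (v : V) : grd I 0 :=
  ⟨Ideal.Quotient.mk I (idem K v), mk_mem_grd I (idem_mem K v)⟩

/-- An arrow, an element of degree `1` of `KQ / I`. -/
def arr (I : Ideal (PathAlg K V)) [I.IsTwoSided] {a b : V} (α : a ⟶ b) : grd I 1 :=
  ⟨Ideal.Quotient.mk I (arrow K α), mk_mem_grd I (arrow_mem K α)⟩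

section
variable {I : Ideal (PathAlg K V)} [I.IsTwoSided]

theorem mk_vtx_mul_arr {s t : V} (α : s ⟶ t) :
    ((vtx I s : grd I 0) : PathAlg K V ⧸ I) * (arr I α : grd I 1) = (arr I α : grd I 1) := by
  change Ideal.Quotient.mk I _ * Ideal.Quotient.mk I _ = Ideal.Quotient.mk I _
  rw [← map_mul, mul_def, idem, arrow, mulLin_path, pathMul_comp, Quiver.Path.nil_comp]

theorem mk_vtx_mul_arr_of_ne {v s t : V} (h : v ≠ s) (α : s ⟶ t) :
    ((vtx I v : grd I 0) : PathAlg K V ⧸ I) * (arr I α : grd I 1) = 0 := by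
  change Ideal.Quotient.mk I _ * Ideal.Quotient.mk I _ = 0
  rw [← map_mul, mul_def, idem, arrow, mulLin_path, pathMul_ne (by exact h), map_zero]

theorem mk_arr_mul_vtx {s t : V} (α : s ⟶ t) :
    ((arr I α : grd I 1) : PathAlg K V ⧸ I) * (vtx I t : grd I 0) = (arr I α : grd I 1) := by
  change Ideal.Quotient.mk I _ * Ideal.Quotient.mk I _ = Ideal.Quotient.mk I _
  rw [← map_mul, mul_def, idem, arrow, mulLin_path, pathMul_comp, Quiver.Path.comp_nil]

theorem mk_arr_mul_vtx_of_ne {v s t : V} (h : t ≠ v) (α : s ⟶ t) :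
    ((arr I α : grd I 1) : PathAlg K V ⧸ I) * (vtx I v : grd I 0) = 0 := by
  change Ideal.Quotient.mk I _ * Ideal.Quotient.mk I _ = 0
  rw [← map_mul, mul_def, idem, arrow, mulLin_path, pathMul_ne (by exact h), map_zero]

theorem mk_arr_mul_arr_of_ne {s t t' r : V} (h : t ≠ t') (α : s ⟶ t) (β : t' ⟶ r) :
    ((arr I α : grd I 1) : PathAlg K V ⧸ I) * (arr I β : grd I 1) = 0 := by
  change Ideal.Quotient.mk I _ * Ideal.Quotient.mk I _ = 0
  rw [← map_mul, mul_def, arrow, arrow, mulLin_path, pathMul_ne (by exact h), map_zero]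

end

instance : Fintype Vᵒᵖ := Fintype.ofEquiv V equivToOpposite

variable (V) in
/-- The set of arrows of `Q`. -/
abbrev Arrows : Type u := Σ a b : V, (a ⟶ b)

variable (V) in
/-- The set of composable pairs of arrows of `Q`, that is, of paths of length two. -/
abbrev ArrowPairs : Type u := Σ a b c : V, (a ⟶ b) × (b ⟶ c)

/-- The path `α β` of length two. -/
def ArrowPairs.toPath (t : ArrowPairs V) : Σ a b : V, Quiver.Path a b :=
  ⟨t.1, t.2.2.1, t.2.2.2.1.toPath.comp t.2.2.2.2.toPath⟩

/-- The element `α β` of degree `2` of `KQ / I`. -/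
def pairElt (I : Ideal (PathAlg K V)) [I.IsTwoSided] (t : ArrowPairs V) : grd I 2 :=
  ⟨Ideal.Quotient.mk I (path K t.toPath), mk_mem_grd I (Submodule.subset_span ⟨_, rfl, rfl⟩)⟩

/-- The path `β^op α^op` of length two in the opposite quiver. -/
def ArrowPairs.toPathOp (t : ArrowPairs V) : Σ a b : Vᵒᵖ, Quiver.Path a b :=
  ⟨op t.2.2.1, op t.1, t.2.2.2.2.op.toPath.comp t.2.2.2.1.op.toPath⟩

theorem ArrowPairs.toPath_injective :
    Function.Injective (ArrowPairs.toPath : ArrowPairs V → _) := by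
  rintro ⟨a, b, c, α, β⟩ ⟨a', b', c', α', β'⟩ h
  simp only [ArrowPairs.toPath, Quiver.Hom.toPath, Quiver.Path.comp_cons, Quiver.Path.comp_nil] at h
  cases h
  rfl

theorem ArrowPairs.toPathOp_injective :
    Function.Injective (ArrowPairs.toPathOp : ArrowPairs V → _) := by
  rintro ⟨a, b, c, α, β⟩ ⟨a', b', c', α', β'⟩ h
  simp only [ArrowPairs.toPathOp, Quiver.Hom.toPath, Quiver.Path.comp_cons,
    Quiver.Path.comp_nil] at h
  cases h
  rfl

theorem exists_arrowPair (p : Σ a b : V, Quiver.Path a b) (hp : p.2.2.length = 2) :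
    ∃ t : ArrowPairs V, t.toPath = p := by
  obtain ⟨a, c, p⟩ := p
  match p, hp with
  | .cons (.cons .nil α) β, _ => exact ⟨⟨a, _, c, α, β⟩, rfl⟩

/-- The element `β^op α^op` of degree `2` of `KQ^op / I'`. -/
def pairEltOp (I' : Ideal (PathAlg K Vᵒᵖ)) [I'.IsTwoSided] (t : ArrowPairs V) : grd I' 2 :=
  ⟨Ideal.Quotient.mk I' (path K t.toPathOp), mk_mem_grd I' (Submodule.subset_span ⟨_, rfl, rfl⟩)⟩

theorem pairElt_coe (I : Ideal (PathAlg K V)) [I.IsTwoSided] (t : ArrowPairs V) :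
    (pairElt I t : PathAlg K V ⧸ I) =
      (arr I t.2.2.2.1 : grd I 1) * (arr I t.2.2.2.2 : grd I 1) := by
  change Ideal.Quotient.mk I _ = Ideal.Quotient.mk I _ * Ideal.Quotient.mk I _
  rw [← map_mul, mul_def, arrow, arrow, mulLin_path, pathMul_comp]
  rfl

theorem pairEltOp_coe (I' : Ideal (PathAlg K Vᵒᵖ)) [I'.IsTwoSided] (t : ArrowPairs V) :
    (pairEltOp I' t : PathAlg K Vᵒᵖ ⧸ I') =
      (arr I' t.2.2.2.2.op : grd I' 1) * (arr I' t.2.2.2.1.op : grd I' 1) := by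
  change Ideal.Quotient.mk I' _ = Ideal.Quotient.mk I' _ * Ideal.Quotient.mk I' _
  rw [← map_mul, mul_def, arrow, arrow, mulLin_path, pathMul_comp]
  rfl

theorem mk_smul_eq {W : Type u} [Fintype W] [Quiver.{u} W] (I : Ideal (PathAlg K W))
    [I.IsTwoSided] (c : K) (x : PathAlg K W) :
    Ideal.Quotient.mk I (c • x) = c • Ideal.Quotient.mk I x := rfl

variable [∀ a b : V, Fintype (a ⟶ b)]

theorem sum_pairElt_eq_zero (I : Ideal (PathAlg K V)) [I.IsTwoSided] (u : ArrowPairs V → K)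
    (hu : (∑ s, u s • path K s.toPath) ∈ I) : ∑ s, u s • pairElt I s = 0 := by
  refine Subtype.ext ?_
  rw [AddSubmonoidClass.coe_finsetSum]
  have := Ideal.Quotient.eq_zero_iff_mem.2 hu
  rw [map_sum] at this
  exact this

theorem sum_pairEltOp_eq_zero (I' : Ideal (PathAlg K Vᵒᵖ)) [I'.IsTwoSided] (w : ArrowPairs V → K)
    (hw : (∑ s, w s • path K s.toPathOp) ∈ I') : ∑ s, w s • pairEltOp I' s = 0 := by
  refine Subtype.ext ?_
  rw [AddSubmonoidClass.coe_finsetSum]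
  have := Ideal.Quotient.eq_zero_iff_mem.2 hw
  rw [map_sum] at this
  exact this


/-- The bilinear form `(KQ)_2 × (KQ^op)_2 → K` with `⟨α β, γ^op δ^op⟩ = 1` if `α = δ`, `β = γ`, and
`0` otherwise. -/
def pairing (x : PathAlg K V) (y : PathAlg K Vᵒᵖ) : K :=
  ∑ t : ArrowPairs V, coeff x t.toPath * coeff y t.toPathOp

/-- The two-sided ideal `I^⊥` of `KQ^op`, generated by the annihilator of `I_2` in `(KQ^op)_2`. The
quadratic dual `A^!` of `A = KQ / I` is `KQ^op / I^⊥`. -/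
def perp (I : Ideal (PathAlg K V)) : Ideal (PathAlg K Vᵒᵖ) :=
  (TwoSidedIdeal.span {y : PathAlg K Vᵒᵖ | y ∈ pathDeg K Vᵒᵖ 2 ∧
    ∀ x ∈ I, x ∈ pathDeg K V 2 → pairing x y = 0}).asIdeal

instance (I : Ideal (PathAlg K V)) : (perp I).IsTwoSided :=
  inferInstanceAs ((TwoSidedIdeal.asIdeal _).IsTwoSided)

/-! ### The canonical element -/

theorem eq_sum_of_mem_pathDeg_two {x : PathAlg K V} (hx : x ∈ pathDeg K V 2) :
    x = ∑ t : ArrowPairs V, coeff x t.toPath • path K t.toPath := by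
  classical
  refine Submodule.span_induction ?_ ?_ ?_ ?_ hx
  · rintro _ ⟨p, hp, rfl⟩
    obtain ⟨t, rfl⟩ := exists_arrowPair p (by exact_mod_cast hp)
    rw [Finset.sum_eq_single t]
    · rw [coeff_path, if_pos rfl, one_smul]
    · intro s _ hs
      rw [coeff_path, if_neg (fun h => hs (ArrowPairs.toPath_injective h).symm), zero_smul]
    · simp
  · refine (Finset.sum_eq_zero fun t _ => ?_).symm
    exact zero_smul K _
  · intro x y _ _ hx hy
    simp only [coeff_add, add_smul, Finset.sum_add_distrib]
    rw [← hx, ← hy]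
  · intro c x _ hx
    simp only [coeff_smul, mul_smul, ← Finset.smul_sum]
    rw [← hx]

theorem coeff_sum_toPathOp (w : ArrowPairs V → K) (t : ArrowPairs V) :
    coeff (∑ s : ArrowPairs V, w s • path K s.toPathOp) t.toPathOp = w t := by
  classical
  have h : ∀ S : Finset (ArrowPairs V), coeff (∑ s ∈ S, w s • path K s.toPathOp) t.toPathOp =
      ∑ s ∈ S, w s * if s = t then 1 else 0 := by
    intro S
    induction S using Finset.induction_on with
    | empty => rfl
    | insert a S ha ih =>
      rw [Finset.sum_insert ha, Finset.sum_insert ha, coeff_add, ih, coeff_smul, coeff_path]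
      simp only [ArrowPairs.toPathOp_injective.eq_iff]
  rw [h]
  simp

/-- If `Φ` is a bilinear map on `(KQ)_2 × (KQ^op)_2` that vanishes on `I_2 × (KQ^op)_2` and on
`(KQ)_2 × (I^⊥)_2`, then it vanishes on the canonical element `∑ α β ⊗ β^op α^op`. -/
theorem canonical_sum_eq_zero (I : Ideal (PathAlg K V)) {X : Type u} [AddCommGroup X] [Module K X]
    (Φ : ArrowPairs V → ArrowPairs V → X)
    (h1 : ∀ u : ArrowPairs V → K, (∑ s, u s • path K s.toPath) ∈ I →
      ∀ t, ∑ s, u s • Φ s t = 0)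
    (h2 : ∀ w : ArrowPairs V → K, (∑ t, w t • path K t.toPathOp) ∈ perp I →
      ∀ s, ∑ t, w t • Φ s t = 0) :
    ∑ t, Φ t t = 0 := by
  classical
  let S : Submodule K (ArrowPairs V → K) :=
    (I.restrictScalars K).comap (Fintype.linearCombination K fun s => path K s.toPath)
  obtain ⟨f, hf⟩ := S.subtype.exists_leftInverse_of_injective (Submodule.ker_subtype S)
  let q : (ArrowPairs V → K) →ₗ[K] (ArrowPairs V → K) := LinearMap.id - S.subtype ∘ₗ f
  have hq : ∀ u ∈ S, q u = 0 := fun u hu => by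
    have := LinearMap.congr_fun hf ⟨u, hu⟩
    change u - ((f u : S) : ArrowPairs V → K) = 0
    have h3 : f u = ⟨u, hu⟩ := this
    rw [h3, sub_self]
  have e1 : ∀ t, Φ t t = ∑ s, q (Pi.single t 1) s • Φ s t := fun t => by
    have h3 := h1 (f (Pi.single t 1)).1 (f (Pi.single t 1)).2 t
    have h4 : ∀ s, q (Pi.single t 1) s = (Pi.single t 1 : ArrowPairs V → K) s -
      (f (Pi.single t 1)).1 s := fun s => rfl
    simp only [h4, sub_smul, Finset.sum_sub_distrib, h3, sub_zero]
    simp [Pi.single_apply]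
  rw [Finset.sum_congr rfl fun t _ => e1 t, Finset.sum_comm]
  refine Finset.sum_eq_zero fun s _ => h2 (fun t => q (Pi.single t 1) s) ?_ s
  refine TwoSidedIdeal.subset_span ⟨?_, fun x hx hx2 => ?_⟩
  · exact Submodule.sum_mem _ fun t _ => Submodule.smul_mem _ _
      (Submodule.subset_span ⟨t.toPathOp, rfl, rfl⟩)
  · simp only [pairing, coeff_sum_toPathOp]
    have hu : (fun t : ArrowPairs V => coeff x t.toPath) ∈ S := by
      change Fintype.linearCombination K _ _ ∈ I
      rw [Fintype.linearCombination_apply, ← eq_sum_of_mem_pathDeg_two hx2]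
      exact hx
    have h5 := congrFun (hq _ hu) s
    rw [pi_eq_sum_univ' (fun t : ArrowPairs V => coeff x t.toPath), map_sum, Finset.sum_apply] at h5
    simpa [Pi.single_apply, ← Pi.single_apply, eq_comm, Pi.single, Function.update_apply] using h5

theorem sum_arrows_arrows {X : Type u} [AddCommGroup X] (g : Arrows V → Arrows V → X)
    (hg : ∀ s t : Arrows V, s.2.1 ≠ t.1 → g s t = 0) :
    ∑ s, ∑ t, g s t = ∑ t : ArrowPairs V, g ⟨t.1, t.2.1, t.2.2.2.1⟩ ⟨t.2.1, t.2.2.1, t.2.2.2.2⟩ := by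
  simp only [Fintype.sum_sigma, Fintype.sum_prod_type]
  refine Finset.sum_congr rfl fun a _ => Finset.sum_congr rfl fun b _ => ?_
  have : ∀ α : a ⟶ b, ∑ b', ∑ c, ∑ β : b' ⟶ c, g ⟨a, b, α⟩ ⟨b', c, β⟩ =
      ∑ c, ∑ β : b ⟶ c, g ⟨a, b, α⟩ ⟨b, c, β⟩ := fun α =>
    Finset.sum_eq_single b (fun b' _ hb => Finset.sum_eq_zero fun c _ =>
      Finset.sum_eq_zero fun β _ => hg _ _ (Ne.symm hb)) (by simp)
  rw [Finset.sum_congr rfl fun α _ => this α, Finset.sum_comm]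

/-! ### The Koszul duality functors -/

section Functors

open GrMod

/-- Right multiplication by an element of degree `m`, on homogeneous components. -/
def rmul {B : Type u} [Ring B] [Algebra K B] (𝓑 : ℤ → Submodule K B) [NonnegGraded 𝓑]
    {l m n : ℤ} (h : l + m = n) (b : 𝓑 m) : (regular 𝓑).obj l →ₗ[K] (regular 𝓑).obj n where
  toFun a := (regular 𝓑).act l m n h a b
  map_add' a a' := LinearMap.congr_fun (map_add ((regular 𝓑).act l m n h) a a') b
  map_smul' c a := LinearMap.congr_fun (map_smul ((regular 𝓑).act l m n h) c a) b

theorem act_rmul {B : Type u} [Ring B] [Algebra K B] (𝓑 : ℤ → Submodule K B)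
    [NonnegGraded 𝓑] {k l m p q r : ℤ} (h : l + m = p) (h1 : k + p = r) (h2 : k + l = q)
    (h3 : q + m = r) (a : 𝓑 k) (x : (regular 𝓑).obj l) (b : 𝓑 m) :
    (regular 𝓑).act k p r h1 a (rmul 𝓑 h b x) =
      rmul 𝓑 h3 b ((regular 𝓑).act k l q h2 a x) :=
  Subtype.ext (mul_assoc _ _ _).symm

theorem rmul_rmul {B : Type u} [Ring B] [Algebra K B] (𝓑 : ℤ → Submodule K B)
    [NonnegGraded 𝓑] {l m n p q r : ℤ} (h : l + m = p) (h1 : p + n = r) (_ : m + n = q)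
    (h3 : l + q = r) (a : (regular 𝓑).obj l) (b : 𝓑 m) (c : 𝓑 n) (d : 𝓑 q)
    (hd : (d : B) = b * c) : rmul 𝓑 h1 c (rmul 𝓑 h b a) = rmul 𝓑 h3 d a :=
  Subtype.ext ((mul_assoc _ _ _).trans (congrArg _ hd.symm))

theorem rmul_zero {B : Type u} [Ring B] [Algebra K B] (𝓑 : ℤ → Submodule K B)
    [NonnegGraded 𝓑] {l m n : ℤ} (h : l + m = n) : rmul 𝓑 h (0 : 𝓑 m) = 0 :=
  LinearMap.ext fun _ => Subtype.ext (mul_zero _)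

/-- Right multiplication is linear in the element. -/
def rmulLin {B : Type u} [Ring B] [Algebra K B] (𝓑 : ℤ → Submodule K B) [NonnegGraded 𝓑]
    {l m n : ℤ} (h : l + m = n) (x : (regular 𝓑).obj l) : 𝓑 m →ₗ[K] (regular 𝓑).obj n where
  toFun b := rmul 𝓑 h b x
  map_add' _ _ := Subtype.ext (mul_add _ _ _)
  map_smul' _ _ := Subtype.ext (mul_smul_comm _ _ _)

theorem act_act {B : Type u} [Ring B] [Algebra K B] {𝓑 : ℤ → Submodule K B}
    [NonnegGraded 𝓑] (M : GrMod 𝓑) {l m i j k n : ℤ} (h : m + i = j) (h1 : l + j = k)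
    (h2 : l + m = n) (h3 : n + i = k) (a : 𝓑 l) (b : 𝓑 m) (c : 𝓑 n) (hc : (c : B) = a * b)
    (x : M.obj i) : M.act l j k h1 a (M.act m i j h b x) = M.act n i k h3 c x := by
  subst h2
  rw [← M.mul_act l m i j k h h1 a b x]
  congr 2
  exact Subtype.ext hc.symm

variable (I : Ideal (PathAlg K V)) [I.IsTwoSided]

/-- The relations `a e_v ⊗ x = a ⊗ e_v x`. -/
def balance (N : GrMod (grd (perp I))) (l j : ℤ) : Submodule K ((regular (grd I)).obj l ⊗[K] N.obj j) :=
  Submodule.span K {t | ∃ (v : V) (a : (regular (grd I)).obj l) (x : N.obj j),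
    t = rmul (grd I) (add_zero l) (vtx I v) a ⊗ₜ[K] x -
      a ⊗ₜ[K] (N.act 0 j j (zero_add j) (vtx (perp I) (op v)) x)}

/-- The space `A_l ⊗_{A_0} N_j`. Here `A_0` is spanned by the idempotents `e_v`. -/
def Tens (N : GrMod (grd (perp I))) (l j : ℤ) : Type u :=
  ((regular (grd I)).obj l ⊗[K] N.obj j) ⧸ balance I N l j

variable {I}

instance (N : GrMod (grd (perp I))) (l j : ℤ) : AddCommGroup (Tens I N l j) :=
  inferInstanceAs (AddCommGroup (_ ⧸ _))
instance (N : GrMod (grd (perp I))) (l j : ℤ) : Module K (Tens I N l j) :=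
  inferInstanceAs (Module K (_ ⧸ _))

/-- The class of `a ⊗ x`, bilinear in `a` and `x`. -/
def tmk (N : GrMod (grd (perp I))) (l j : ℤ) : (regular (grd I)).obj l →ₗ[K] N.obj j →ₗ[K] Tens I N l j :=
  (TensorProduct.mk K ((regular (grd I)).obj l) (N.obj j)).compr₂ (balance I N l j).mkQ

theorem tmk_balanced (N : GrMod (grd (perp I))) (l j : ℤ) (v : V) (a : (regular (grd I)).obj l) (x : N.obj j) :
    tmk N l j (rmul (grd I) (add_zero l) (vtx I v) a) x =
      tmk N l j a (N.act 0 j j (zero_add j) (vtx (perp I) (op v)) x) :=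
  (Submodule.Quotient.eq _).2 (Submodule.subset_span ⟨v, a, x, rfl⟩)

theorem tens_hom_ext {N : GrMod (grd (perp I))} {l j : ℤ} {X : Type u} [AddCommGroup X]
    [Module K X] {f g : Tens I N l j →ₗ[K] X} (h : ∀ a x, f (tmk N l j a x) = g (tmk N l j a x)) :
    f = g :=
  Submodule.linearMap_qext _ (TensorProduct.ext (LinearMap.ext₂ h))

/-- The linear map on `A_l ⊗_{A_0} N_j` induced by a balanced bilinear map. -/
def tlift {N : GrMod (grd (perp I))} {l j : ℤ} {X : Type u} [AddCommGroup X] [Module K X]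
    (f : (regular (grd I)).obj l →ₗ[K] N.obj j →ₗ[K] X)
    (hf : ∀ (v : V) (a : (regular (grd I)).obj l) (x : N.obj j),
      f (rmul (grd I) (add_zero l) (vtx I v) a) x =
        f a (N.act 0 j j (zero_add j) (vtx (perp I) (op v)) x)) : Tens I N l j →ₗ[K] X :=
  (balance I N l j).liftQ (TensorProduct.lift f) (by
    rw [balance, Submodule.span_le]
    rintro _ ⟨v, a, x, rfl⟩
    change TensorProduct.lift f _ = 0
    rw [map_sub, TensorProduct.lift.tmul, TensorProduct.lift.tmul, hf, sub_self])

@[simp] theorem tlift_tmk {N : GrMod (grd (perp I))} {l j : ℤ} {X : Type u} [AddCommGroup X]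
    [Module K X] (f : (regular (grd I)).obj l →ₗ[K] N.obj j →ₗ[K] X) (hf) (a : (regular (grd I)).obj l) (x : N.obj j) :
    tlift (N := N) f hf (tmk N l j a x) = f a x := rfl

/-- Left multiplication by `a` on `A ⊗_{A_0} N_j`. -/
def tact (N : GrMod (grd (perp I))) {m l l' : ℤ} (h : m + l = l') (j : ℤ) (a : grd I m) :
    Tens I N l j →ₗ[K] Tens I N l' j :=
  tlift ((tmk N l' j).comp ((regular (grd I)).act m l l' h a)) fun v b x => by
    change tmk N l' j _ x = tmk N l' j _ _
    rw [← tmk_balanced, ← act_rmul (grd I) (add_zero l) h h (add_zero l')]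

theorem tact_tmk (N : GrMod (grd (perp I))) {m l l' : ℤ} (h : m + l = l') (j : ℤ) (a : grd I m)
    (b : (regular (grd I)).obj l) (x : N.obj j) :
    tact N h j a (tmk N l j b x) = tmk N l' j ((regular (grd I)).act m l l' h a b) x := rfl

theorem tact_add (N : GrMod (grd (perp I))) {m l l' : ℤ} (h : m + l = l') (j : ℤ)
    (a b : grd I m) : tact N h j (a + b) = tact N h j a + tact N h j b :=
  tens_hom_ext fun c y => by simp only [tact_tmk, map_add, LinearMap.add_apply]

theorem tact_smul (N : GrMod (grd (perp I))) {m l l' : ℤ} (h : m + l = l') (j : ℤ) (c : K)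
    (a : grd I m) : tact N h j (c • a) = c • tact N h j a :=
  tens_hom_ext fun c y => by simp only [tact_tmk, map_smul, LinearMap.smul_apply]

theorem tact_one (N : GrMod (grd (perp I))) {l : ℤ} (h : 0 + l = l) (j : ℤ) :
    tact N h j ⟨1, SetLike.GradedOne.one_mem⟩ = LinearMap.id :=
  tens_hom_ext fun c y => by rw [tact_tmk, GrMod.one_act, LinearMap.id_apply]

theorem tact_mul (N : GrMod (grd (perp I))) {n m l l' l'' : ℤ} (h : m + l = l')
    (h1 : n + l' = l'') (h2 : n + m + l = l'') (j : ℤ) (a : grd I n) (b : grd I m) :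
    tact N h2 j ⟨a * b, SetLike.GradedMul.mul_mem a.2 b.2⟩ = tact N h1 j a ∘ₗ tact N h j b :=
  tens_hom_ext fun c y => by
    rw [LinearMap.comp_apply, tact_tmk, tact_tmk, tact_tmk, GrMod.mul_act _ n m l l' l'' h h1]

/-- The graded left `A`-module `A ⊗_{A_0} N_j`, with `A_l ⊗_{A_0} N_j` in degree `l - j`. -/
def tensMod (N : GrMod (grd (perp I))) (j : ℤ) : GrMod (grd I) where
  obj q := Tens I N (q + j) j
  act l q q' h := LinearMap.mk₂ K
    (fun a x => tact N (show l + (q + j) = q' + j by omega) j a x)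
    (fun a a' x => LinearMap.congr_fun (tact_add N _ j a a') x)
    (fun c a x => LinearMap.congr_fun (tact_smul N _ j c a) x)
    (fun a x x' => map_add _ _ _)
    (fun c a x => map_smul _ _ _)
  one_act q x := LinearMap.congr_fun (tact_one N (zero_add (q + j)) j) x
  mul_act l m i i' k h h' a b x := LinearMap.congr_fun (tact_mul N
    (show m + (i + j) = i' + j by omega) (show l + (i' + j) = k + j by omega)
    (show l + m + (i + j) = k + j by omega) j a b) x

/-- The map `a ⊗ x ↦ a ⊗ φ(x)`. -/
def tmap {N N' : GrMod (grd (perp I))} (φ : N ⟶ N') (l j : ℤ) : Tens I N l j →ₗ[K] Tens I N' l j :=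
  tlift ((tmk N' l j).compl₂ (app φ j)) fun v a x => by
    simp only [LinearMap.compl₂_apply, app_act]
    rw [tmk_balanced]

theorem tmap_tmk {N N' : GrMod (grd (perp I))} (φ : N ⟶ N') (l j : ℤ)
    (a : (regular (grd I)).obj l) (x : N.obj j) :
    tmap φ l j (tmk N l j a x) = tmk N' l j a (app φ j x) := rfl

/-- The map `d'(a ⊗ x) = ∑_α a α ⊗ α^op x`. -/
def td (N : GrMod (grd (perp I))) {l l' j j' : ℤ} (h : l + 1 = l') (h' : 1 + j = j') :
    Tens I N l j →ₗ[K] Tens I N l' j' :=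
  tlift (∑ α : Arrows V, ((tmk N l' j').compl₂
      (N.act 1 j j' h' (arr (perp I) α.2.2.op))).comp (rmul (grd I) h (arr I α.2.2)))
    fun v a x => by
      classical
      simp only [LinearMap.sum_apply, LinearMap.comp_apply, LinearMap.compl₂_apply]
      refine Finset.sum_congr rfl fun ⟨s, t, α⟩ _ => ?_
      by_cases hv : v = s
      · subst hv
        rw [rmul_rmul (grd I) (add_zero l) h (zero_add 1) h a _ _ (arr I α)
            (mk_vtx_mul_arr α).symm,
          act_act N (zero_add j) h' (add_zero 1) h' _ _ (arr (perp I) α.op)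
            (mk_arr_mul_vtx α.op).symm]
      · rw [rmul_rmul (grd I) (add_zero l) h (zero_add 1) h a _ _ 0
            (mk_vtx_mul_arr_of_ne hv α).symm,
          act_act N (zero_add j) h' (add_zero 1) h' _ _ 0
            (mk_arr_mul_vtx_of_ne (fun e => hv (op_injective e).symm) α.op).symm]
        simp only [rmul_zero, map_zero, LinearMap.zero_apply]

theorem td_tmk (N : GrMod (grd (perp I))) {l l' j j' : ℤ} (h : l + 1 = l') (h' : 1 + j = j')
    (a : (regular (grd I)).obj l) (x : N.obj j) :
    td N h h' (tmk N l j a x) = ∑ α : Arrows V, tmk N l' j' (rmul (grd I) h (arr I α.2.2) a)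
      (N.act 1 j j' h' (arr (perp I) α.2.2.op) x) := by
  simp only [td, tlift_tmk, LinearMap.sum_apply, LinearMap.comp_apply, LinearMap.compl₂_apply]

theorem tmap_tact {N N' : GrMod (grd (perp I))} (φ : N ⟶ N') {m l l' : ℤ} (h : m + l = l') (j : ℤ)
    (a : grd I m) : tmap φ l' j ∘ₗ tact N h j a = tact N' h j a ∘ₗ tmap φ l j :=
  tens_hom_ext fun _ _ => rfl

theorem td_tact (N : GrMod (grd (perp I))) {m l l' k k' j j' : ℤ} (h : m + l = l')
    (e : l + 1 = k) (e' : l' + 1 = k') (h1 : 1 + j = j') (h2 : m + k = k') (a : grd I m) :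
    td N e' h1 ∘ₗ tact N h j a = tact N h2 j' a ∘ₗ td N e h1 :=
  tens_hom_ext fun b x => by
    simp only [LinearMap.comp_apply, tact_tmk, td_tmk, map_sum]
    refine Finset.sum_congr rfl fun α _ => ?_
    rw [act_rmul (grd I) e h2 h e']

theorem tmap_td {N N' : GrMod (grd (perp I))} (φ : N ⟶ N') {l l' j j' : ℤ} (h : l + 1 = l')
    (h' : 1 + j = j') : tmap φ l' j' ∘ₗ td N h h' = td N' h h' ∘ₗ tmap φ l j :=
  tens_hom_ext fun b x => by
    simp only [LinearMap.comp_apply, td_tmk, map_sum, tmap_tmk, app_act]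

theorem td_td (N : GrMod (grd (perp I))) {l l' l'' j j' j'' : ℤ} (h : l + 1 = l')
    (h' : 1 + j = j') (k : l' + 1 = l'') (k' : 1 + j' = j'') :
    td N k k' ∘ₗ td N h h' = 0 :=
  tens_hom_ext fun b x => by
    have e2 : l + 2 = l'' := by omega
    have f2 : 2 + j = j'' := by omega
    simp only [LinearMap.comp_apply, td_tmk, map_sum, LinearMap.zero_apply]
    rw [sum_arrows_arrows]
    · refine Eq.trans (Finset.sum_congr rfl fun t _ => ?_)
        (canonical_sum_eq_zero I (fun s t => tmk N l'' j'' (rmul (grd I) e2 (pairElt I s) b)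
          (N.act 2 j j'' f2 (pairEltOp (perp I) t) x)) (fun u hu t => ?_) (fun w hw s => ?_))
      · rw [rmul_rmul (grd I) h k (by norm_num) e2 b _ _ (pairElt I t) (pairElt_coe I t),
          act_act N h' k' (by norm_num) f2 _ _ (pairEltOp (perp I) t) (pairEltOp_coe _ t)]
      · have h0 := sum_pairElt_eq_zero I u hu
        have h1 := congrArg (fun c => tmk N l'' j'' (rmulLin (grd I) e2 b c)
          (N.act 2 j j'' f2 (pairEltOp (perp I) t) x)) h0
        simp only [map_sum, map_smul, LinearMap.sum_apply, LinearMap.smul_apply, map_zero,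
          LinearMap.zero_apply] at h1
        exact h1
      · have h0 := sum_pairEltOp_eq_zero (perp I) w hw
        have h1 := congrArg (fun c => tmk N l'' j'' (rmul (grd I) e2 (pairElt I s) b)
          (N.act 2 j j'' f2 c x)) h0
        simpa only [map_sum, map_smul, LinearMap.sum_apply, LinearMap.smul_apply, map_zero,
          LinearMap.zero_apply] using h1
    · rintro ⟨s, t, α⟩ ⟨t', r, β⟩ hne
      rw [rmul_rmul (grd I) h k (by norm_num) e2 b _ _ 0 (mk_arr_mul_arr_of_ne hne α β).symm]
      simp only [rmul_zero, map_zero, LinearMap.zero_apply]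

/-- The morphism `A ⊗_{A_0} N_j ⟶ A ⊗_{A_0} N'_j`, `a ⊗ x ↦ a ⊗ φ(x)`. -/
def tensMap {N N' : GrMod (grd (perp I))} (φ : N ⟶ N') (j : ℤ) : tensMod N j ⟶ tensMod N' j :=
  mkHom (M := tensMod N j) (N := tensMod N' j) (fun q => tmap φ (q + j) j)
    fun _ _ _ _ a x => LinearMap.congr_fun (tmap_tact φ _ j a) x

/-- The morphism `d' : A ⊗_{A_0} N_j ⟶ A ⊗_{A_0} N_{j+1}`, `d'(a ⊗ x) = ∑_α a α ⊗ α^op x`. -/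
def tensD (N : GrMod (grd (perp I))) (j : ℤ) : tensMod N j ⟶ tensMod N (j + 1) :=
  mkHom (M := tensMod N j) (N := tensMod N (j + 1))
    (fun q => td N (add_assoc q j 1) (add_comm 1 j))
    fun _ _ _ _ a x => LinearMap.congr_fun (td_tact N _ _ _ _ _ a) x

theorem tensMap_comp_eq_zero {N N' N'' : GrMod (grd (perp I))} (φ : N ⟶ N') (ψ : N' ⟶ N'')
    (h : φ ≫ ψ = 0) (j : ℤ) : tensMap φ j ≫ tensMap ψ j = 0 :=
  hom_ext fun q x => LinearMap.congr_fun (f := tmap ψ (q + j) j ∘ₗ tmap φ (q + j) j) (g := 0)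
    (tens_hom_ext fun a y => by
      rw [LinearMap.comp_apply, tmap_tmk, tmap_tmk, ← app_comp, h]
      exact map_zero _) x

theorem tensMap_tensD {N N' : GrMod (grd (perp I))} (φ : N ⟶ N') (j : ℤ) :
    tensMap φ j ≫ tensD N' j = tensD N j ≫ tensMap φ (j + 1) :=
  hom_ext fun _ x => (LinearMap.congr_fun (tmap_td φ _ _) x).symm

theorem tensD_tensD (N : GrMod (grd (perp I))) (j : ℤ) : tensD N j ≫ tensD N (j + 1) = 0 :=
  hom_ext fun _ x => LinearMap.congr_fun (td_td N _ _ _ _) x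

/-- The set of pairs `(i, j)` with `i + j = p`. -/
abbrev Diag (p : ℤ) : Type := {x : ℤ × ℤ // x.1 + x.2 = p}

/-- The term `F(N)^p = ⨁_{i + j = p} A ⊗_{A_0} N^i_j`. -/
def FX (N : CochainComplex (GrMod (grd (perp I))) ℤ) (p : ℤ) : GrMod (grd I) :=
  dirSum fun t : Diag p => tensMod (N.X t.1.1) t.1.2

/-- The inclusion of the summand `A ⊗_{A_0} N^i_j` in `F(N)^{i+j}`. -/
def Fincl (N : CochainComplex (GrMod (grd (perp I))) ℤ) {i j p : ℤ} (h : i + j = p) :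
    tensMod (N.X i) j ⟶ FX N p :=
  incl (fun t : Diag p => tensMod (N.X t.1.1) t.1.2) ⟨(i, j), h⟩

/-- The differential of `F(N)`, which is `d'' + (-1)^i d'` on `A ⊗_{A_0} N^i_j`. -/
def Fd (N : CochainComplex (GrMod (grd (perp I))) ℤ) (p : ℤ) : FX N p ⟶ FX N (p + 1) :=
  desc _ fun t : Diag p =>
    tensMap (N.d t.1.1 (t.1.1 + 1)) t.1.2 ≫
        Fincl N (show t.1.1 + 1 + t.1.2 = p + 1 by have := t.2; omega) +
      t.1.1.negOnePow • (tensD (N.X t.1.1) t.1.2 ≫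
        Fincl N (show t.1.1 + (t.1.2 + 1) = p + 1 by have := t.2; omega))

theorem Fincl_Fd (N : CochainComplex (GrMod (grd (perp I))) ℤ) {i j p : ℤ} (h : i + j = p) :
    Fincl N h ≫ Fd N p =
      tensMap (N.d i (i + 1)) j ≫ Fincl N (show i + 1 + j = p + 1 by omega) +
        i.negOnePow • (tensD (N.X i) j ≫ Fincl N (show i + (j + 1) = p + 1 by omega)) :=
  incl_desc _ _ _

theorem Fd_comp_Fd (N : CochainComplex (GrMod (grd (perp I))) ℤ) (p : ℤ) :
    Fd N p ≫ Fd N (p + 1) = 0 :=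
  dirSum_hom_ext fun ⟨⟨i, j⟩, h⟩ => by
    change Fincl N h ≫ _ = _
    rw [← Category.assoc, Fincl_Fd, Preadditive.add_comp, Category.assoc, Fincl_Fd,
      Linear.units_smul_comp, Category.assoc, Fincl_Fd, Preadditive.comp_add, Preadditive.comp_add,
      Linear.comp_units_smul, Linear.comp_units_smul, ← Category.assoc, ← Category.assoc,
      ← Category.assoc, ← Category.assoc, tensMap_comp_eq_zero _ _ (N.d_comp_d _ _ _),
      tensD_tensD, tensMap_tensD, Int.negOnePow_succ]
    simp only [Limits.zero_comp, smul_zero, zero_add, add_zero, Units.neg_smul, neg_add_cancel,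
      Category.assoc]
    exact Limits.comp_zero.symm

/-- The Koszul duality functor `F`: the complex `F(N) = A ⊗_{A_0} N` of graded left `A`-modules,
the total complex of the double complex `A ⊗_{A_0} N^i_j`. -/
def koszulF (N : CochainComplex (GrMod (grd (perp I))) ℤ) : CochainComplex (GrMod (grd I)) ℤ :=
  CochainComplex.of (FX N) (Fd N) (Fd_comp_Fd N)

variable (I) in
/-- The space `Hom_{A_0}((A^!)_l, M_j)`. Here `A_0` is spanned by the idempotents `e_v`. -/
def HomA0 (M : GrMod (grd I)) (l j : ℤ) :
    Submodule K ((regular (grd (perp I))).obj l →ₗ[K] M.obj j) where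
  carrier := {f | ∀ (v : V) (x : (regular (grd (perp I))).obj l),
    f ((regular (grd (perp I))).act 0 l l (zero_add l) (vtx (perp I) (op v)) x) =
      M.act 0 j j (zero_add j) (vtx I v) (f x)}
  add_mem' hf hg v x := by simp only [LinearMap.add_apply, map_add, hf v x, hg v x]
  zero_mem' v x := by simp only [LinearMap.zero_apply, map_zero]
  smul_mem' c f hf v x := by simp only [LinearMap.smul_apply, map_smul, hf v x]

/-- The action `(b f)(x) = f(x b)` of `b ∈ A^!`. -/
def hact (M : GrMod (grd I)) {l m l' : ℤ} (h : l' + m = l) (j : ℤ) (b : grd (perp I) m) :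
    HomA0 I M l j →ₗ[K] HomA0 I M l' j where
  toFun f := ⟨f.1 ∘ₗ rmul (grd (perp I)) h b, fun v x => by
    rw [LinearMap.comp_apply, LinearMap.comp_apply, ← f.2 v,
      act_rmul (grd (perp I)) h (zero_add l) (zero_add l') h]⟩
  map_add' _ _ := rfl
  map_smul' _ _ := rfl

theorem hact_apply (M : GrMod (grd I)) {l m l' : ℤ} (h : l' + m = l) (j : ℤ)
    (b : grd (perp I) m) (f : HomA0 I M l j) (x : (regular (grd (perp I))).obj l') :
    (hact M h j b f).1 x = f.1 (rmul (grd (perp I)) h b x) := rfl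

theorem homA0_ext {M : GrMod (grd I)} {l j : ℤ} {f g : HomA0 I M l j} (h : ∀ x, f.1 x = g.1 x) :
    f = g := Subtype.ext (LinearMap.ext h)

theorem hact_add (M : GrMod (grd I)) {l m l' : ℤ} (h : l' + m = l) (j : ℤ)
    (b b' : grd (perp I) m) (f : HomA0 I M l j) :
    hact M h j (b + b') f = hact M h j b f + hact M h j b' f :=
  homA0_ext fun x =>
    (congrArg f.1 (map_add (rmulLin (grd (perp I)) h x) b b')).trans (map_add f.1 _ _)

theorem hact_smul (M : GrMod (grd I)) {l m l' : ℤ} (h : l' + m = l) (j : ℤ) (c : K)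
    (b : grd (perp I) m) (f : HomA0 I M l j) :
    hact M h j (c • b) f = c • hact M h j b f :=
  homA0_ext fun x =>
    (congrArg f.1 (map_smul (rmulLin (grd (perp I)) h x) c b)).trans (map_smul f.1 _ _)

/-- The graded left `A^!`-module `Hom_{A_0}(A^!, M_j)`, with `Hom_{A_0}((A^!)_l, M_j)` in degree
`-l - j`. -/
def homMod (M : GrMod (grd I)) (j : ℤ) : GrMod (grd (perp I)) where
  obj q := HomA0 I M (-q - j) j
  act m q q' h := LinearMap.mk₂ K
    (fun b f => hact M (show (-q' - j) + m = -q - j by omega) j b f)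
    (fun b b' f => hact_add M _ j b b' f)
    (fun c b f => hact_smul M _ j c b f)
    (fun b f f' => map_add _ _ _)
    (fun c b f => map_smul _ _ _)
  one_act q f := homA0_ext fun x => congrArg f.1 (Subtype.ext (mul_one _))
  mul_act l m i i' k h h' a b f := homA0_ext fun x =>
    congrArg f.1 (Subtype.ext (mul_assoc _ _ _).symm)

/-- The map `f ↦ φ ∘ f`. -/
def hmap {M M' : GrMod (grd I)} (φ : M ⟶ M') (l j : ℤ) : HomA0 I M l j →ₗ[K] HomA0 I M' l j where
  toFun f := ⟨app φ j ∘ₗ f.1, fun v x => by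
    rw [LinearMap.comp_apply, LinearMap.comp_apply, f.2 v, app_act]⟩
  map_add' f g := homA0_ext fun x => map_add (app φ j) _ _
  map_smul' c f := homA0_ext fun x => map_smul (app φ j) _ _

theorem hmap_apply {M M' : GrMod (grd I)} (φ : M ⟶ M') (l j : ℤ) (f : HomA0 I M l j)
    (x : (regular (grd (perp I))).obj l) : (hmap φ l j f).1 x = app φ j (f.1 x) := rfl

/-- The map `d'(f)(x) = ∑_α α f(α^op x)`. -/
def hd (M : GrMod (grd I)) {l l' j j' : ℤ} (h : 1 + l' = l) (h' : 1 + j = j') :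
    HomA0 I M l j →ₗ[K] HomA0 I M l' j' where
  toFun f := ⟨∑ α : Arrows V, M.act 1 j j' h' (arr I α.2.2) ∘ₗ f.1 ∘ₗ
      (regular (grd (perp I))).act 1 l' l h (arr (perp I) α.2.2.op), fun v x => by
    classical
    simp only [LinearMap.sum_apply, LinearMap.comp_apply, map_sum]
    refine Finset.sum_congr rfl fun ⟨s, t, α⟩ _ => ?_
    by_cases hv : v = s
    · subst hv
      rw [act_act _ (zero_add l') h (add_zero 1) h _ _ (arr (perp I) α.op)
          (mk_arr_mul_vtx α.op).symm,
        act_act M h' (zero_add j') (zero_add 1) h' _ _ (arr I α) (mk_vtx_mul_arr α).symm]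
    · rw [act_act _ (zero_add l') h (add_zero 1) h _ _ 0
          (mk_arr_mul_vtx_of_ne (fun e => hv (op_injective e).symm) α.op).symm,
        act_act M h' (zero_add j') (zero_add 1) h' _ _ 0 (mk_vtx_mul_arr_of_ne hv α).symm]
      simp only [map_zero, LinearMap.zero_apply]⟩
  map_add' f g := homA0_ext fun x => by
    simp only [LinearMap.sum_apply, LinearMap.comp_apply, Submodule.coe_add, LinearMap.add_apply,
      map_add, Finset.sum_add_distrib]
  map_smul' c f := homA0_ext fun x => by
    simp only [LinearMap.sum_apply, LinearMap.comp_apply, Submodule.coe_smul, LinearMap.smul_apply,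
      map_smul, Finset.smul_sum, RingHom.id_apply]

theorem hd_apply (M : GrMod (grd I)) {l l' j j' : ℤ} (h : 1 + l' = l) (h' : 1 + j = j')
    (f : HomA0 I M l j) (x : (regular (grd (perp I))).obj l') :
    (hd M h h' f).1 x = ∑ α : Arrows V, M.act 1 j j' h' (arr I α.2.2)
      (f.1 ((regular (grd (perp I))).act 1 l' l h (arr (perp I) α.2.2.op) x)) := by
  simp only [hd, LinearMap.coe_mk, AddHom.coe_mk, LinearMap.sum_apply, LinearMap.comp_apply]

theorem hmap_hact {M M' : GrMod (grd I)} (φ : M ⟶ M') {l m l' : ℤ} (h : l' + m = l) (j : ℤ)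
    (b : grd (perp I) m) (f : HomA0 I M l j) :
    hmap φ l' j (hact M h j b f) = hact M' h j b (hmap φ l j f) := rfl

theorem hd_hact (M : GrMod (grd I)) {l m l' k k' j j' : ℤ} (h : l' + m = l) (e : 1 + k = l)
    (e' : 1 + k' = l') (h1 : 1 + j = j') (h2 : k' + m = k) (b : grd (perp I) m)
    (f : HomA0 I M l j) :
    hd M e' h1 (hact M h j b f) = hact M h2 j' b (hd M e h1 f) :=
  homA0_ext fun x => by
    simp only [hd_apply, hact_apply]
    refine Finset.sum_congr rfl fun α _ => ?_
    rw [act_rmul (grd (perp I)) h2 e e' h]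

theorem hmap_hd {M M' : GrMod (grd I)} (φ : M ⟶ M') {l l' j j' : ℤ} (h : 1 + l' = l)
    (h' : 1 + j = j') (f : HomA0 I M l j) :
    hmap φ l' j' (hd M h h' f) = hd M' h h' (hmap φ l j f) :=
  homA0_ext fun x => by
    simp only [hd_apply, hmap_apply, map_sum, app_act]

theorem hd_hd (M : GrMod (grd I)) {l l' l'' j j' j'' : ℤ} (h : 1 + l' = l) (h' : 1 + j = j')
    (k : 1 + l'' = l') (k' : 1 + j' = j'') (f : HomA0 I M l j) :
    hd M k k' (hd M h h' f) = 0 :=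
  homA0_ext fun x => by
    have e2 : 2 + l'' = l := by omega
    have f2 : 2 + j = j'' := by omega
    change _ = (0 : M.obj j'')
    simp only [hd_apply, map_sum]
    rw [sum_arrows_arrows]
    · refine Eq.trans (Finset.sum_congr rfl fun t _ => ?_)
        (canonical_sum_eq_zero I (fun s t => M.act 2 j j'' f2 (pairElt I s)
          (f.1 ((regular (grd (perp I))).act 2 l'' l e2 (pairEltOp (perp I) t) x)))
          (fun u hu t => ?_) (fun w hw s => ?_))
      · rw [act_act M h' k' (by norm_num) f2 _ _ (pairElt I t) (pairElt_coe I t),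
          act_act _ k h (by norm_num) e2 _ _ (pairEltOp (perp I) t) (pairEltOp_coe _ t)]
      · have h0 := sum_pairElt_eq_zero I u hu
        have h1 := congrArg (fun c => M.act 2 j j'' f2 c
          (f.1 ((regular (grd (perp I))).act 2 l'' l e2 (pairEltOp (perp I) t) x))) h0
        simpa only [map_sum, map_smul, LinearMap.sum_apply, LinearMap.smul_apply, map_zero,
          LinearMap.zero_apply] using h1
      · have h0 := sum_pairEltOp_eq_zero (perp I) w hw
        have h1 := congrArg (fun c => M.act 2 j j'' f2 (pairElt I s)
          (f.1 ((regular (grd (perp I))).act 2 l'' l e2 c x))) h0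
        simpa only [map_sum, map_smul, LinearMap.sum_apply, LinearMap.smul_apply, map_zero,
          LinearMap.zero_apply] using h1
    · rintro ⟨s, t, α⟩ ⟨t', r, β⟩ hne
      rw [act_act M h' k' (by norm_num) f2 _ _ 0 (mk_arr_mul_arr_of_ne hne α β).symm]
      simp only [map_zero, LinearMap.zero_apply]

/-- The morphism `Hom_{A_0}(A^!, M_j) ⟶ Hom_{A_0}(A^!, M'_j)`, `f ↦ φ ∘ f`. -/
def homMap {M M' : GrMod (grd I)} (φ : M ⟶ M') (j : ℤ) : homMod M j ⟶ homMod M' j :=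
  mkHom (M := homMod M j) (N := homMod M' j) (fun q => hmap φ (-q - j) j)
    fun _ _ _ _ b f => hmap_hact φ _ j b f

/-- The morphism `d' : Hom_{A_0}(A^!, M_j) ⟶ Hom_{A_0}(A^!, M_{j+1})`,
`d'(f)(x) = ∑_α α f(α^op x)`. -/
def homD (M : GrMod (grd I)) (j : ℤ) : homMod M j ⟶ homMod M (j + 1) :=
  mkHom (M := homMod M j) (N := homMod M (j + 1))
    (fun q => hd M (show 1 + (-q - (j + 1)) = -q - j by omega) (add_comm 1 j))
    fun _ _ _ _ b f => hd_hact M _ _ _ _ _ b f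

theorem homMap_comp_eq_zero {M M' M'' : GrMod (grd I)} (φ : M ⟶ M') (ψ : M' ⟶ M'')
    (h : φ ≫ ψ = 0) (j : ℤ) : homMap φ j ≫ homMap ψ j = 0 :=
  hom_ext fun q (f : HomA0 I M (-q - j) j) => homA0_ext fun x => by
    change app ψ j (app φ j (f.1 x)) = 0
    rw [← app_comp, h]
    rfl

theorem homMap_homD {M M' : GrMod (grd I)} (φ : M ⟶ M') (j : ℤ) :
    homMap φ j ≫ homD M' j = homD M j ≫ homMap φ (j + 1) :=
  hom_ext fun _ f => (hmap_hd φ _ _ f).symm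

theorem homD_homD (M : GrMod (grd I)) (j : ℤ) : homD M j ≫ homD M (j + 1) = 0 :=
  hom_ext fun _ f => hd_hd M _ _ _ _ f

/-- The term `G(M)^p = ⨁_{i + j = p} Hom_{A_0}(A^!, M^i_j)`. -/
def GX (M : CochainComplex (GrMod (grd I)) ℤ) (p : ℤ) : GrMod (grd (perp I)) :=
  dirSum fun t : Diag p => homMod (M.X t.1.1) t.1.2

/-- The inclusion of the summand `Hom_{A_0}(A^!, M^i_j)` in `G(M)^{i+j}`. -/
def Gincl (M : CochainComplex (GrMod (grd I)) ℤ) {i j p : ℤ} (h : i + j = p) :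
    homMod (M.X i) j ⟶ GX M p :=
  incl (fun t : Diag p => homMod (M.X t.1.1) t.1.2) ⟨(i, j), h⟩

/-- The differential of `G(M)`, which is `d'' + (-1)^i d'` on `Hom_{A_0}(A^!, M^i_j)`. -/
def Gd (M : CochainComplex (GrMod (grd I)) ℤ) (p : ℤ) : GX M p ⟶ GX M (p + 1) :=
  desc _ fun t : Diag p =>
    homMap (M.d t.1.1 (t.1.1 + 1)) t.1.2 ≫
        Gincl M (show t.1.1 + 1 + t.1.2 = p + 1 by have := t.2; omega) +
      t.1.1.negOnePow • (homD (M.X t.1.1) t.1.2 ≫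
        Gincl M (show t.1.1 + (t.1.2 + 1) = p + 1 by have := t.2; omega))

theorem Gincl_Gd (M : CochainComplex (GrMod (grd I)) ℤ) {i j p : ℤ} (h : i + j = p) :
    Gincl M h ≫ Gd M p =
      homMap (M.d i (i + 1)) j ≫ Gincl M (show i + 1 + j = p + 1 by omega) +
        i.negOnePow • (homD (M.X i) j ≫ Gincl M (show i + (j + 1) = p + 1 by omega)) :=
  incl_desc _ _ _

theorem Gd_comp_Gd (M : CochainComplex (GrMod (grd I)) ℤ) (p : ℤ) :
    Gd M p ≫ Gd M (p + 1) = 0 :=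
  dirSum_hom_ext fun ⟨⟨i, j⟩, h⟩ => by
    change Gincl M h ≫ _ = _
    rw [← Category.assoc, Gincl_Gd, Preadditive.add_comp, Category.assoc, Gincl_Gd,
      Linear.units_smul_comp, Category.assoc, Gincl_Gd, Preadditive.comp_add, Preadditive.comp_add,
      Linear.comp_units_smul, Linear.comp_units_smul, ← Category.assoc, ← Category.assoc,
      ← Category.assoc, ← Category.assoc, homMap_comp_eq_zero _ _ (M.d_comp_d _ _ _),
      homD_homD, homMap_homD, Int.negOnePow_succ]
    simp only [Limits.zero_comp, smul_zero, zero_add, add_zero, Units.neg_smul, neg_add_cancel,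
      Category.assoc]
    exact Limits.comp_zero.symm

/-- The Koszul duality functor `G`: the complex `G(M) = Hom_{A_0}(A^!, M)` of graded left
`A^!`-modules, the total complex of the double complex `Hom_{A_0}(A^!, M^i_j)`. -/
def koszulG (M : CochainComplex (GrMod (grd I)) ℤ) : CochainComplex (GrMod (grd (perp I))) ℤ :=
  CochainComplex.of (GX M) (Gd M) (Gd_comp_Gd M)

end Functors

end QuiverAlgebra

end KoszulDuality

end

open KoszulDuality KoszulDuality.GrMod

/-!
Both halves compare two descriptions of one homotopy class of complexes. Write the total complexes
`F(N)` and `G(M)` as totalisations of double complexes whose rows carry the differential induced by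
that of `N` or `M`, and whose columns carry the Koszul differential.

*Contracting the rows.* The degree zero part `A₀` of either algebra is a product of copies of `K`,
so each degree of a complex of modules splits, linearly over `A₀`, as its cohomology plus a
contractible complex (`exists_splitting`). The functors `A ⊗ -` and `Hom(A^!, -)` over `A₀` turn
these splittings into contractions of the rows, and the homological perturbation lemma
(`BiCx.Contraction.exists_minimal`) deforms the total complex to a homotopy equivalent minimal one
whose terms are the modules `A ⊗ Hⁱ(N)_j`, respectively `Hom(A^!, Hⁱ(M)_j)`. This gives existence of
the resolutions.

*Reading off the linear strands.* Conversely every minimal resolution is homotopy equivalent to the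
total complex (`exists_hEquiv_of_projective`, `exists_hEquiv_of_injective`). A morphism between sums
of summands of shifts of `A` (or of `A^!`) vanishes if it goes to a larger degree of generation, and
the differential of a minimal complex strictly lowers that degree. Hence, in such an equivalence
composed with the contraction of the rows, only the components which preserve the degree of
generation contribute to the composites with the inverse equivalence. These components are
isomorphisms from the summands `C^{i+j,-j}` of the resolution to the terms of the contracted rows
(`isoH`), and they take the linear part of the differential to the Koszul differential on the
cohomology of the rows (`comp_toH`). The statements on strands and on their sum follow
(`nonempty_strand_iso`, `nonempty_sumComplex_iso`).

*What is needed of the algebras.* For `F`, the module `A ⊗ N_j` is a summand of a sum of copies of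
`A(j)` (`isLin_tensMod`), and only finitely many degrees matter because `A^!` vanishes above the
global dimension (`eq_zero_of_globalDim`). For `G`, the module `Hom(A^!, M_j)` is always injective
(`injective_homMod`), and the point is that it is a summand of a sum of copies of `A^!(d+j)`
(`isLin_homMod`), which is the Frobenius property of `A^!`. The hypotheses enter as follows.
Koszulity makes the complex `F` of the injective hull `Hom(A^!, K_v)` of a simple `A^!`-module a
projective resolution of `K_v` (`isExactAt_koszulComplex_degZero`, `nonempty_hEquiv_koszulComplex`).
Applying `Hom(-, A)` to it computes the `Ext` groups of the definition of Artin–Schelter regularity.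
Their vanishing outside degree `d` says that no nonzero element of `A^!` of degree other than `d` is
annihilated by all arrows (`eq_zero_of_rmul_arr_eq_zero`), and their value in degree `d` says that
each `e_v (A^!)_d` has dimension at most one and equals `e_v (A^!)_d e_{δ(v)}` for a permutation `δ`
(`exists_perm_socle`). So there is a functional `τ` on `(A^!)_d` for which `(x, b) ↦ τ (x b)` is a
perfect pairing (`exists_frobenius`), and this pairing identifies the dual of `A^!` with a twist of
`A^!` itself.
-/

noncomputable section

namespace KoszulDuality

namespace GrMod

section General

variable {K : Type u} [Field K] {B : Type u} [Ring B] [Algebra K B]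
  {𝓑 : ℤ → Submodule K B} [NonnegGraded 𝓑]

/-! ### Elementary homological algebra of graded modules -/

/-- The inclusion of a graded submodule. -/
def Sub.ι {M : GrMod 𝓑} (S : Sub M) : S.toMod ⟶ M :=
  mkHom (M := S.toMod) (fun i => (S.carrier i).subtype) fun _ _ _ _ _ _ => rfl

/-- The projection to a quotient. -/
def Sub.π {M : GrMod 𝓑} (S : Sub M) : M ⟶ S.quot :=
  mkHom (N := S.quot) (fun i => (S.carrier i).mkQ) fun _ _ _ _ _ _ => rfl

/-- The corestriction of a morphism to a graded submodule that contains its image. -/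
def Sub.lift {M N : GrMod 𝓑} (S : Sub M) (f : N ⟶ M) (h : ∀ i x, app f i x ∈ S.carrier i) :
    N ⟶ S.toMod :=
  mkHom (N := S.toMod) (fun i => (app f i).codRestrict (S.carrier i) (h i))
    fun l i j e a x => Subtype.ext (app_act f l i j e a x)

/-- The morphism induced on a quotient by a morphism that vanishes on the submodule. -/
def Sub.desc {M N : GrMod 𝓑} (S : Sub M) (f : M ⟶ N) (h : ∀ i, ∀ x ∈ S.carrier i, app f i x = 0) :
    S.quot ⟶ N :=
  mkHom (M := S.quot) (fun i => (S.carrier i).liftQ (app f i) (h i)) fun l i j e a x => by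
    induction x using Submodule.Quotient.induction_on with
    | H x => exact app_act f l i j e a x

/-- Epimorphisms are surjective: compare the projection to the cokernel with zero. -/
theorem surjective_of_epi {M N : GrMod 𝓑} (f : M ⟶ N) [Epi f] (i : ℤ) :
    Function.Surjective (app f i) := by
  intro y
  have h : (Sub.range f).π = 0 := by
    rw [← cancel_epi f]
    exact hom_ext fun i x => (Submodule.Quotient.mk_eq_zero _).2 ⟨x, rfl⟩
  exact (Submodule.Quotient.mk_eq_zero _).1 (congrArg (fun t => app t i y) h)

theorem injective_of_mono {M N : GrMod 𝓑} (f : M ⟶ N) [Mono f] (i : ℤ) :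
    Function.Injective (app f i) := by
  refine (injective_iff_map_eq_zero _).2 fun x hx => ?_
  have h : (Sub.ker f).ι = 0 := by
    rw [← cancel_mono f]
    rw [Limits.zero_comp]
    exact hom_ext fun i x => LinearMap.mem_ker.1 x.2
  exact congrArg (fun t => app t i (⟨x, hx⟩ : LinearMap.ker (app f i))) h

theorem epi_of_surjective {M N : GrMod 𝓑} (f : M ⟶ N)
    (h : ∀ i, Function.Surjective (app f i)) : Epi f :=
  ⟨fun _ _ huv => hom_ext fun i x => by
    obtain ⟨y, rfl⟩ := h i x
    exact congrArg (fun t => app t i y) huv⟩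

theorem mono_of_injective {M N : GrMod 𝓑} (f : M ⟶ N)
    (h : ∀ i, Function.Injective (app f i)) : Mono f :=
  ⟨fun _ _ huv => hom_ext fun i x => h i (congrArg (fun t => app t i x) huv)⟩

theorem isZero_iff {M : GrMod 𝓑} : Limits.IsZero M ↔ ∀ i (x : M.obj i), x = 0 := by
  rw [Limits.IsZero.iff_id_eq_zero]
  exact ⟨fun h i x => congrArg (fun t => app t i x) h, fun h => hom_ext h⟩

theorem hom_eq_of_isZero_left {M N : GrMod 𝓑} (h : Limits.IsZero M) (f g : M ⟶ N) : f = g :=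
  h.eq_of_src f g

/-- A morphism from a projective module lifts along `g` as soon as its image lies in that of `g`;
the morphism `g` need not be an epimorphism. -/
theorem exists_lift {P X Y : GrMod 𝓑} [Projective P] (f : P ⟶ Y) (g : X ⟶ Y)
    (h : ∀ i x, ∃ y, app g i y = app f i x) : ∃ s : P ⟶ X, s ≫ g = f := by
  let e : X ⟶ (Sub.range g).toMod := (Sub.range g).lift g fun i x => ⟨x, rfl⟩
  have : Epi e := epi_of_surjective e fun i => by
    rintro ⟨_, y, rfl⟩
    exact ⟨y, rfl⟩
  let f' : P ⟶ (Sub.range g).toMod := (Sub.range g).lift f h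
  refine ⟨Projective.factorThru f' e, ?_⟩
  change Projective.factorThru f' e ≫ e ≫ (Sub.range g).ι = f' ≫ (Sub.range g).ι
  rw [Projective.factorThru_comp_assoc]

/-- A morphism to an injective module extends along `g` as soon as it vanishes on the kernel of
`g`; the morphism `g` need not be a monomorphism. -/
theorem exists_extension {E X Y : GrMod 𝓑} [Injective E] (f : X ⟶ E) (g : X ⟶ Y)
    (h : ∀ i x, app g i x = 0 → app f i x = 0) : ∃ s : Y ⟶ E, g ≫ s = f := by
  let m : (Sub.ker g).quot ⟶ Y := (Sub.ker g).desc g fun i x hx => hx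
  have : Mono m := mono_of_injective m fun i => by
    refine (injective_iff_map_eq_zero _).2 fun x => ?_
    induction x using Submodule.Quotient.induction_on with
    | H x => exact fun hx => (Submodule.Quotient.mk_eq_zero _).2 hx
  let f' : (Sub.ker g).quot ⟶ E := (Sub.ker g).desc f h
  refine ⟨Injective.factorThru f' m, ?_⟩
  change (Sub.ker g).π ≫ m ≫ Injective.factorThru f' m = (Sub.ker g).π ≫ f'
  rw [Injective.comp_factorThru]

/-! ### Null homotopies and homotopy equivalences -/

/-- The complex `C` is exact at the degree `j` component of its term of index `n + 1`. -/
def IsExactAt (C : CochainComplex (GrMod 𝓑) ℤ) (n j : ℤ) : Prop :=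
  ∀ x : (C.X (n + 1)).obj j, app (C.d (n + 1) (n + 1 + 1)) j x = 0 →
    ∃ y : (C.X n).obj j, app (C.d n (n + 1)) j y = x

/-- The complex `C` is exact. -/
def IsExact (C : CochainComplex (GrMod 𝓑) ℤ) : Prop := ∀ n j : ℤ, IsExactAt C n j

/-- Descending recursion on the integers, with a default value above `b`. -/
def descRec (b : ℤ) {X : ℤ → Type u} (z : ∀ n, X n) (next : ∀ n, X (n + 1) → X n) (n : ℤ) : X n :=
  if b < n then z n else next n (descRec b z next (n + 1))
termination_by (b + 1 - n).toNat
decreasing_by omega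

/-- A family indexed by the integers may be prescribed through its values at the successors `n +
1`. This is how morphisms constructed in the shape `C^{n+1} ⟶ D^{n+1}` become families over all of
`ℤ`. -/
theorem exists_shift {X : ℤ → Type u} (φ : ∀ n, X (n + 1)) :
    ∃ ψ : ∀ n, X n, ∀ n, ψ (n + 1) = φ n := by
  refine ⟨fun m => (sub_add_cancel m 1) ▸ φ (m - 1), fun n => ?_⟩
  have key : ∀ (m k : ℤ) (h : k + 1 = m + 1), (h ▸ φ k : X (m + 1)) = φ m := by
    intro m k h
    obtain rfl : k = m := by omega
    rfl
  exact key n _ _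

theorem descRec_of_le {b : ℤ} {X : ℤ → Type u} (z : ∀ n, X n) (next : ∀ n, X (n + 1) → X n)
    {n : ℤ} (h : ¬ b < n) : descRec b z next n = next n (descRec b z next (n + 1)) := by
  rw [descRec, if_neg h]

/-- Ascending recursion on the integers, with a default value below `b`. -/
def ascRec (b : ℤ) {X : ℤ → Type u} (z : ∀ n, X n) (next : ∀ n, X n → X (n + 1)) (n : ℤ) : X n :=
  if n < b then z n else (sub_add_cancel n 1) ▸ next (n - 1) (ascRec b z next (n - 1))
termination_by (n + 1 - b).toNat
decreasing_by omega

theorem ascRec_succ {b : ℤ} {X : ℤ → Type u} (z : ∀ n, X n) (next : ∀ n, X n → X (n + 1))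
    {n : ℤ} (h : b ≤ n + 1) : ascRec b z next (n + 1) = next n (ascRec b z next n) := by
  have key : ∀ (k : ℤ) (e : k + 1 = n + 1),
      (e ▸ next k (ascRec b z next k) : X (n + 1)) = next n (ascRec b z next n) := by
    intro k e
    obtain rfl : k = n := by omega
    rfl
  rw [ascRec, if_neg (by omega)]
  exact key _ _

/-- A morphism from a bounded above complex of projectives to an exact complex is null homotopic.
The homotopy is found by descending recursion from the upper bound. -/
theorem exists_nullHomotopy_of_projective {C Q : CochainComplex (GrMod 𝓑) ℤ} (φ : C ⟶ Q)
    (hC : ∀ n, Projective (C.X n)) {b : ℤ} (hb : ∀ n, b < n → Limits.IsZero (C.X n))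
    (hQ : IsExact Q) :
    ∃ s : ∀ n, C.X (n + 1) ⟶ Q.X n, ∀ n,
      φ.f (n + 1) = C.d (n + 1) (n + 1 + 1) ≫ s (n + 1) + s n ≫ Q.d n (n + 1) := by
  classical
  -- `Good n s` is the condition under which a component `s` of the homotopy has a predecessor.
  let Good : ∀ n, (C.X (n + 1) ⟶ Q.X n) → Prop := fun n s =>
    C.d n (n + 1) ≫ (φ.f (n + 1) - s ≫ Q.d n (n + 1)) = 0
  have step : ∀ n (s : C.X (n + 1 + 1) ⟶ Q.X (n + 1)), Good (n + 1) s →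
      ∃ s' : C.X (n + 1) ⟶ Q.X n,
        φ.f (n + 1) = C.d (n + 1) (n + 1 + 1) ≫ s + s' ≫ Q.d n (n + 1) := by
    intro n s hs
    have := hC (n + 1)
    obtain ⟨s', h⟩ := exists_lift (φ.f (n + 1) - C.d (n + 1) (n + 1 + 1) ≫ s) (Q.d n (n + 1))
      fun j x => hQ n j _ <| by
        rw [← app_comp, Preadditive.sub_comp, φ.comm, Category.assoc, ← Preadditive.comp_sub]
        exact congrArg (fun t => app t j x) hs
    exact ⟨s', by rw [h]; abel⟩
  let next : ∀ n, (C.X (n + 1 + 1) ⟶ Q.X (n + 1)) → (C.X (n + 1) ⟶ Q.X n) := fun n s =>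
    if h : Good (n + 1) s then (step n s h).choose else 0
  have good_next : ∀ n s, Good (n + 1) s → φ.f (n + 1) =
      C.d (n + 1) (n + 1 + 1) ≫ s + next n s ≫ Q.d n (n + 1) := fun n s h => by
    simp only [next, dif_pos h]
    exact (step n s h).choose_spec
  let s : ∀ n, C.X (n + 1) ⟶ Q.X n :=
    descRec b (X := fun n => C.X (n + 1) ⟶ Q.X n) (fun _ => 0) next
  have hs : ∀ n, ¬ b < n → s n = next n (s (n + 1)) := fun n hn => descRec_of_le _ _ hn
  have hgood : ∀ k : ℕ, ∀ n, b + 1 - n ≤ k → Good n (s n) := by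
    intro k
    induction k with
    | zero => exact fun n hn => hom_eq_of_isZero_left (hb n (by push_cast at hn; omega)) _ _
    | succ k ih =>
      intro n hn
      by_cases hbn : b < n
      · exact hom_eq_of_isZero_left (hb n hbn) _ _
      · have h1 := good_next n _ (ih (n + 1) (by push_cast at hn; omega))
        change C.d n (n + 1) ≫ (φ.f (n + 1) - s n ≫ Q.d n (n + 1)) = 0
        rw [hs n hbn, h1, add_sub_cancel_right, ← Category.assoc, C.d_comp_d, Limits.zero_comp]
  refine ⟨s, fun n => ?_⟩
  by_cases hbn : b < n
  · exact hom_eq_of_isZero_left (hb (n + 1) (by omega)) _ _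
  · have h1 := good_next n _ (hgood (b + 1 - (n + 1)).toNat (n + 1) (by omega))
    rw [hs n hbn]
    exact h1

/-- A morphism from an exact complex to a bounded below complex of injectives is null homotopic.
The homotopy is found by ascending recursion from the lower bound. -/
theorem exists_nullHomotopy_of_injective {Q E : CochainComplex (GrMod 𝓑) ℤ} (φ : Q ⟶ E)
    (hE : ∀ n, Injective (E.X n)) {b : ℤ} (hb : ∀ n, n < b → Limits.IsZero (E.X n))
    (hQ : IsExact Q) :
    ∃ s : ∀ n, Q.X (n + 1) ⟶ E.X n, ∀ n,
      φ.f (n + 1) = Q.d (n + 1) (n + 1 + 1) ≫ s (n + 1) + s n ≫ E.d n (n + 1) := by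
  classical
  -- `Good n s` is the condition under which a component `s` of the homotopy has a successor.
  let Good : ∀ n, (Q.X (n + 1) ⟶ E.X n) → Prop := fun n s =>
    Q.d n (n + 1) ≫ (φ.f (n + 1) - s ≫ E.d n (n + 1)) = 0
  have step : ∀ n (s : Q.X (n + 1) ⟶ E.X n), Good n s →
      ∃ s' : Q.X (n + 1 + 1) ⟶ E.X (n + 1),
        φ.f (n + 1) = Q.d (n + 1) (n + 1 + 1) ≫ s' + s ≫ E.d n (n + 1) := by
    intro n s hs
    have := hE (n + 1)
    obtain ⟨s', h⟩ := exists_extension (φ.f (n + 1) - s ≫ E.d n (n + 1))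
      (Q.d (n + 1) (n + 1 + 1)) fun j x hx => by
        obtain ⟨y, rfl⟩ := hQ n j x hx
        exact congrArg (fun t => app t j y) hs
    exact ⟨s', by rw [h]; abel⟩
  let next : ∀ n, (Q.X (n + 1) ⟶ E.X n) → (Q.X (n + 1 + 1) ⟶ E.X (n + 1)) := fun n s =>
    if h : Good n s then (step n s h).choose else 0
  have good_next : ∀ n s, Good n s → φ.f (n + 1) =
      Q.d (n + 1) (n + 1 + 1) ≫ next n s + s ≫ E.d n (n + 1) := fun n s h => by
    simp only [next, dif_pos h]
    exact (step n s h).choose_spec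
  let s : ∀ n, Q.X (n + 1) ⟶ E.X n :=
    ascRec b (X := fun n => Q.X (n + 1) ⟶ E.X n) (fun _ => 0) next
  have hs : ∀ n, b ≤ n + 1 → s (n + 1) = next n (s n) := fun n hn => ascRec_succ _ _ hn
  have hgood : ∀ k : ℕ, ∀ n, n + 2 - b ≤ k → Good n (s n) := by
    intro k
    induction k with
    | zero => exact fun n hn => (hb (n + 1) (by push_cast at hn; omega)).eq_of_tgt _ _
    | succ k ih =>
      intro n hn
      by_cases hbn : n + 1 < b
      · exact (hb (n + 1) hbn).eq_of_tgt _ _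
      · obtain ⟨m, rfl⟩ : ∃ m, n = m + 1 := ⟨n - 1, by omega⟩
        have hm : Good m (s m) := ih m (by push_cast at hn; omega)
        by_cases hbm : m + 1 < b
        · change Q.d (m + 1) (m + 1 + 1) ≫ (φ.f (m + 1 + 1) - s (m + 1) ≫ _) = 0
          rw [Preadditive.comp_sub, ← φ.comm, (hb (m + 1) hbm).eq_of_tgt (φ.f (m + 1)) 0,
            (hb (m + 1) hbm).eq_of_tgt (s (m + 1)) 0]
          simp
        · have h1 := good_next m _ hm
          rw [← hs m (by omega)] at h1
          change Q.d (m + 1) (m + 1 + 1) ≫ (φ.f (m + 1 + 1) - s (m + 1) ≫ _) = 0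
          rw [Preadditive.comp_sub, ← φ.comm, h1, Preadditive.add_comp, Category.assoc,
            Category.assoc, E.d_comp_d, Limits.comp_zero, add_zero, sub_self]
  refine ⟨s, fun n => ?_⟩
  by_cases hbn : n + 1 < b
  · exact (hb (n + 1) hbn).eq_of_tgt _ _
  · have h1 := good_next n _ (hgood (n + 2 - b).toNat n (by omega))
    rw [hs n (by omega)]
    exact h1

/-- The product of two graded modules. -/
def prodMod (M N : GrMod 𝓑) : GrMod 𝓑 where
  obj i := M.obj i × N.obj i
  act l i j h := LinearMap.mk₂ K (fun a x => (M.act l i j h a x.1, N.act l i j h a x.2))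
    (fun a a' x => by simp) (fun c a x => by simp) (fun a x x' => by simp) (fun c a x => by simp)
  one_act i x := Prod.ext (M.one_act i x.1) (N.one_act i x.2)
  mul_act l m i j k h h' a b x :=
    Prod.ext (M.mul_act l m i j k h h' a b x.1) (N.mul_act l m i j k h h' a b x.2)

section Prod
variable (M N : GrMod 𝓑)

/-- The first projection. -/
def pfst : prodMod M N ⟶ M :=
  mkHom (M := prodMod M N) (fun i => LinearMap.fst K (M.obj i) (N.obj i)) fun _ _ _ _ _ _ => rfl
/-- The second projection. -/
def psnd : prodMod M N ⟶ N :=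
  mkHom (M := prodMod M N) (fun i => LinearMap.snd K (M.obj i) (N.obj i)) fun _ _ _ _ _ _ => rfl
/-- The first inclusion. -/
def pinl : M ⟶ prodMod M N :=
  mkHom (N := prodMod M N) (fun i => LinearMap.inl K (M.obj i) (N.obj i)) fun l i j h a _ =>
    Prod.ext rfl (map_zero (N.act l i j h a)).symm
/-- The second inclusion. -/
def pinr : N ⟶ prodMod M N :=
  mkHom (N := prodMod M N) (fun i => LinearMap.inr K (M.obj i) (N.obj i)) fun l i j h a _ =>
    Prod.ext (map_zero (M.act l i j h a)).symm rfl

@[simp] theorem pinl_pfst : pinl M N ≫ pfst M N = 𝟙 M := rfl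
@[simp] theorem pinr_psnd : pinr M N ≫ psnd M N = 𝟙 N := rfl
@[simp] theorem pinl_psnd : pinl M N ≫ psnd M N = 0 := rfl
@[simp] theorem pinr_pfst : pinr M N ≫ pfst M N = 0 := rfl

variable {M N}

@[simp] theorem pinl_pfst_assoc {L : GrMod 𝓑} (f : M ⟶ L) : pinl M N ≫ pfst M N ≫ f = f := rfl
@[simp] theorem pinr_psnd_assoc {L : GrMod 𝓑} (f : N ⟶ L) : pinr M N ≫ psnd M N ≫ f = f := rfl
@[simp] theorem pinl_psnd_assoc {L : GrMod 𝓑} (f : N ⟶ L) : pinl M N ≫ psnd M N ≫ f = 0 := by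
  rw [← Category.assoc, pinl_psnd, Limits.zero_comp]
@[simp] theorem pinr_pfst_assoc {L : GrMod 𝓑} (f : M ⟶ L) : pinr M N ≫ pfst M N ≫ f = 0 := by
  rw [← Category.assoc, pinr_pfst, Limits.zero_comp]

theorem prod_total : pfst M N ≫ pinl M N + psnd M N ≫ pinr M N = 𝟙 _ :=
  hom_ext fun _ x => Prod.ext (add_zero x.1) (zero_add x.2)

theorem projective_prod (hM : Projective M) (hN : Projective N) : Projective (prodMod M N) :=
  ⟨fun {E X} f e he => ⟨pfst M N ≫ Projective.factorThru (pinl M N ≫ f) e +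
    psnd M N ≫ Projective.factorThru (pinr M N ≫ f) e, by
      rw [Preadditive.add_comp, Category.assoc, Category.assoc, Projective.factorThru_comp,
        Projective.factorThru_comp, ← Category.assoc, ← Category.assoc, ← Preadditive.add_comp,
        prod_total, Category.id_comp]⟩⟩

theorem injective_prod (hM : Injective M) (hN : Injective N) : Injective (prodMod M N) :=
  ⟨fun {X Y} f e he => ⟨Injective.factorThru (f ≫ pfst M N) e ≫ pinl M N +
    Injective.factorThru (f ≫ psnd M N) e ≫ pinr M N, by
      rw [Preadditive.comp_add, ← Category.assoc, ← Category.assoc, Injective.comp_factorThru,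
        Injective.comp_factorThru, Category.assoc, Category.assoc, ← Preadditive.comp_add,
        prod_total, Category.comp_id]⟩⟩

end Prod

section Cone
variable {C D : CochainComplex (GrMod 𝓑) ℤ} (f : C ⟶ D)

/-- The differential `(x, y) ↦ (-dx, f x + dy)` of the mapping cone. -/
def coneD (n : ℤ) : prodMod (C.X (n + 1)) (D.X n) ⟶ prodMod (C.X (n + 1 + 1)) (D.X (n + 1)) :=
  pfst _ _ ≫ (-(C.d (n + 1) (n + 1 + 1) ≫ pinl _ _) + f.f (n + 1) ≫ pinr _ _) +
    psnd _ _ ≫ D.d n (n + 1) ≫ pinr _ _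

theorem coneD_apply (n j : ℤ) (x : (C.X (n + 1)).obj j) (y : (D.X n).obj j) :
    app (coneD f n) j (x, y) = (-app (C.d (n + 1) (n + 1 + 1)) j x,
      app (f.f (n + 1)) j x + app (D.d n (n + 1)) j y) :=
  Prod.ext (by change (-_ + 0) + 0 = _; rw [add_zero, add_zero]; rfl)
    (by change (-0 + _) + _ = _; rw [neg_zero, zero_add]; rfl)

theorem coneD_pfst (n : ℤ) : coneD f n ≫ pfst _ _ = -(pfst _ _ ≫ C.d (n + 1) (n + 1 + 1)) := by
  simp [coneD]

theorem coneD_psnd (n : ℤ) :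
    coneD f n ≫ psnd _ _ = pfst _ _ ≫ f.f (n + 1) + psnd _ _ ≫ D.d n (n + 1) := by
  simp [coneD]

theorem pinl_coneD_assoc (n : ℤ) {L : GrMod 𝓑} (u : prodMod (C.X (n + 1 + 1)) (D.X (n + 1)) ⟶ L) :
    pinl _ _ ≫ coneD f n ≫ u =
      -(C.d (n + 1) (n + 1 + 1) ≫ pinl _ _ ≫ u) + f.f (n + 1) ≫ pinr _ _ ≫ u := by
  simp [coneD, Preadditive.add_comp, Preadditive.comp_add]

theorem pinr_coneD (n : ℤ) : pinr _ _ ≫ coneD f n = D.d n (n + 1) ≫ pinr _ _ := by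
  simp [coneD, Preadditive.comp_add]

theorem pinr_coneD_assoc (n : ℤ) {L : GrMod 𝓑} (u : prodMod (C.X (n + 1 + 1)) (D.X (n + 1)) ⟶ L) :
    pinr _ _ ≫ coneD f n ≫ u = D.d n (n + 1) ≫ pinr _ _ ≫ u := by
  rw [← Category.assoc, pinr_coneD, Category.assoc]

/-- The mapping cone, with `C^{n+1} ⊕ D^n` in degree `n`. -/
def cone : CochainComplex (GrMod 𝓑) ℤ :=
  CochainComplex.of (fun n => prodMod (C.X (n + 1)) (D.X n)) (coneD f) fun n => by
    simp [coneD, Preadditive.add_comp, Preadditive.comp_add]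

theorem cone_d (n : ℤ) : (cone f).d n (n + 1) = coneD f n :=
  CochainComplex.of_d (fun n => prodMod (C.X (n + 1)) (D.X n)) (coneD f) n

end Cone

/-- A homotopy equivalence of complexes: morphisms `f` and `g` in both directions and homotopies
from the composites to the identities. -/
structure HEquiv (C D : CochainComplex (GrMod 𝓑) ℤ) where
  /-- The morphism from `C` to `D`. -/
  f : C ⟶ D
  /-- The morphism from `D` to `C`. -/
  g : D ⟶ C
  /-- The homotopy on `C`. -/
  a : ∀ n, C.X (n + 1) ⟶ C.X n
  /-- The homotopy on `D`. -/
  e : ∀ n, D.X (n + 1) ⟶ D.X n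
  fg : ∀ n, f.f (n + 1) ≫ g.f (n + 1) =
    𝟙 _ + C.d (n + 1) (n + 1 + 1) ≫ a (n + 1) + a n ≫ C.d n (n + 1)
  gf : ∀ n, g.f (n + 1) ≫ f.f (n + 1) =
    𝟙 _ + D.d (n + 1) (n + 1 + 1) ≫ e (n + 1) + e n ≫ D.d n (n + 1)

/-- The inverse homotopy equivalence. -/
def HEquiv.symm {C D : CochainComplex (GrMod 𝓑) ℤ} (h : HEquiv C D) : HEquiv D C where
  f := h.g
  g := h.f
  a := h.e
  e := h.a
  fg := h.gf
  gf := h.fg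

theorem exists_range_d_iff (C : CochainComplex (GrMod 𝓑) ℤ) (n j : ℤ) (x : (C.X (n + 1)).obj j) :
    (∃ y, app (C.d (n + 1 - 1) (n + 1)) j y = x) ↔ ∃ y, app (C.d n (n + 1)) j y = x := by
  rw [add_sub_cancel_right]

/-- `f` is injective on the degree `j` component of `H^{n+1}`. -/
def InjAt {C D : CochainComplex (GrMod 𝓑) ℤ} (f : C ⟶ D) (n j : ℤ) : Prop :=
  ∀ x, app (C.d (n + 1) (n + 1 + 1)) j x = 0 →
    (∃ y, app (D.d n (n + 1)) j y = app (f.f (n + 1)) j x) →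
    ∃ y, app (C.d n (n + 1)) j y = x

/-- `f` is surjective on the degree `j` component of `H^{n+1}`. -/
def SurjAt {C D : CochainComplex (GrMod 𝓑) ℤ} (f : C ⟶ D) (n j : ℤ) : Prop :=
  ∀ y, app (D.d (n + 1) (n + 1 + 1)) j y = 0 →
    ∃ x, app (C.d (n + 1) (n + 1 + 1)) j x = 0 ∧
      ∃ z, app (D.d n (n + 1)) j z = y - app (f.f (n + 1)) j x

theorem isQuasiIso_iff {C D : CochainComplex (GrMod 𝓑) ℤ} (f : C ⟶ D) :
    IsQuasiIso f ↔ ∀ n j, InjAt f n j ∧ SurjAt f n j := by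
  constructor
  · intro h n j
    obtain ⟨h1, h2⟩ := h (n + 1) j
    refine ⟨fun x hx hy => ?_, fun y hy => ?_⟩
    · have h3 := (injective_iff_map_eq_zero _).1 h1 (Submodule.Quotient.mk ⟨x, hx⟩)
        ((Submodule.Quotient.mk_eq_zero _).2 ((exists_range_d_iff D n j _).2 hy))
      exact (exists_range_d_iff C n j _).1 ((Submodule.Quotient.mk_eq_zero _).1 h3)
    · obtain ⟨x, hx⟩ := h2 (Submodule.Quotient.mk ⟨y, hy⟩)
      induction x using Submodule.Quotient.induction_on with
      | H x =>
        refine ⟨x.1, x.2, ?_⟩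
        have h4 := (Submodule.Quotient.eq _).1 hx.symm
        exact (exists_range_d_iff D n j _).1 h4
  · intro h n j
    obtain ⟨n, rfl⟩ : ∃ m, n = m + 1 := ⟨n - 1, by omega⟩
    obtain ⟨h1, h2⟩ := h n j
    refine ⟨(injective_iff_map_eq_zero _).2 fun x hx => ?_, fun y => ?_⟩
    · induction x using Submodule.Quotient.induction_on with
      | H x =>
        refine (Submodule.Quotient.mk_eq_zero _).2 ((exists_range_d_iff C n j _).2
          (h1 x.1 x.2 ((exists_range_d_iff D n j _).1 ?_)))
        exact (Submodule.Quotient.mk_eq_zero _).1 hx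
    · induction y using Submodule.Quotient.induction_on with
      | H y =>
        obtain ⟨x, hx, z, hz⟩ := h2 y.1 y.2
        refine ⟨Submodule.Quotient.mk ⟨x, hx⟩, ?_⟩
        exact Eq.symm ((Submodule.Quotient.eq _).2 ((exists_range_d_iff D n j _).2 ⟨z, hz⟩))

theorem HEquiv.isQuasiIso {C D : CochainComplex (GrMod 𝓑) ℤ} (h : HEquiv C D) :
    IsQuasiIso h.f := by
  refine (isQuasiIso_iff _).2 fun n j => ⟨fun x hx ⟨y, hy⟩ => ?_, fun y hy => ?_⟩
  · have h1 := congrArg (fun t => app t j x) (h.fg n)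
    simp only [app_comp, app_add, app_id, LinearMap.add_apply, LinearMap.id_apply, hx,
      map_zero, add_zero] at h1
    refine ⟨app (h.g.f n) j y - app (h.a n) j x, ?_⟩
    rw [map_sub, ← app_comp, h.g.comm, app_comp, hy, h1, add_sub_cancel_right]
  · have h1 := congrArg (fun t => app t j y) (h.gf n)
    simp only [app_comp, app_add, app_id, LinearMap.add_apply, LinearMap.id_apply, hy,
      map_zero, add_zero] at h1
    refine ⟨app (h.g.f (n + 1)) j y, ?_, -app (h.e n) j y, ?_⟩
    · rw [← app_comp, h.g.comm, app_comp, hy, map_zero]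
    · rw [h1, map_neg]; abel

/-- Exactness of the mapping cone at one place, from the behaviour of the morphism on two
successive cohomology groups in a single internal degree. -/
theorem isExactAt_cone {C D : CochainComplex (GrMod 𝓑) ℤ} {f : C ⟶ D} {n j : ℤ}
    (h1 : InjAt f (n + 1) j) (h2 : SurjAt f n j) : IsExactAt (cone f) n j := by
  rintro ⟨x, y⟩ h
  rw [cone_d] at h ⊢
  replace h := (coneD_apply f (n + 1) j x y).symm.trans h
  have hx := neg_eq_zero.1 (congrArg Prod.fst h)
  have hy : app (f.f (n + 1 + 1)) j x + app (D.d (n + 1) (n + 1 + 1)) j y = 0 := congrArg Prod.snd h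
  obtain ⟨x', hx'⟩ := h1 x hx
    ⟨-y, by rw [map_neg]; exact (eq_neg_of_add_eq_zero_left hy).symm⟩
  obtain ⟨z, hz, y', hy'⟩ := h2 (y + app (f.f (n + 1)) j x') (by
    rw [map_add, ← app_comp (f.f (n + 1)), f.comm, app_comp, hx']; exact (add_comm _ _).trans hy)
  refine ⟨(z - x', y'), (coneD_apply f n j _ _).trans (Prod.ext ?_ ?_)⟩
  · change -app (C.d (n + 1) (n + 1 + 1)) j (z - x') = x
    rw [map_sub, hz, hx', zero_sub, neg_neg]
  · change app (f.f (n + 1)) j (z - x') + app (D.d n (n + 1)) j y' = y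
    rw [hy', map_sub]; abel

theorem isExact_cone {C D : CochainComplex (GrMod 𝓑) ℤ} {f : C ⟶ D} (hf : IsQuasiIso f) :
    IsExact (cone f) := fun n j =>
  isExactAt_cone ((isQuasiIso_iff f).1 hf (n + 1) j).1 ((isQuasiIso_iff f).1 hf n j).2

/-- If `f ≫ g` is homotopic to `h`, then `f` is injective on cohomology where `h` is. -/
theorem InjAt.of_homotopy {C D E : CochainComplex (GrMod 𝓑) ℤ} {f : C ⟶ D} {g : D ⟶ E} {h : C ⟶ E}
    {s : ∀ n, C.X (n + 1) ⟶ E.X n} (hs : ∀ n, f.f (n + 1) ≫ g.f (n + 1) =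
      h.f (n + 1) + C.d (n + 1) (n + 1 + 1) ≫ s (n + 1) + s n ≫ E.d n (n + 1))
    {n j : ℤ} (hh : InjAt h n j) : InjAt f n j := fun x hx ⟨y, hy⟩ => by
  have h1 := congrArg (fun t => app t j x) (hs n)
  simp only [app_comp, app_add, LinearMap.add_apply, hx, map_zero, add_zero] at h1
  refine hh x hx ⟨app (g.f n) j y - app (s n) j x, ?_⟩
  rw [map_sub, ← app_comp, g.comm, app_comp, hy, h1, add_sub_cancel_right]

/-- If `f ≫ g` is homotopic to `h`, and `g` is injective on cohomology, then `f` is surjective on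
cohomology where `h` is. -/
theorem SurjAt.of_homotopy {C D E : CochainComplex (GrMod 𝓑) ℤ} {f : C ⟶ D} {g : D ⟶ E} {h : C ⟶ E}
    {s : ∀ n, C.X (n + 1) ⟶ E.X n} (hs : ∀ n, f.f (n + 1) ≫ g.f (n + 1) =
      h.f (n + 1) + C.d (n + 1) (n + 1 + 1) ≫ s (n + 1) + s n ≫ E.d n (n + 1))
    {n j : ℤ} (hg : InjAt g n j) (hh : SurjAt h n j) : SurjAt f n j := fun y hy => by
  obtain ⟨x, hx, z, hz⟩ := hh (app (g.f (n + 1)) j y) (by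
    rw [← app_comp, g.comm, app_comp, hy, map_zero])
  have h1 := congrArg (fun t => app t j x) (hs n)
  simp only [app_comp, app_add, LinearMap.add_apply, hx, map_zero, add_zero] at h1
  refine ⟨x, hx, hg _ ?_ ⟨z - app (s n) j x, ?_⟩⟩
  · rw [map_sub, hy, zero_sub, ← app_comp, f.comm, app_comp, hx, map_zero, neg_zero]
  · rw [map_sub, map_sub, hz, h1]
    abel

/-- A contraction of the mapping cone of `f` gives a homotopy equivalence. -/
theorem exists_hEquiv_of_cone {C D : CochainComplex (GrMod 𝓑) ℤ} (f : C ⟶ D)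
    (h : ∃ s : ∀ n, (cone f).X (n + 1) ⟶ (cone f).X n, ∀ n,
      (𝟙 (cone f) : cone f ⟶ cone f).f (n + 1) =
        (cone f).d (n + 1) (n + 1 + 1) ≫ s (n + 1) + s n ≫ (cone f).d n (n + 1)) :
    ∃ H : HEquiv C D, H.f = f := by
  obtain ⟨s, hs⟩ := h
  simp only [cone_d] at hs
  let s' : ∀ n, prodMod (C.X (n + 1 + 1)) (D.X (n + 1)) ⟶ prodMod (C.X (n + 1)) (D.X n) := s
  have hs' : ∀ n, 𝟙 _ = coneD f (n + 1) ≫ s' (n + 1) + s' n ≫ coneD f n := hs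
  -- The contraction of the cone is a matrix with four entries: `D ⟶ C` is the homotopy inverse,
  -- the diagonal entries are the homotopies, and the entry `C ⟶ D` is not needed.
  obtain ⟨g, hg⟩ := exists_shift (X := fun n => D.X n ⟶ C.X n)
    fun n => pinr _ _ ≫ s' n ≫ pfst _ _
  obtain ⟨a, ha⟩ := exists_shift (X := fun n => C.X (n + 1) ⟶ C.X n)
    fun n => pinl _ _ ≫ s' n ≫ pfst _ _
  have hcomm : ∀ n, D.d (n + 1) (n + 1 + 1) ≫ g (n + 1 + 1) =
      g (n + 1) ≫ C.d (n + 1) (n + 1 + 1) := fun n => by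
    have h1 := congrArg (fun t => pinr _ _ ≫ t ≫ pfst _ _) (hs' n)
    simp only [Preadditive.add_comp, Preadditive.comp_add, Category.assoc, coneD_pfst,
      pinr_coneD_assoc, Category.id_comp, pinr_pfst, Preadditive.comp_neg] at h1
    simp only [hg, Category.assoc]
    exact eq_of_sub_eq_zero ((sub_eq_add_neg _ _).trans h1.symm)
  have hfg : ∀ n, f.f (n + 1 + 1) ≫ g (n + 1 + 1) = 𝟙 _ + C.d (n + 1 + 1) (n + 1 + 1 + 1) ≫
      a (n + 1 + 1) + a (n + 1) ≫ C.d (n + 1) (n + 1 + 1) := fun n => by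
    have h1 := congrArg (fun t => pinl _ _ ≫ t ≫ pfst _ _) (hs' n)
    simp only [Preadditive.add_comp, Preadditive.comp_add, Category.assoc, coneD_pfst,
      pinl_coneD_assoc, Category.id_comp, pinl_pfst, Preadditive.comp_neg] at h1
    rw [h1]
    simp only [hg, ha, Category.assoc]
    abel
  have hgf : ∀ n, g (n + 1) ≫ f.f (n + 1) = 𝟙 _ +
      D.d (n + 1) (n + 1 + 1) ≫ (-(pinr _ _ ≫ s' (n + 1) ≫ psnd _ _)) +
        (-(pinr _ _ ≫ s' n ≫ psnd _ _)) ≫ D.d n (n + 1) := fun n => by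
    have h1 := congrArg (fun t => pinr _ _ ≫ t ≫ psnd _ _) (hs' n)
    simp only [Preadditive.add_comp, Preadditive.comp_add, Category.assoc, coneD_psnd,
      pinr_coneD_assoc, Category.id_comp, pinr_psnd] at h1
    rw [h1]
    simp only [hg, Category.assoc, Preadditive.comp_neg, Preadditive.neg_comp]
    abel
  refine ⟨⟨f, ⟨g, ?_⟩, a, fun n => -(pinr _ _ ≫ s' n ≫ psnd _ _), fun n => ?_, hgf⟩, rfl⟩
  · rintro i _ rfl
    obtain ⟨i, rfl⟩ : ∃ m, i = m + 1 := ⟨i - 1, by omega⟩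
    exact (hcomm i).symm
  · obtain ⟨n, rfl⟩ : ∃ m, n = m + 1 := ⟨n - 1, by omega⟩
    exact hfg n

/-- A quasi-isomorphism between bounded above complexes of projectives is a homotopy equivalence.
-/
theorem exists_hEquiv_of_projective {C D : CochainComplex (GrMod 𝓑) ℤ} {f : C ⟶ D}
    (hf : IsQuasiIso f) (hC : ∀ n, Projective (C.X n)) (hD : ∀ n, Projective (D.X n)) {b b' : ℤ}
    (hb : ∀ n, b < n → Limits.IsZero (C.X n)) (hb' : ∀ n, b' < n → Limits.IsZero (D.X n)) :
    ∃ H : HEquiv C D, H.f = f :=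
  exists_hEquiv_of_cone f <| exists_nullHomotopy_of_projective _
    (fun n => projective_prod (hC (n + 1)) (hD n)) (b := max b b')
    (fun n hn => isZero_iff.2 fun i x => Prod.ext
      (isZero_iff.1 (hb (n + 1) (by omega)) i x.1) (isZero_iff.1 (hb' n (by omega)) i x.2))
    (isExact_cone hf)

/-- A quasi-isomorphism between bounded below complexes of injectives is a homotopy equivalence. -/
theorem exists_hEquiv_of_injective {C D : CochainComplex (GrMod 𝓑) ℤ} {f : C ⟶ D}
    (hf : IsQuasiIso f) (hC : ∀ n, Injective (C.X n)) (hD : ∀ n, Injective (D.X n)) {b b' : ℤ}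
    (hb : ∀ n, n < b → Limits.IsZero (C.X n)) (hb' : ∀ n, n < b' → Limits.IsZero (D.X n)) :
    ∃ H : HEquiv C D, H.f = f :=
  exists_hEquiv_of_cone f <| exists_nullHomotopy_of_injective _
    (fun n => injective_prod (hC (n + 1)) (hD n)) (b := min (b - 1) b')
    (fun n hn => isZero_iff.2 fun i x => Prod.ext
      (isZero_iff.1 (hb (n + 1) (by omega)) i x.1) (isZero_iff.1 (hb' n (by omega)) i x.2))
    (isExact_cone hf)

/-- A complex of projectives that is bounded above lifts through quasi-isomorphisms, up to
homotopy. -/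
theorem exists_lift_of_isQuasiIso {C P D : CochainComplex (GrMod 𝓑) ℤ} {π : P ⟶ D}
    (hπ : IsQuasiIso π) (φ : C ⟶ D) (hC : ∀ n, Projective (C.X n)) {b : ℤ}
    (hb : ∀ n, b < n → Limits.IsZero (C.X n)) :
    ∃ (ψ : C ⟶ P) (s : ∀ n, C.X (n + 1) ⟶ D.X n), ∀ n, ψ.f (n + 1) ≫ π.f (n + 1) =
      φ.f (n + 1) + C.d (n + 1) (n + 1 + 1) ≫ s (n + 1) + s n ≫ D.d n (n + 1) := by
  have hinr : ∀ n, pinr (P.X (n + 1)) (D.X n) ≫ coneD π n = D.d n (n + 1) ≫ pinr _ _ :=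
    pinr_coneD π
  -- The composite `C ⟶ D ⟶ cone π` is null homotopic; the components of the homotopy in `P` form
  -- the lift, those in `D` the homotopy from `ψ ≫ π` to `φ`.
  let j : D ⟶ cone π :=
    { f := fun n => pinr (P.X (n + 1)) (D.X n)
      comm' := by
        rintro n _ rfl
        rw [cone_d]
        exact hinr n }
  obtain ⟨s, hs⟩ := exists_nullHomotopy_of_projective (φ ≫ j) hC hb (isExact_cone hπ)
  simp only [cone_d] at hs
  let s' : ∀ n, C.X (n + 1) ⟶ prodMod (P.X (n + 1)) (D.X n) := s
  have hs' : ∀ n, φ.f (n + 1) ≫ pinr (P.X (n + 1 + 1)) (D.X (n + 1)) =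
    C.d (n + 1) (n + 1 + 1) ≫ s' (n + 1) + s' n ≫ coneD π n := hs
  obtain ⟨ψ, hψ⟩ := exists_shift (X := fun n => C.X n ⟶ P.X n) fun n => s' n ≫ pfst _ _
  refine ⟨⟨ψ, ?_⟩, fun n => -(s' n ≫ psnd _ _), fun n => ?_⟩
  · rintro i _ rfl
    obtain ⟨i, rfl⟩ : ∃ m, i = m + 1 := ⟨i - 1, by omega⟩
    have h1 := congrArg (fun t => t ≫ pfst _ _) (hs' i)
    simp only [Preadditive.add_comp, Category.assoc, coneD_pfst, pinr_pfst, Limits.comp_zero,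
      Preadditive.comp_neg] at h1
    rw [hψ, hψ, Category.assoc]
    exact (eq_of_sub_eq_zero ((sub_eq_add_neg _ _).trans h1.symm)).symm
  · have h1 := congrArg (fun t => t ≫ psnd _ _) (hs' n)
    simp only [Preadditive.add_comp, Preadditive.comp_add, Category.assoc, coneD_psnd, pinr_psnd,
      Category.comp_id] at h1
    change ψ (n + 1) ≫ _ = _
    rw [hψ, h1]
    simp only [Category.assoc, Preadditive.comp_neg, Preadditive.neg_comp]
    abel

end General

end GrMod

end KoszulDuality

end

noncomputable section

namespace KoszulDuality

namespace GrMod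

section Matrices

variable {K : Type u} [Field K] {B : Type u} [Ring B] [Algebra K B]
  {𝓑 : ℤ → Submodule K B} [NonnegGraded 𝓑]

/-! ### Matrices of morphisms between direct sums -/

section
variable {ι : Type} [DecidableEq ι] {M : ι → GrMod 𝓑}

theorem incl_proj_self (k : ι) : incl M k ≫ proj M k = 𝟙 _ :=
  hom_ext fun _ _ => DFinsupp.single_eq_same

theorem incl_proj_of_ne {k k' : ι} (h : k ≠ k') : incl M k ≫ proj M k' = 0 :=
  hom_ext fun _ _ => DFinsupp.single_eq_of_ne h.symm

theorem hom_ext_proj {N : GrMod 𝓑} {f g : N ⟶ dirSum M}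
    (h : ∀ k, f ≫ proj M k = g ≫ proj M k) : f = g :=
  hom_ext fun j x => DFinsupp.ext fun k => congrArg (fun t => app t j x) (h k)

/-- The inclusion of a summand of a decomposed module. -/
def inc {X : GrMod 𝓑} (s : X ≅ dirSum M) (k : ι) : M k ⟶ X := incl M k ≫ s.inv

/-- The projection to a summand of a decomposed module. -/
def prj {X : GrMod 𝓑} (s : X ≅ dirSum M) (k : ι) : X ⟶ M k := s.hom ≫ proj M k

theorem inc_prj_self {X : GrMod 𝓑} (s : X ≅ dirSum M) (k : ι) : inc s k ≫ prj s k = 𝟙 _ := by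
  simp [inc, prj, incl_proj_self]

theorem inc_prj_of_ne {X : GrMod 𝓑} (s : X ≅ dirSum M) {k k' : ι} (h : k ≠ k') :
    inc s k ≫ prj s k' = 0 := by
  simp [inc, prj, incl_proj_of_ne h]

/-- A composite through a direct sum vanishes if it does so through every summand. The index set
may be infinite, as every element has finite support. -/
theorem comp_eq_zero_of_summands {X Y Z : GrMod 𝓑} (s : X ≅ dirSum M) (f : Y ⟶ X) (g : X ⟶ Z)
    (h : ∀ k, (f ≫ prj s k) ≫ inc s k ≫ g = 0) : f ≫ g = 0 := by
  classical
  refine hom_ext fun j y => ?_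
  let z : ⨁ i, (M i).obj j := app (f ≫ s.hom) j y
  have hz : z = ∑ i ∈ DFinsupp.support z, app (incl M i) j (app (f ≫ prj s i) j y) :=
    (DirectSum.sum_support_of z).symm
  have h1 : f ≫ g = (f ≫ s.hom) ≫ s.inv ≫ g := by simp
  rw [h1, app_comp]
  change app (s.inv ≫ g) j z = 0
  rw [hz, map_sum]
  exact Finset.sum_eq_zero fun i _ => congrArg (fun t => app t j y) (h i)

/-- A composite through a direct sum equals the composite through a single summand if it vanishes
through all the others. -/
theorem comp_eq_single {X Y Z : GrMod 𝓑} (s : X ≅ dirSum M) (f : Y ⟶ X) (g : X ⟶ Z) (b : ι)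
    (h : ∀ k, k ≠ b → (f ≫ prj s k) ≫ inc s k ≫ g = 0) :
    f ≫ g = (f ≫ prj s b) ≫ inc s b ≫ g := by
  have h1 : f ≫ (g - prj s b ≫ inc s b ≫ g) = 0 := comp_eq_zero_of_summands s _ _ fun k => by
    rw [Preadditive.comp_sub, Preadditive.comp_sub, sub_eq_zero]
    by_cases hk : k = b
    · subst hk
      rw [← Category.assoc (inc s k) (prj s k), inc_prj_self, Category.id_comp]
    · rw [h k hk, ← Category.assoc (inc s k) (prj s b), inc_prj_of_ne s hk, Limits.zero_comp,
        Limits.comp_zero]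
  rw [Preadditive.comp_sub, sub_eq_zero] at h1
  rw [h1, Category.assoc]

/-- Reindexing a direct sum along a bijection. -/
def dirSumReindex {κ : Type} [DecidableEq κ] (e : κ ≃ ι) (M : ι → GrMod 𝓑) :
    dirSum (fun k => M (e k)) ≅ dirSum M where
  hom := desc _ fun k => incl M (e k)
  inv := mkHom (M := dirSum M) (N := dirSum fun k => M (e k))
    (fun j =>
      { toFun := fun x => DFinsupp.comapDomain e e.injective x
        map_add' := fun x y => DFinsupp.comapDomain_add e e.injective x y
        map_smul' := fun c x => DFinsupp.comapDomain_smul e e.injective c x })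
    fun _ _ _ _ _ _ => DFinsupp.ext fun _ => rfl
  hom_inv_id := dirSum_hom_ext fun k => hom_ext_proj fun k' => by
    rw [incl_desc_assoc, Category.assoc, Category.comp_id]
    change incl M (e k) ≫ proj M (e k') = _
    by_cases h : k = k'
    · subst h
      rw [incl_proj_self, incl_proj_self]
    · rw [incl_proj_of_ne h, incl_proj_of_ne (fun h' => h (e.injective h'))]
  inv_hom_id := by
    refine hom_ext fun j x => DFinsupp.ext fun k => ?_
    obtain ⟨k, rfl⟩ := e.surjective k
    have key : desc _ (fun k => incl M (e k)) ≫ proj M (e k) = proj (fun k => M (e k)) k :=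
      dirSum_hom_ext fun k' => by
        rw [incl_desc_assoc]
        by_cases h : k' = k
        · subst h
          rw [incl_proj_self]
          exact (incl_proj_self (M := fun k => M (e k)) k').symm
        · rw [incl_proj_of_ne (fun h' => h (e.injective h'))]
          exact (incl_proj_of_ne (M := fun k => M (e k)) h).symm
    exact congrArg (fun t => app t j _) key

end

/-! ### Modules generated in one degree -/

/-- `M` is a direct summand of a finite direct sum of copies of `B(c - j)`. -/
def IsLin (c j : ℤ) (M : GrMod 𝓑) : Prop :=
  ∃ n : ℕ, Nonempty (Retract M (dirSum fun _ : Fin n => (regular 𝓑).shift (c - j)))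

/-- A module generated in degree `j - c` vanishes below this degree. -/
theorem IsLin.eq_zero {c j i : ℤ} {M : GrMod 𝓑} (h : IsLin c j M) (hi : i < j - c) (x : M.obj i) :
    x = 0 := by
  obtain ⟨n, ⟨r⟩⟩ := h
  exact retract_obj_eq_zero r (by omega) x

/-- There are no nonzero morphisms to a module generated in a larger degree. -/
theorem IsLin.hom_eq_zero {c j j' : ℤ} {M N : GrMod 𝓑} (hM : IsLin c j M) (hN : IsLin c j' N)
    (h : j < j') (f : M ⟶ N) : f = 0 := by
  obtain ⟨n, ⟨r⟩⟩ := hM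
  exact retract_hom_ext r fun x => hN.eq_zero (by omega) _

theorem mem_rad_shift {m i : ℤ} (hi : -m < i) (x : ((regular 𝓑).shift m).obj i) :
    x ∈ (rad ((regular 𝓑).shift m)).carrier i := by
  let e : ((regular 𝓑).shift m).obj (-m) :=
    ⟨1, by rw [add_neg_cancel]; exact SetLike.GradedOne.one_mem⟩
  refine Submodule.subset_span ⟨m + i, -m, by omega, (x : 𝓑 (m + i)), e, by omega, ?_⟩
  exact Subtype.ext (mul_one (x : 𝓑 (m + i)).1).symm

theorem IsLin.mem_rad {c j i : ℤ} {M : GrMod 𝓑} (h : IsLin c j M) (hi : j - c < i) (x : M.obj i) :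
    x ∈ (rad M).carrier i := by
  obtain ⟨n, ⟨r⟩⟩ := h
  have key : ∀ y : (dirSum fun _ : Fin n => (regular 𝓑).shift (c - j)).obj i,
      y ∈ (rad (dirSum fun _ : Fin n => (regular 𝓑).shift (c - j))).carrier i := by
    intro y
    refine DirectSum.induction_on (motive := fun y =>
      y ∈ (rad (dirSum fun _ : Fin n => (regular 𝓑).shift (c - j))).carrier i) y
      (Submodule.zero_mem _) (fun t z => ?_) fun _ _ h1 h2 => Submodule.add_mem _ h1 h2
    exact app_mem_rad (incl (fun _ : Fin n => (regular 𝓑).shift (c - j)) t)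
      (mem_rad_shift (by omega) z)
  have h2 := congrArg (fun f => app f i x) r.retract
  rw [← show app r.r i (app r.i i x) = x from h2]
  exact app_mem_rad r.r (key _)

/-- The morphisms with image in the radical. -/
def IsRad {M N : GrMod 𝓑} (f : M ⟶ N) : Prop := ∀ i x, app f i x ∈ (rad N).carrier i

theorem IsRad.comp_left {M N L : GrMod 𝓑} {f : M ⟶ N} (hf : IsRad f) (g : N ⟶ L) :
    IsRad (f ≫ g) := fun i x => app_mem_rad g (hf i x)

theorem IsRad.comp_right {M N L : GrMod 𝓑} (f : M ⟶ N) {g : N ⟶ L} (hg : IsRad g) :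
    IsRad (f ≫ g) := fun i _ => hg i _

theorem IsRad.add {M N : GrMod 𝓑} {f g : M ⟶ N} (hf : IsRad f) (hg : IsRad g) : IsRad (f + g) :=
  fun i x => Submodule.add_mem _ (hf i x) (hg i x)

theorem IsRad.neg {M N : GrMod 𝓑} {f : M ⟶ N} (hf : IsRad f) : IsRad (-f) :=
  fun i x => Submodule.neg_mem _ (hf i x)

theorem IsRad.of_units_smul {M N : GrMod 𝓑} {f : M ⟶ N} (hf : IsRad f) (n : ℤ) :
    IsRad (n.negOnePow • f) := by
  rcases Int.even_or_odd n with h | h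
  · rwa [Int.negOnePow_even n h, one_smul]
  · rw [Int.negOnePow_odd n h, Units.neg_smul, one_smul]
    exact hf.neg

theorem isRad_desc {ι : Type} [DecidableEq ι] {M : ι → GrMod 𝓑} {N : GrMod 𝓑}
    {f : dirSum M ⟶ N} (h : ∀ k, IsRad (incl M k ≫ f)) : IsRad f := fun i x =>
  DirectSum.induction_on (motive := fun y => app f i y ∈ (rad N).carrier i) x
    ((congrArg (· ∈ (rad N).carrier i) (map_zero (app f i))).mpr (Submodule.zero_mem _))
    (fun k z => h k i z)
    fun x y hx hy => by
      have : app f i (x + y) = app f i x + app f i y := map_add (app f i) x y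
      rw [this]
      exact Submodule.add_mem _ hx hy

/-- A morphism to a module generated in a smaller degree has image in the radical. -/
theorem IsLin.isRad {c j j' : ℤ} {M N : GrMod 𝓑} (hM : IsLin c j M) (hN : IsLin c j' N)
    (h : j' < j) (f : M ⟶ N) : IsRad f := fun i x => by
  rcases lt_or_ge i (j - c) with hi | hi
  · rw [hM.eq_zero hi x, map_zero]
    exact Submodule.zero_mem _
  · exact hN.mem_rad (by omega) _

/-! ### Double complexes and their total complexes -/

variable (𝓑) in
/-- A double complex of graded modules, with commuting differentials `d''` (raising the first
index) and `d'` (raising the second index). -/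
structure BiCx where
  /-- The terms. -/
  T : ℤ → ℤ → GrMod 𝓑
  /-- The differential `d''`. -/
  d : ∀ i j, T i j ⟶ T (i + 1) j
  /-- The differential `d'`. -/
  t : ∀ i j, T i j ⟶ T i (j + 1)
  d_d : ∀ i j, d i j ≫ d (i + 1) j = 0
  t_t : ∀ i j, t i j ≫ t i (j + 1) = 0
  d_t : ∀ i j, d i j ≫ t (i + 1) j = t i j ≫ d i (j + 1)

namespace BiCx

variable (E : BiCx 𝓑)

/-- The terms of the total complex. -/
def totX (p : ℤ) : GrMod 𝓑 := dirSum fun x : Diag p => E.T x.1.1 x.1.2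

/-- The inclusion of a term of the double complex. -/
def tinc {i j p : ℤ} (h : i + j = p) : E.T i j ⟶ E.totX p :=
  incl (fun x : Diag p => E.T x.1.1 x.1.2) ⟨(i, j), h⟩

/-- The projection to a term of the double complex. -/
def tprj {i j p : ℤ} (h : i + j = p) : E.totX p ⟶ E.T i j :=
  proj (fun x : Diag p => E.T x.1.1 x.1.2) ⟨(i, j), h⟩

/-- The differential `d'' + (-1)^i d'` of the total complex. -/
def totD (p : ℤ) : E.totX p ⟶ E.totX (p + 1) :=
  desc _ fun x : Diag p =>
    E.d x.1.1 x.1.2 ≫ E.tinc (show x.1.1 + 1 + x.1.2 = p + 1 by have := x.2; omega) +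
      x.1.1.negOnePow • (E.t x.1.1 x.1.2 ≫
        E.tinc (show x.1.1 + (x.1.2 + 1) = p + 1 by have := x.2; omega))

theorem tinc_tprj {i j p : ℤ} (h : i + j = p) : E.tinc h ≫ E.tprj h = 𝟙 _ := incl_proj_self _

theorem tinc_tprj_of_ne {i j i' j' p : ℤ} (h : i + j = p) (h' : i' + j' = p) (hi : i ≠ i') :
    E.tinc h ≫ E.tprj h' = 0 :=
  incl_proj_of_ne fun e => hi (congrArg (fun x : Diag p => x.1.1) e)

theorem totX_hom_ext {p : ℤ} {N : GrMod 𝓑} {f g : E.totX p ⟶ N}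
    (h : ∀ (i j : ℤ) (h : i + j = p), E.tinc h ≫ f = E.tinc h ≫ g) : f = g :=
  dirSum_hom_ext fun x => h x.1.1 x.1.2 x.2

theorem tinc_totD {i j p : ℤ} (h : i + j = p) : E.tinc h ≫ E.totD p =
    E.d i j ≫ E.tinc (show i + 1 + j = p + 1 by omega) +
      i.negOnePow • (E.t i j ≫ E.tinc (show i + (j + 1) = p + 1 by omega)) :=
  incl_desc _ _ _

/-- The components of the differential of the total complex, in terms of the target. -/
theorem totD_tprj {i j p : ℤ} (h : i + 1 + (j + 1) = p + 1) : E.totD p ≫ E.tprj h =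
    E.tprj (show i + (j + 1) = p by omega) ≫ E.d i (j + 1) +
      (i + 1).negOnePow • (E.tprj (show i + 1 + j = p by omega) ≫ E.t (i + 1) j) := by
  refine E.totX_hom_ext fun i' j' h' => ?_
  rw [← Category.assoc, tinc_totD, Preadditive.add_comp, Preadditive.comp_add, Category.assoc,
    Linear.units_smul_comp, Category.assoc, Linear.comp_units_smul]
  by_cases h1 : i' = i
  · subst h1
    obtain rfl : j' = j + 1 := by omega
    rw [tinc_tprj, E.tinc_tprj_of_ne _ _ (by omega), ← Category.assoc, tinc_tprj,
      ← Category.assoc, E.tinc_tprj_of_ne _ _ (by omega)]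
    simp
  · rw [E.tinc_tprj_of_ne (i := i' + 1) _ _ (by omega),
      ← Category.assoc (E.tinc h') (E.tprj (show i + (j + 1) = p by omega)),
      E.tinc_tprj_of_ne h' (show i + (j + 1) = p by omega) h1]
    by_cases h2 : i' = i + 1
    · subst h2
      obtain rfl : j' = j := by omega
      rw [tinc_tprj, ← Category.assoc, tinc_tprj]
      simp
    · rw [E.tinc_tprj_of_ne (i := i') _ _ h2, ← Category.assoc (E.tinc h'),
        E.tinc_tprj_of_ne h' (show i + 1 + j = p by omega) h2]
      simp

theorem totD_totD (p : ℤ) : E.totD p ≫ E.totD (p + 1) = 0 :=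
  E.totX_hom_ext fun i j h => by
    rw [← Category.assoc, tinc_totD, Preadditive.add_comp, Category.assoc, tinc_totD,
      Linear.units_smul_comp, Category.assoc, tinc_totD, Preadditive.comp_add,
      Preadditive.comp_add, Linear.comp_units_smul, Linear.comp_units_smul, ← Category.assoc,
      ← Category.assoc, ← Category.assoc, ← Category.assoc, E.d_d, E.t_t, E.d_t,
      Int.negOnePow_succ]
    simp

/-- The total complex of a double complex. -/
def tot : CochainComplex (GrMod 𝓑) ℤ := CochainComplex.of E.totX E.totD E.totD_totD

theorem tot_d (p : ℤ) : E.tot.d p (p + 1) = E.totD p := CochainComplex.of_d E.totX E.totD p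

/-- A contraction of the rows of a double complex (with the differential `d''`) to objects `H i j`,
together with the morphisms that `d'` induces on the `H i j`. -/
structure Contraction where
  /-- The objects to which the rows are contracted. -/
  H : ℤ → ℤ → GrMod 𝓑
  /-- The inclusion. -/
  ι : ∀ i j, H i j ⟶ E.T i j
  /-- The projection. -/
  p : ∀ i j, E.T i j ⟶ H i j
  /-- The homotopy. -/
  h : ∀ i j, E.T (i + 1) j ⟶ E.T i j
  /-- The morphism induced by `d'`. -/
  tH : ∀ i j, H i j ⟶ H i (j + 1)
  ι_p : ∀ i j, ι i j ≫ p i j = 𝟙 _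
  ι_d : ∀ i j, ι i j ≫ E.d i j = 0
  d_p : ∀ i j, E.d i j ≫ p (i + 1) j = 0
  h_p : ∀ i j, h i j ≫ p i j = 0
  ι_h : ∀ i j, ι (i + 1) j ≫ h i j = 0
  h_h : ∀ i j, h (i + 1) j ≫ h i j = 0
  htpy : ∀ i j, p (i + 1) j ≫ ι (i + 1) j + E.d (i + 1) j ≫ h (i + 1) j + h i j ≫ E.d i j = 𝟙 _
  ι_t_p : ∀ i j, ι i j ≫ E.t i j ≫ p i (j + 1) = tH i j

end BiCx

/-! ### Linear strands of a minimal complex homotopy equivalent to a total complex -/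

/-- A homotopy equivalence between a complex `P` and the total complex of a double complex, in
terms of the components of the morphisms and homotopies. -/
structure TotEquiv (E : BiCx 𝓑) (P : CochainComplex (GrMod 𝓑) ℤ) where
  /-- The morphism to the total complex. -/
  f : ∀ p, P.X p ⟶ E.totX p
  /-- The morphism from the total complex. -/
  g : ∀ p, E.totX p ⟶ P.X p
  /-- The homotopy on `P`. -/
  a : ∀ p, P.X (p + 1) ⟶ P.X p
  /-- The homotopy on the total complex. -/
  e : ∀ p, E.totX (p + 1) ⟶ E.totX p
  f_comm : ∀ p, f p ≫ E.totD p = P.d p (p + 1) ≫ f (p + 1)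
  g_comm : ∀ p, g p ≫ P.d p (p + 1) = E.totD p ≫ g (p + 1)
  fg : ∀ p, f (p + 1) ≫ g (p + 1) =
    𝟙 _ + P.d (p + 1) (p + 1 + 1) ≫ a (p + 1) + a p ≫ P.d p (p + 1)
  gf : ∀ p, g (p + 1) ≫ f (p + 1) = 𝟙 _ + E.totD (p + 1) ≫ e (p + 1) + e p ≫ E.totD p

/-- A homotopy equivalence with the total complex, in terms of components. -/
def TotEquiv.ofHEquiv {E : BiCx 𝓑} {P : CochainComplex (GrMod 𝓑) ℤ} (Q : HEquiv P E.tot) :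
    TotEquiv E P where
  f p := Q.f.f p
  g p := Q.g.f p
  a := Q.a
  e := Q.e
  f_comm p := by rw [← BiCx.tot_d]; exact Q.f.comm p (p + 1)
  g_comm p := by rw [← BiCx.tot_d]; exact Q.g.comm p (p + 1)
  fg := Q.fg
  gf p := by rw [← BiCx.tot_d, ← BiCx.tot_d]; exact Q.gf p

section Strands

variable {E : BiCx 𝓑} (κ : E.Contraction) {c : ℤ} (hE : ∀ i j, IsLin c (-j) (E.T i j))
  {P : CochainComplex (GrMod 𝓑) ℤ} (hP : IsMinimal P) (D : LinDecomp c P) (Q : TotEquiv E P)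

/-- The component of `Q.f` from a summand of `P` to a term of the double complex. -/
def fcomp {l j p : ℤ} (h : l + j = p) (a : ℤ) : D.part p a ⟶ E.T l j :=
  inc (D.iso p) a ≫ Q.f p ≫ E.tprj h

/-- The component of `Q.g` from a term of the double complex to a summand of `P`. -/
def gcomp {l j p : ℤ} (h : l + j = p) (a : ℤ) : E.T l j ⟶ D.part p a :=
  E.tinc h ≫ Q.g p ≫ prj (D.iso p) a

theorem comp_def (i j j' : ℤ) :
    D.comp i j j' = inc (D.iso i) j ≫ P.d i (i + 1) ≫ prj (D.iso (i + 1)) j' := by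
  simp [LinDecomp.comp, inc, prj]

theorem part_isLin (i j : ℤ) : IsLin c j (D.part i j) := D.summand i j

include hE hP

/-- For reasons of degree, a component of `Q.f` can be nonzero only if the target is generated in a
degree at most that of the source. -/
theorem fcomp_eq_zero {l j p : ℤ} (h : l + j = p) {a : ℤ} (ha : a < -j) : fcomp D Q h a = 0 :=
  (part_isLin D p a).hom_eq_zero (hE l j) ha _

/-- For reasons of degree, a component of `Q.g` can be nonzero only if the target is generated in a
degree at most that of the source. -/
theorem gcomp_eq_zero {l j p : ℤ} (h : l + j = p) {a : ℤ} (ha : -j < a) : gcomp D Q h a = 0 :=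
  (hE l j).hom_eq_zero (part_isLin D p a) ha _

/-- The diagonal components of `Q.f` are cocycles for `d''`, as `P` is minimal. -/
theorem fcomp_d {l j p : ℤ} (h : l + j = p) : fcomp D Q h (-j) ≫ E.d l j = 0 := by
  obtain ⟨j, rfl⟩ : ∃ k, j = k + 1 := ⟨j - 1, by omega⟩
  have h1 : inc (D.iso p) (-(j + 1)) ≫ (Q.f p ≫ E.totD p) ≫
      E.tprj (show l + 1 + (j + 1) = p + 1 by omega) = 0 := by
    rw [Q.f_comm, Category.assoc]
    refine (Category.assoc _ _ _).symm.trans (comp_eq_zero_of_summands (D.iso (p + 1)) _ _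
      fun k => ?_)
    rw [Category.assoc (inc _ _), ← comp_def]
    rcases le_or_gt (-(j + 1)) k with hk | hk
    · rw [D.comp_eq_zero hP _ _ _ hk, Limits.zero_comp]
    · exact (congrArg (D.comp p _ k ≫ ·) (fcomp_eq_zero hE hP D Q
        (show l + 1 + (j + 1) = p + 1 by omega) hk)).trans Limits.comp_zero
  rw [Category.assoc, BiCx.totD_tprj, Preadditive.comp_add, Preadditive.comp_add,
    Linear.comp_units_smul, Linear.comp_units_smul] at h1
  have h2 := fcomp_eq_zero hE hP D Q (show l + 1 + j = p by omega) (a := -(j + 1)) (by omega)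
  simp only [fcomp, Category.assoc] at h2 ⊢
  rw [reassoc_of% h2, Limits.zero_comp, smul_zero, add_zero] at h1
  exact h1

/-- The diagonal components of `Q.g` vanish on coboundaries for `d''`, as `P` is minimal. -/
theorem d_gcomp {l j p : ℤ} (h : l + 1 + j = p + 1) :
    E.d l j ≫ gcomp D Q h (-j) = 0 := by
  have h1 : E.tinc (show l + j = p by omega) ≫ (E.totD p ≫ Q.g (p + 1)) ≫
      prj (D.iso (p + 1)) (-j) = 0 := by
    rw [← Q.g_comm, Category.assoc]
    refine (Category.assoc _ _ _).symm.trans (comp_eq_zero_of_summands (D.iso p) _ _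
      fun k => ?_)
    rw [Category.assoc (E.tinc _), ← comp_def]
    rcases le_or_gt k (-j) with hk | hk
    · rw [D.comp_eq_zero hP _ _ _ hk, Limits.comp_zero]
    · exact (congrArg (· ≫ D.comp p k _) (gcomp_eq_zero hE hP D Q
        (show l + j = p by omega) hk)).trans Limits.zero_comp
  rw [Category.assoc, ← Category.assoc (E.tinc _), BiCx.tinc_totD, Preadditive.add_comp,
    Linear.units_smul_comp] at h1
  have h2 := gcomp_eq_zero hE hP D Q (show l + (j + 1) = p + 1 by omega) (a := -j) (by omega)
  simp only [gcomp, Category.assoc] at h1 h2 ⊢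
  rw [h2, Limits.comp_zero, smul_zero, add_zero] at h1
  exact h1

/-- The diagonal components of `Q.f` and `Q.g` compose to the identity of the summand of `P`: the
off-diagonal components do not contribute for reasons of degree, and the homotopy on `P` does not
contribute since the differential of `P` strictly lowers the degree of generation. -/
theorem fcomp_gcomp {l j p : ℤ} (h : l + j = p) :
    fcomp D Q h (-j) ≫ gcomp D Q h (-j) = 𝟙 _ := by
  obtain ⟨p, rfl⟩ : ∃ k, p = k + 1 := ⟨p - 1, by omega⟩
  -- Only the summand `T l j` of the total complex contributes to the composite.
  have h1 := comp_eq_single (Iso.refl (E.totX (p + 1))) (inc (D.iso (p + 1)) (-j) ≫ Q.f (p + 1))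
    (Q.g (p + 1) ≫ prj (D.iso (p + 1)) (-j)) ⟨(l, j), h⟩ (by
      rintro ⟨⟨i, k⟩, hik⟩ hne
      change ((inc (D.iso (p + 1)) (-j) ≫ Q.f (p + 1)) ≫ 𝟙 _ ≫ E.tprj hik) ≫
        (E.tinc hik ≫ 𝟙 _) ≫ Q.g (p + 1) ≫ prj (D.iso (p + 1)) (-j) = 0
      rw [Category.id_comp, Category.comp_id, Category.assoc]
      change fcomp D Q hik (-j) ≫ gcomp D Q hik (-j) = 0
      rcases lt_trichotomy k j with hk | hk | hk
      · rw [fcomp_eq_zero hE hP D Q hik (by omega), Limits.zero_comp]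
      · exact (hne (Subtype.ext (Prod.ext (by change i = l; change i + k = _ at hik; omega) hk))).elim
      · rw [gcomp_eq_zero hE hP D Q hik (by omega), Limits.comp_zero])
  have h2 : fcomp D Q h (-j) ≫ gcomp D Q h (-j) =
      (inc (D.iso (p + 1)) (-j) ≫ Q.f (p + 1)) ≫ Q.g (p + 1) ≫ prj (D.iso (p + 1)) (-j) := by
    rw [h1]
    change _ = (_ ≫ 𝟙 _ ≫ E.tprj h) ≫ (E.tinc h ≫ 𝟙 _) ≫ _
    rw [Category.id_comp, Category.comp_id, Category.assoc]
    rfl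
  -- The homotopy on `P` contributes nothing: by minimality the differential strictly lowers
  -- the degree of generation, and the homotopy does not raise it.
  have h3 : (inc (D.iso (p + 1)) (-j) ≫ P.d (p + 1) (p + 1 + 1)) ≫ Q.a (p + 1) ≫
      prj (D.iso (p + 1)) (-j) = 0 :=
    comp_eq_zero_of_summands (D.iso (p + 1 + 1)) _ _ fun k => by
      rw [Category.assoc (inc _ _), ← comp_def]
      rcases le_or_gt (-j) k with hk | hk
      · rw [D.comp_eq_zero hP _ _ _ hk, Limits.zero_comp]
      · rw [(part_isLin D _ k).hom_eq_zero (part_isLin D _ (-j)) hk (inc _ k ≫ _),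
          Limits.comp_zero]
  have h4 : (inc (D.iso (p + 1)) (-j) ≫ Q.a p) ≫ P.d p (p + 1) ≫
      prj (D.iso (p + 1)) (-j) = 0 :=
    comp_eq_zero_of_summands (D.iso p) _ _ fun k => by
      rw [← comp_def]
      rcases le_or_gt k (-j) with hk | hk
      · rw [D.comp_eq_zero hP _ _ _ hk, Limits.comp_zero]
      · rw [(part_isLin D _ (-j)).hom_eq_zero (part_isLin D _ k) hk (_ ≫ prj _ k),
          Limits.zero_comp]
  have h5 := congrArg (fun t => inc (D.iso (p + 1)) (-j) ≫ t ≫ prj (D.iso (p + 1)) (-j)) (Q.fg p)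
  simp only [Preadditive.add_comp, Preadditive.comp_add, Category.id_comp, inc_prj_self,
    Category.assoc] at h3 h4 h5
  rw [h2, Category.assoc, h5, h3, h4, add_zero, add_zero]

/-- The morphism from a summand of `P` to the contraction of the double complex. -/
def toH {l j p : ℤ} (h : l + j = p) : D.part p (-j) ⟶ κ.H l j := fcomp D Q h (-j) ≫ κ.p l j

/-- The morphism from the contraction of the double complex to a summand of `P`. -/
def ofH {l j p : ℤ} (h : l + j = p) : κ.H l j ⟶ D.part p (-j) := κ.ι l j ≫ gcomp D Q h (-j)

/-- The morphisms `toH` and `ofH` are mutually inverse. In this order, the homotopy `h` of the rows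
does not contribute, since the components of `Q.f` are cocycles and those of `Q.g` vanish on
coboundaries. -/
theorem toH_ofH {l j p : ℤ} (h : l + j = p) : toH κ D Q h ≫ ofH κ D Q h = 𝟙 _ := by
  obtain ⟨l, rfl⟩ : ∃ k, l = k + 1 := ⟨l - 1, by omega⟩
  obtain ⟨p, rfl⟩ : ∃ k, p = k + 1 := ⟨p - 1, by omega⟩
  have h1 : κ.p (l + 1) j ≫ κ.ι (l + 1) j =
      𝟙 _ - E.d (l + 1) j ≫ κ.h (l + 1) j - κ.h l j ≫ E.d l j := by
    rw [← κ.htpy l j]; abel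
  rw [toH, ofH, Category.assoc, ← Category.assoc (κ.p _ _), h1, Preadditive.sub_comp,
    Preadditive.sub_comp, Preadditive.comp_sub, Preadditive.comp_sub, Category.assoc,
    Category.assoc, d_gcomp hE hP D Q h, ← Category.assoc _ (E.d _ _), fcomp_d hE hP D Q h,
    Category.id_comp, fcomp_gcomp hE hP D Q h]
  simp

/-- The composite on `H l j` is the identity: the part of the homotopy on the total complex that
survives for reasons of degree consists of terms starting or ending with `d''`, which `ι` and `p`
kill. -/
theorem ofH_toH {l j p : ℤ} (h : l + j = p) : ofH κ D Q h ≫ toH κ D Q h = 𝟙 _ := by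
  obtain ⟨l, rfl⟩ : ∃ k, l = k + 1 := ⟨l - 1, by omega⟩
  obtain ⟨j, rfl⟩ : ∃ k, j = k + 1 := ⟨j - 1, by omega⟩
  obtain ⟨p, rfl⟩ : ∃ k, p = k + 1 := ⟨p - 1, by omega⟩
  -- Only the summand of `P` generated in the degree of `T l j` contributes to the composite.
  have h1 := comp_eq_single (D.iso (p + 1)) (E.tinc h ≫ Q.g (p + 1))
    (Q.f (p + 1) ≫ E.tprj h) (-(j + 1)) fun k hk => by
      rw [Category.assoc]
      change gcomp D Q h k ≫ fcomp D Q h k = 0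
      rcases lt_or_gt_of_ne hk with hk | hk
      · rw [fcomp_eq_zero hE hP D Q h hk, Limits.comp_zero]
      · rw [gcomp_eq_zero hE hP D Q h hk, Limits.zero_comp]
  have h2 : gcomp D Q h (-(j + 1)) ≫ fcomp D Q h (-(j + 1)) =
      𝟙 _ + E.d _ _ ≫ E.tinc (show l + 1 + 1 + (j + 1) = p + 1 + 1 by omega) ≫ Q.e (p + 1) ≫
        E.tprj h + E.tinc h ≫ Q.e p ≫ E.tprj (show l + (j + 1) = p by omega) ≫ E.d _ _ := by
    have h3 := congrArg (fun t => E.tinc h ≫ t ≫ E.tprj h) (Q.gf p)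
    -- The terms of the homotopy that involve `d'` vanish for reasons of degree.
    have z1 : E.t (l + 1) (j + 1) ≫ E.tinc (show l + 1 + (j + 1 + 1) = p + 1 + 1 by omega) ≫
        Q.e (p + 1) ≫ E.tprj h = 0 := by
      rw [(hE (l + 1) (j + 1 + 1)).hom_eq_zero (hE (l + 1) (j + 1)) (by omega) (E.tinc _ ≫ _),
        Limits.comp_zero]
    have z2 : E.tinc h ≫ Q.e p ≫ E.tprj (show l + 1 + j = p by omega) = 0 :=
      (hE (l + 1) (j + 1)).hom_eq_zero (hE (l + 1) j) (by omega) _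
    have e1 : (E.tinc h ≫ E.totD (p + 1)) ≫ Q.e (p + 1) ≫ E.tprj h = E.d _ _ ≫
        E.tinc (show l + 1 + 1 + (j + 1) = p + 1 + 1 by omega) ≫ Q.e (p + 1) ≫ E.tprj h := by
      rw [BiCx.tinc_totD, Preadditive.add_comp, Linear.units_smul_comp, Category.assoc,
        Category.assoc, z1, smul_zero, add_zero]
    have e2 : E.tinc h ≫ Q.e p ≫ E.totD p ≫ E.tprj h =
        E.tinc h ≫ Q.e p ≫ E.tprj (show l + (j + 1) = p by omega) ≫ E.d _ _ := by
      rw [BiCx.totD_tprj, Preadditive.comp_add, Preadditive.comp_add, Linear.comp_units_smul,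
        Linear.comp_units_smul, reassoc_of% z2, Limits.zero_comp, smul_zero, add_zero]
    have e3 : E.tinc h ≫ (Q.g (p + 1) ≫ Q.f (p + 1)) ≫ E.tprj h =
        gcomp D Q h (-(j + 1)) ≫ fcomp D Q h (-(j + 1)) := by
      simp only [gcomp, fcomp, Category.assoc] at h1 ⊢
      exact h1
    refine e3.symm.trans (h3.trans ?_)
    rw [Preadditive.add_comp, Preadditive.add_comp, Preadditive.comp_add, Preadditive.comp_add,
      ← e1, ← e2]
    simp only [Category.assoc]
    congr 2
    exact (congrArg (E.tinc h ≫ ·) (Category.id_comp _)).trans (E.tinc_tprj h)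
  rw [toH, ofH, Category.assoc, ← Category.assoc (gcomp _ _ _ _), h2]
  simp only [Preadditive.add_comp, Preadditive.comp_add, Category.assoc, Category.id_comp, κ.d_p,
    κ.ι_p, Limits.comp_zero, add_zero]
  rw [← Category.assoc, κ.ι_d, Limits.zero_comp, add_zero]

/-- The isomorphism between a summand of `P` and the contraction of the double complex. -/
def isoH {l j p : ℤ} (h : l + j = p) : D.part p (-j) ≅ κ.H l j where
  hom := toH κ D Q h
  inv := ofH κ D Q h
  hom_inv_id := toH_ofH κ hE hP D Q h
  inv_hom_id := ofH_toH κ hE hP D Q h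

/-- The isomorphisms `toH` carry the linear part of the differential of `P` to the morphisms
induced by `d'`. -/
theorem comp_toH {l j p : ℤ} (h : l + j = p) :
    D.comp p (-j) (-(j + 1)) ≫ toH κ D Q (show l + (j + 1) = p + 1 by omega) =
      l.negOnePow • (toH κ D Q h ≫ κ.tH l j) := by
  obtain ⟨l, rfl⟩ : ∃ k, l = k + 1 := ⟨l - 1, by omega⟩
  have hp : l + 1 + (j + 1) = p + 1 := by omega
  have h1 := comp_eq_single (D.iso (p + 1)) (inc (D.iso p) (-j) ≫ P.d p (p + 1))
    (Q.f (p + 1) ≫ E.tprj hp) (-(j + 1)) fun k hk => by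
      rw [Category.assoc (inc _ _), ← comp_def]
      rcases lt_or_gt_of_ne hk with hk | hk
      · exact (congrArg (D.comp p _ k ≫ ·) (fcomp_eq_zero hE hP D Q hp hk)).trans Limits.comp_zero
      · rw [D.comp_eq_zero hP _ _ _ (by omega), Limits.zero_comp]
  have h2 : D.comp p (-j) (-(j + 1)) ≫ fcomp D Q hp (-(j + 1)) =
      inc (D.iso p) (-j) ≫ (Q.f p ≫ E.totD p) ≫ E.tprj hp := by
    rw [Q.f_comm, comp_def]
    simp only [fcomp, Category.assoc] at h1 ⊢
    exact h1.symm
  -- Insert `1 = p ι + d'' h + h d''`; the last two terms vanish because `fcomp` is a cocycle and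
  -- `d''` commutes with `d'`.
  have h3 : fcomp D Q h (-j) ≫ E.t (l + 1) j ≫ κ.p (l + 1) (j + 1) =
      fcomp D Q h (-j) ≫ κ.p (l + 1) j ≫ κ.tH (l + 1) j := by
    have h4 := congrArg (fun t => fcomp D Q h (-j) ≫ t ≫ E.t (l + 1) j ≫ κ.p (l + 1) (j + 1))
      (κ.htpy l j)
    simp only [Preadditive.add_comp, Preadditive.comp_add, Category.assoc, Category.id_comp,
      κ.ι_t_p] at h4
    rw [← h4, reassoc_of% (fcomp_d hE hP D Q h), reassoc_of% (E.d_t l j), κ.d_p]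
    simp
  rw [toH, toH, ← Category.assoc, h2]
  simp only [reassoc_of% (E.totD_tprj hp), Preadditive.add_comp, Category.assoc, κ.d_p,
    Limits.comp_zero, zero_add, Linear.comp_units_smul, Linear.units_smul_comp]
  rw [← h3]
  simp only [fcomp, Category.assoc]

end Strands

end Matrices

end GrMod

end KoszulDuality

end

noncomputable section

namespace KoszulDuality

namespace GrMod

section Perturbation

variable {K : Type u} [Field K] {B : Type u} [Ring B] [Algebra K B]
  {𝓑 : ℤ → Submodule K B} [NonnegGraded 𝓑]

/-! ### Homological perturbation -/

namespace BiCx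

variable (E : BiCx 𝓑)

/-- The summand `d''` of the differential of the total complex. -/
def totd (p : ℤ) : E.totX p ⟶ E.totX (p + 1) :=
  desc _ fun x : Diag p =>
    E.d x.1.1 x.1.2 ≫ E.tinc (show x.1.1 + 1 + x.1.2 = p + 1 by have := x.2; omega)

/-- The summand `(-1)^i d'` of the differential of the total complex. -/
def tott (p : ℤ) : E.totX p ⟶ E.totX (p + 1) :=
  desc _ fun x : Diag p => x.1.1.negOnePow • (E.t x.1.1 x.1.2 ≫
    E.tinc (show x.1.1 + (x.1.2 + 1) = p + 1 by have := x.2; omega))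

theorem tinc_totd {i j p : ℤ} (h : i + j = p) : E.tinc h ≫ E.totd p =
    E.d i j ≫ E.tinc (show i + 1 + j = p + 1 by omega) :=
  incl_desc _ _ _

theorem tinc_tott {i j p : ℤ} (h : i + j = p) : E.tinc h ≫ E.tott p =
    i.negOnePow • (E.t i j ≫ E.tinc (show i + (j + 1) = p + 1 by omega)) :=
  incl_desc _ _ _

theorem totD_eq (p : ℤ) : E.totD p = E.totd p + E.tott p :=
  E.totX_hom_ext fun i j h => by
    rw [tinc_totD, Preadditive.comp_add, tinc_totd, tinc_tott]

theorem totd_totd (p : ℤ) : E.totd p ≫ E.totd (p + 1) = 0 :=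
  E.totX_hom_ext fun i j h => by
    rw [← Category.assoc, tinc_totd, Category.assoc, tinc_totd, ← Category.assoc, E.d_d]
    simp

variable {E} (κ : E.Contraction)

namespace Contraction

/-- The homotopy `h`, with a flexible index. -/
def hh {i i' : ℤ} (e : i' + 1 = i) (j : ℤ) : E.T i j ⟶ E.T i' j :=
  eqToHom (by rw [e]) ≫ κ.h i' j

/-- The homotopy `h` on the total complex. -/
def toth (p : ℤ) : E.totX (p + 1) ⟶ E.totX p :=
  desc _ fun x : Diag (p + 1) => κ.hh (sub_add_cancel x.1.1 1) x.1.2 ≫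
    E.tinc (show x.1.1 - 1 + x.1.2 = p by have := x.2; omega)

theorem tinc_toth {i j p : ℤ} (h : i + 1 + j = p + 1) :
    E.tinc h ≫ κ.toth p = κ.h i j ≫ E.tinc (show i + j = p by omega) := by
  have h1 : E.tinc h ≫ κ.toth p = κ.hh (sub_add_cancel (i + 1) 1) j ≫
      E.tinc (show i + 1 - 1 + j = p by omega) := incl_desc _ _ _
  rw [h1]
  have key : ∀ (i' : ℤ) (e : i' + 1 = i + 1) (h' : i' + j = p),
      κ.hh e j ≫ E.tinc h' = κ.h i j ≫ E.tinc (show i + j = p by omega) := by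
    intro i' e h'
    obtain rfl : i' = i := by omega
    simp [hh]
  exact key _ _ _

/-- The terms of the contracted complex. -/
def HX (p : ℤ) : GrMod 𝓑 := dirSum fun x : Diag p => κ.H x.1.1 x.1.2

/-- The inclusion of a summand of the contracted complex. -/
def hinc {i j p : ℤ} (h : i + j = p) : κ.H i j ⟶ κ.HX p :=
  incl (fun x : Diag p => κ.H x.1.1 x.1.2) ⟨(i, j), h⟩

/-- The inclusion of the contracted complex. -/
def totι (p : ℤ) : κ.HX p ⟶ E.totX p := desc _ fun x : Diag p => κ.ι x.1.1 x.1.2 ≫ E.tinc x.2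

/-- The projection to the contracted complex. -/
def totp (p : ℤ) : E.totX p ⟶ κ.HX p := desc _ fun x : Diag p => κ.p x.1.1 x.1.2 ≫ κ.hinc x.2

theorem hinc_totι {i j p : ℤ} (h : i + j = p) : κ.hinc h ≫ κ.totι p = κ.ι i j ≫ E.tinc h :=
  incl_desc _ _ _

theorem tinc_totp {i j p : ℤ} (h : i + j = p) : E.tinc h ≫ κ.totp p = κ.p i j ≫ κ.hinc h :=
  incl_desc _ _ _

theorem HX_hom_ext {p : ℤ} {N : GrMod 𝓑} {f g : κ.HX p ⟶ N}
    (h : ∀ (i j : ℤ) (h : i + j = p), κ.hinc h ≫ f = κ.hinc h ≫ g) : f = g :=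
  dirSum_hom_ext fun x => h x.1.1 x.1.2 x.2

theorem totι_totp (p : ℤ) : κ.totι p ≫ κ.totp p = 𝟙 _ :=
  κ.HX_hom_ext fun i j h => by
    rw [← Category.assoc, hinc_totι, Category.assoc, tinc_totp, ← Category.assoc, κ.ι_p]
    simp

theorem totι_totd (p : ℤ) : κ.totι p ≫ E.totd p = 0 :=
  κ.HX_hom_ext fun i j h => by
    rw [← Category.assoc, hinc_totι, Category.assoc, tinc_totd, ← Category.assoc, κ.ι_d]
    simp

theorem toth_totp (p : ℤ) : κ.toth p ≫ κ.totp p = 0 :=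
  E.totX_hom_ext fun i j h => by
    obtain ⟨i, rfl⟩ : ∃ k, i = k + 1 := ⟨i - 1, by omega⟩
    rw [← Category.assoc, tinc_toth, Category.assoc, tinc_totp, ← Category.assoc, κ.h_p]
    simp

theorem totι_toth (p : ℤ) : κ.totι (p + 1) ≫ κ.toth p = 0 :=
  κ.HX_hom_ext fun i j h => by
    obtain ⟨i, rfl⟩ : ∃ k, i = k + 1 := ⟨i - 1, by omega⟩
    rw [← Category.assoc, hinc_totι, Category.assoc, tinc_toth, ← Category.assoc, κ.ι_h]
    simp

theorem toth_toth (p : ℤ) : κ.toth (p + 1) ≫ κ.toth p = 0 :=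
  E.totX_hom_ext fun i j h => by
    obtain ⟨i, rfl⟩ : ∃ k, i = k + 1 + 1 := ⟨i - 1 - 1, by omega⟩
    rw [← Category.assoc, tinc_toth, Category.assoc, tinc_toth, ← Category.assoc, κ.h_h]
    simp

/-- The rows of the total complex, with the differential `d''` alone, are contracted by the sum of
the homotopies `h`. -/
theorem tot_htpy (p : ℤ) : κ.totp (p + 1) ≫ κ.totι (p + 1) =
    𝟙 _ - E.totd (p + 1) ≫ κ.toth (p + 1) - κ.toth p ≫ E.totd p := by
  rw [eq_sub_iff_add_eq, eq_sub_iff_add_eq]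
  refine E.totX_hom_ext fun i j h => ?_
  obtain ⟨i, rfl⟩ : ∃ k, i = k + 1 := ⟨i - 1, by omega⟩
  have h1 : E.tinc h ≫ κ.totp (p + 1) ≫ κ.totι (p + 1) =
      (κ.p (i + 1) j ≫ κ.ι (i + 1) j) ≫ E.tinc h := by
    rw [← Category.assoc, tinc_totp, Category.assoc, hinc_totι, ← Category.assoc]
  have h2 : E.tinc h ≫ κ.toth p ≫ E.totd p = (κ.h i j ≫ E.d i j) ≫ E.tinc h := by
    rw [← Category.assoc, tinc_toth, Category.assoc, tinc_totd, ← Category.assoc]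
  have h3 : E.tinc h ≫ E.totd (p + 1) ≫ κ.toth (p + 1) =
      (E.d (i + 1) j ≫ κ.h (i + 1) j) ≫ E.tinc h := by
    rw [← Category.assoc, tinc_totd, Category.assoc, tinc_toth, ← Category.assoc]
  rw [Preadditive.comp_add, Preadditive.comp_add, h1, h2, h3, ← Preadditive.add_comp,
    ← Preadditive.add_comp, add_right_comm, κ.htpy, Category.id_comp, Category.comp_id]

/-- If only finitely many columns are nonzero, then `h` followed by `d'` is nilpotent. -/
theorem isNilpotent_toth_tott {a b : ℤ}
    (hb : ∀ i j, i < a ∨ b < i → Limits.IsZero (E.T i j)) (p : ℤ) :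
    IsNilpotent (show End (E.totX (p + 1)) from κ.toth p ≫ E.tott p) := by
  have key : ∀ (n : ℕ) (i j : ℤ) (h : i + j = p + 1), ∃ (i' j' : ℤ) (h' : i' + j' = p + 1)
      (x : E.T i j ⟶ E.T i' j'), i' = i - n ∧
        E.tinc h ≫ (show End (E.totX (p + 1)) from κ.toth p ≫ E.tott p) ^ n = x ≫ E.tinc h' := by
    intro n
    induction n with
    | zero =>
      intro i j h
      exact ⟨i, j, h, 𝟙 _, by simp, by
        rw [pow_zero, Category.id_comp]; exact Category.comp_id _⟩
    | succ n ih =>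
      intro i j h
      obtain ⟨i', j', h', x, hi, hx⟩ := ih i j h
      obtain ⟨i', rfl⟩ : ∃ k, i' = k + 1 := ⟨i' - 1, by omega⟩
      refine ⟨i', j' + 1, by omega, i'.negOnePow • (x ≫ κ.h i' j' ≫ E.t i' j'), by omega, ?_⟩
      rw [pow_succ']
      refine (Category.assoc (E.tinc h) ((show End (E.totX (p + 1)) from
        κ.toth p ≫ E.tott p) ^ n) (κ.toth p ≫ E.tott p)).symm.trans ?_
      rw [hx, Category.assoc, ← Category.assoc (E.tinc h'), tinc_toth, Category.assoc, tinc_tott]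
      simp
  refine ⟨(b - a + 1).toNat, E.totX_hom_ext fun i j h => ?_⟩
  by_cases hi : i < a ∨ b < i
  · exact (hb i j hi).eq_of_src _ _
  · obtain ⟨i', j', h', x, hi', hx⟩ := key (b - a + 1).toNat i j h
    rw [hx, (hb i' j' (by omega)).eq_of_tgt x 0, Limits.zero_comp]
    exact Limits.comp_zero.symm

/-- The perturbed contraction involves the inverse `U` of `1 + h d'`, which exists by nilpotency.
-/
theorem exists_inverse {a b : ℤ} (hb : ∀ i j, i < a ∨ b < i → Limits.IsZero (E.T i j)) :
    ∃ U : ∀ p, E.totX p ⟶ E.totX p, ∀ p, U (p + 1) ≫ (𝟙 _ + κ.toth p ≫ E.tott p) = 𝟙 _ ∧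
      (𝟙 _ + κ.toth p ≫ E.tott p) ≫ U (p + 1) = 𝟙 _ := by
  have h : ∀ p, ∃ V : E.totX (p + 1) ⟶ E.totX (p + 1),
      V ≫ (𝟙 _ + κ.toth p ≫ E.tott p) = 𝟙 _ ∧ (𝟙 _ + κ.toth p ≫ E.tott p) ≫ V = 𝟙 _ := by
    intro p
    obtain ⟨⟨x, y, hxy, hyx⟩, rfl : x = _⟩ := (κ.isNilpotent_toth_tott hb p).isUnit_one_add
    exact ⟨y, hxy, hyx⟩
  choose V hV using h
  obtain ⟨U, hU⟩ := exists_shift (X := fun p => E.totX p ⟶ E.totX p) V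
  exact ⟨U, fun p => by rw [hU]; exact hV p⟩

/-- The homological perturbation lemma: the total complex of a double complex with finitely many
columns is homotopy equivalent to a complex with the terms `⨁_{i + j = p} H i j`, which is minimal
if `d'` has image in the radical. -/
theorem exists_minimal {a b c : ℤ} (hb : ∀ i j, i < a ∨ b < i → Limits.IsZero (E.T i j))
    (ht : ∀ i j, IsRad (E.t i j)) (hH : ∀ i j, IsLin c (-j) (κ.H i j)) :
    ∃ (P : CochainComplex (GrMod 𝓑) ℤ) (_ : HEquiv P E.tot),
      IsMinimal P ∧ Nonempty (LinDecomp c P) ∧ ∀ p, P.X p = κ.HX p := by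
  obtain ⟨U, hU⟩ := κ.exists_inverse hb
  have U_eq : ∀ p, U (p + 1) = 𝟙 _ - κ.toth p ≫ E.tott p ≫ U (p + 1) := fun p => by
    have h1 := (hU p).2
    rw [Preadditive.add_comp, Category.id_comp, Category.assoc] at h1
    exact eq_sub_of_add_eq h1
  have hhU : ∀ p, κ.toth p ≫ U p = κ.toth p := fun p => by
    obtain ⟨p, rfl⟩ : ∃ k, p = k + 1 := ⟨p - 1, by omega⟩
    rw [U_eq, Preadditive.comp_sub, Category.comp_id, ← Category.assoc, κ.toth_toth,
      Limits.zero_comp, sub_zero]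
  have hιU : ∀ p, κ.totι p ≫ U p = κ.totι p := fun p => by
    obtain ⟨p, rfl⟩ : ∃ k, p = k + 1 := ⟨p - 1, by omega⟩
    rw [U_eq, Preadditive.comp_sub, Category.comp_id, ← Category.assoc, κ.totι_toth,
      Limits.zero_comp, sub_zero]
  -- In diagrammatic order, `U` inverts `1 + h d'` and `W` inverts `1 + d' h`; the perturbed
  -- inclusion, projection and homotopy are `ι W`, `U p` and `U h = h W`.
  let W : ∀ p, E.totX p ⟶ E.totX p := fun p => 𝟙 _ - E.tott p ≫ U (p + 1) ≫ κ.toth p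
  have hW : ∀ p, (𝟙 _ + E.tott p ≫ κ.toth p) ≫ W p = 𝟙 _ := fun p => by
    have h1 := congrArg (fun x => E.tott p ≫ x ≫ κ.toth p) (hU p).2
    simp only [Preadditive.add_comp, Preadditive.comp_add, Category.assoc, Category.id_comp] at h1
    simp only [W, Preadditive.add_comp, Preadditive.comp_sub, Category.assoc, Category.id_comp,
      Category.comp_id]
    rw [← h1]; abel
  let f : ∀ p, κ.HX p ⟶ E.totX p := fun p => κ.totι p ≫ W p
  let g : ∀ p, E.totX p ⟶ κ.HX p := fun p => U p ≫ κ.totp p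
  have fg : ∀ p, f p ≫ g p = 𝟙 _ := fun p => by
    simp only [f, g, W, Preadditive.comp_sub, Preadditive.sub_comp, Category.assoc,
      Category.comp_id]
    rw [reassoc_of% (hhU p), κ.toth_totp, reassoc_of% (hιU p), κ.totι_totp]
    simp
  let k : ∀ p, E.totX (p + 1) ⟶ E.totX p := fun p => U (p + 1) ≫ κ.toth p
  have k_eq : ∀ p, k p = κ.toth p ≫ W p := fun p => by
    simp only [k, W, Preadditive.comp_sub, Category.comp_id]
    conv_lhs => rw [U_eq]
    simp only [Preadditive.sub_comp, Category.id_comp, Category.assoc]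
  -- The relation `d'' d' + d' d'' + d' d' = 0` for the signed differentials.
  have DD : ∀ p, E.totd p ≫ E.tott (p + 1) + E.tott p ≫ E.totd (p + 1) +
      E.tott p ≫ E.tott (p + 1) = 0 := fun p => by
    have h1 := E.totD_totD p
    rw [E.totD_eq, E.totD_eq] at h1
    simp only [Preadditive.add_comp, Preadditive.comp_add, E.totd_totd, zero_add] at h1
    rw [← h1]; abel
  -- Multiplying by `1 + h d'` on the left and by `1 + d' h` on the right turns the claim into the
  -- contraction identity of the rows and the relation `DD` between two copies of `h`.
  have gf : ∀ p, g (p + 1) ≫ f (p + 1) =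
      𝟙 _ - E.totD (p + 1) ≫ k (p + 1) - k p ≫ E.totD p := fun p => by
    have h1 : (𝟙 _ - E.totD (p + 1) ≫ k (p + 1) - k p ≫ E.totD p) = U (p + 1) ≫
        ((𝟙 _ + κ.toth p ≫ E.tott p) ≫ (𝟙 _ + E.tott (p + 1) ≫ κ.toth (p + 1)) -
          (𝟙 _ + κ.toth p ≫ E.tott p) ≫ E.totD (p + 1) ≫ κ.toth (p + 1) -
          κ.toth p ≫ E.totD p ≫ (𝟙 _ + E.tott (p + 1) ≫ κ.toth (p + 1))) ≫ W (p + 1) := by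
      have e1 : U (p + 1) ≫ ((𝟙 _ + κ.toth p ≫ E.tott p) ≫
          (𝟙 _ + E.tott (p + 1) ≫ κ.toth (p + 1))) ≫ W (p + 1) = 𝟙 _ := by
        rw [Category.assoc, hW, Category.comp_id, (hU p).1]
      have e2 : U (p + 1) ≫ ((𝟙 _ + κ.toth p ≫ E.tott p) ≫ E.totD (p + 1) ≫
          κ.toth (p + 1)) ≫ W (p + 1) = E.totD (p + 1) ≫ k (p + 1) := by
        rw [k_eq, Category.assoc, ← Category.assoc (U (p + 1)), (hU p).1, Category.id_comp,
          Category.assoc]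
      have e3 : U (p + 1) ≫ (κ.toth p ≫ E.totD p ≫
          (𝟙 _ + E.tott (p + 1) ≫ κ.toth (p + 1))) ≫ W (p + 1) = k p ≫ E.totD p := by
        rw [Category.assoc, Category.assoc, hW, Category.comp_id]
        exact (Category.assoc _ _ _).symm
      rw [Preadditive.sub_comp, Preadditive.sub_comp, Preadditive.comp_sub, Preadditive.comp_sub,
        e1, e2, e3]
    have h2 := congrArg (fun x => κ.toth p ≫ x ≫ κ.toth (p + 1)) (DD p)
    simp only [Preadditive.add_comp, Preadditive.comp_add, Category.assoc, Limits.zero_comp,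
      Limits.comp_zero] at h2
    have h3 : (𝟙 _ + κ.toth p ≫ E.tott p) ≫ (𝟙 _ + E.tott (p + 1) ≫ κ.toth (p + 1)) -
          (𝟙 _ + κ.toth p ≫ E.tott p) ≫ E.totD (p + 1) ≫ κ.toth (p + 1) -
          κ.toth p ≫ E.totD p ≫ (𝟙 _ + E.tott (p + 1) ≫ κ.toth (p + 1)) =
        κ.totp (p + 1) ≫ κ.totι (p + 1) := by
      rw [κ.tot_htpy, E.totD_eq, E.totD_eq, ← sub_eq_zero, ← neg_eq_zero, ← h2]
      simp only [Preadditive.add_comp, Preadditive.comp_add, Category.assoc, Category.id_comp,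
        Category.comp_id]
      abel
    rw [h1, h3]
    simp only [f, g, Category.assoc]
  -- As `g f` is homotopic to the identity, it commutes with the differential, so `f D g` is a
  -- differential on the contracted complex.
  have e_comm : ∀ p, E.totD p ≫ g (p + 1) ≫ f (p + 1) = g p ≫ f p ≫ E.totD p := fun p => by
    obtain ⟨p, rfl⟩ : ∃ k, p = k + 1 := ⟨p - 1, by omega⟩
    rw [gf, ← Category.assoc (g _), gf]
    simp only [Preadditive.sub_comp, Preadditive.comp_sub, Category.assoc, Category.id_comp,
      Category.comp_id, E.totD_totD, Limits.comp_zero, sub_zero]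
    rw [← Category.assoc (E.totD (p + 1)) (E.totD (p + 1 + 1)), E.totD_totD, Limits.zero_comp,
      sub_zero]
  let dP : ∀ p, κ.HX p ⟶ κ.HX (p + 1) := fun p => f p ≫ E.totD p ≫ g (p + 1)
  have dP_f : ∀ p, dP p ≫ f (p + 1) = f p ≫ E.totD p := fun p => by
    simp only [dP, Category.assoc]
    rw [e_comm, ← Category.assoc (f p), fg, Category.id_comp]
  have g_dP : ∀ p, g p ≫ dP p = E.totD p ≫ g (p + 1) := fun p => by
    simp only [dP]
    rw [← reassoc_of% (e_comm p), fg, Category.comp_id]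
  have dP_dP : ∀ p, dP p ≫ dP (p + 1) = 0 := fun p => by
    simp only [dP, Category.assoc]
    rw [reassoc_of% (e_comm p), ← Category.assoc (E.totD p) (E.totD (p + 1)), E.totD_totD]
    simp
  let P : CochainComplex (GrMod 𝓑) ℤ := CochainComplex.of κ.HX dP dP_dP
  have P_d : ∀ p, P.d p (p + 1) = dP p := fun p => CochainComplex.of_d κ.HX dP p
  refine ⟨P, ⟨⟨f, ?_⟩, ⟨g, ?_⟩, fun _ => 0, fun p => -k p, fun p => ?_, fun p => ?_⟩, ?_, ?_,
    fun _ => rfl⟩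
  · rintro p _ rfl
    rw [P_d, tot_d]
    exact (dP_f p).symm
  · rintro p _ rfl
    rw [P_d, tot_d]
    exact g_dP p
  · rw [Limits.comp_zero, Limits.zero_comp, add_zero, add_zero]
    exact fg (p + 1)
  · rw [tot_d, tot_d]
    refine (gf p).trans ?_
    rw [sub_eq_add_neg, sub_eq_add_neg]
    exact congrArg₂ (fun x y => 𝟙 _ + x + y) (Preadditive.comp_neg _ _).symm
      (Preadditive.neg_comp _ _).symm
  -- Minimality: every term of the perturbed differential contains `d'`.
  · have ht' : ∀ p, IsRad (E.tott p) := fun p => isRad_desc fun x => by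
      have := E.tinc_tott x.2
      change IsRad (E.tinc x.2 ≫ E.tott p)
      rw [this]
      exact ((ht _ _).comp_left _).of_units_smul _
    intro p
    rw [P_d]
    change IsRad (dP p)
    have h1 : dP p = κ.totι p ≫ E.tott p ≫ g (p + 1) -
        κ.totι p ≫ E.tott p ≫ U (p + 1) ≫ κ.toth p ≫ E.totD p ≫ g (p + 1) := by
      simp only [dP, f, W, Preadditive.comp_sub, Preadditive.sub_comp, Category.comp_id,
        Category.assoc]
      conv_lhs => rw [← Category.assoc (κ.totι p) (E.totD p), E.totD_eq, Preadditive.comp_add,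
        κ.totι_totd, zero_add, Category.assoc]
      rw [E.totD_eq]
    rw [h1, sub_eq_add_neg]
    exact (((ht' p).comp_left _).comp_right _).add (((ht' p).comp_left _).comp_right _).neg
  -- The summand `H i j` is generated in degree `-j - c`, so the diagonal is indexed by `s = -j`.
  · let e : ∀ p : ℤ, ℤ ≃ Diag p := fun p =>
      { toFun := fun s => ⟨(p + s, -s), by simp⟩
        invFun := fun x => -x.1.2
        left_inv := fun s => neg_neg s
        right_inv := fun x => by
          have := x.2
          exact Subtype.ext (Prod.ext (by change p + -x.1.2 = x.1.1; omega) (neg_neg _)) }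
    exact ⟨⟨fun p s => κ.H (p + s) (-s),
      fun p => (dirSumReindex (e p) fun x : Diag p => κ.H x.1.1 x.1.2).symm,
      fun p s => by
        have := hH (p + s) (-s)
        rwa [neg_neg] at this⟩⟩

end Contraction

end BiCx

end Perturbation

end GrMod

end KoszulDuality

end

noncomputable section

namespace KoszulDuality

namespace GrMod

section Finiteness

variable {K : Type u} [Field K] {B : Type u} [Ring B] [Algebra K B]
  {𝓑 : ℤ → Submodule K B} [NonnegGraded 𝓑]

/-! ### Finitely generated, projective and injective modules -/

theorem act_of_neg (M : GrMod 𝓑) {l i j : ℤ} (h : l + i = j) (hl : l < 0) (a : 𝓑 l)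
    (x : M.obj i) : M.act l i j h a x = 0 := by
  have ha : a = 0 :=
    Subtype.ext ((Submodule.mem_bot K).1 (NonnegGraded.eq_bot (𝓑 := 𝓑) l hl ▸ a.2))
  rw [ha, map_zero, LinearMap.zero_apply]

theorem IsFG.of_surjective {M N : GrMod 𝓑} (hM : IsFG M) (f : M ⟶ N)
    (hf : ∀ i, Function.Surjective (app f i)) : IsFG N := by
  obtain ⟨n, deg, g, hg⟩ := hM
  refine ⟨n, deg, fun t => app f _ (g t), fun j => ?_⟩
  have h1 := congrArg (Submodule.map (app f j)) (hg j)
  rw [Submodule.map_top, LinearMap.range_eq_top.2 (hf j), Submodule.map_span] at h1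
  rw [← h1]
  congr 1
  ext y
  constructor
  · rintro ⟨t, l, h, a, rfl⟩
    exact ⟨_, ⟨t, l, h, a, rfl⟩, app_act f _ _ _ _ _ _⟩
  · rintro ⟨_, ⟨t, l, h, a, rfl⟩, rfl⟩
    exact ⟨t, l, h, a, app_act f _ _ _ _ _ _⟩

theorem IsFG.of_retract {M N : GrMod 𝓑} (hM : IsFG M) (r : Retract N M) : IsFG N :=
  hM.of_surjective r.r fun i x =>
    ⟨app r.i i x, congrArg (fun f => app f i x) r.retract⟩

theorem isFG_shift_regular (n : ℤ) : IsFG ((regular 𝓑).shift n) := by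
  let e : ((regular 𝓑).shift n).obj (-n) :=
    ⟨1, by rw [add_neg_cancel]; exact SetLike.GradedOne.one_mem⟩
  refine ⟨1, fun _ => -n, fun _ => e, fun j => eq_top_iff.2 fun x _ => ?_⟩
  exact Submodule.subset_span ⟨0, n + j, show n + j + -n = j by omega, (x : 𝓑 (n + j)),
    Subtype.ext (mul_one (x : 𝓑 (n + j)).1).symm⟩

theorem dirSum_induction {ι : Type} [DecidableEq ι] {M : ι → GrMod 𝓑} {j : ℤ}
    {C : (dirSum M).obj j → Prop} (x : (dirSum M).obj j) (h0 : C 0)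
    (hi : ∀ i z, C (app (incl M i) j z)) (hadd : ∀ x y, C x → C y → C (x + y)) : C x :=
  DirectSum.induction_on (motive := C) x h0 hi hadd

/-- A direct sum of finitely generated modules, all but finitely many of which vanish, is finitely
generated. -/
theorem isFG_dirSum {ι : Type} [DecidableEq ι] {M : ι → GrMod 𝓑} (hM : ∀ i, IsFG (M i))
    (s : Finset ι) (hs : ∀ i ∉ s, Limits.IsZero (M i)) : IsFG (dirSum M) := by
  classical
  choose n deg g hg using hM
  let T := Σ i : s, Fin (n i)
  let φ : Fin (Fintype.card T) ≃ T := (Fintype.equivFin T).symm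
  refine ⟨Fintype.card T, fun t => deg (φ t).1 (φ t).2,
    fun t => app (incl M (φ t).1) _ (g (φ t).1 (φ t).2), fun j => eq_top_iff.2 fun x _ => ?_⟩
  refine dirSum_induction x (Submodule.zero_mem _) (fun i z => ?_)
    fun _ _ h1 h2 => Submodule.add_mem _ h1 h2
  by_cases hi : i ∈ s
  · have hz : z ∈ (⊤ : Submodule K ((M i).obj j)) := trivial
    rw [← hg i j] at hz
    have h2 := Submodule.mem_map_of_mem (f := app (incl M i) j) hz
    rw [Submodule.map_span] at h2
    refine Submodule.span_mono ?_ h2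
    rintro _ ⟨_, ⟨t, l, h, a, rfl⟩, rfl⟩
    obtain ⟨t', ht'⟩ := φ.surjective ⟨⟨i, hi⟩, t⟩
    have key : ∀ w : T, φ t' = w → ∀ (a : 𝓑 l) (h : l + deg w.1 w.2 = j), ∃ (t : Fin (Fintype.card T))
        (l' : ℤ) (h' : l' + deg (φ t).1 (φ t).2 = j) (a' : 𝓑 l'),
        app (incl M w.1) j ((M w.1).act l (deg w.1 w.2) j h a (g w.1 w.2)) =
          (dirSum M).act l' _ j h' a' (app (incl M (φ t).1) _ (g (φ t).1 (φ t).2)) := by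
      rintro w rfl a h
      exact ⟨t', l, h, a, app_act (incl M (φ t').1) _ _ _ _ _ _⟩
    exact key _ ht' a h
  · rw [isZero_iff.1 (hs i hi) j z, map_zero]
    exact Submodule.zero_mem _

theorem IsLin.isFG {c j : ℤ} {M : GrMod 𝓑} (h : IsLin c j M) : IsFG M := by
  obtain ⟨n, ⟨r⟩⟩ := h
  exact (isFG_dirSum (fun _ => isFG_shift_regular _) Finset.univ (by simp)).of_retract r

/-- A finitely generated graded module is bounded below. -/
theorem IsFG.exists_eq_zero_of_lt {M : GrMod 𝓑} (hM : IsFG M) :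
    ∃ m : ℤ, ∀ j < m, ∀ x : M.obj j, x = 0 := by
  obtain ⟨n, deg, g, hg⟩ := hM
  obtain ⟨m, hm⟩ : ∃ m, ∀ t, m ≤ deg t := by
    obtain ⟨m, hm⟩ := (Set.finite_range deg).bddBelow
    exact ⟨m, fun t => hm ⟨t, rfl⟩⟩
  refine ⟨m, fun j hj x => ?_⟩
  have hx : x ∈ (⊤ : Submodule K (M.obj j)) := trivial
  rw [← hg j] at hx
  refine (Submodule.mem_bot K).1 ((Submodule.span_le.2 ?_ : _ ≤ (⊥ : Submodule K _)) hx)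
  rintro _ ⟨t, l, h, a, rfl⟩
  exact act_of_neg M h (by have := hm t; omega) a _

/-- A finitely generated module over an algebra that vanishes in degrees above `d` is bounded
above. -/
theorem IsFG.exists_eq_zero_of_gt {M : GrMod 𝓑} (hM : IsFG M) {d : ℤ}
    (hd : ∀ l, d < l → ∀ a : 𝓑 l, a = 0) : ∃ m : ℤ, ∀ j, m < j → ∀ x : M.obj j, x = 0 := by
  obtain ⟨n, deg, g, hg⟩ := hM
  obtain ⟨m, hm⟩ : ∃ m, ∀ t, deg t ≤ m := by
    obtain ⟨m, hm⟩ := (Set.finite_range deg).bddAbove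
    exact ⟨m, fun t => hm ⟨t, rfl⟩⟩
  refine ⟨d + m, fun j hj x => ?_⟩
  have hx : x ∈ (⊤ : Submodule K (M.obj j)) := trivial
  rw [← hg j] at hx
  refine (Submodule.mem_bot K).1 ((Submodule.span_le.2 ?_ : _ ≤ (⊥ : Submodule K _)) hx)
  rintro _ ⟨t, l, h, a, rfl⟩
  rw [hd l (by have := hm t; omega) a]
  simp

theorem IsFG.finiteDimensional {M : GrMod 𝓑} (hM : IsFG M) (hB : ∀ l, FiniteDimensional K (𝓑 l))
    (j : ℤ) : FiniteDimensional K (M.obj j) := by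
  obtain ⟨n, deg, g, hg⟩ := hM
  let S : Fin n → Submodule K (M.obj j) := fun t =>
    LinearMap.range ((M.act (j - deg t) (deg t) j (sub_add_cancel _ _)).flip (g t))
  have h1 : (⨆ t, S t) = ⊤ := by
    refine eq_top_iff.2 ?_
    rw [← hg j, Submodule.span_le]
    rintro _ ⟨t, l, h, a, rfl⟩
    obtain rfl : l = j - deg t := by omega
    exact Submodule.mem_iSup_of_mem t ⟨a, rfl⟩
  have h2 : FiniteDimensional K (⨆ t, S t : Submodule K (M.obj j)) := inferInstance
  rw [h1] at h2
  exact Module.Finite.equiv (Submodule.topEquiv)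

theorem isProjective_shift_regular (n : ℤ) : Projective ((regular 𝓑).shift n) where
  factors {X Y} f g _ := by
    let e : ((regular 𝓑).shift n).obj (-n) :=
      ⟨1, by rw [add_neg_cancel]; exact SetLike.GradedOne.one_mem⟩
    obtain ⟨y, hy⟩ := surjective_of_epi g (-n) (app f (-n) e)
    let φ : (regular 𝓑).shift n ⟶ X := mkHom (M := (regular 𝓑).shift n) (N := X)
      (fun i => (X.act (n + i) (-n) i (by omega)).flip y) fun l i j h a x => by
        have h1 := X.mul_act l (n + i) (-n) i j (by omega) h a x y
        refine Eq.trans ?_ h1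
        obtain rfl : j = l + i := h.symm
        have key : ∀ (k k' : ℤ) (e : k' = k) (h : k + -n = l + i) (h' : k' + -n = l + i) (b : 𝓑 k)
            (b' : 𝓑 k') (_ : (b : B) = b'), X.act k (-n) (l + i) h b y =
              X.act k' (-n) (l + i) h' b' y := by
          rintro k k' rfl h h' b b' hb
          rw [Subtype.ext hb]
        exact key _ _ (by omega) _ _ _ _ rfl
    refine ⟨φ, hom_ext fun i (x : 𝓑 (n + i)) => ?_⟩
    have h1 : x = ((regular 𝓑).shift n).act (n + i) (-n) i (by omega) x e :=
      Subtype.ext (mul_one x.1).symm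
    have h2 : app (φ ≫ g) i x = Y.act (n + i) (-n) i (by omega) x (app g (-n) y) :=
      app_act g _ _ _ _ _ _
    rw [h2, hy, ← app_act]
    exact congrArg (app f i) h1.symm

theorem projective_dirSum {ι : Type} [DecidableEq ι] {M : ι → GrMod 𝓑}
    (hM : ∀ i, Projective (M i)) : Projective (dirSum M) where
  factors {X Y} f g _ :=
    ⟨desc M fun i => (hM i).factors (incl M i ≫ f) g |>.choose, dirSum_hom_ext fun i => by
      rw [incl_desc_assoc]
      exact ((hM i).factors (incl M i ≫ f) g).choose_spec⟩

theorem IsLin.projective {c j : ℤ} {M : GrMod 𝓑} (h : IsLin c j M) : Projective M := by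
  obtain ⟨n, ⟨r⟩⟩ := h
  have := projective_dirSum (M := fun _ : Fin n => (regular 𝓑).shift (c - j))
    fun _ => isProjective_shift_regular _
  exact r.projective

/-- The identity of a direct sum with finitely many nonzero summands is the sum of the projections
to the summands. -/
theorem sum_proj_incl {ι : Type} [DecidableEq ι] {M : ι → GrMod 𝓑} (s : Finset ι)
    (hs : ∀ i ∉ s, Limits.IsZero (M i)) : ∑ i ∈ s, proj M i ≫ incl M i = 𝟙 (dirSum M) :=
  dirSum_hom_ext fun k => by
    by_cases hk : k ∈ s
    · rw [Preadditive.comp_sum, Finset.sum_eq_single k, ← Category.assoc, incl_proj_self]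
      · simp
      · intro b _ hb
        rw [← Category.assoc, incl_proj_of_ne hb.symm, Limits.zero_comp]
      · exact fun h => (h hk).elim
    · exact (hs k hk).eq_of_src _ _

/-- A direct sum of injective modules, all but finitely many of which vanish, is injective. -/
theorem injective_dirSum {ι : Type} [DecidableEq ι] {M : ι → GrMod 𝓑}
    (hM : ∀ i, Injective (M i)) (s : Finset ι) (hs : ∀ i ∉ s, Limits.IsZero (M i)) :
    Injective (dirSum M) where
  factors {X Y} f g _ := by
    choose φ hφ using fun i => (hM i).factors (f ≫ proj M i) g
    refine ⟨∑ i ∈ s, φ i ≫ incl M i, ?_⟩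
    rw [Preadditive.comp_sum, ← Category.comp_id f, ← sum_proj_incl s hs, Preadditive.comp_sum]
    refine Finset.sum_congr rfl fun i _ => ?_
    rw [← Category.assoc, hφ, Category.assoc]

theorem isZero_dirSum {ι : Type} [DecidableEq ι] {M : ι → GrMod 𝓑}
    (hM : ∀ i, Limits.IsZero (M i)) : Limits.IsZero (dirSum M) :=
  isZero_iff.2 fun i _ => DFinsupp.ext fun k => isZero_iff.1 (hM k) i _

end Finiteness

section Splitting

variable {K : Type u} [Field K] {B : Type u} [Ring B] [Algebra K B]
  {𝓑 : ℤ → Submodule K B} [NonnegGraded 𝓑] {V : Type u} [Fintype V]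

/-! ### Equivariant contractions of complexes -/

/-- The `e v` are orthogonal idempotents of degree `0` with sum `1`. -/
structure IsComplete (e : V → 𝓑 0) : Prop where
  sum_eq : ∑ v, (e v : B) = 1
  mul_self : ∀ v, (e v : B) * e v = e v
  mul_of_ne : ∀ v w, v ≠ w → (e v : B) * e w = 0

/-- The `K`-linear map `φ` commutes with the action of the idempotents `e v`. -/
def Equivariant (e : V → 𝓑 0) {M N : GrMod 𝓑} {i j : ℤ} (φ : M.obj i →ₗ[K] N.obj j) : Prop :=
  ∀ v x, φ (M.act 0 i i (zero_add i) (e v) x) = N.act 0 j j (zero_add j) (e v) (φ x)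

theorem equivariant_app (e : V → 𝓑 0) {M N : GrMod 𝓑} (f : M ⟶ N) (i : ℤ) :
    Equivariant e (app f i) := fun _ _ => app_act f _ _ _ _ _ _

namespace IsComplete

variable {e : V → 𝓑 0} (he : IsComplete e)
include he

theorem sum_act (M : GrMod 𝓑) (i : ℤ) (x : M.obj i) :
    ∑ v, M.act 0 i i (zero_add i) (e v) x = x := by
  have h1 : ∑ v, e v = ⟨1, SetLike.GradedOne.one_mem⟩ :=
    Subtype.ext (by rw [AddSubmonoidClass.coe_finsetSum]; exact he.sum_eq)
  rw [← LinearMap.sum_apply, ← map_sum, h1, M.one_act]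

theorem act_self (M : GrMod 𝓑) (i : ℤ) (v : V) (x : M.obj i) :
    M.act 0 i i (zero_add i) (e v) (M.act 0 i i (zero_add i) (e v) x) =
      M.act 0 i i (zero_add i) (e v) x :=
  act_act M _ _ (add_zero 0) _ _ _ _ (he.mul_self v).symm x

theorem act_of_ne (M : GrMod 𝓑) (i : ℤ) {v w : V} (h : v ≠ w) (x : M.obj i) :
    M.act 0 i i (zero_add i) (e v) (M.act 0 i i (zero_add i) (e w) x) = 0 := by
  rw [act_act M _ _ (add_zero 0) (zero_add i) _ _ 0 (he.mul_of_ne v w h).symm x, map_zero,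
    LinearMap.zero_apply]

/-- Averaging over the idempotents makes a linear map equivariant. -/
theorem equivariant_average {M N : GrMod 𝓑} {i j : ℤ} (φ : M.obj i →ₗ[K] N.obj j) :
    Equivariant e (∑ v, N.act 0 j j (zero_add j) (e v) ∘ₗ φ ∘ₗ M.act 0 i i (zero_add i) (e v)) := by
  classical
  intro w x
  simp only [LinearMap.sum_apply, LinearMap.comp_apply, map_sum]
  rw [Finset.sum_eq_single w, Finset.sum_eq_single w]
  · rw [he.act_self, he.act_self]
  · intro v _ hv
    exact he.act_of_ne _ _ hv.symm _
  · simp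
  · intro v _ hv
    rw [he.act_of_ne _ _ hv, map_zero, map_zero]
  · simp

end IsComplete

/-- The projection from the cocycles to the cohomology. -/
def cohMk (C : CochainComplex (GrMod 𝓑) ℤ) (i : ℤ) :
    (Sub.ker (C.d i (i + 1))).toMod ⟶ cohomology C i := Sub.π _

/-- A cocycle, as an element of the module of cocycles. -/
def mkCyc {C : CochainComplex (GrMod 𝓑) ℤ} {i j : ℤ} (x : (C.X i).obj j)
    (hx : app (C.d i (i + 1)) j x = 0) : (Sub.ker (C.d i (i + 1))).toMod.obj j := ⟨x, hx⟩

/-- A contraction, by linear maps that commute with the idempotents `e v`, of the degree `j` part of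
a complex to its cohomology. -/
structure Splitting (e : V → 𝓑 0) (C : CochainComplex (GrMod 𝓑) ℤ) (j : ℤ) where
  /-- The inclusion. -/
  ι : ∀ i, (cohomology C i).obj j →ₗ[K] (C.X i).obj j
  /-- The projection. -/
  p : ∀ i, (C.X i).obj j →ₗ[K] (cohomology C i).obj j
  /-- The homotopy. -/
  h : ∀ i, (C.X (i + 1)).obj j →ₗ[K] (C.X i).obj j
  ι_equiv : ∀ i, Equivariant e (ι i)
  p_equiv : ∀ i, Equivariant e (p i)
  h_equiv : ∀ i, Equivariant e (h i)
  p_ι : ∀ i z, p i (ι i z) = z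
  d_ι : ∀ i z, app (C.d i (i + 1)) j (ι i z) = 0
  p_d : ∀ i x, p (i + 1) (app (C.d i (i + 1)) j x) = 0
  p_h : ∀ i x, p i (h i x) = 0
  h_ι : ∀ i z, h i (ι (i + 1) z) = 0
  h_h : ∀ i x, h i (h (i + 1) x) = 0
  htpy : ∀ i x, ι (i + 1) (p (i + 1) x) + h (i + 1) (app (C.d (i + 1) (i + 1 + 1)) j x) +
    app (C.d i (i + 1)) j (h i x) = x
  p_mk : ∀ i (x : (Sub.ker (C.d i (i + 1))).toMod.obj j), p i x.1 = app (cohMk C i) j x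

section
variable (C : CochainComplex (GrMod 𝓑) ℤ) (j : ℤ)

/-- Over a field, every linear map `f` has a quasi-inverse `g`, with `f g f = f` and `g f g = g`.
Averaging over the idempotents makes it equivariant; this is where the semisimplicity of `A_0`
enters. -/
theorem exists_equivariant_quasiInverse {e : V → 𝓑 0} (he : IsComplete e) {M N : GrMod 𝓑}
    (f : M ⟶ N) : ∃ g : N.obj j →ₗ[K] M.obj j, Equivariant e g ∧
      (∀ x, app f j (g (app f j x)) = app f j x) ∧ ∀ y, g (app f j (g y)) = g y := by
  obtain ⟨s, hs⟩ := (app f j).rangeRestrict.exists_rightInverse_of_surjective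
    (app f j).range_rangeRestrict
  obtain ⟨r, hr⟩ := (LinearMap.range (app f j)).subtype.exists_leftInverse_of_injective
    (Submodule.ker_subtype _)
  have h1 : ∀ x, app f j (s (r (app f j x))) = app f j x := fun x => by
    have h2 : r (app f j x) = ⟨app f j x, x, rfl⟩ :=
      LinearMap.congr_fun hr ⟨app f j x, x, rfl⟩
    rw [h2]
    exact congrArg Subtype.val (LinearMap.congr_fun hs _)
  let g := ∑ v, M.act 0 j j (zero_add j) (e v) ∘ₗ (s ∘ₗ r) ∘ₗ N.act 0 j j (zero_add j) (e v)
  have hg : Equivariant e g := he.equivariant_average _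
  have h3 : ∀ x, app f j (g (app f j x)) = app f j x := fun x => by
    simp only [g, LinearMap.sum_apply, LinearMap.comp_apply, map_sum, app_act]
    simp only [← app_act, h1]
    simp only [app_act, he.act_self]
    rw [he.sum_act]
  refine ⟨g ∘ₗ app f j ∘ₗ g, fun v x => ?_, fun x => ?_, fun y => ?_⟩
  · simp only [LinearMap.comp_apply]
    rw [hg, app_act, hg]
  · simp only [LinearMap.comp_apply, h3]
  · simp only [LinearMap.comp_apply, h3]

theorem cohMk_surjective (i : ℤ) : Function.Surjective (app (cohMk C i) j) :=
  Submodule.mkQ_surjective _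

theorem cohMk_eq_zero_iff (i : ℤ) (x : (Sub.ker (C.d (i + 1) (i + 1 + 1))).toMod.obj j) :
    app (cohMk C (i + 1)) j x = 0 ↔ ∃ y, app (C.d i (i + 1)) j y = x.1 :=
  (Submodule.Quotient.mk_eq_zero _).trans (exists_range_d_iff C i j x.1)

theorem cohMk_eq_iff (i : ℤ) (x y : (Sub.ker (C.d (i + 1) (i + 1 + 1))).toMod.obj j) :
    app (cohMk C (i + 1)) j x = app (cohMk C (i + 1)) j y ↔
      ∃ z, app (C.d i (i + 1)) j z = x.1 - y.1 :=
  (Submodule.Quotient.eq _).trans (exists_range_d_iff C i j (x.1 - y.1))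

/-- In each internal degree, a complex of graded modules contracts onto its cohomology by maps that
are linear over the span of the idempotents `e v`, with the side conditions of a strong deformation
retract. -/
theorem exists_splitting {e : V → 𝓑 0} (he : IsComplete e) : Nonempty (Splitting e C j) := by
  choose k k_equiv d_k_d k_d_k using fun i =>
    exists_equivariant_quasiInverse j he (C.d i (i + 1))
  let D : ∀ i, (C.X i).obj j →ₗ[K] (C.X (i + 1)).obj j := fun i => app (C.d i (i + 1)) j
  have DD : ∀ i x, D (i + 1) (D i x) = 0 := fun i x => by
    change app (C.d i (i + 1) ≫ C.d (i + 1) (i + 1 + 1)) j x = 0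
    rw [C.d_comp_d]
    rfl
  have D_equiv : ∀ i, Equivariant e (D i) := fun i => equivariant_app e _ _
  -- The correction `h = (1 - d k) k` of `k` satisfies `h h = 0`.
  obtain ⟨h, h_eq⟩ := exists_shift (X := fun i => (C.X (i + 1)).obj j →ₗ[K] (C.X i).obj j)
    fun i => k (i + 1) - D i ∘ₗ k i ∘ₗ k (i + 1)
  have h_app : ∀ i x, h (i + 1) x = k (i + 1) x - D i (k i (k (i + 1) x)) := fun i x => by
    rw [h_eq]; rfl
  have h_equiv : ∀ i, Equivariant e (h i) := fun i v x => by
    obtain ⟨i, rfl⟩ : ∃ m, i = m + 1 := ⟨i - 1, by omega⟩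
    simp only [h_app, map_sub]
    rw [k_equiv, k_equiv, D_equiv]
  have h_h : ∀ i x, h i (h (i + 1) x) = 0 := fun i x => by
    obtain ⟨i, rfl⟩ : ∃ m, i = m + 1 := ⟨i - 1, by omega⟩
    have h1 := k_d_k (i + 1) (k (i + 1 + 1) x)
    simp only [h_app, map_sub]
    simp only [D]
    rw [h1]
    simp
  have d_h_d : ∀ i x, D i (h i (D i x)) = D i x := fun i x => by
    obtain ⟨i, rfl⟩ : ∃ m, i = m + 1 := ⟨i - 1, by omega⟩
    rw [h_app, map_sub, DD, sub_zero]
    exact d_k_d (i + 1) x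
  have h_d_h : ∀ i x, h i (D i (h i x)) = h i x := fun i x => by
    obtain ⟨i, rfl⟩ : ∃ m, i = m + 1 := ⟨i - 1, by omega⟩
    have h1 := k_d_k (i + 1) x
    simp only [h_app, map_sub, DD, sub_zero]
    simp only [D]
    rw [h1]
  -- The projector `E = 1 - d h - h d`.
  obtain ⟨E, E_eq⟩ := exists_shift (X := fun i => (C.X i).obj j →ₗ[K] (C.X i).obj j)
    fun i => LinearMap.id - D i ∘ₗ h i - h (i + 1) ∘ₗ D (i + 1)
  have E_app : ∀ i x, E (i + 1) x = x - D i (h i x) - h (i + 1) (D (i + 1) x) := fun i x => by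
    rw [E_eq]; rfl
  have E_equiv : ∀ i, Equivariant e (E i) := fun i v x => by
    obtain ⟨i, rfl⟩ : ∃ m, i = m + 1 := ⟨i - 1, by omega⟩
    simp only [E_app, map_sub]
    rw [h_equiv, D_equiv, D_equiv, h_equiv]
  have D_E : ∀ i x, D i (E i x) = 0 := fun i x => by
    obtain ⟨i, rfl⟩ : ∃ m, i = m + 1 := ⟨i - 1, by omega⟩
    rw [E_app, map_sub, map_sub, DD, d_h_d]
    simp
  have E_D : ∀ i x, E (i + 1) (D i x) = 0 := fun i x => by
    rw [E_app, DD, d_h_d]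
    simp
  have E_h : ∀ i x, E i (h i x) = 0 := fun i x => by
    obtain ⟨i, rfl⟩ : ∃ m, i = m + 1 := ⟨i - 1, by omega⟩
    rw [E_app, h_h, h_d_h]
    simp
  have h_E : ∀ i x, h i (E (i + 1) x) = 0 := fun i x => by
    rw [E_app, map_sub, map_sub, h_h, h_d_h]
    simp
  have E_range : ∀ i (x : (Sub.ker (C.d i (i + 1))).toMod.obj j), app (cohMk C i) j x = 0 →
      E i x.1 = 0 := fun i x hx => by
    obtain ⟨i, rfl⟩ : ∃ m, i = m + 1 := ⟨i - 1, by omega⟩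
    obtain ⟨y, hy⟩ := (cohMk_eq_zero_iff C j i x).1 hx
    rw [← hy]
    exact E_D i y
  -- The projector `E` has image in the cocycles and kills the coboundaries, so it
  -- factors through the cohomology, as `p` followed by `ι`.
  let ι : ∀ i, (cohomology C i).obj j →ₗ[K] (C.X i).obj j := fun i =>
    Submodule.liftQ _ (E i ∘ₗ ((Sub.ker (C.d i (i + 1))).carrier j).subtype) fun x hx =>
      E_range i x ((Submodule.Quotient.mk_eq_zero _).2 hx)
  have ι_mk : ∀ i x, ι i (app (cohMk C i) j x) = E i x.1 := fun _ _ => rfl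
  let p : ∀ i, (C.X i).obj j →ₗ[K] (cohomology C i).obj j := fun i =>
    app (cohMk C i) j ∘ₗ (E i).codRestrict ((Sub.ker (C.d i (i + 1))).carrier j) (D_E i)
  have p_eq : ∀ i x, p i x = app (cohMk C i) j (mkCyc (E i x) (D_E i x)) := fun _ _ => rfl
  have p_mk : ∀ i (x : (Sub.ker (C.d i (i + 1))).toMod.obj j), p i x.1 = app (cohMk C i) j x :=
    fun i x => by
      obtain ⟨i, rfl⟩ : ∃ m, i = m + 1 := ⟨i - 1, by omega⟩
      rw [p_eq, cohMk_eq_iff]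
      refine ⟨-h i x.1, ?_⟩
      change D i (-h i x.1) = E (i + 1) x.1 - x.1
      have hx : D (i + 1) x.1 = 0 := x.2
      rw [E_app, hx, map_neg, map_zero]
      abel
  have E_E : ∀ i x, E (i + 1) (E (i + 1) x) = E (i + 1) x := fun i x => by
    conv_lhs => rw [E_app, D_E, h_E, map_zero, map_zero, sub_zero, sub_zero]
  refine ⟨⟨ι, p, h, fun i v z => ?_, fun i v x => ?_, h_equiv, fun i z => ?_, fun i z => ?_,
    fun i x => ?_, fun i x => ?_, fun i z => ?_, h_h, fun i x => ?_, p_mk⟩⟩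
  · obtain ⟨x, rfl⟩ := cohMk_surjective C j i z
    rw [← app_act, ι_mk, ι_mk]
    exact E_equiv i v x.1
  · rw [p_eq, p_eq]
    refine Eq.trans ?_ (app_act (cohMk C i) _ _ _ _ _ _)
    exact congrArg (app (cohMk C i) j) (Subtype.ext (E_equiv i v x))
  · obtain ⟨x, rfl⟩ := cohMk_surjective C j i z
    rw [ι_mk]
    exact (p_mk i (mkCyc (E i x.1) (D_E i x.1))).trans ((p_eq i x.1).symm.trans (p_mk i x))
  · obtain ⟨x, rfl⟩ := cohMk_surjective C j i z
    exact D_E i x.1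
  · rw [p_eq, ← map_zero (app (cohMk C (i + 1)) j)]
    exact congrArg _ (Subtype.ext (E_D i x))
  · rw [p_eq, ← map_zero (app (cohMk C i) j)]
    exact congrArg _ (Subtype.ext (E_h i x))
  · obtain ⟨x, rfl⟩ := cohMk_surjective C j (i + 1) z
    rw [ι_mk, h_E]
  · rw [p_eq, ι_mk]
    change E (i + 1) (E (i + 1) x) + h (i + 1) (D (i + 1) x) + D i (h i x) = x
    rw [E_E, E_app]
    abel

end

/-- The inclusion and projection of contractions in different degrees carry the action on the
complex to the action on the cohomology. -/
theorem Splitting.p_act_ι {e : V → 𝓑 0} {C : CochainComplex (GrMod 𝓑) ℤ} {l j j' : ℤ}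
    (s : Splitting e C j) (s' : Splitting e C j') (h : l + j = j') (a : 𝓑 l) (i : ℤ)
    (x : (cohomology C i).obj j) :
    s'.p i ((C.X i).act l j j' h a (s.ι i x)) = (cohomology C i).act l j j' h a x := by
  have h1 : app (cohMk C i) j (mkCyc (s.ι i x) (s.d_ι i x)) = x :=
    (s.p_mk i (mkCyc (s.ι i x) (s.d_ι i x))).symm.trans (s.p_ι i x)
  conv_rhs => rw [← h1, ← app_act]
  exact s'.p_mk i ((Sub.ker (C.d i (i + 1))).toMod.act l j j' h a
    (mkCyc (s.ι i x) (s.d_ι i x)))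

end Splitting

end GrMod

end KoszulDuality

end

noncomputable section

namespace KoszulDuality

open GrMod

section QuiverAlgebra

variable {K V : Type u} [Field K] [Fintype V] [Quiver.{u} V]

/-! ### Quotients of path algebras -/

section Generation

variable (I : Ideal (PathAlg K V)) [I.IsTwoSided]

/-- A linear map on `KQ` that vanishes on `I` descends to `KQ / I`. -/
theorem exists_desc_quotient {X : Type*} [AddCommGroup X] [Module K X] (F : PathAlg K V →ₗ[K] X)
    (hF : ∀ x ∈ I, F x = 0) :
    ∃ f : (PathAlg K V ⧸ I) →ₗ[K] X, ∀ x, f (Ideal.Quotient.mk I x) = F x := by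
  obtain ⟨s, hs⟩ := (Ideal.Quotient.mkₐ K I).toLinearMap.exists_rightInverse_of_surjective
    (LinearMap.range_eq_top.2 (Ideal.Quotient.mkₐ_surjective K I))
  refine ⟨F ∘ₗ s, fun x => ?_⟩
  have h1 : Ideal.Quotient.mk I (s (Ideal.Quotient.mk I x)) = Ideal.Quotient.mk I x :=
    LinearMap.congr_fun hs _
  have h2 := hF _ (Ideal.Quotient.eq.1 h1)
  rw [map_sub, sub_eq_zero] at h2
  exact h2

/-- The trivial paths are a complete system of orthogonal idempotents of `KQ / I`. -/
theorem isComplete_vtx : IsComplete (vtx I) where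
  sum_eq := by
    have h := map_sum (Ideal.Quotient.mk I) (fun v => idem K v) Finset.univ
    refine h.symm.trans (map_one (Ideal.Quotient.mk I))
  mul_self v := by
    change Ideal.Quotient.mk I _ * Ideal.Quotient.mk I _ = Ideal.Quotient.mk I _
    rw [← map_mul, mul_def, idem, mulLin_path, pathMul_comp]
    rfl
  mul_of_ne v w h := by
    change Ideal.Quotient.mk I _ * Ideal.Quotient.mk I _ = 0
    rw [← map_mul, mul_def, idem, idem, mulLin_path, pathMul_ne (by exact h), map_zero]

/-- The class of a path in `KQ / I`. -/
def pathElt {n : ℤ} (p : Σ a b : V, Quiver.Path a b) (hp : (p.2.2.length : ℤ) = n) : grd I n :=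
  ⟨Ideal.Quotient.mk I (path K p), mk_mem_grd I (Submodule.subset_span ⟨p, hp, rfl⟩)⟩

/-- The classes of the paths of length `n` span the degree `n` component. -/
theorem eq_top_of_pathElt_mem {n : ℤ} (S : Submodule K (grd I n))
    (hS : ∀ p hp, pathElt I p hp ∈ S) : S = ⊤ := by
  refine eq_top_iff.2 fun x _ => ?_
  obtain ⟨_, y, hy, rfl⟩ := x
  refine Submodule.span_induction
    (p := fun y hy => (⟨_, mk_mem_grd I hy⟩ : grd I n) ∈ S) ?_ ?_ ?_ ?_ hy
  · rintro _ ⟨p, hp, rfl⟩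
    exact hS p hp
  · exact (congrArg (· ∈ S) (Subtype.ext (map_zero (Ideal.Quotient.mk I)))).mpr S.zero_mem
  · intro x y _ _ hx hy
    exact (congrArg (· ∈ S) (Subtype.ext (map_add (Ideal.Quotient.mk I) x y))).mpr
      (S.add_mem hx hy)
  · intro c x _ hx
    exact S.smul_mem c hx

/-- `A_0` is spanned by the idempotents of the vertices. -/
theorem span_vtx : Submodule.span K (Set.range (vtx I)) = ⊤ := by
  refine eq_top_of_pathElt_mem I _ fun ⟨a, b, p⟩ hp => ?_
  cases p with
  | nil => exact Submodule.subset_span ⟨a, rfl⟩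
  | cons p α => simp at hp; omega

theorem pathElt_cons {a b c : V} (p : Quiver.Path a b) (α : b ⟶ c) {n m : ℤ} (h : n + 1 = m)
    (hp : (p.length : ℤ) = n) : pathElt I ⟨a, c, p.cons α⟩ (by simp [hp, h]) =
      rmul (grd I) h (arr I α) (pathElt I ⟨a, b, p⟩ hp) := by
  refine Subtype.ext ?_
  change _ = Ideal.Quotient.mk I _ * Ideal.Quotient.mk I _
  rw [← map_mul, mul_def, arrow, mulLin_path, pathMul_comp]
  rfl

/-- The degree `n + 1` component is spanned by the products of an element of degree `n` with an
arrow. -/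
theorem eq_top_of_rmul_arr_mem {n m : ℤ} (h : n + 1 = m) (hn : 0 ≤ n) (S : Submodule K (grd I m))
    (hS : ∀ (α : Arrows V) (y : grd I n), rmul (grd I) h (arr I α.2.2) y ∈ S) : S = ⊤ := by
  refine eq_top_of_pathElt_mem I _ fun ⟨a, b, p⟩ hp => ?_
  cases p with
  | nil => simp at hp; omega
  | cons p α =>
    have hp' : (p.length : ℤ) = n := by
      simp only [Quiver.Path.length_cons] at hp
      push_cast at hp
      omega
    rw [pathElt_cons I p α h hp']
    exact hS ⟨_, _, α⟩ _

theorem finiteDimensional_grd [∀ a b : V, Finite (a ⟶ b)] (n : ℤ) :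
    FiniteDimensional K (grd I n) := by
  rcases lt_or_ge n 0 with hn | hn
  · rw [NonnegGraded.eq_bot (𝓑 := grd I) n hn]
    infer_instance
  induction n, hn using Int.leInduction with
  | base =>
    have h1 : FiniteDimensional K (Submodule.span K (Set.range (vtx I))) :=
      FiniteDimensional.span_of_finite K (Set.finite_range _)
    rw [span_vtx] at h1
    exact Module.Finite.equiv Submodule.topEquiv
  | succ n hn ih =>
    let f : Arrows V → (regular (grd I)).obj n →ₗ[K] (regular (grd I)).obj (n + 1) :=
      fun α => rmul (grd I) rfl (arr I α.2.2)
    have ih' : FiniteDimensional K ((regular (grd I)).obj n) := ih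
    have hf : ∀ α, Module.Finite K (LinearMap.range (f α)) := fun α => inferInstance
    have h1 : (⨆ α, LinearMap.range (f α)) = ⊤ := eq_top_of_rmul_arr_mem I rfl hn _ fun α y =>
      Submodule.mem_iSup_of_mem α ⟨y, rfl⟩
    have h2 : FiniteDimensional K (⨆ α, LinearMap.range (f α) : Submodule K _) :=
      Submodule.finite_iSup _
    rw [h1] at h2
    have h3 : FiniteDimensional K ((regular (grd I)).obj (n + 1)) :=
      Module.Finite.equiv Submodule.topEquiv
    exact h3

end Generation

theorem isComplete_vtx_op (I : Ideal (PathAlg K Vᵒᵖ)) [I.IsTwoSided] :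
    IsComplete fun v : V => vtx I (op v) where
  sum_eq := (Equiv.sum_comp equivToOpposite fun v => (vtx I v : PathAlg K Vᵒᵖ ⧸ I)).trans
    (isComplete_vtx I).sum_eq
  mul_self v := (isComplete_vtx I).mul_self _
  mul_of_ne v w h := (isComplete_vtx I).mul_of_ne _ _ fun e => h (op_injective e)

variable [∀ a b : V, Fintype (a ⟶ b)] {I : Ideal (PathAlg K V)} [I.IsTwoSided]

/-! ### The double complexes of the Koszul functors -/

/-- The double complex whose total complex is `F(N)`. -/
def FBi (N : CochainComplex (GrMod (grd (perp I))) ℤ) : BiCx (grd I) where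
  T i j := tensMod (N.X i) j
  d i j := tensMap (N.d i (i + 1)) j
  t i j := tensD (N.X i) j
  d_d i j := tensMap_comp_eq_zero _ _ (N.d_comp_d _ _ _) j
  t_t i j := tensD_tensD _ j
  d_t i j := tensMap_tensD _ j

/-- The double complex whose total complex is `G(M)`. -/
def GBi (M : CochainComplex (GrMod (grd I)) ℤ) : BiCx (grd (perp I)) where
  T i j := homMod (M.X i) j
  d i j := homMap (M.d i (i + 1)) j
  t i j := homD (M.X i) j
  d_d i j := homMap_comp_eq_zero _ _ (M.d_comp_d _ _ _) j
  t_t i j := homD_homD _ j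
  d_t i j := homMap_homD _ j

/-- The map `a ⊗ x ↦ a ⊗ φ(x)` for an `A_0`-linear map `φ`. -/
def tmapLin {N N' : GrMod (grd (perp I))} {j : ℤ} (φ : N.obj j →ₗ[K] N'.obj j)
    (hφ : Equivariant (fun v : V => vtx (perp I) (op v)) φ) (l : ℤ) :
    Tens I N l j →ₗ[K] Tens I N' l j :=
  tlift ((tmk N' l j).compl₂ φ) fun v a x => by
    simp only [LinearMap.compl₂_apply, hφ v x]
    rw [tmk_balanced]

theorem tmapLin_tact {N N' : GrMod (grd (perp I))} {j : ℤ} (φ : N.obj j →ₗ[K] N'.obj j) (hφ)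
    {m l l' : ℤ} (h : m + l = l') (a : grd I m) :
    tmapLin φ hφ l' ∘ₗ tact N h j a = tact N' h j a ∘ₗ tmapLin φ hφ l :=
  tens_hom_ext fun _ _ => rfl

/-- The morphism `a ⊗ x ↦ a ⊗ φ(x)` for an `A_0`-linear map `φ`. -/
def tensLin {N N' : GrMod (grd (perp I))} {j : ℤ} (φ : N.obj j →ₗ[K] N'.obj j)
    (hφ : Equivariant (fun v : V => vtx (perp I) (op v)) φ) :
    tensMod (I := I) N j ⟶ tensMod N' j :=
  mkHom (M := tensMod N j) (N := tensMod N' j) (fun q => tmapLin φ hφ (q + j))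
    fun _ _ _ _ a x => LinearMap.congr_fun (tmapLin_tact φ hφ _ a) x

theorem tensMod_hom_ext {N : GrMod (grd (perp I))} {j : ℤ} {L : GrMod (grd I)}
    {f g : tensMod N j ⟶ L}
    (h : ∀ (q : ℤ) (a : (regular (grd I)).obj (q + j)) (x : N.obj j),
      app f q (tmk N (q + j) j a x) = app g q (tmk N (q + j) j a x)) : f = g :=
  hom_ext fun q x => LinearMap.congr_fun (f := app f q) (g := app g q) (tens_hom_ext (h q)) x

/-- The morphism `f ↦ φ ∘ f` for an `A_0`-linear map `φ`. -/
def homLin {M M' : GrMod (grd I)} {j : ℤ} (φ : M.obj j →ₗ[K] M'.obj j)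
    (hφ : Equivariant (vtx I) φ) : homMod (I := I) M j ⟶ homMod M' j :=
  mkHom (M := homMod M j) (N := homMod M' j)
    (fun q =>
      { toFun := fun f : HomA0 I M (-q - j) j => (⟨φ ∘ₗ f.1, fun v x => by
          rw [LinearMap.comp_apply, LinearMap.comp_apply, f.2 v, hφ]⟩ : HomA0 I M' (-q - j) j)
        map_add' := fun f g => homA0_ext fun x => map_add φ _ _
        map_smul' := fun c f => homA0_ext fun x => map_smul φ _ _ })
    fun _ _ _ _ _ _ => rfl

/-- The value of an element of `Hom_{A_0}(A^!, M_j)`. -/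
def hval {M : GrMod (grd I)} {j q : ℤ} (f : (homMod M j).obj q)
    (x : (regular (grd (perp I))).obj (-q - j)) : M.obj j := (show HomA0 I M (-q - j) j from f).1 x

theorem hval_ext {M : GrMod (grd I)} {j q : ℤ} {f g : (homMod M j).obj q}
    (h : ∀ x, hval f x = hval g x) : f = g := homA0_ext h

/-- An equivariant contraction of a complex of `A^!`-modules induces a contraction of the double
complex of the functor `F`. -/
def FContraction (N : CochainComplex (GrMod (grd (perp I))) ℤ)
    (s : ∀ j, Splitting (fun v : V => vtx (perp I) (op v)) N j) : (FBi N).Contraction where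
  H i j := tensMod (cohomology N i) j
  ι i j := tensLin ((s j).ι i) ((s j).ι_equiv i)
  p i j := tensLin ((s j).p i) ((s j).p_equiv i)
  h i j := tensLin ((s j).h i) ((s j).h_equiv i)
  tH i j := tensD (cohomology N i) j
  ι_p i j := tensMod_hom_ext fun q a x => congrArg (tmk _ _ _ a) ((s j).p_ι i x)
  ι_d i j := tensMod_hom_ext fun q a x =>
    (congrArg (tmk _ _ _ a) ((s j).d_ι i x)).trans (map_zero _)
  d_p i j := tensMod_hom_ext fun q a x =>
    (congrArg (tmk _ _ _ a) ((s j).p_d i x)).trans (map_zero _)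
  h_p i j := tensMod_hom_ext fun q a x =>
    (congrArg (tmk _ _ _ a) ((s j).p_h i x)).trans (map_zero _)
  ι_h i j := tensMod_hom_ext fun q a x =>
    (congrArg (tmk _ _ _ a) ((s j).h_ι i x)).trans (map_zero _)
  h_h i j := tensMod_hom_ext fun q a x =>
    (congrArg (tmk _ _ _ a) ((s j).h_h i x)).trans (map_zero _)
  htpy i j := tensMod_hom_ext fun q a x => by
    refine Eq.trans ?_ (congrArg (tmk _ _ _ a) ((s j).htpy i x))
    rw [map_add, map_add]
    rfl
  -- The morphism induced by `d'` on the cohomology is `d'` itself, since `p` and `ι` carry the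
  -- action of the arrows on the complex to that on the cohomology.
  ι_t_p i j := tensMod_hom_ext fun q a x => by
    refine (congrArg (tmapLin ((s (j + 1)).p i) ((s (j + 1)).p_equiv i) _)
      (td_tmk _ _ _ a ((s j).ι i x))).trans ?_
    refine Eq.trans ?_ (td_tmk (cohomology N i) (add_assoc q j 1) (add_comm 1 j) a x).symm
    rw [map_sum]
    exact Finset.sum_congr rfl fun α _ => congrArg (tmk _ _ _ _) (Splitting.p_act_ι _ _ _ _ _ _)

/-- An equivariant contraction of a complex of `A`-modules induces a contraction of the double
complex of the functor `G`. -/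
def GContraction (M : CochainComplex (GrMod (grd I)) ℤ)
    (s : ∀ j, Splitting (vtx I) M j) : (GBi M).Contraction where
  H i j := homMod (cohomology M i) j
  ι i j := homLin ((s j).ι i) ((s j).ι_equiv i)
  p i j := homLin ((s j).p i) ((s j).p_equiv i)
  h i j := homLin ((s j).h i) ((s j).h_equiv i)
  tH i j := homD (cohomology M i) j
  ι_p i j := hom_ext fun q f => hval_ext fun x => (s j).p_ι i (hval f x)
  ι_d i j := hom_ext fun q f => hval_ext fun x => (s j).d_ι i (hval f x)
  d_p i j := hom_ext fun q f => hval_ext fun x => (s j).p_d i (hval f x)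
  h_p i j := hom_ext fun q f => hval_ext fun x => (s j).p_h i (hval f x)
  ι_h i j := hom_ext fun q f => hval_ext fun x => (s j).h_ι i (hval f x)
  h_h i j := hom_ext fun q f => hval_ext fun x => (s j).h_h i (hval f x)
  htpy i j := hom_ext fun q f => hval_ext fun x => (s j).htpy i (hval f x)
  -- As for the functor `F`, the morphism induced by `d'` is `d'` itself.
  ι_t_p i j := hom_ext fun q f => hval_ext fun x => by
    refine (congrArg ((s (j + 1)).p i) (hd_apply _ _ _ _ x)).trans ?_
    refine Eq.trans ?_ (hd_apply (cohomology M i) _ (add_comm 1 j) _ x).symm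
    rw [map_sum]
    exact Finset.sum_congr rfl fun α _ => Splitting.p_act_ι _ _ _ _ _ _

end QuiverAlgebra

end KoszulDuality

end

noncomputable section

namespace KoszulDuality

open GrMod

section QuiverAlgebra

variable {K V : Type u} [Field K] [Fintype V] [Quiver.{u} V]

/-! ### Quadratic duality -/

theorem rmul_vtx_self (I : Ideal (PathAlg K V)) [I.IsTwoSided] {l : ℤ} (v : V)
    (a : (regular (grd I)).obj l) : rmul (grd I) (add_zero l) (vtx I v)
      (rmul (grd I) (add_zero l) (vtx I v) a) = rmul (grd I) (add_zero l) (vtx I v) a :=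
  rmul_rmul _ _ _ (add_zero 0) _ _ _ _ _ ((isComplete_vtx I).mul_self v).symm

theorem rmul_vtx_of_ne (I : Ideal (PathAlg K V)) [I.IsTwoSided] {l : ℤ} {v w : V} (h : v ≠ w)
    (a : (regular (grd I)).obj l) : rmul (grd I) (add_zero l) (vtx I w)
      (rmul (grd I) (add_zero l) (vtx I v) a) = 0 := by
  rw [rmul_rmul _ _ _ (add_zero 0) (add_zero l) _ _ _ 0 ((isComplete_vtx I).mul_of_ne v w h).symm,
    rmul_zero]
  rfl

theorem sum_rmul_vtx (I : Ideal (PathAlg K V)) [I.IsTwoSided] {l : ℤ}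
    (a : (regular (grd I)).obj l) : ∑ v, rmul (grd I) (add_zero l) (vtx I v) a = a := by
  refine Subtype.ext ?_
  refine (AddSubmonoidClass.coe_finsetSum _ _).trans ?_
  refine (Finset.mul_sum _ _ _).symm.trans ?_
  rw [(isComplete_vtx I).sum_eq]
  exact mul_one _

/-- The coefficient of a path of length at most `1` is well defined on `KQ / I`, as `I` is
contained in `J^2`. -/
theorem exists_coeff {I : Ideal (PathAlg K V)} [I.IsTwoSided] (hI : ∀ x ∈ I, ∀ p : Σ a b : V,
      Quiver.Path a b, coeff x p ≠ 0 → 2 ≤ p.2.2.length)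
    (p : Σ a b : V, Quiver.Path a b) (hp : p.2.2.length < 2) :
    ∃ f : (PathAlg K V ⧸ I) →ₗ[K] K, f (Ideal.Quotient.mk I (path K p)) = 1 ∧
      ∀ q, q ≠ p → f (Ideal.Quotient.mk I (path K q)) = 0 := by
  classical
  obtain ⟨f, hf⟩ := exists_desc_quotient I (X := K)
    { toFun := fun x => coeff x p
      map_add' := fun x y => coeff_add x y p
      map_smul' := fun c x => coeff_smul c x p } fun x hx => by
        by_contra h
        have := hI x hx p h
        omega
  refine ⟨f, ?_, fun q hq => ?_⟩
  · exact (hf _).trans ((coeff_path p p).trans (if_pos rfl))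
  · exact (hf _).trans ((coeff_path q p).trans (if_neg hq))

/-- The classes of the trivial paths are linearly independent in `A_0`. -/
theorem exists_vtx_coeff {I : Ideal (PathAlg K V)} [I.IsTwoSided] (hI : ∀ x ∈ I, ∀ p : Σ a b : V,
      Quiver.Path a b, coeff x p ≠ 0 → 2 ≤ p.2.2.length)
    (v : V) : ∃ f : (regular (grd I)).obj 0 →ₗ[K] K, f (vtx I v) = 1 ∧
      ∀ w, w ≠ v → f (vtx I w) = 0 := by
  obtain ⟨f, hf, hf'⟩ := exists_coeff hI ⟨v, v, .nil⟩ (by simp)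
  exact ⟨f ∘ₗ (grd I 0).subtype, hf, fun w hw => hf' _ fun e => hw (congrArg Sigma.fst e)⟩

/-- The classes of the arrows are linearly independent in `A_1`. -/
theorem exists_arr_coeff {I : Ideal (PathAlg K V)} [I.IsTwoSided] (hI : ∀ x ∈ I, ∀ p : Σ a b : V,
      Quiver.Path a b, coeff x p ≠ 0 → 2 ≤ p.2.2.length)
    (α : Arrows V) : ∃ f : (regular (grd I)).obj 1 →ₗ[K] K, f (arr I α.2.2) = 1 ∧
      ∀ β : Arrows V, β ≠ α → f (arr I β.2.2) = 0 := by
  obtain ⟨f, hf, hf'⟩ := exists_coeff hI ⟨α.1, α.2.1, α.2.2.toPath⟩ (by simp)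
  refine ⟨f ∘ₗ (grd I 1).subtype, hf, fun β hβ => hf' _ fun e => hβ ?_⟩
  obtain ⟨a, b, α⟩ := α
  obtain ⟨a', b', β⟩ := β
  simp only [Quiver.Hom.toPath] at e
  cases e
  rfl

theorem path_mul_arrow {a b c : V} (p : Quiver.Path a b) (α : b ⟶ c) :
    path K ⟨a, b, p⟩ * arrow K α = path K ⟨a, c, p.cons α⟩ := by
  rw [mul_def, arrow, mulLin_path, pathMul_comp]
  rfl

theorem path_mul_arrow_of_ne {a b b' c : V} (p : Quiver.Path a b) (α : b' ⟶ c) (h : b ≠ b') :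
    path K ⟨a, b, p⟩ * arrow K α = 0 := by
  rw [mul_def, arrow, mulLin_path, pathMul_ne (by exact h)]

theorem toPathOp_eq (t : ArrowPairs V) :
    path K t.toPathOp = arrow K t.2.2.2.2.op * arrow K t.2.2.2.1.op := by
  rw [mul_def, arrow, arrow, mulLin_path, pathMul_comp]
  rfl

theorem exists_arrowPair_op (p : Σ a b : Vᵒᵖ, Quiver.Path a b) (hp : p.2.2.length = 2) :
    ∃ t : ArrowPairs V, t.toPathOp = p := by
  obtain ⟨a, c, p⟩ := p
  match p, hp with
  | .cons (.cons .nil α) β, _ => exact ⟨⟨_, _, _, β.unop, α.unop⟩, rfl⟩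

variable [∀ a b : V, Fintype (a ⟶ b)]

theorem eq_sum_toPathOp {x : PathAlg K Vᵒᵖ} (hx : x ∈ pathDeg K Vᵒᵖ 2) :
    x = ∑ t : ArrowPairs V, coeff x t.toPathOp • path K t.toPathOp := by
  classical
  refine Submodule.span_induction ?_ ?_ ?_ ?_ hx
  · rintro _ ⟨p, hp, rfl⟩
    obtain ⟨t, rfl⟩ := exists_arrowPair_op p (by exact_mod_cast hp)
    rw [Finset.sum_eq_single t]
    · rw [coeff_path, if_pos rfl, one_smul]
    · intro s _ hs
      rw [coeff_path, if_neg (fun h => hs (ArrowPairs.toPathOp_injective h).symm), zero_smul]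
    · simp
  · exact (Finset.sum_eq_zero fun t _ => zero_smul K _).symm
  · intro x y _ _ hx hy
    simp only [coeff_add, add_smul, Finset.sum_add_distrib]
    rw [← hx, ← hy]
  · intro c x _ hx
    simp only [coeff_smul, mul_smul, ← Finset.smul_sum]
    rw [← hx]

/-- A linear map on `KQ^op`, defined by its values on the products of a path of length `n` with an
arrow. -/
theorem exists_map_on_paths {I' : Ideal (PathAlg K Vᵒᵖ)} [I'.IsTwoSided] {X : Type u}
    [AddCommGroup X] [Module K X] (n : ℤ) (G : Arrows V → (grd I' n →ₗ[K] X))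
    (hG : ∀ (α : Arrows V) y,
      G α (rmul (grd I') (add_zero n) (vtx I' (op α.2.1)) y) = G α y) :
    ∃ F : PathAlg K Vᵒᵖ →ₗ[K] X,
      (∀ (α : Arrows V) x (hx : x ∈ pathDeg K Vᵒᵖ n),
        F (x * arrow K α.2.2.op) = G α ⟨Ideal.Quotient.mk I' x, mk_mem_grd I' hx⟩) ∧
      ∀ (α : Arrows V) k x, x ∈ pathDeg K Vᵒᵖ k → k ≠ n → F (x * arrow K α.2.2.op) = 0 := by
  let Fb : (Σ a b : Vᵒᵖ, Quiver.Path a b) → X := fun q =>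
    match q with
    | ⟨_, _, .nil⟩ => 0
    | ⟨a, _, .cons p γ⟩ => if h : (p.length : ℤ) = n then
        G ⟨_, _, γ.unop⟩ (pathElt I' ⟨a, _, p⟩ h) else 0
  let F : PathAlg K Vᵒᵖ →ₗ[K] X := Finsupp.linearCombination K Fb
  have hF : ∀ q, F (path K q) = Fb q := fun q => by
    simp only [F, path]
    erw [Finsupp.linearCombination_single, one_smul]
  have key : ∀ (α : Arrows V) (p : Σ a b : Vᵒᵖ, Quiver.Path a b), F (path K p *
      arrow K α.2.2.op) = if h : (p.2.2.length : ℤ) = n then G α (pathElt I' p h) else 0 := by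
    rintro ⟨s, t, α⟩ ⟨a, b, p⟩
    by_cases hb : b = op t
    · subst hb
      rw [path_mul_arrow, hF]
      rfl
    · rw [path_mul_arrow_of_ne _ _ hb, map_zero]
      split_ifs with h
      · refine Eq.trans ?_ (hG ⟨s, t, α⟩ _)
        have h1 : rmul (grd I') (add_zero n) (vtx I' (op t)) (pathElt I' ⟨a, b, p⟩ h) =
            (0 : grd I' n) := by
          refine Subtype.ext ?_
          change Ideal.Quotient.mk I' _ * Ideal.Quotient.mk I' _ = 0
          rw [← map_mul, mul_def, idem, mulLin_path, pathMul_ne (by exact hb), map_zero]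
        exact ((congrArg _ h1).trans (map_zero _)).symm
      · rfl
  refine ⟨F, fun α x hx => ?_, fun α k x hx hk => ?_⟩
  · refine Submodule.span_induction (p := fun x hx => F (x * arrow K α.2.2.op) =
      G α ⟨Ideal.Quotient.mk I' x, mk_mem_grd I' hx⟩) ?_ ?_ ?_ ?_ hx
    · rintro _ ⟨p, hp, rfl⟩
      rw [key, dif_pos hp]
      rfl
    · rw [zero_mul, map_zero, ← map_zero (G α)]
      exact congrArg (G α) (Subtype.ext (map_zero (Ideal.Quotient.mk I')).symm)
    · intro x y hx hy h1 h2
      rw [add_mul, map_add, h1, h2, ← map_add]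
      exact congrArg (G α) (Subtype.ext (map_add (Ideal.Quotient.mk I') x y).symm)
    · intro c x _ h1
      rw [smul_mul_assoc, map_smul, h1, ← map_smul]
      rfl
  · refine Submodule.span_induction (p := fun x _ => F (x * arrow K α.2.2.op) = 0)
      ?_ ?_ ?_ ?_ hx
    · rintro _ ⟨p, hp, rfl⟩
      rw [key, dif_neg (by omega)]
    · rw [zero_mul, map_zero]
    · intro x y hx hy h1 h2
      rw [add_mul, map_add, h1, h2, add_zero]
    · intro c x _ h1
      rw [smul_mul_assoc, map_smul, h1, smul_zero]

open Classical in
/-- As `A^!` is quadratic, a linear map on `A^!_{n+1}` can be defined by its values on the products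
`y α^op`, if these values respect the relations of degree two. -/
theorem exists_of_quadratic {I : Ideal (PathAlg K V)} {X : Type u} [AddCommGroup X] [Module K X]
    {n m : ℤ} (h : n + 1 = m) (G : Arrows V → (grd (perp I) n →ₗ[K] X))
    (hG : ∀ (α : Arrows V) y,
      G α (rmul (grd (perp I)) (add_zero n) (vtx (perp I) (op α.2.1)) y) = G α y)
    (hG' : ∀ w : ArrowPairs V → K,
      (∀ x ∈ I, x ∈ pathDeg K V 2 → ∑ t, coeff x t.toPath * w t = 0) →
      ∀ (s : V) (k : ℤ) (hk : k + 1 = n) (u : grd (perp I) k), ∑ t : ArrowPairs V,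
        (if t.1 = s then w t else 0) • G ⟨t.1, t.2.1, t.2.2.2.1⟩
          (rmul (grd (perp I)) hk (arr (perp I) t.2.2.2.2.op) u) = 0) :
    ∃ f : grd (perp I) m →ₗ[K] X, ∀ (α : Arrows V) (y : grd (perp I) n),
      f (rmul (grd (perp I)) h (arr (perp I) α.2.2.op) y) = G α y := by
  obtain ⟨F, hF, hF'⟩ := exists_map_on_paths n G hG
  have hperp : ∀ x ∈ perp I, F x = 0 := fun x hx => by
    have hx' : x ∈ AddSubgroup.closure _ := TwoSidedIdeal.mem_span_iff_mem_addSubgroup_closure.1 hx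
    refine AddSubgroup.closure_induction ?_ (map_zero F)
      (fun x y _ _ hx hy => by rw [map_add, hx, hy, add_zero])
      (fun x _ hx => by rw [map_neg, hx, neg_zero]) hx'
    -- The two-sided ideal is spanned by the products `a y b` with `y` a quadratic relation and
    -- `a`, `b` paths; `F` sees only the last arrow of such a product.
    rintro _ ⟨_, ⟨a, -, y, ⟨hy, hy'⟩, rfl⟩, b, -, rfl⟩
    change F (a * y * b) = 0
    induction a using path_induction with
    | h0 => rw [zero_mul, zero_mul, map_zero]
    | hadd x x' h1 h2 => rw [add_mul, add_mul, map_add, h1, h2, add_zero]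
    | hs c p =>
    rw [smul_mul_assoc, smul_mul_assoc, map_smul]
    refine (congrArg (c • ·) ?_).trans (smul_zero c)
    induction b using path_induction with
    | h0 => rw [mul_zero, map_zero]
    | hadd x x' h1 h2 => rw [mul_add, map_add, h1, h2, add_zero]
    | hs c z =>
    rw [mul_smul_comm, map_smul]
    refine (congrArg (c • ·) ?_).trans (smul_zero c)
    have hp := path_mem_pathDeg (K := K) p
    obtain ⟨v, r, z⟩ := z
    cases z with
    -- If `b` is trivial, the last two arrows come from the relation `y`, and the vanishing is the
    -- hypothesis on `G`.
    | nil =>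
      have h1 : ∀ t : ArrowPairs V, path K p * path K t.toPathOp * path K ⟨v, v, .nil⟩ =
          if t.1 = v.unop then (path K p * arrow K t.2.2.2.2.op) * arrow K t.2.2.2.1.op else 0 := by
        rintro ⟨a, b, e, α, β⟩
        rw [toPathOp_eq, mul_assoc, mul_assoc]
        split_ifs with hv
        · obtain rfl : v = op a := congrArg op hv.symm
          have h0 : arrow K α.op * path K ⟨op a, op a, .nil⟩ = arrow K α.op := by
            rw [mul_def, arrow, mulLin_path, pathMul_comp, Quiver.Path.comp_nil]
          rw [h0, mul_assoc]
        · have h0 : arrow K α.op * path K ⟨v, v, .nil⟩ = 0 := by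
            rw [mul_def, arrow, mulLin_path, pathMul_ne (fun e => hv (congrArg unop e))]
          rw [h0, mul_zero, mul_zero]
      have h2 : path K p * y * path K ⟨v, v, .nil⟩ = ∑ t : ArrowPairs V,
          (if t.1 = v.unop then coeff y t.toPathOp else 0) •
            ((path K p * arrow K t.2.2.2.2.op) * arrow K t.2.2.2.1.op) := by
        conv_lhs => rw [eq_sum_toPathOp hy]
        rw [Finset.mul_sum, Finset.sum_mul]
        refine Finset.sum_congr rfl fun t _ => ?_
        rw [mul_smul_comm, smul_mul_assoc, h1]
        split_ifs
        · rfl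
        · rw [smul_zero, zero_smul]
      rw [h2, map_sum]
      simp only [map_smul]
      by_cases hn : (p.2.2.length : ℤ) + 1 = n
      · rw [← hG' (fun t => coeff y t.toPathOp) hy' v.unop _ hn (pathElt (perp I) p rfl)]
        refine Finset.sum_congr rfl fun t _ => congrArg _ ?_
        have hpn : path K p * arrow K t.2.2.2.2.op ∈ pathDeg K Vᵒᵖ n :=
          hn ▸ mul_mem_pathDeg hp (arrow_mem K _)
        exact (hF ⟨_, _, t.2.2.2.1⟩ _ hpn).trans (congrArg _ (Subtype.ext
          (map_mul (Ideal.Quotient.mk (perp I)) _ _)))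
      · refine Finset.sum_eq_zero fun t _ => ?_
        rw [hF' ⟨_, _, t.2.2.2.1⟩ _ _ (mul_mem_pathDeg hp (arrow_mem K _)) hn, smul_zero]
    -- If `b = z γ`, the factor `a y z` is already zero in `A^!`.
    | cons z γ =>
      rw [← path_mul_arrow, ← mul_assoc]
      have hx : path K p * y * path K ⟨v, _, z⟩ ∈ pathDeg K Vᵒᵖ _ :=
        mul_mem_pathDeg (mul_mem_pathDeg hp hy) (path_mem_pathDeg _)
      have hx0 : path K p * y * path K ⟨v, _, z⟩ ∈ perp I :=
        Ideal.mul_mem_right _ _ (Ideal.mul_mem_left _ _ (TwoSidedIdeal.subset_span ⟨hy, hy'⟩))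
      by_cases hn : (p.2.2.length : ℤ) + 2 + z.length = n
      · refine (hF ⟨_, _, γ.unop⟩ _ (hn ▸ hx)).trans ?_
        rw [← map_zero (G ⟨_, _, γ.unop⟩)]
        exact congrArg _ (Subtype.ext (Ideal.Quotient.eq_zero_iff_mem.2 hx0))
      · exact hF' ⟨_, _, γ.unop⟩ _ _ hx hn
  obtain ⟨f, hf⟩ := exists_desc_quotient (perp I) F hperp
  refine ⟨f ∘ₗ (grd (perp I) m).subtype, fun α ⟨_, x, hx, rfl⟩ => ?_⟩
  refine Eq.trans ((hf (x * arrow K α.2.2.op)).symm.trans ?_).symm (hF α x hx)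
  rw [map_mul]
  rfl

end QuiverAlgebra

end KoszulDuality

end

noncomputable section

namespace KoszulDuality

open GrMod

section LinearModules

variable {K : Type u} [Field K] {B : Type u} [Ring B] [Algebra K B] {𝓑 : ℤ → Submodule K B}
  [NonnegGraded 𝓑]

/-! ### The modules `A ⊗_{A_0} N_j` and `Hom_{A_0}(A^!, M_j)` -/

/-- A module whose identity factors through a finite direct sum of copies of `B(c - j)`, the
factorization being given by its components. -/
theorem GrMod.isLin_of_sum {c j : ℤ} {M : GrMod 𝓑} {n : ℕ}
    (r : Fin n → (M ⟶ (regular 𝓑).shift (c - j))) (s : Fin n → ((regular 𝓑).shift (c - j) ⟶ M))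
    (h : ∑ t, r t ≫ s t = 𝟙 M) : IsLin c j M := by
  refine ⟨n, ⟨⟨∑ t, r t ≫ incl (fun _ => (regular 𝓑).shift (c - j)) t, desc _ s, ?_⟩⟩⟩
  rw [Preadditive.sum_comp, ← h]
  exact Finset.sum_congr rfl fun t _ => by rw [Category.assoc, incl_desc]

theorem GrMod.app_sum {ι : Type*} {M N : GrMod 𝓑} (s : Finset ι) (f : ι → (M ⟶ N)) (i : ℤ)
    (x : M.obj i) : app (∑ t ∈ s, f t) i x = ∑ t ∈ s, app (f t) i x := by
  classical
  induction s using Finset.induction_on with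
  | empty => rfl
  | insert a s ha ih => rw [Finset.sum_insert ha, Finset.sum_insert ha, ← ih]; rfl

/-- The identification of two equal degrees. -/
def GrMod.degCast {m n : ℤ} (h : m = n) : (regular 𝓑).obj m →ₗ[K] (regular 𝓑).obj n :=
  Submodule.inclusion (le_of_eq (congrArg 𝓑 h))

end LinearModules

section QuiverAlgebra

variable {K V : Type u} [Field K] [Fintype V] [Quiver.{u} V]
variable [∀ a b : V, Fintype (a ⟶ b)] {I : Ideal (PathAlg K V)} [I.IsTwoSided]

/-- The balanced average `a ⊗ x ↦ ∑_v φ(a e_v, e_v x)` of a bilinear map. -/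
def tavg {N : GrMod (grd (perp I))} {l j : ℤ} {X : Type u} [AddCommGroup X] [Module K X]
    (φ : (regular (grd I)).obj l →ₗ[K] N.obj j →ₗ[K] X) : Tens I N l j →ₗ[K] X :=
  tlift (∑ v : V, (φ.compl₂ (N.act 0 j j (zero_add j) (vtx (perp I) (op v)))).comp
      (rmul (grd I) (add_zero l) (vtx I v))) fun v a x => by
    have h0 := isComplete_vtx_op (perp I)
    simp only [LinearMap.sum_apply, LinearMap.comp_apply, LinearMap.compl₂_apply]
    rw [Finset.sum_eq_single v, Finset.sum_eq_single v, rmul_vtx_self, h0.act_self N j v x]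
    · intro w _ hw
      rw [h0.act_of_ne N j hw, map_zero]
    · simp
    · intro w _ hw
      rw [rmul_vtx_of_ne I hw.symm, map_zero, LinearMap.zero_apply]
    · simp

theorem tavg_tmk {N : GrMod (grd (perp I))} {l j : ℤ} {X : Type u} [AddCommGroup X] [Module K X]
    (φ : (regular (grd I)).obj l →ₗ[K] N.obj j →ₗ[K] X) (a : (regular (grd I)).obj l)
    (x : N.obj j) : tavg φ (tmk N l j a x) = ∑ v : V, φ (rmul (grd I) (add_zero l) (vtx I v) a)
      (N.act 0 j j (zero_add j) (vtx (perp I) (op v)) x) := by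
  simp only [tavg, tlift_tmk, LinearMap.sum_apply, LinearMap.comp_apply, LinearMap.compl₂_apply]

/-- The map `A_l ⊗_{A_0} N_j ⟶ A_l`, `a ⊗ x ↦ ∑_v ψ(e_v x) a e_v`, of a linear form `ψ`
on `N_j`. -/
def tcoordLin {N : GrMod (grd (perp I))} {j : ℤ} (ψ : N.obj j →ₗ[K] K) {l n : ℤ} (h : l = n) :
    Tens I N l j →ₗ[K] (regular (grd I)).obj n :=
  tavg ((LinearMap.lsmul K ((regular (grd I)).obj n)).flip.compl₂ ψ ∘ₗ degCast h)

theorem tcoordLin_tmk {N : GrMod (grd (perp I))} {j : ℤ} (ψ : N.obj j →ₗ[K] K) {l n : ℤ}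
    (h : l = n) (a : (regular (grd I)).obj l) (x : N.obj j) :
    tcoordLin ψ h (tmk N l j a x) =
      ∑ v : V, ψ (N.act 0 j j (zero_add j) (vtx (perp I) (op v)) x) •
        degCast h (rmul (grd I) (add_zero l) (vtx I v) a) :=
  tavg_tmk _ a x

theorem tcoordLin_tact {N : GrMod (grd (perp I))} {j : ℤ} (ψ : N.obj j →ₗ[K] K) {m l l' n n' : ℤ}
    (h : l = n) (h' : l' = n') (e : m + l = l') (e' : m + n = n') (a : grd I m) :
    tcoordLin ψ h' ∘ₗ tact N e j a = (regular (grd I)).act m n n' e' a ∘ₗ tcoordLin ψ h :=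
  tens_hom_ext fun b y => by
    subst h h'
    rw [LinearMap.comp_apply, LinearMap.comp_apply, tact_tmk, tcoordLin_tmk, tcoordLin_tmk, map_sum]
    refine Finset.sum_congr rfl fun v _ => ?_
    rw [← act_rmul (grd I) (add_zero l) e e (add_zero l'), map_smul]
    rfl

/-- The morphism `A ⊗_{A_0} N_j ⟶ A(j)`, `a ⊗ x ↦ ∑_v ψ(e_v x) a e_v`, of a linear form `ψ`
on `N_j`. -/
def tcoord {N : GrMod (grd (perp I))} {j : ℤ} (ψ : N.obj j →ₗ[K] K) :
    tensMod N j ⟶ (regular (grd I)).shift j :=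
  mkHom (M := tensMod N j) (N := (regular (grd I)).shift j)
    (fun q => tcoordLin ψ (add_comm q j))
    fun l q q' h a x => LinearMap.congr_fun (tcoordLin_tact ψ (add_comm q j) (add_comm q' j) _
      (show l + (j + q) = j + q' by omega) a) x

theorem app_tcoord {N : GrMod (grd (perp I))} {j : ℤ} (ψ : N.obj j →ₗ[K] K) (q : ℤ)
    (a : (regular (grd I)).obj (q + j)) (x : N.obj j) :
    app (tcoord ψ) q (tmk N (q + j) j a x) =
      ∑ v : V, ψ (N.act 0 j j (zero_add j) (vtx (perp I) (op v)) x) •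
        degCast (add_comm q j) (rmul (grd I) (add_zero (q + j)) (vtx I v) a) :=
  tcoordLin_tmk _ _ a x

/-- The morphism `A(j) ⟶ A ⊗_{A_0} N_j`, `a ↦ a ⊗ x`. -/
def tgen {N : GrMod (grd (perp I))} {j : ℤ} (x : N.obj j) :
    (regular (grd I)).shift j ⟶ tensMod N j :=
  mkHom (M := (regular (grd I)).shift j) (N := tensMod N j)
    (fun q => (tmk N (q + j) j).flip x ∘ₗ degCast (add_comm j q)) fun _ _ _ _ _ _ => rfl

/-- As `A_0` is semisimple, `A ⊗_{A_0} N_j` is a summand of a finite direct sum of copies of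
`A(j)`: with a basis `b_t` of `N_j`, the identity is the sum of the composites of `tcoord` of the
dual basis vectors with `tgen b_t`. -/
theorem isLin_tensMod {N : GrMod (grd (perp I))} {j : ℤ} [FiniteDimensional K (N.obj j)] :
    IsLin 0 (-j) (tensMod (I := I) N j) := by
  have e : (0 : ℤ) - -j = j := by ring
  let b := Module.finBasis K (N.obj j)
  have h : ∑ t, tcoord (b.coord t) ≫ tgen (b t) = 𝟙 (tensMod N j) := by
    refine tensMod_hom_ext fun q a x => (app_sum _ _ _ _).trans ?_
    have h1 : ∀ t, app (tcoord (b.coord t) ≫ tgen (b t)) q (tmk N (q + j) j a x) =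
        ∑ v : V, b.coord t (N.act 0 j j (zero_add j) (vtx (perp I) (op v)) x) •
          tmk N (q + j) j (rmul (grd I) (add_zero (q + j)) (vtx I v) a) (b t) := fun t => by
      refine (congrArg (app (tgen (b t)) q) (app_tcoord _ q a x)).trans ?_
      refine (map_sum (app (tgen (b t)) q) _ _).trans ?_
      exact Finset.sum_congr rfl fun v _ => map_smul (app (tgen (b t)) q) _ _
    refine (Finset.sum_congr rfl fun t _ => h1 t).trans (Finset.sum_comm.trans ?_)
    have h2 : ∀ v : V, ∑ t, b.coord t (N.act 0 j j (zero_add j) (vtx (perp I) (op v)) x) •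
          tmk N (q + j) j (rmul (grd I) (add_zero (q + j)) (vtx I v) a) (b t) =
        tmk N (q + j) j (rmul (grd I) (add_zero (q + j)) (vtx I v) a) x := fun v => by
      simp only [← map_smul]
      rw [← map_sum]
      refine (congrArg _ (b.sum_repr _)).trans ?_
      rw [← tmk_balanced, rmul_vtx_self]
    have h3 : ∑ v : V, tmk N (q + j) j (rmul (grd I) (add_zero (q + j)) (vtx I v) a) x =
        tmk N (q + j) j a x := by
      rw [← LinearMap.sum_apply, ← map_sum, sum_rmul_vtx]
    exact (Finset.sum_congr rfl fun v _ => h2 v).trans h3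
  -- The shift in `IsLin` is `0 - (-j)`, which is equal to `j` only propositionally.
  have key : ∀ m, m = j → ∀ (n : ℕ) (r : Fin n → (tensMod (I := I) N j ⟶ (regular (grd I)).shift j))
      (s : Fin n → ((regular (grd I)).shift j ⟶ tensMod N j)), ∑ t, r t ≫ s t = 𝟙 (tensMod N j) →
      ∃ (r : Fin n → (tensMod (I := I) N j ⟶ (regular (grd I)).shift m))
        (s : Fin n → ((regular (grd I)).shift m ⟶ tensMod N j)), ∑ t, r t ≫ s t = 𝟙 _ := by
    rintro m rfl n r s h
    exact ⟨r, s, h⟩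
  obtain ⟨r, s, h⟩ := key _ e _ _ _ h
  exact isLin_of_sum r s h

/-- The morphism `Y ⟶ Hom_{A_0}(A^!, M_j)`, `y ↦ (b ↦ φ(b y))`, of an `A_0`-linear map
`φ : Y_{-j} ⟶ M_j`. -/
def coind {Y : GrMod (grd (perp I))} {M : GrMod (grd I)} {j : ℤ}
    (φ : Y.obj (-j) →ₗ[K] M.obj j)
    (hφ : ∀ (v : V) y, φ (Y.act 0 (-j) (-j) (zero_add _) (vtx (perp I) (op v)) y) =
      M.act 0 j j (zero_add j) (vtx I v) (φ y)) : Y ⟶ homMod M j :=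
  mkHom (M := Y) (N := homMod M j)
    (fun q =>
      { toFun := fun y => (⟨φ ∘ₗ (Y.act (-q - j) q (-j) (by ring)).flip y, fun v b =>
          (congrArg φ (act_act Y (show -q - j + q = -j by ring) (zero_add (-j))
            (zero_add (-q - j)) _ _ _ _ rfl y).symm).trans (hφ v _)⟩ : HomA0 I M (-q - j) j)
        map_add' := fun y y' => homA0_ext fun b =>
          (congrArg φ (map_add (Y.act (-q - j) q (-j) (by ring) b) y y')).trans (map_add φ _ _)
        map_smul' := fun c y => homA0_ext fun b =>
          (congrArg φ (map_smul (Y.act (-q - j) q (-j) (by ring) b) c y)).trans (map_smul φ _ _) })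
    fun l q q' h a y => homA0_ext fun b =>
      congrArg φ (act_act Y h (show -q' - j + q' = -j by ring) (show -q' - j + l = -q - j by omega)
        (by ring) b a (rmul (grd (perp I)) (by omega) a b) rfl y)

/-- The unit, in the degree in which elements of `Hom_{A_0}(A^!, M_j)_{-j}` can be evaluated
at it. -/
def unitElt (I' : Ideal (PathAlg K Vᵒᵖ)) [I'.IsTwoSided] {n : ℤ} (h : n = 0) :
    (regular (grd I')).obj n := ⟨1, h ▸ SetLike.GradedOne.one_mem⟩

/-- The functor `Hom_{A_0}(A^!, -)` is right adjoint to the restriction to `A_0`, over which every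
module is injective. -/
theorem injective_homMod (M : GrMod (grd I)) (j : ℤ) : Injective (homMod M j) where
  factors {X Y} g f hf := by
    have e0 : -(-j) - j = 0 := by ring
    -- The `A_0`-linear map that corresponds to `g` under the adjunction.
    let φ : X.obj (-j) →ₗ[K] M.obj j :=
      { toFun := fun x => hval (app g (-j) x) (unitElt (perp I) e0)
        map_add' := fun x y => by rw [map_add]; rfl
        map_smul' := fun c x => by rw [map_smul]; rfl }
    have hφ : ∀ (q : ℤ) (x : X.obj q) b, hval (app g q x) b =
        φ (X.act (-q - j) q (-j) (by ring) b x) := fun q x b => by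
      refine Eq.trans ?_ (congrArg (fun z => hval z (unitElt (perp I) e0))
        (app_act g (-q - j) q (-j) (by ring) b x)).symm
      exact congrArg (hval (app g q x)) (Subtype.ext (one_mul _).symm)
    have hφ0 : ∀ (v : V) (x : X.obj (-j)),
        φ (X.act 0 (-j) (-j) (zero_add _) (vtx (perp I) (op v)) x) =
          M.act 0 j j (zero_add j) (vtx I v) (φ x) := fun v x => by
      have h1 := (show HomA0 I M (-(-j) - j) j from app g (-j) x).2 v (unitElt (perp I) e0)
      refine Eq.trans ?_ h1
      refine (congrArg (fun z => hval z (unitElt (perp I) e0))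
        (app_act g 0 (-j) (-j) (zero_add _) (vtx (perp I) (op v)) x)).trans ?_
      exact congrArg (hval (app g (-j) x)) (Subtype.ext ((one_mul _).trans (mul_one _).symm))
    -- Extend `φ` along `f` by a linear retraction of `f`, made `A_0`-linear by averaging.
    obtain ⟨r, hr⟩ := (app f (-j)).exists_leftInverse_of_injective
      (LinearMap.ker_eq_bot.2 (injective_of_mono f (-j)))
    let φ' : Y.obj (-j) →ₗ[K] M.obj j := ∑ v : V, M.act 0 j j (zero_add j) (vtx I v) ∘ₗ (φ ∘ₗ r) ∘ₗ
      Y.act 0 (-j) (-j) (zero_add _) (vtx (perp I) (op v))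
    have h1 := isComplete_vtx I
    have h2 := isComplete_vtx_op (perp I)
    have hφ' : ∀ (v : V) y, φ' (Y.act 0 (-j) (-j) (zero_add _) (vtx (perp I) (op v)) y) =
        M.act 0 j j (zero_add j) (vtx I v) (φ' y) := fun v y => by
      simp only [φ', LinearMap.sum_apply, LinearMap.comp_apply, map_sum]
      rw [Finset.sum_eq_single v, Finset.sum_eq_single v, h2.act_self Y, h1.act_self M]
      · intro w _ hw
        rw [h1.act_of_ne M j hw.symm]
      · simp
      · intro w _ hw
        rw [h2.act_of_ne Y _ hw]
        simp only [map_zero]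
      · simp
    have hφf : ∀ x, φ' (app f (-j) x) = φ x := fun x => by
      simp only [φ', LinearMap.sum_apply, LinearMap.comp_apply]
      have h3 : ∀ v : V, M.act 0 j j (zero_add j) (vtx I v) (φ (r (Y.act 0 (-j) (-j) (zero_add _)
          (vtx (perp I) (op v)) (app f (-j) x)))) = M.act 0 j j (zero_add j) (vtx I v) (φ x) :=
        fun v => by
          rw [← app_act]
          refine (congrArg (fun z => M.act 0 j j (zero_add j) (vtx I v) (φ z))
            (LinearMap.congr_fun hr _)).trans ?_
          rw [LinearMap.id_apply, hφ0, h1.act_self M]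
      rw [Finset.sum_congr rfl fun v _ => h3 v, h1.sum_act M]
    refine ⟨coind φ' hφ', hom_ext fun q x => hval_ext fun b => ?_⟩
    refine Eq.trans ?_ (hφ q x b).symm
    refine Eq.trans ?_ (hφf _)
    exact congrArg φ' (app_act f _ _ _ _ b x).symm

end QuiverAlgebra

end KoszulDuality

end

noncomputable section

namespace KoszulDuality

open GrMod

section QuiverAlgebra

variable {K V : Type u} [Field K] [Fintype V] [Quiver.{u} V]

/-! ### The Koszul complex near the diagonal -/

section
variable {I : Ideal (PathAlg K V)} [I.IsTwoSided]

theorem vtx_act_arr {I' : Ideal (PathAlg K V)} [I'.IsTwoSided] (N : GrMod (grd I'))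
    {a b : V} (α : a ⟶ b) {j j' : ℤ} (h : 1 + j = j') (x : N.obj j) :
    N.act 0 j' j' (zero_add j') (vtx I' a) (N.act 1 j j' h (arr I' α) x) =
      N.act 1 j j' h (arr I' α) x :=
  act_act N h (zero_add j') (zero_add 1) h _ _ _ (mk_vtx_mul_arr α).symm x

theorem vtx_act_arr_of_ne {I' : Ideal (PathAlg K V)} [I'.IsTwoSided] (N : GrMod (grd I'))
    {a b v : V} (hv : v ≠ a) (α : a ⟶ b) {j j' : ℤ} (h : 1 + j = j') (x : N.obj j) :
    N.act 0 j' j' (zero_add j') (vtx I' v) (N.act 1 j j' h (arr I' α) x) = 0 := by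
  rw [act_act N h (zero_add j') (zero_add 1) h _ _ 0 (mk_vtx_mul_arr_of_ne hv α).symm x, map_zero,
    LinearMap.zero_apply]

theorem filter_mem_pathDeg (x : PathAlg K V) (n : ℕ) :
    (show PathAlg K V from Finsupp.filter (fun p => p.2.2.length = n) x) ∈ pathDeg K V n := by
  classical
  refine Finsupp.induction_linear (motive := fun x => (show PathAlg K V from
    Finsupp.filter (fun p => p.2.2.length = n) x) ∈ pathDeg K V n) x ?_ ?_ ?_
  · rw [Finsupp.filter_zero]
    exact Submodule.zero_mem _
  · intro f g hf hg
    rw [Finsupp.filter_add]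
    exact Submodule.add_mem _ hf hg
  · intro p c
    by_cases hp : p.2.2.length = n
    · rw [Finsupp.filter_single_of_pos (fun p : Σ a b : V, Quiver.Path a b => p.2.2.length = n) hp,
        ← mul_one c, ← smul_eq_mul, ← Finsupp.smul_single]
      exact Submodule.smul_mem _ c (Submodule.subset_span ⟨p, by exact_mod_cast hp, rfl⟩)
    · rw [Finsupp.filter_single_of_neg (fun p : Σ a b : V, Quiver.Path a b => p.2.2.length = n) hp]
      exact Submodule.zero_mem _

end

variable [∀ a b : V, Fintype (a ⟶ b)] {I : Ideal (PathAlg K V)} [I.IsTwoSided]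

/-- The map `A_l ⊗_{A_0} N_j ⟶ N_j`, `a ⊗ x ↦ ∑_v ρ(a e_v) e_v x`, of a linear form `ρ` on
`A_l`. -/
def tcoef {N : GrMod (grd (perp I))} {l j : ℤ} (ρ : (regular (grd I)).obj l →ₗ[K] K) :
    Tens I N l j →ₗ[K] N.obj j :=
  tavg (LinearMap.lsmul K (N.obj j) ∘ₗ ρ)

theorem tcoef_tmk {N : GrMod (grd (perp I))} {l j : ℤ} (ρ : (regular (grd I)).obj l →ₗ[K] K)
    (v : V) (a : (regular (grd I)).obj l) (ha : rmul (grd I) (add_zero l) (vtx I v) a = a)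
    (x : N.obj j) : tcoef ρ (tmk N l j a x) =
      ρ a • N.act 0 j j (zero_add j) (vtx (perp I) (op v)) x := by
  rw [tcoef, tavg_tmk, Finset.sum_eq_single v]
  · rw [ha]
    rfl
  · intro w _ hw
    rw [← ha, rmul_vtx_of_ne I hw.symm, map_zero, LinearMap.zero_apply]
  · simp

/-- The unit in degree `0`. -/
def oneElt (I : Ideal (PathAlg K V)) [I.IsTwoSided] : (regular (grd I)).obj 0 :=
  ⟨1, SetLike.GradedOne.one_mem⟩

theorem tens_eq_top {N : GrMod (grd (perp I))} {l j : ℤ} (S : Submodule K (Tens I N l j))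
    (h : ∀ p (hp : (p.2.2.length : ℤ) = l) x, tmk N l j (pathElt I p hp) x ∈ S) : S = ⊤ := by
  refine top_unique fun t _ => ?_
  suffices h : S.mkQ = 0 by
    rw [← Submodule.Quotient.mk_eq_zero]
    exact LinearMap.congr_fun h t
  refine tens_hom_ext fun a x => (Submodule.Quotient.mk_eq_zero _).2 ?_
  have h1 := eq_top_of_pathElt_mem I (n := l) (S.comap ((tmk N l j).flip x)) fun p hp => h p hp x
  have h2 : a ∈ S.comap ((tmk N l j).flip x) := h1 ▸ Submodule.mem_top (x := a)
  exact h2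

/-- The canonical map `N_j ⟶ A_0 ⊗_{A_0} N_j` is surjective. -/
theorem exists_eq_tmk_one (N : GrMod (grd (perp I))) {j : ℤ} (t : Tens I N 0 j) :
    ∃ y, tmk N 0 j (oneElt I) y = t := by
  have h := tens_eq_top (LinearMap.range (tmk N 0 j (oneElt I))) fun ⟨a, b, p⟩ hp x => by
    match p, hp with
    | .nil, _ =>
      refine ⟨_, (tmk_balanced N 0 j a (oneElt I) x).symm.trans ?_⟩
      exact congrArg (fun z => tmk N 0 j z x) (Subtype.ext (one_mul _))
    | .cons p α, hp =>
      simp only [Quiver.Path.length_cons] at hp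
      omega
  exact (h ▸ Submodule.mem_top : t ∈ LinearMap.range _)

/-- Every element of `A_1 ⊗_{A_0} N_j` has the form `∑_α α ⊗ x_α`, and the `x_α` can be chosen in
the parts `e_v N_j` that belong to the targets of the arrows. -/
theorem exists_eq_sum_tmk_arr (N : GrMod (grd (perp I))) {j : ℤ} (t : Tens I N 1 j) :
    ∃ g : Arrows V → N.obj j,
      (∀ α, N.act 0 j j (zero_add j) (vtx (perp I) (op α.2.1)) (g α) = g α) ∧
      t = ∑ α : Arrows V, tmk N 1 j (arr I α.2.2) (g α) := by
  classical
  let f : (Arrows V → N.obj j) →ₗ[K] Tens I N 1 j :=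
    ∑ α : Arrows V, tmk N 1 j (arr I α.2.2) ∘ₗ LinearMap.proj α
  have hf : ∀ g, f g = ∑ α : Arrows V, tmk N 1 j (arr I α.2.2) (g α) := fun g => by
    simp only [f, LinearMap.sum_apply, LinearMap.comp_apply, LinearMap.proj_apply]
  have h := tens_eq_top (LinearMap.range f) fun ⟨a, b, p⟩ hp x => by
    match p, hp with
    | .cons .nil α, _ =>
      refine ⟨Pi.single ⟨_, _, α⟩ x, (hf _).trans
        ((Finset.sum_eq_single ⟨_, _, α⟩ ?_ (by simp)).trans ?_)⟩
      · intro β _ hβ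
        rw [Pi.single_eq_of_ne hβ, map_zero]
      · rw [Pi.single_eq_same]
        rfl
  obtain ⟨g, hg⟩ := (h ▸ Submodule.mem_top : t ∈ LinearMap.range f)
  refine ⟨fun α => N.act 0 j j (zero_add j) (vtx (perp I) (op α.2.1)) (g α), fun α =>
    (isComplete_vtx_op (perp I)).act_self N j _ _, hg.symm.trans ((hf g).trans ?_)⟩
  refine Finset.sum_congr rfl fun α _ => ?_
  refine Eq.trans ?_ (tmk_balanced N 1 j _ _ _)
  exact congrArg (fun z => tmk N 1 j z (g α)) (Subtype.ext (mk_arr_mul_vtx α.2.2).symm)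

theorem td_one (N : GrMod (grd (perp I))) {j j' : ℤ} (h : 1 + j = j') (y : N.obj j) :
    td N (zero_add 1) h (tmk N 0 j (oneElt I) y) =
      ∑ α : Arrows V, tmk N 1 j' (arr I α.2.2) (N.act 1 j j' h (arr (perp I) α.2.2.op) y) := by
  rw [td_tmk]
  exact Finset.sum_congr rfl fun α _ =>
    congrArg (fun z => tmk N 1 j' z _) (Subtype.ext (one_mul _))

/-- The coefficient of an arrow in an element of `A_1 ⊗_{A_0} N_j`. -/
theorem exists_tcoef_arr (hI : IsQuiverRelations I) (N : GrMod (grd (perp I))) {j : ℤ}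
    (α : Arrows V) : ∃ ρ : (regular (grd I)).obj 1 →ₗ[K] K, ∀ g : Arrows V → N.obj j,
      tcoef ρ (∑ β : Arrows V, tmk N 1 j (arr I β.2.2) (g β)) =
        N.act 0 j j (zero_add j) (vtx (perp I) (op α.2.1)) (g α) := by
  obtain ⟨ρ, h1, h2⟩ := exists_arr_coeff hI.le_sq α
  refine ⟨ρ, fun g => ?_⟩
  rw [map_sum]
  have h3 : ∀ β : Arrows V, tcoef ρ (tmk N 1 j (arr I β.2.2) (g β)) =
      ρ (arr I β.2.2) • N.act 0 j j (zero_add j) (vtx (perp I) (op β.2.1)) (g β) := fun β =>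
    tcoef_tmk ρ β.2.1 _ (Subtype.ext (mk_arr_mul_vtx β.2.2)) _
  rw [Finset.sum_congr rfl fun β _ => h3 β, Finset.sum_eq_single α]
  · rw [h1, one_smul]
  · intro β _ hβ
    rw [h2 β hβ, zero_smul]
  · simp

/-- The arrows are a basis of `A_1`, so the vanishing of `∑_α α ⊗ α^op y` makes every `α^op y`
vanish. -/
theorem act_arr_eq_zero_of_td_eq_zero (hI : IsQuiverRelations I) (N : GrMod (grd (perp I)))
    {j j' : ℤ} (h : 1 + j = j') (y : N.obj j)
    (hy : td N (zero_add 1) h (tmk N 0 j (oneElt I) y) = 0) (α : Arrows V) :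
    N.act 1 j j' h (arr (perp I) α.2.2.op) y = 0 := by
  obtain ⟨ρ, hρ⟩ := exists_tcoef_arr (j := j') hI N α
  have h1 := hρ fun β => N.act 1 j j' h (arr (perp I) β.2.2.op) y
  rw [← td_one, hy, map_zero] at h1
  exact (vtx_act_arr N α.2.2.op h y).symm.trans h1.symm

/-- Evaluation at an element of `A^!` is linear. -/
def hvalLin {M : GrMod (grd I)} {j q : ℤ} (x : (regular (grd (perp I))).obj (-q - j)) :
    (homMod M j).obj q →ₗ[K] M.obj j where
  toFun f := hval f x
  map_add' _ _ := rfl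
  map_smul' _ _ := rfl

/-- The first differential of the Koszul complex of `M` is injective on the diagonal: an element of
`Hom_{A_0}(A^!, M_0)` of degree `k < 0` killed by all arrows is zero, since `A^!` is generated in
degree `1`. -/
theorem tmk_one_eq_zero (hI : IsQuiverRelations I) (M : GrMod (grd I)) {k k' : ℤ}
    (h : 1 + k = k') (hk : k < 0) (t : Tens I (homMod M 0) 0 k)
    (ht : td (homMod M 0) (zero_add 1) h t = 0) : t = 0 := by
  obtain ⟨y, rfl⟩ := exists_eq_tmk_one _ t
  suffices hy : y = 0 by rw [hy, map_zero]
  have h1 := act_arr_eq_zero_of_td_eq_zero hI _ h y ht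
  have h2 := eq_top_of_rmul_arr_mem (perp I) (n := -k' - 0) (m := -k - 0) (by omega) (by omega)
    (LinearMap.ker (show HomA0 I M (-k - 0) 0 from y).1) fun α x =>
      congrArg (fun z => hval z x) (h1 ⟨_, _, α.2.2.unop⟩)
  exact hval_ext fun x => (h2 ▸ Submodule.mem_top (x := x) : _ ∈ LinearMap.ker _)

variable (I) in
/-- The path `α β` as an element of the regular module. -/
def pairReg (t : ArrowPairs V) : (regular (grd I)).obj 2 := pairElt I t

open Classical in
/-- The linear form on `A_2` of an orthogonal relation, restricted to the paths that start
at `s`. -/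
theorem exists_form_of_orthogonal (hI : IsQuiverRelations I) (w : ArrowPairs V → K)
    (hw : ∀ x ∈ I, x ∈ pathDeg K V 2 → ∑ t, coeff x t.toPath * w t = 0) (s : V) :
    ∃ ρ : (regular (grd I)).obj 2 →ₗ[K] K, ∀ t, ρ (pairReg I t) = if t.1 = s then w t else 0 := by
  obtain ⟨r, hr⟩ := exists_desc_quotient I (X := K)
    { toFun := fun x => ∑ t : ArrowPairs V, coeff x t.toPath * w t
      map_add' := fun x y => by simp only [coeff_add, add_mul, Finset.sum_add_distrib]
      map_smul' := fun c x => by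
        simp only [coeff_smul, mul_assoc, ← Finset.mul_sum, RingHom.id_apply, smul_eq_mul] }
    fun x hx => by
      have h1 := hI.homogeneous x hx 2
      refine Eq.trans ?_ (hw _ h1 ?_)
      · refine Finset.sum_congr rfl fun t _ => congrArg (· * w t) ?_
        exact (Finsupp.filter_apply_pos (fun p : Σ a b : V, Quiver.Path a b =>
          p.2.2.length = 2) x rfl).symm
      · exact filter_mem_pathDeg x 2
  have hr' : ∀ t, r (pairElt I t).1 = w t := fun t => by
    refine (hr (path K t.toPath)).trans ?_
    refine (Finset.sum_eq_single t ?_ (by simp)).trans ?_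
    · intro t' _ ht'
      rw [coeff_path, if_neg fun e => ht' (ArrowPairs.toPath_injective e).symm, zero_mul]
    · rw [coeff_path, if_pos rfl, one_mul]
  refine ⟨r ∘ₗ (grd I 2).subtype ∘ₗ (regular (grd I)).act 0 2 2 (zero_add 2) (vtx I s),
    fun t => ?_⟩
  obtain ⟨a, b, c, α, β⟩ := t
  split_ifs with ht
  · refine Eq.trans (congrArg r ?_) (hr' ⟨a, b, c, α, β⟩)
    subst ht
    refine (congrArg (((vtx I a : grd I 0) : PathAlg K V ⧸ I) * ·)
      (pairElt_coe I ⟨a, b, c, α, β⟩)).trans ((mul_assoc _ _ _).symm.trans ?_)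
    rw [pairElt_coe]
    exact congrArg (· * _) (mk_vtx_mul_arr α)
  · refine Eq.trans (congrArg r ?_) (map_zero r)
    refine (congrArg (((vtx I s : grd I 0) : PathAlg K V ⧸ I) * ·)
      (pairElt_coe I ⟨a, b, c, α, β⟩)).trans ((mul_assoc _ _ _).symm.trans ?_)
    exact (congrArg (· * _) (mk_vtx_mul_arr_of_ne (fun e => ht e.symm) α)).trans (zero_mul _)

open Classical in
/-- The Koszul complex of `M` is exact next to the diagonal, since `A^!` is quadratic with the
relations orthogonal to those of `A`. -/
theorem exists_td_tmk_one_eq (hI : IsQuiverRelations I) (M : GrMod (grd I)) {k k' k'' : ℤ}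
    (h : 1 + k = k') (h' : 1 + k' = k'') (hk : k' ≤ 0) (t : Tens I (homMod M 0) 1 k')
    (ht : td (homMod M 0) (show (1 : ℤ) + 1 = 2 by norm_num) h' t = 0) :
    ∃ y, td (homMod M 0) (zero_add 1) h (tmk (homMod M 0) 0 k (oneElt I) y) = t := by
  obtain ⟨g, hg, rfl⟩ := exists_eq_sum_tmk_arr _ t
  have e : (-k' - 0) + 1 = -k - 0 := by omega
  -- The coefficients `g α` are the values on the products `y α^op` of the map `f` to be found.
  -- That they respect the quadratic relations is what the cocycle condition says, after applying
  -- the forms on `A_2` given by the relations.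
  obtain ⟨f, hf⟩ := exists_of_quadratic (I := I) (X := M.obj 0) e
    (fun α => (show HomA0 I M (-k' - 0) 0 from g α).1)
    (fun α y => congrArg (fun z => hval z y) (hg α)) fun w hw s i hi u => by
      obtain ⟨ρ, hρ⟩ := exists_form_of_orthogonal hI w hw s
      obtain rfl : i = -k'' - 0 := by omega
      have h1 : ∑ t : ArrowPairs V, tmk (homMod M 0) 2 k'' (pairReg I t)
          ((homMod M 0).act 1 k' k'' h' (arr (perp I) t.2.2.2.2.op)
            (g ⟨t.1, t.2.1, t.2.2.2.1⟩)) = 0 := by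
        refine Eq.trans ?_ ((map_sum (td (homMod M 0) _ h') _ _).symm.trans ht)
        refine Eq.trans ?_ (Finset.sum_congr rfl fun α _ => (td_tmk _ _ _ _ _).symm)
        refine Eq.trans ?_ (sum_arrows_arrows _ ?_).symm
        · refine Finset.sum_congr rfl fun t _ => congrArg (fun z => tmk _ 2 k'' z _) ?_
          exact Subtype.ext (pairElt_coe I t)
        · rintro ⟨a, b, α⟩ ⟨b', c, β⟩ hne
          have h0 : rmul (grd I) (show (1 : ℤ) + 1 = 2 by norm_num) (arr I β) (arr I α) = 0 :=
            Subtype.ext (mk_arr_mul_arr_of_ne hne α β)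
          refine (congrArg (fun z => tmk (homMod M 0) 2 k'' z _) h0).trans ?_
          rw [map_zero, LinearMap.zero_apply]
      have h2 : ∀ t : ArrowPairs V, tcoef ρ (tmk (homMod M 0) 2 k'' (pairReg I t)
          ((homMod M 0).act 1 k' k'' h' (arr (perp I) t.2.2.2.2.op)
            (g ⟨t.1, t.2.1, t.2.2.2.1⟩))) = (if t.1 = s then w t else 0) •
          (homMod M 0).act 1 k' k'' h' (arr (perp I) t.2.2.2.2.op)
            (g ⟨t.1, t.2.1, t.2.2.2.1⟩) := fun t => by
        rw [tcoef_tmk ρ t.2.2.1, hρ, vtx_act_arr]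
        refine Subtype.ext ?_
        refine (congrArg (· * _) (pairElt_coe I t)).trans ((mul_assoc _ _ _).trans ?_)
        exact (congrArg (_ * ·) (mk_arr_mul_vtx t.2.2.2.2)).trans (pairElt_coe I t).symm
      have h3 := congrArg (tcoef ρ) h1
      rw [map_sum, map_zero, Finset.sum_congr rfl fun t _ => h2 t] at h3
      have h4 := congrArg (hvalLin u) h3
      rw [map_sum, map_zero] at h4
      refine Eq.trans (Finset.sum_congr rfl fun t _ => ?_) h4
      rw [map_smul]
      rfl
  -- The map `f` is `A_0`-linear, as this holds on the generators `y α^op`.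
  have hlin : ∀ (v : V) (x : (regular (grd (perp I))).obj (-k - 0)),
      f ((regular (grd (perp I))).act 0 _ _ (zero_add (-k - 0)) (vtx (perp I) (op v)) x) =
        M.act 0 0 0 (zero_add 0) (vtx I v) (f x) := fun v x => by
    let S : Submodule K (grd (perp I) (-k - 0)) := LinearMap.eqLocus
      (f ∘ₗ (regular (grd (perp I))).act 0 _ _ (zero_add (-k - 0)) (vtx (perp I) (op v)))
      (M.act 0 0 0 (zero_add 0) (vtx I v) ∘ₗ f)
    have hS : S = ⊤ := eq_top_of_rmul_arr_mem (perp I) e (by omega) S fun α y => by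
      have e1 := act_rmul (grd (perp I)) e (zero_add (-k - 0)) (zero_add (-k' - 0)) e
        (vtx (perp I) (op v)) y (arr (perp I) α.2.2)
      refine (congrArg f e1).trans ((hf ⟨_, _, α.2.2.unop⟩ _).trans ?_)
      refine Eq.trans ?_
        (congrArg (M.act 0 0 0 (zero_add 0) (vtx I v)) (hf ⟨_, _, α.2.2.unop⟩ y).symm)
      exact (show HomA0 I M (-k' - 0) 0 from g ⟨_, _, α.2.2.unop⟩).2 v y
    exact Submodule.eq_top_iff'.1 hS x
  refine ⟨(⟨f, hlin⟩ : HomA0 I M (-k - 0) 0), (td_one (homMod M 0) h _).trans ?_⟩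
  exact Finset.sum_congr rfl fun α _ => congrArg _ (hval_ext fun x => hf α x)

end QuiverAlgebra

end KoszulDuality

end

noncomputable section

namespace KoszulDuality

namespace GrMod

section DegZero

variable {K : Type u} [Field K] {B : Type u} [Ring B] [Algebra K B] {𝓑 : ℤ → Submodule K B}
  [NonnegGraded 𝓑]

/-! ### Morphisms to shifts of `A_0` -/

/-- The module `A_0` is concentrated in degree `0`. -/
theorem degZero_eq_zero {n : ℤ} (hn : n ≠ 0) (x : (degZero 𝓑).obj n) : x = 0 := by
  induction x using Submodule.Quotient.induction_on with
  | H x =>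
  refine (Submodule.Quotient.mk_eq_zero _).2 ?_
  rcases lt_or_gt_of_ne hn with hn | hn
  · have hx : x = 0 := Subtype.ext ((Submodule.mem_bot K).1
      (NonnegGraded.eq_bot (𝓑 := 𝓑) n hn ▸ (show 𝓑 n from x).2))
    rw [hx]
    exact Submodule.zero_mem _
  · exact Submodule.subset_span ⟨n, 0, add_zero n, x, (⟨1, SetLike.GradedOne.one_mem⟩ : 𝓑 0), hn,
      Subtype.ext (mul_one _).symm⟩

/-- The radical of `B` starts in degree `1`. -/
theorem rad_regular_zero {x : (regular 𝓑).obj 0} (hx : x ∈ (rad (regular 𝓑)).carrier 0) :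
    x = 0 :=
  rad_eq_zero (m := 0) (fun j hj y => Subtype.ext ((Submodule.mem_bot K).1
    (NonnegGraded.eq_bot (𝓑 := 𝓑) j hj ▸ (show 𝓑 j from y).2))) le_rfl hx

/-- A morphism from a module generated in one degree to a shift of `A_0` concentrated in another
degree is zero. -/
theorem IsLin.hom_degZero_eq_zero {j k : ℤ} {M : GrMod 𝓑} (h : IsLin 0 j M) (hk : j < k)
    (f : M ⟶ (degZero 𝓑).shift (-k)) : f = 0 :=
  hom_ext fun i x => by
    by_cases hi : i = k
    · refine rad_eq_zero (M := (degZero 𝓑).shift (-k)) (m := k)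
        (fun i hi => degZero_eq_zero (by omega)) hi.le (app_mem_rad f (h.mem_rad (by omega) x))
    · exact degZero_eq_zero (n := -k + i) (by omega) _

theorem finiteDimensional_hom {M N : GrMod 𝓑} (hM : IsFG M)
    (hN : ∀ i, FiniteDimensional K (N.obj i)) : FiniteDimensional K (M ⟶ N) := by
  obtain ⟨n, deg, g, hg⟩ := hM
  let F : (M ⟶ N) →ₗ[K] ∀ t, N.obj (deg t) :=
    { toFun := fun f t => app f (deg t) (g t)
      map_add' := fun _ _ => rfl
      map_smul' := fun _ _ => rfl }
  refine Module.Finite.of_injective F ((injective_iff_map_eq_zero F).2 fun f hf => ?_)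
  refine hom_ext fun j x => ?_
  have hx : x ∈ Submodule.span K _ := (hg j).symm ▸ Submodule.mem_top
  refine (Submodule.span_le (p := LinearMap.ker (app f j)).2 ?_ hx :)
  rintro _ ⟨t, l, h, a, rfl⟩
  change app f j _ = 0
  rw [app_act, show app f (deg t) (g t) = 0 from congrFun hf t, map_zero]

/-- If `β^{i,j}(P) = 0`, then every cocycle `P^i ⟶ A_0(-j)` is a coboundary. -/
theorem exists_d_comp_eq_of_betti_eq_zero (hB : ∀ l, FiniteDimensional K (𝓑 l))
    {P : CochainComplex (GrMod 𝓑) ℤ} {i j : ℤ} (hP : IsFG (P.X i)) (h : betti P i j = 0)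
    (θ : P.X i ⟶ (degZero 𝓑).shift (-j)) (hθ : P.d (i - 1) i ≫ θ = 0) :
    ∃ η, P.d i (i + 1) ≫ η = θ := by
  have hN : ∀ n, FiniteDimensional K (((degZero 𝓑).shift (-j)).obj n) := fun n => by
    have h1 : FiniteDimensional K ((regular 𝓑).obj (-j + n)) := hB _
    exact Module.Finite.quotient K _
  have h0 : FiniteDimensional K (P.X i ⟶ (degZero 𝓑).shift (-j)) := finiteDimensional_hom hP hN
  have h1 : Module.Finite K (ExtSpace P (degZero 𝓑) i (-j)) := Module.Finite.quotient K _
  have h2 : Subsingleton (ExtSpace P (degZero 𝓑) i (-j)) := Module.finrank_zero_iff.1 h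
  have h3 := (Submodule.Quotient.mk_eq_zero _).1 (h2.elim (Submodule.Quotient.mk ⟨θ, hθ⟩) 0)
  exact h3

theorem prod_hom_ext {M N L : GrMod 𝓑} {f g : prodMod M N ⟶ L}
    (h1 : pinl M N ≫ f = pinl M N ≫ g) (h2 : pinr M N ≫ f = pinr M N ≫ g) : f = g := by
  rw [← Category.id_comp f, ← Category.id_comp g, ← prod_total, Preadditive.add_comp,
    Preadditive.add_comp]
  simp only [Category.assoc, h1, h2]

end DegZero

end GrMod

open GrMod

section QuiverAlgebra

variable {K V : Type u} [Field K] [Fintype V] [Quiver.{u} V] {I : Ideal (PathAlg K V)}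
  [I.IsTwoSided]

variable (I) in
/-- The class of the idempotent `e_v` in `A_0`. -/
def topVtx (v : V) {n : ℤ} (h : n = 0) : (degZero (grd I)).obj n :=
  Submodule.Quotient.mk (⟨(vtx I v : PathAlg K V ⧸ I), h ▸ (vtx I v).2⟩ : grd I n)

theorem act_topVtx_self (v : V) {n : ℤ} (h : n = 0) :
    (degZero (grd I)).act 0 n n (zero_add n) (vtx I v) (topVtx I v h) = topVtx I v h :=
  congrArg (Submodule.Quotient.mk (p := (rad (regular (grd I))).carrier n))
    (Subtype.ext ((isComplete_vtx I).mul_self v))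

theorem act_topVtx_of_ne {v w : V} (hw : w ≠ v) {n : ℤ} (h : n = 0) :
    (degZero (grd I)).act 0 n n (zero_add n) (vtx I w) (topVtx I v h) = 0 :=
  (Submodule.Quotient.mk_eq_zero _).2 (by
    have h0 : (regular (grd I)).act 0 n n (zero_add n) (vtx I w)
        (⟨(vtx I v : PathAlg K V ⧸ I), h ▸ (vtx I v).2⟩ : grd I n) = 0 :=
      Subtype.ext ((isComplete_vtx I).mul_of_ne w v hw)
    rw [h0]
    exact Submodule.zero_mem _)

/-- The classes of the idempotents are linearly independent in `A_0`. -/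
theorem eq_zero_of_sum_smul_topVtx (hI : IsQuiverRelations I) {n : ℤ} (h : n = 0) (c : V → K)
    (hc : ∑ v, c v • topVtx I v h = 0) (v : V) : c v = 0 := by
  subst h
  obtain ⟨f, h1, h2⟩ := exists_vtx_coeff hI.le_sq v
  let e : V → (regular (grd I)).obj 0 := fun w => vtx I w
  have h3 : ((rad (regular (grd I))).carrier 0).mkQ (∑ v, c v • e v) = 0 := by
    rw [map_sum]
    exact hc
  have h4 := congrArg f (rad_regular_zero ((Submodule.Quotient.mk_eq_zero _).1 h3))
  rw [map_sum, map_zero, Finset.sum_eq_single v] at h4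
  · rw [map_smul, show f (e v) = 1 from h1] at h4
    simpa using h4
  · intro w _ hw
    rw [map_smul, show f (e w) = 0 from h2 w hw, smul_zero]
  · simp

/-- A linear form on `M_k` that vanishes on the elements `a x` with `a` of positive degree gives a
morphism `M ⟶ A_0(-k)`, `x ↦ ∑_v μ(e_v x) e_v`. -/
theorem exists_hom_degZero (hI : IsQuiverRelations I) (M : GrMod (grd I)) {k : ℤ}
    (μ : M.obj k →ₗ[K] K) (hμ : ∀ (l i : ℤ) (h : l + i = k) (a : grd I l) (x : M.obj i), 1 ≤ l →
      μ (M.act l i k h a x) = 0) :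
    ∃ Θ : M ⟶ (degZero (grd I)).shift (-k), (∀ x : M.obj k, app Θ k x = 0 → μ x = 0) ∧
      ∀ {N : GrMod (grd I)} (f : N ⟶ M), (∀ x : N.obj k, μ (app f k x) = 0) → f ≫ Θ = 0 := by
  let θ : ∀ i, M.obj i →ₗ[K] (degZero (grd I)).obj (-k + i) := fun i =>
    if h : i = k then ∑ v : V, LinearMap.toSpanSingleton K ((degZero (grd I)).obj (-k + i))
      (topVtx I v (by omega)) ∘ₗ μ ∘ₗ M.act 0 i k (by omega) (vtx I v) else 0
  have hθ : ∀ x : M.obj k, θ k x = ∑ v : V, μ (M.act 0 k k (zero_add k) (vtx I v) x) •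
      topVtx I v (show -k + k = 0 by omega) := fun x => by
    simp only [θ, dif_pos, LinearMap.sum_apply, LinearMap.comp_apply,
      LinearMap.toSpanSingleton_apply]
  have hθ' : ∀ i, i ≠ k → θ i = 0 := fun i hi => dif_neg hi
  refine ⟨mkHom (M := M) (N := (degZero (grd I)).shift (-k)) θ fun l i j h a x => ?_,
    fun x hx => ?_, fun {N} f hf => hom_ext fun i x => ?_⟩
  · by_cases hj : j = k
    · subst hj
      by_cases hl : l = 0
      · subst hl
        obtain rfl : i = j := by omega
        have ha : a ∈ Submodule.span K (Set.range (vtx I)) := by rw [span_vtx]; trivial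
        refine Submodule.span_induction (p := fun a _ => θ i (M.act 0 i i h a x) =
          (degZero (grd I)).act 0 (-i + i) (-i + i) (by omega) a (θ i x)) ?_ ?_ ?_ ?_ ha
        · rintro _ ⟨w, rfl⟩
          rw [hθ, hθ, map_sum, Finset.sum_eq_single w, Finset.sum_eq_single w]
          · rw [map_smul, act_topVtx_self, (isComplete_vtx I).act_self]
          · intro v _ hv
            rw [map_smul, act_topVtx_of_ne hv.symm, smul_zero]
          · simp
          · intro v _ hv
            rw [(isComplete_vtx I).act_of_ne M i hv, map_zero, zero_smul]
          · simp
        · simp only [map_zero, LinearMap.zero_apply]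
        · intro a b _ _ ha hb
          simp only [map_add, LinearMap.add_apply, ha, hb]
        · intro c a _ ha
          simp only [map_smul, LinearMap.smul_apply, ha]
      · refine Eq.trans ?_ ((congrArg _ (LinearMap.congr_fun (hθ' i (by omega)) x)).trans
          (map_zero _)).symm
        refine (hθ _).trans (Finset.sum_eq_zero fun v _ => ?_)
        rcases lt_or_gt_of_ne hl with hl | hl
        · rw [act_of_neg M h hl, map_zero, map_zero, zero_smul]
        · rw [← M.mul_act 0 l i j j h (zero_add j), hμ _ _ _ _ _ (by omega), zero_smul]
    · exact (degZero_eq_zero (n := -k + j) (by omega) _).trans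
        (degZero_eq_zero (n := -k + j) (by omega) _).symm
  · have h1 := (hθ x).symm.trans hx
    have h2 := eq_zero_of_sum_smul_topVtx hI _ _ h1
    rw [← (isComplete_vtx I).sum_act M k x, map_sum]
    exact Finset.sum_eq_zero fun v _ => h2 v
  · by_cases hi : i = k
    · subst hi
      refine (hθ (app f i x)).trans (Finset.sum_eq_zero fun v _ => ?_)
      rw [← app_act, hf, zero_smul]
    · exact degZero_eq_zero (n := -k + i) (by omega) _

/-! ### The exactness of the Koszul complex -/

/-- The main step in the proof that the Koszul complex is a resolution. Let `C` and `P` be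
complexes of projectives such that `C^n` is generated in degree `-n`, and every cocycle
`P^m ⟶ A_0(-k)` with `m + k > 0` is a coboundary. If the cone of `ψ : C ⟶ P` is exact on and below
the diagonal, then it is exact. Indeed a nonzero class of the cone in the largest possible
cohomological degree `m`, and then in the smallest possible degree `k`, is detected by a cocycle
with values in `A_0(-k)`, because the cocycles are a direct summand of the cone in degree `m`. -/
theorem isExact_cone_of_isExactAt (hI : IsQuiverRelations I)
    {C P : CochainComplex (GrMod (grd I)) ℤ} (ψ : C ⟶ P) (hC : ∀ n, IsLin 0 (-n) (C.X n))
    (hP : ∀ n, Projective (P.X n)) {b : ℤ} (hb : ∀ n, b < n → Limits.IsZero (C.X n))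
    (hb' : ∀ n, b < n → Limits.IsZero (P.X n))
    (hext : ∀ m k, 0 < m + k → ∀ θ : P.X m ⟶ (degZero (grd I)).shift (-k),
      P.d (m - 1) m ≫ θ = 0 → ∃ η, P.d m (m + 1) ≫ η = θ)
    (hQ : ∀ n j, 0 ≤ n + 2 ∨ j ≤ -(n + 1) → IsExactAt (cone ψ) n j) : IsExact (cone ψ) := by
  have hproj : ∀ n, Projective ((cone ψ).X n) := fun n =>
    projective_prod (hC (n + 1)).projective (hP n)
  -- If the differential leaving the degree `n + 1` of the cone has a quasi-inverse, then `π`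
  -- projects onto the cocycles, and exactness follows by induction on the internal degree.
  have key : ∀ n, (∃ s : (cone ψ).X (n + 1 + 1) ⟶ (cone ψ).X (n + 1),
      (cone ψ).d (n + 1) (n + 1 + 1) ≫ s ≫ (cone ψ).d (n + 1) (n + 1 + 1) =
        (cone ψ).d (n + 1) (n + 1 + 1)) → ∀ j, IsExactAt (cone ψ) n j := by
    rintro n ⟨s, hs⟩
    let π : (cone ψ).X (n + 1) ⟶ (cone ψ).X (n + 1) := 𝟙 _ - (cone ψ).d (n + 1) (n + 1 + 1) ≫ s
    have hπd : π ≫ (cone ψ).d (n + 1) (n + 1 + 1) = 0 := by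
      simp only [π, Preadditive.sub_comp, Category.id_comp, Category.assoc, hs, sub_self]
    have hdπ : (cone ψ).d n (n + 1) ≫ π = (cone ψ).d n (n + 1) := by
      simp only [π, Preadditive.comp_sub, Category.comp_id]
      rw [← Category.assoc, HomologicalComplex.d_comp_d, Limits.zero_comp, sub_zero]
    have hπ : ∀ k x, app ((cone ψ).d (n + 1) (n + 1 + 1)) k x = 0 → app π k x = x := by
      intro k x hx
      change x - app s k (app ((cone ψ).d (n + 1) (n + 1 + 1)) k x) = x
      rw [hx, map_zero, sub_zero]
    suffices h : ∀ t : ℕ, ∀ k : ℤ, k ≤ -(n + 1) + t → IsExactAt (cone ψ) n k from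
      fun k => h (k + (n + 1)).toNat k (by omega)
    intro t
    induction t with
    | zero => exact fun k hk => hQ n k (Or.inr (by simpa using hk))
    | succ t ih =>
      intro k hk
      rcases le_or_gt k (-(n + 1)) with hk' | hk'
      · exact hQ n k (Or.inr hk')
      intro x hx
      by_contra hne
      -- A form `f` that vanishes on the coboundaries but not on `x`. By induction, `f π` vanishes
      -- on the radical, so it gives a morphism `Θ` to `A_0(-k)`.
      obtain ⟨f, hf, hf'⟩ := Submodule.exists_le_ker_of_notMem
        (p := LinearMap.range (app ((cone ψ).d n (n + 1)) k)) (v := x) hne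
      obtain ⟨Θ, hΘ, hΘ'⟩ := exists_hom_degZero hI ((cone ψ).X (n + 1)) (f ∘ₗ app π k)
        fun l i h a y hl => by
          obtain ⟨z, hz⟩ := ih i (by push_cast at hk; omega) (app π i y)
            (congrArg (fun t => app t i y) hπd)
          refine hf' ⟨(cone ψ).X n |>.act l i k h a z, ?_⟩
          rw [app_act, app_act, hz]
      have hdΘ : (cone ψ).d n (n + 1) ≫ Θ = 0 := hΘ' _ fun z => hf' ⟨z,
        (congrArg (fun t => app t k z) hdπ).symm⟩
      have hdθ : P.d n (n + 1) ≫ pinr (C.X (n + 1 + 1)) (P.X (n + 1)) ≫ Θ = 0 := by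
        rw [← pinr_coneD_assoc ψ n Θ]
        have h1 : coneD ψ n ≫ Θ = 0 := by rw [← cone_d]; exact hdΘ
        rw [h1, Limits.comp_zero]
      -- The restriction of `Θ` to `P` is a cocycle, hence a coboundary; its restriction to `C`
      -- vanishes for reasons of degree. So `Θ` factors through the differential and kills the
      -- cocycle `x`.
      obtain ⟨η, hη⟩ := hext (n + 1) k (by omega) (pinr (C.X (n + 1 + 1)) (P.X (n + 1)) ≫ Θ) (by
        have e : n + 1 - 1 = n := by omega
        rw [e]
        exact hdθ)
      let Θ' : prodMod (C.X (n + 1 + 1)) (P.X (n + 1)) ⟶ (degZero (grd I)).shift (-k) := Θ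
      have hΘη : Θ' = coneD ψ (n + 1) ≫ psnd _ _ ≫ η := by
        refine prod_hom_ext ?_ ?_
        · exact ((hC (n + 1 + 1)).hom_degZero_eq_zero (by omega) _).trans
            ((hC (n + 1 + 1)).hom_degZero_eq_zero (by omega) _).symm
        · rw [pinr_coneD_assoc, pinr_psnd_assoc, hη]
      refine hf ?_
      have h3 : app Θ k x = 0 := by
        refine (congrArg (fun t => app t k x) hΘη).trans ?_
        rw [← cone_d]
        refine (congrArg (app (psnd _ _ ≫ η) k) hx).trans (map_zero _)
      have h4 := hΘ x h3
      rwa [LinearMap.comp_apply, hπ k x hx] at h4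
  -- Descending induction on the cohomological degree: exactness in one degree and projectivity
  -- produce the quasi-inverse of the preceding differential.
  suffices h : ∀ t : ℕ, ∀ n : ℤ, b + 1 - t ≤ n → ∃ s : (cone ψ).X (n + 1 + 1) ⟶ (cone ψ).X (n + 1),
      (cone ψ).d (n + 1) (n + 1 + 1) ≫ s ≫ (cone ψ).d (n + 1) (n + 1 + 1) =
        (cone ψ).d (n + 1) (n + 1 + 1) from
    fun n j => key n (h (b + 1 - n).toNat n (by omega)) j
  intro t
  induction t with
  | zero =>
    intro n hn
    have hz : Limits.IsZero (prodMod (C.X (n + 1 + 1)) (P.X (n + 1))) :=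
      isZero_iff.2 fun i x => Prod.ext
        (isZero_iff.1 (hb (n + 1 + 1) (by push_cast at hn; omega)) i x.1)
        (isZero_iff.1 (hb' (n + 1) (by push_cast at hn; omega)) i x.2)
    exact ⟨0, hom_eq_of_isZero_left hz _ _⟩
  | succ t ih =>
    intro n hn
    obtain ⟨s', hs'⟩ := ih (n + 1) (by push_cast at hn; omega)
    have := hproj (n + 1 + 1)
    obtain ⟨s, hs⟩ := exists_lift (𝟙 _ - (cone ψ).d (n + 1 + 1) (n + 1 + 1 + 1) ≫ s')
      ((cone ψ).d (n + 1) (n + 1 + 1)) fun j x => key (n + 1) ⟨s', hs'⟩ j _ (by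
        rw [← app_comp, Preadditive.sub_comp, Category.id_comp, Category.assoc, hs', sub_self]
        rfl)
    refine ⟨s, ?_⟩
    rw [hs, Preadditive.comp_sub, Category.comp_id, ← Category.assoc, HomologicalComplex.d_comp_d,
      Limits.zero_comp, sub_zero]

end QuiverAlgebra

end KoszulDuality

end

noncomputable section

namespace KoszulDuality

open GrMod

section QuiverAlgebra

variable {K V : Type u} [Field K] [Fintype V] [Quiver.{u} V]

/-! ### The Koszul complex of a module concentrated in degree zero -/

theorem coeff_eq_zero_of_mem_pathDeg {W : Type u} [Fintype W] [Quiver.{u} W] {n : ℤ} {x : PathAlg K W}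
    (hx : x ∈ pathDeg K W n) {p : Σ a b : W, Quiver.Path a b} (hp : (p.2.2.length : ℤ) ≠ n) :
    coeff x p = 0 := by
  classical
  refine Submodule.span_induction (p := fun x _ => coeff x p = 0) ?_ rfl ?_ ?_ hx
  · rintro _ ⟨q, hq, rfl⟩
    rw [coeff_path, if_neg]
    rintro rfl
    exact hp hq
  · intro x y _ _ hx hy
    rw [coeff_add, hx, hy, add_zero]
  · intro c x _ hx
    rw [coeff_smul, hx, mul_zero]

variable [∀ a b : V, Fintype (a ⟶ b)] {I : Ideal (PathAlg K V)}

/-- The ideal of the quadratic dual is again contained in the square of the arrow ideal. -/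
theorem perp_le_sq {x : PathAlg K Vᵒᵖ} (hx : x ∈ perp I) (p : Σ a b : Vᵒᵖ, Quiver.Path a b)
    (hp : coeff x p ≠ 0) : 2 ≤ p.2.2.length := by
  by_contra hlt
  refine hp ?_
  have hx' : x ∈ AddSubgroup.closure _ := TwoSidedIdeal.mem_span_iff_mem_addSubgroup_closure.1 hx
  refine AddSubgroup.closure_induction (p := fun x _ => coeff x p = 0) ?_ rfl
    (fun x y _ _ hx hy => by rw [coeff_add, hx, hy, add_zero])
    (fun x _ hx => by
      rw [← neg_one_smul K x, coeff_smul, hx, mul_zero]) hx'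
  rintro _ ⟨_, ⟨a, -, y, ⟨hy, -⟩, rfl⟩, b, -, rfl⟩
  change coeff (a * y * b) p = 0
  induction a using path_induction with
  | h0 => rw [zero_mul, zero_mul]; rfl
  | hadd x x' h1 h2 => rw [add_mul, add_mul, coeff_add, h1, h2, add_zero]
  | hs c q =>
  rw [smul_mul_assoc, smul_mul_assoc, coeff_smul]
  induction b using path_induction with
  | h0 => rw [mul_zero]; exact mul_zero c
  | hadd x x' h1 h2 => rw [mul_add, coeff_add, mul_add, h1, h2, add_zero]
  | hs c' r =>
  rw [mul_smul_comm, coeff_smul, coeff_eq_zero_of_mem_pathDeg (mul_mem_pathDeg (mul_mem_pathDeg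
    (path_mem_pathDeg q) hy) (path_mem_pathDeg r)) (by omega), mul_zero, mul_zero]

variable [I.IsTwoSided]

/-- The complex `A ⊗_{A_0} N_j`, `j ∈ ℤ`, with differential `d'`. -/
def koszulComplex (N : GrMod (grd (perp I))) : CochainComplex (GrMod (grd I)) ℤ :=
  CochainComplex.of (tensMod N) (tensD N) (tensD_tensD N)

theorem koszulComplex_d_apply (N : GrMod (grd (perp I))) {n m : ℤ} (h : n + 1 = m) (q : ℤ)
    (t : Tens I N (q + n) n) : app ((koszulComplex N).d n m) q t =
      td N (show q + n + 1 = q + m by omega) (show 1 + n = m by omega) t := by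
  subst h
  exact congrArg (fun f : tensMod N n ⟶ tensMod N (n + 1) => app f q t)
    (CochainComplex.of_d (tensMod N) (tensD N) n)

/-- `A` has no components of negative degree. -/
theorem tens_eq_zero_of_neg {N : GrMod (grd (perp I))} {l j : ℤ} (hl : l < 0)
    (t : Tens I N l j) : t = 0 :=
  LinearMap.congr_fun (f := LinearMap.id) (g := 0) (tens_hom_ext fun a x => by
    have ha : a = 0 := Subtype.ext ((Submodule.mem_bot K).1
      (NonnegGraded.eq_bot (𝓑 := grd I) l hl ▸ (show grd I l from a).2))
    rw [ha, map_zero]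
    rfl) t

theorem tens_eq_zero {N : GrMod (grd (perp I))} {l j : ℤ} (h : ∀ x : N.obj j, x = 0)
    (t : Tens I N l j) : t = 0 :=
  LinearMap.congr_fun (f := LinearMap.id) (g := 0) (tens_hom_ext fun a x => by
    rw [h x, map_zero]
    rfl) t

/-- `A^!` has no components of negative degree. -/
theorem homMod_eq_zero {M : GrMod (grd I)} {j q : ℤ} (h : -q - j < 0) (f : (homMod M j).obj q) :
    f = 0 :=
  hval_ext fun x => by
    have hx : x = 0 := Subtype.ext ((Submodule.mem_bot K).1
      (NonnegGraded.eq_bot (𝓑 := grd (perp I)) _ h ▸ (show grd (perp I) _ from x).2))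
    rw [hx]
    exact (map_zero (show HomA0 I M (-q - j) j from f).1).trans
      (map_zero (show HomA0 I M (-q - j) j from 0).1).symm

instance (a b : Vᵒᵖ) : Finite (a ⟶ b) := Finite.of_equiv (b.unop ⟶ a.unop) Quiver.Hom.opEquiv

theorem finiteDimensional_homMod {M : GrMod (grd I)} {j : ℤ} [FiniteDimensional K (M.obj j)]
    (q : ℤ) : FiniteDimensional K ((homMod M j).obj q) := by
  have h : FiniteDimensional K ((regular (grd (perp I))).obj (-q - j)) :=
    finiteDimensional_grd (perp I) _
  exact inferInstanceAs (FiniteDimensional K (HomA0 I M (-q - j) j))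

/-- The map `A_l ⊗_{A_0} Hom_{A_0}(A^!_0, M_0) ⟶ M_l`, `a ⊗ f ↦ a f(1)`. -/
def tevalLin (M : GrMod (grd I)) {l q : ℤ} (h : l + 0 = q) :
    Tens I (homMod M 0) l 0 →ₗ[K] M.obj q :=
  tlift ((M.act l 0 q h).compl₂ (hvalLin (unitElt (perp I) (show -(0 : ℤ) - 0 = 0 by norm_num))))
    fun v a f => by
      refine (act_act M (zero_add 0) h (add_zero l) h a (vtx I v) _ rfl _).symm.trans ?_
      refine congrArg (M.act l 0 q h a) ?_
      refine ((show HomA0 I M (-0 - 0) 0 from f).2 v (unitElt (perp I) (by norm_num))).symm.trans ?_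
      exact congrArg (hval f) (Subtype.ext ((mul_one _).trans (one_mul _).symm))

theorem tevalLin_tmk (M : GrMod (grd I)) {l q : ℤ} (h : l + 0 = q) (a : (regular (grd I)).obj l)
    (f : (homMod M 0).obj 0) : tevalLin M h (tmk (homMod M 0) l 0 a f) =
      M.act l 0 q h a (hval f (unitElt (perp I) (by norm_num))) := rfl

/-- The augmentation vanishes on boundaries, provided that `M_1 = 0`. -/
theorem tevalLin_td (M : GrMod (grd I)) (hM : ∀ x : M.obj 1, x = 0) {l l' j q : ℤ}
    (e : l + 1 = l') (h' : 1 + j = 0) (h : l' + 0 = q) (t : Tens I (homMod M 0) l j) :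
    tevalLin M h (td (homMod M 0) e h' t) = 0 :=
  LinearMap.congr_fun (f := tevalLin M h ∘ₗ td (homMod M 0) e h') (g := 0)
    (tens_hom_ext fun a f => by
      rw [LinearMap.comp_apply, td_tmk, map_sum]
      refine Finset.sum_eq_zero fun α _ => ?_
      refine (tevalLin_tmk M h _ _).trans ?_
      refine (act_act M (add_zero 1) (show l + 1 = q by omega) e h a (arr I α.2.2) _ rfl _).symm.trans
        ?_
      rw [hM (M.act 1 0 1 _ _ _), map_zero]) t

/-- The morphism `A ⊗_{A_0} Hom_{A_0}(A^!_0, M_0) ⟶ M`, `a ⊗ f ↦ a f(1)`. -/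
def teval (M : GrMod (grd I)) : tensMod (homMod M 0) 0 ⟶ M :=
  mkHom (M := tensMod (homMod M 0) 0) (fun q => tevalLin M (show q + 0 + 0 = q by omega))
    fun l q q' h a t => LinearMap.congr_fun (f := tevalLin M (show q' + 0 + 0 = q' by omega) ∘ₗ
        tact (homMod M 0) (show l + (q + 0) = q' + 0 by omega) 0 a)
      (g := M.act l q q' h a ∘ₗ tevalLin M (show q + 0 + 0 = q by omega))
      (tens_hom_ext fun b f => (act_act M (show q + 0 + 0 = q by omega) h
        (show l + (q + 0) = q' + 0 by omega) (show q' + 0 + 0 = q' by omega) a b _ rfl _).symm) t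

/-- The augmentation of the Koszul complex of a module with no component of degree `1`. -/
def augmentation (M : GrMod (grd I)) (hM : ∀ x : M.obj 1, x = 0) :
    koszulComplex (homMod M 0) ⟶ inDegZero M :=
  HomologicalComplex.mkHomToSingle (K := koszulComplex (homMod M 0)) (teval M) fun i hi =>
    hom_ext fun q t => by
      have hi : i + 1 = 0 := hi
      refine (congrArg (app (teval M) q) (koszulComplex_d_apply _ hi q t)).trans ?_
      exact tevalLin_td M hM _ _ _ t

theorem augmentation_apply (M : GrMod (grd I)) (hM : ∀ x : M.obj 1, x = 0) (q : ℤ)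
    (t : Tens I (homMod M 0) (q + 0) 0) : app (HomologicalComplex.singleObjXSelf
      (ComplexShape.up ℤ) 0 M).hom q (app ((augmentation M hM).f 0) q t) =
        tevalLin M (show q + 0 + 0 = q by omega) t := by
  have h : (augmentation M hM).f 0 ≫ (HomologicalComplex.singleObjXSelf
      (ComplexShape.up ℤ) 0 M).hom = teval M := by
    refine (congrArg (· ≫ _) (HomologicalComplex.mkHomToSingle_f
      (K := koszulComplex (homMod M 0)) (teval M) _)).trans ?_
    exact (Category.assoc _ _ _).trans ((congrArg (_ ≫ ·) (Iso.inv_hom_id _)).trans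
      (Category.comp_id _))
  exact congrArg (fun f => app f q t) h

/-- Evaluation at `1` is injective on `Hom_{A_0}(A^!_0, M_0)`. -/
theorem hval_eq_zero {M : GrMod (grd I)} {f : (homMod M 0).obj 0}
    (hf : hval f (unitElt (perp I) (by norm_num)) = 0) : f = 0 := by
  let g : grd (perp I) 0 →ₗ[K] M.obj 0 := (show HomA0 I M (-0 - 0) 0 from f).1
  have h2 : Submodule.span K (Set.range (vtx (perp I))) ≤ LinearMap.ker g := by
    refine Submodule.span_le.2 ?_
    rintro _ ⟨v, rfl⟩
    refine Eq.trans (congrArg (hval f) ?_) (((show HomA0 I M (-0 - 0) 0 from f).2 v.unop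
      (unitElt (perp I) (by norm_num))).trans ((congrArg _ hf).trans (map_zero _)))
    exact Subtype.ext (mul_one _).symm
  rw [span_vtx] at h2
  exact hval_ext fun x => h2 (Submodule.mem_top (x := (show grd (perp I) 0 from x)))

/-- Evaluation at `1` maps `Hom_{A_0}(A^!_0, M_0)` onto `M_0`. -/
theorem exists_hval_eq (M : GrMod (grd I)) (y : M.obj 0) :
    ∃ f : (homMod M 0).obj 0, hval f (unitElt (perp I) (by norm_num)) = y := by
  classical
  choose c hc hc' using fun v : V => exists_vtx_coeff (I := perp I)
    (fun x hx p hp => perp_le_sq hx p hp) (op v)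
  let f : (regular (grd (perp I))).obj 0 →ₗ[K] M.obj 0 :=
    ∑ v : V, (LinearMap.toSpanSingleton K (M.obj 0) (M.act 0 0 0 (zero_add 0) (vtx I v) y)) ∘ₗ c v
  have hf0 : ∀ x, f x = ∑ v : V, c v x • M.act 0 0 0 (zero_add 0) (vtx I v) y := fun x => by
    simp only [f, LinearMap.sum_apply, LinearMap.comp_apply, LinearMap.toSpanSingleton_apply]
  have hf : ∀ v : V, f (vtx (perp I) (op v)) = M.act 0 0 0 (zero_add 0) (vtx I v) y := fun v => by
    refine (hf0 _).trans ((Finset.sum_eq_single v (fun w _ hw => ?_) fun h =>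
      absurd (Finset.mem_univ v) h).trans ?_)
    · exact (congrArg (· • _) (hc' w (op v) fun e => hw (op_injective e).symm)).trans (zero_smul K _)
    · exact (congrArg (· • _) (hc v)).trans (one_smul K _)
  have hlin : ∀ (v : V) (x : (regular (grd (perp I))).obj 0),
      f ((regular (grd (perp I))).act 0 0 0 (zero_add 0) (vtx (perp I) (op v)) x) =
        M.act 0 0 0 (zero_add 0) (vtx I v) (f x) := fun v x => by
    -- The map `f` is `A_0`-linear, as this holds on the idempotents, which span `A^!_0`.
    let S : Submodule K (grd (perp I) 0) := LinearMap.eqLocus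
      (f ∘ₗ (regular (grd (perp I))).act 0 0 0 (zero_add 0) (vtx (perp I) (op v)))
      (M.act 0 0 0 (zero_add 0) (vtx I v) ∘ₗ f)
    have hS : Submodule.span K (Set.range (vtx (perp I))) ≤ S := by
      rw [Submodule.span_le]
      rintro _ ⟨⟨w⟩, rfl⟩
      refine Eq.trans ?_ (congrArg (M.act 0 0 0 (zero_add 0) (vtx I v)) (hf w)).symm
      by_cases hw : v = w
      · subst hw
        refine Eq.trans (congrArg f ?_) ((hf v).trans ((isComplete_vtx I).act_self M 0 v y).symm)
        exact Subtype.ext ((isComplete_vtx (perp I)).mul_self (op v))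
      · refine Eq.trans (congrArg f ?_) ((map_zero f).trans
          ((isComplete_vtx I).act_of_ne M 0 hw y).symm)
        exact Subtype.ext ((isComplete_vtx (perp I)).mul_of_ne _ _ fun e => hw (op_injective e))
    rw [span_vtx] at hS
    exact hS (Submodule.mem_top (x := x))
  refine ⟨(⟨f, hlin⟩ : HomA0 I M (-0 - 0) 0), ?_⟩
  have h1 : (unitElt (perp I) (rfl : (0 : ℤ) = 0)) =
      ∑ v : V, (show (regular (grd (perp I))).obj 0 from vtx (perp I) (op v)) :=
    Subtype.ext ((isComplete_vtx_op (perp I)).sum_eq.symm.trans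
      (AddSubmonoidClass.coe_finsetSum _ _).symm)
  refine (congrArg f h1).trans ((map_sum f _ _).trans ?_)
  exact (Finset.sum_congr rfl fun v _ => hf v).trans ((isComplete_vtx I).sum_act M 0 y)

/-- The elements of `A_l ⊗_{A_0} Hom_{A_0}(A^!_0, M_0)` with `l > 0` are boundaries. For `l = 1`
this is exactness next to the diagonal, and the general case follows by multiplying with a path. -/
theorem exists_td_eq_of_pos (hI : IsQuiverRelations I) (M : GrMod (grd I)) {l l' j : ℤ}
    (e : l + 1 = l') (h : 1 + j = 0) (hl : 0 ≤ l) (t : Tens I (homMod M 0) l' 0) :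
    ∃ y, td (homMod M 0) e h y = t := by
  have htop := tens_eq_top (LinearMap.range (td (homMod M 0) e h)) fun ⟨a, b, p⟩ hp x => by
    match p, hp with
    | .nil, hp =>
      simp only [Quiver.Path.length_nil] at hp
      omega
    | .cons p α, hp =>
      have hp' : (p.length : ℤ) = l := by
        simp only [Quiver.Path.length_cons] at hp
        push_cast at hp
        omega
      obtain ⟨y, hy⟩ := exists_td_tmk_one_eq hI M h (add_zero 1) le_rfl
        (tmk (homMod M 0) 1 0 (arr I α) x)
        (tens_eq_zero (fun f => homMod_eq_zero (by norm_num) f) _)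
      refine ⟨tact (homMod M 0) (add_zero l) j
        (pathElt I ⟨_, _, p⟩ hp') (tmk _ 0 j (oneElt I) y), ?_⟩
      refine (LinearMap.congr_fun (td_tact (homMod M 0) (add_zero l) (zero_add 1) e h e
        (pathElt I ⟨_, _, p⟩ hp')) (tmk _ 0 j (oneElt I) y)).trans ?_
      refine (congrArg (tact (homMod M 0) e 0 (pathElt I ⟨_, _, p⟩ hp')) hy).trans ?_
      refine (tact_tmk _ _ _ _ _ _).trans (congrArg (fun z => tmk (homMod M 0) l' 0 z x) ?_)
      exact (pathElt_cons I p α e hp').symm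
  exact (htop ▸ Submodule.mem_top : t ∈ LinearMap.range _)

/-- Exactness of the Koszul complex of `M` where the tensor factor in `A` has degree at most `1`.
-/
theorem exists_td_eq_of_le (hI : IsQuiverRelations I) (M : GrMod (grd I)) {l l' l'' k k' k'' : ℤ}
    (e : l + 1 = l') (h : 1 + k = k') (e' : l' + 1 = l'') (h' : 1 + k' = k'') (hk : k' < 0)
    (hl : l' ≤ 1) (t : Tens I (homMod M 0) l' k') (ht : td (homMod M 0) e' h' t = 0) :
    ∃ y, td (homMod M 0) e h y = t := by
  rcases lt_trichotomy l' 0 with h0 | h0 | h0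
  · exact ⟨0, (map_zero _).trans (tens_eq_zero_of_neg h0 t).symm⟩
  · subst h0
    obtain rfl : l'' = 1 := by omega
    exact ⟨0, (map_zero _).trans (tmk_one_eq_zero hI M h' hk t ht).symm⟩
  · obtain rfl : l' = 1 := by omega
    obtain rfl : l'' = 2 := by omega
    obtain rfl : l = 0 := by omega
    obtain ⟨y, hy⟩ := exists_td_tmk_one_eq hI M h h' hk.le t ht
    exact ⟨_, hy⟩

/-- The Koszul complex of `M` is exact at the terms of negative index, on the diagonal and next
to it. -/
theorem isExactAt_koszulComplex (hI : IsQuiverRelations I) (M : GrMod (grd I)) {n q : ℤ}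
    (hn : n + 1 < 0) (hq : q + (n + 1) ≤ 1) : IsExactAt (koszulComplex (homMod M 0)) n q := by
  intro (t : Tens I (homMod M 0) (q + (n + 1)) (n + 1)) ht
  obtain ⟨y, hy⟩ := exists_td_eq_of_le hI M (show q + n + 1 = q + (n + 1) by omega)
    (show 1 + n = n + 1 by omega) _ _ hn hq t ((koszulComplex_d_apply _ rfl q t).symm.trans ht)
  exact ⟨y, (koszulComplex_d_apply _ rfl q y).trans hy⟩

/-- The kernel of the augmentation consists of boundaries. -/
theorem exists_koszulComplex_d_eq (hI : IsQuiverRelations I) (M : GrMod (grd I)) {l l' l'' j k : ℤ}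
    (e : l + 1 = l') (h : 1 + j = k) (hk : k = 0) (h' : l' + 0 = l'')
    (t : Tens I (homMod M 0) l' k)
    (ht : tevalLin M h' (hk ▸ t) = 0) : ∃ y, td (homMod M 0) e h y = t := by
  subst hk
  rcases lt_trichotomy l' 0 with h0 | h0 | h0
  · exact ⟨0, (map_zero _).trans (tens_eq_zero_of_neg h0 t).symm⟩
  · subst h0
    obtain rfl : l'' = 0 := by omega
    obtain ⟨f, rfl⟩ := exists_eq_tmk_one _ t
    have hf : hval f (unitElt (perp I) (by norm_num)) = 0 :=
      Eq.trans (M.one_act 0 _).symm ((tevalLin_tmk M h' (oneElt I) f).symm.trans ht)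
    refine ⟨0, (map_zero _).trans ?_⟩
    rw [hval_eq_zero hf]
    exact (map_zero (tmk (homMod M 0) 0 0 (oneElt I))).symm
  · exact exists_td_eq_of_pos hI M e h (by omega) t

end QuiverAlgebra

end KoszulDuality

end

noncomputable section

namespace KoszulDuality

open GrMod

section QuiverAlgebra

variable {K V : Type u} [Field K] [Fintype V] [Quiver.{u} V]
variable [∀ a b : V, Fintype (a ⟶ b)] {I : Ideal (PathAlg K V)} [I.IsTwoSided]

/-! ### Linear resolutions of semisimple modules -/

theorem koszulComplex_eq_zero (M : GrMod (grd I)) {m : ℤ} (hm : 0 < m) (q : ℤ)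
    (t : ((koszulComplex (homMod M 0)).X m).obj q) : t = 0 :=
  tens_eq_zero (fun f => homMod_eq_zero (by omega) f) _

theorem inDegZero_eq_zero {B : Type u} [Ring B] [Algebra K B] {𝓑 : ℤ → Submodule K B}
    [NonnegGraded 𝓑] (M : GrMod 𝓑) {m : ℤ} (hm : m ≠ 0) {q : ℤ}
    (x : ((inDegZero M).X m).obj q) : x = 0 :=
  isZero_iff.1 (HomologicalComplex.isZero_single_obj_X (ComplexShape.up ℤ) 0 M m hm) q x

/-- The term of index `m = 0` of the complex `inDegZero M`. -/
def inDegZeroIso {B : Type u} [Ring B] [Algebra K B] {𝓑 : ℤ → Submodule K B}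
    [NonnegGraded 𝓑] (M : GrMod 𝓑) {m : ℤ} (hm : m = 0) : (inDegZero M).X m ≅ M :=
  HomologicalComplex.singleObjXIsoOfEq (ComplexShape.up ℤ) 0 M m hm

theorem inDegZeroIso_injective {B : Type u} [Ring B] [Algebra K B] {𝓑 : ℤ → Submodule K B}
    [NonnegGraded 𝓑] (M : GrMod 𝓑) {m : ℤ} (hm : m = 0) {q : ℤ} {x : ((inDegZero M).X m).obj q}
    (hx : app (inDegZeroIso M hm).hom q x = 0) : x = 0 := by
  have h := congrArg (fun f => app f q x) (inDegZeroIso M hm).hom_inv_id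
  exact h.symm.trans ((congrArg (app (inDegZeroIso M hm).inv q) hx).trans (map_zero _))

theorem inDegZeroIso_surjective {B : Type u} [Ring B] [Algebra K B] {𝓑 : ℤ → Submodule K B}
    [NonnegGraded 𝓑] (M : GrMod 𝓑) {m : ℤ} (hm : m = 0) {q : ℤ} (y : M.obj q) :
    ∃ x, app (inDegZeroIso M hm).hom q x = y :=
  ⟨app (inDegZeroIso M hm).inv q y,
    congrArg (fun f => app f q y) (inDegZeroIso M hm).inv_hom_id⟩

theorem exists_tevalLin_eq (M : GrMod (grd I)) {l q : ℤ} (h : l + 0 = q) (hq : q = 0)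
    (y : M.obj q) : ∃ t, tevalLin M h t = y := by
  obtain rfl : l = 0 := by omega
  subst hq
  obtain ⟨f, hf⟩ := exists_hval_eq M y
  refine ⟨tmk (homMod M 0) 0 0 (oneElt I) f, (tevalLin_tmk M h _ f).trans ?_⟩
  exact (congrArg (M.act 0 0 0 h (oneElt I)) hf).trans (M.one_act 0 y)

section
variable (M : GrMod (grd I)) (hM : ∀ j, j ≠ 0 → ∀ x : M.obj j, x = 0)

theorem exists_augmentation_eq {m : ℤ} (hm : m = 0) {q : ℤ} (y : ((inDegZero M).X m).obj q) :
    ∃ x, app ((augmentation M (hM 1 one_ne_zero)).f m) q x = y := by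
  subst hm
  by_cases hq : q = 0
  · obtain ⟨t, ht⟩ := exists_tevalLin_eq M (show q + 0 + 0 = q by omega) hq
      (app (inDegZeroIso M rfl).hom q y)
    refine ⟨t, ?_⟩
    have h0 := (augmentation_apply M (hM 1 one_ne_zero) q t).trans ht
    have h1 := congrArg (app (inDegZeroIso M rfl).inv q) h0
    have h2 := fun z => congrArg (fun f => app f q z) (inDegZeroIso M (m := 0) rfl).hom_inv_id
    exact (h2 _).symm.trans (h1.trans (h2 y))
  · refine ⟨0, (map_zero _).trans (inDegZeroIso_injective M rfl (hM q hq _)).symm⟩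

theorem exists_d_eq_of_augmentation_eq_zero (hI : IsQuiverRelations I) {n m : ℤ} (h : n + 1 = m)
    (hm : m = 0) {q : ℤ} (x : ((koszulComplex (homMod M 0)).X m).obj q)
    (hx : app ((augmentation M (hM 1 one_ne_zero)).f m) q x = 0) :
    ∃ y, app ((koszulComplex (homMod M 0)).d n m) q y = x := by
  subst hm
  obtain ⟨y, hy⟩ := exists_koszulComplex_d_eq hI M (show q + n + 1 = q + 0 by omega)
    (show 1 + n = 0 by omega) rfl (show q + 0 + 0 = q by omega) x
    ((augmentation_apply M (hM 1 one_ne_zero) q x).symm.trans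
      ((congrArg _ hx).trans (map_zero _)))
  exact ⟨y, (koszulComplex_d_apply _ h q y).trans hy⟩

/-- The augmentation onto a module concentrated in degree `0` is surjective on cohomology. -/
theorem surjAt_augmentation (n q : ℤ) : SurjAt (augmentation M (hM 1 one_ne_zero)) n q := by
  intro y _
  by_cases hn : n + 1 = 0
  · obtain ⟨x, hx⟩ := exists_augmentation_eq M hM hn y
    exact ⟨x, koszulComplex_eq_zero M (by omega) q _, 0,
      (map_zero _).trans (by rw [hx, sub_self])⟩
  · refine ⟨0, map_zero _, 0, (map_zero _).trans ?_⟩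
    rw [map_zero, sub_zero, inDegZero_eq_zero M hn y]

/-- The augmentation onto a module concentrated in degree `0` is injective on
cohomology where the Koszul complex is exact; exactness is only needed at terms of negative index. -/
theorem injAt_augmentation (hI : IsQuiverRelations I) {n q : ℤ}
    (h : n + 1 < 0 → IsExactAt (koszulComplex (homMod M 0)) n q) :
    InjAt (augmentation M (hM 1 one_ne_zero)) n q := by
  rintro x hx ⟨y, hy⟩
  rcases lt_trichotomy (n + 1) 0 with hn | hn | hn
  · exact h hn x hx
  · refine exists_d_eq_of_augmentation_eq_zero M hM hI rfl hn x (hy.symm.trans ?_)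
    rw [inDegZero_eq_zero M (by omega) y, map_zero]
  · exact ⟨0, (map_zero _).trans (koszulComplex_eq_zero M hn q x).symm⟩

end

theorem isLin_koszulComplex (M : GrMod (grd I)) [FiniteDimensional K (M.obj 0)] (n : ℤ) :
    IsLin 0 (-n) ((koszulComplex (homMod M 0)).X n) := by
  have := finiteDimensional_homMod (M := M) (j := 0) n
  exact isLin_tensMod

theorem isZero_koszulComplex (M : GrMod (grd I)) {n : ℤ} (hn : 0 < n) :
    Limits.IsZero ((koszulComplex (homMod M 0)).X n) :=
  isZero_iff.2 fun q x => koszulComplex_eq_zero M hn q x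

/-- If the mapping cone is exact, the morphism is injective on cohomology. -/
theorem injAt_of_isExact_cone {B : Type u} [Ring B] [Algebra K B] {𝓑 : ℤ → Submodule K B}
    [NonnegGraded 𝓑] {C D : CochainComplex (GrMod 𝓑) ℤ} {f : C ⟶ D} (h : IsExact (cone f))
    (n j : ℤ) : InjAt f n j := by
  obtain ⟨n, rfl⟩ : ∃ k, n = k + 1 := ⟨n - 1, by omega⟩
  rintro x hx ⟨y, hy⟩
  obtain ⟨⟨x', y'⟩, h'⟩ := h n j ((x, -y) : (C.X (n + 1 + 1)).obj j × (D.X (n + 1)).obj j) (by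
    rw [cone_d]
    refine (coneD_apply f (n + 1) j x (-y)).trans ?_
    rw [hx, map_neg, hy, neg_zero, add_neg_cancel]
    rfl)
  rw [cone_d] at h'
  have h1 := congrArg Prod.fst ((coneD_apply f n j x' y').symm.trans h')
  exact ⟨-x', (map_neg _ _).trans h1⟩

theorem finiteDimensional_degZero : FiniteDimensional K ((degZero (grd I)).obj 0) := by
  have : FiniteDimensional K ((regular (grd I)).obj 0) := finiteDimensional_grd I 0
  exact inferInstanceAs (FiniteDimensional K
    ((regular (grd I)).obj 0 ⧸ (rad (regular (grd I))).carrier 0))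

/-- If `β^{0,0}(A_0) = 0`, then `A_0 = 0`. -/
theorem degZero_eq_zero_of_betti_eq_zero (hI : IsQuiverRelations I)
    {P : CochainComplex (GrMod (grd I)) ℤ} {π : P ⟶ inDegZero (degZero (grd I))}
    (hπ : IsProjRes π) {n : ℤ} (hn : n + 1 = 0) (hb : betti P (n + 1) 0 = 0) (j : ℤ)
    (z : (degZero (grd I)).obj j) : z = 0 := by
  by_cases hj : j = 0
  swap
  · exact degZero_eq_zero hj z
  subst hj
  -- A linear form on `A_0`, composed with the augmentation of the resolution, gives a cocycle with
  -- values in `A_0`. It is a coboundary, hence vanishes on the cocycles of `P`, which map onto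
  -- `A_0`.
  refine (Module.forall_dual_apply_eq_zero_iff K z).1 fun lam => ?_
  let e := inDegZeroIso (degZero (grd I)) hn
  let μ : (P.X (n + 1)).obj 0 →ₗ[K] K := lam ∘ₗ app e.hom 0 ∘ₗ app (π.f (n + 1)) 0
  obtain ⟨Θ, h1, h2⟩ := exists_hom_degZero hI (P.X (n + 1)) μ fun l i h a x hl => by
    refine (congrArg (fun y => lam (app e.hom 0 y)) (app_act (π.f (n + 1)) l i 0 h a x)).trans ?_
    refine (congrArg lam (app_act e.hom l i 0 h a _)).trans ?_
    rw [degZero_eq_zero (show i ≠ 0 by omega) (app e.hom i _), map_zero, map_zero]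
  have hd : P.d (n + 1 - 1) (n + 1) ≫ Θ = 0 := h2 _ fun x => by
    have h3 := congrArg (fun f => app f 0 x) (π.comm (n + 1 - 1) (n + 1))
    refine (congrArg (fun y => lam (app e.hom 0 y)) h3.symm).trans ?_
    change lam (app e.hom 0 (app ((inDegZero (degZero (grd I))).d _ _) 0
      (app (π.f (n + 1 - 1)) 0 x))) = 0
    rw [inDegZero_eq_zero _ (show n + 1 - 1 ≠ 0 by omega) (app (π.f (n + 1 - 1)) 0 x), map_zero,
      map_zero, map_zero]
  obtain ⟨η, hη⟩ := exists_d_comp_eq_of_betti_eq_zero (finiteDimensional_grd I) (hπ.fg (n + 1)) hb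
    Θ hd
  obtain ⟨y, hy⟩ := inDegZeroIso_surjective (degZero (grd I)) hn z
  obtain ⟨x, hx, w, hw⟩ := ((isQuasiIso_iff π).1 hπ.quasiIso n 0).2 y
    (inDegZero_eq_zero _ (by omega) _)
  rw [inDegZero_eq_zero _ (by omega) w, map_zero] at hw
  have hx' : app (π.f (n + 1)) 0 x = y := (sub_eq_zero.1 hw.symm).symm
  have h4 : μ x = 0 := h1 x (by
    rw [← hη]
    exact (congrArg (app η 0) hx).trans (map_zero (app η 0)))
  exact ((congrArg lam ((congrArg (app e.hom 0) hx').trans hy)).symm.trans h4)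

/-- If `A` is Koszul, the Koszul complex of `A_0` is exact outside of degree zero. -/
theorem isExactAt_koszulComplex_degZero (hI : IsQuiverRelations I) (hK : IsKoszul (grd I)) {n : ℤ}
    (hn : n + 1 < 0) (q : ℤ) : IsExactAt (koszulComplex (homMod (degZero (grd I)) 0)) n q := by
  obtain ⟨l, P, π, hπ, hb⟩ := hK
  have hM : ∀ j, j ≠ 0 → ∀ x : (degZero (grd I)).obj j, x = 0 := fun j => degZero_eq_zero
  have := finiteDimensional_degZero (I := I)
  have hlin := isLin_koszulComplex (degZero (grd I))
  obtain ⟨b, hb'⟩ := hπ.bounded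
  obtain ⟨ψ, s, hs⟩ := exists_lift_of_isQuasiIso hπ.quasiIso
    (augmentation (degZero (grd I)) (hM 1 one_ne_zero)) (fun n => (hlin n).projective)
    (b := 0) fun n hn => isZero_koszulComplex _ hn
  have hQ := (isQuasiIso_iff π).1 hπ.quasiIso
  have hcone : IsExact (cone ψ) := by
    refine isExact_cone_of_isExactAt hI ψ hlin hπ.projective (b := max b 0)
      (fun n hn => isZero_koszulComplex _ (by omega)) (fun n hn => hb' n (by omega)) ?_ ?_
    · intro m k hmk θ hθ
      -- Linearity of the resolution is only assumed up to an overall shift `l`. If `l ≠ 0`, then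
      -- `A_0 = 0`, and there is nothing to show.
      by_cases hl : l = 0
      · exact exists_d_comp_eq_of_betti_eq_zero (finiteDimensional_grd I) (hπ.fg m)
          (by_contra fun h => by have := hb m k h; omega) θ hθ
      · refine ⟨0, Limits.comp_zero.trans (hom_ext fun i x => ?_)⟩
        exact (degZero_eq_zero_of_betti_eq_zero hI hπ (n := -1) rfl
          (by_contra fun h => hl (by have := hb _ _ h; omega)) _ _).symm
    -- Near the diagonal, the exactness of the cone follows from that of the augmented Koszul
    -- complex.
    · intro n j hnj
      refine isExactAt_cone (.of_homotopy hs (injAt_augmentation _ hM hI fun hn =>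
          isExactAt_koszulComplex hI _ hn (by omega)))
        (.of_homotopy hs (hQ n j).1 (surjAt_augmentation _ hM n j))
  intro x hx
  refine injAt_of_isExact_cone hcone n q x hx ?_
  refine (hQ n q).1 _ ?_ ⟨0, (map_zero _).trans (inDegZero_eq_zero _ hn.ne _).symm⟩
  have h1 := congrArg (fun f => app f q x) (ψ.comm (n + 1) (n + 1 + 1))
  exact h1.trans ((congrArg _ hx).trans (map_zero (app (ψ.f (n + 1 + 1)) q)))

/-- The Koszul complex is functorial, so its exactness passes to direct summands. -/
theorem isExactAt_koszulComplex_of_retract {N N' : GrMod (grd (perp I))} (f : N ⟶ N')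
    (g : N' ⟶ N) (h : f ≫ g = 𝟙 N) {n q : ℤ} (hN : IsExactAt (koszulComplex N') n q) :
    IsExactAt (koszulComplex N) n q := by
  intro (x : Tens I N (q + (n + 1)) (n + 1)) hx
  have hx := (koszulComplex_d_apply N rfl q x).symm.trans hx
  obtain ⟨y, hy⟩ := hN (tmap f _ _ x) ((koszulComplex_d_apply N' rfl q _).trans
    ((LinearMap.congr_fun (tmap_td f _ _) x).symm.trans ((congrArg _ hx).trans (map_zero _))))
  have hy := (koszulComplex_d_apply N' rfl q y).symm.trans hy
  refine ⟨tmap g (q + n) n y, (koszulComplex_d_apply N rfl q _).trans ?_⟩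
  refine (LinearMap.congr_fun (tmap_td g _ _) y).symm.trans ((congrArg (tmap g _ _) hy).trans ?_)
  refine LinearMap.congr_fun (f := tmap g _ _ ∘ₗ tmap f _ _) (g := LinearMap.id)
    (tens_hom_ext fun a z => ?_) x
  rw [LinearMap.comp_apply, tmap_tmk, tmap_tmk, ← app_comp, h]
  rfl

end QuiverAlgebra

end KoszulDuality

end

noncomputable section

namespace KoszulDuality

open GrMod

/-! ### The simple modules -/

namespace GrMod

section Simple

variable {K : Type u} [Field K] {B : Type u} [Ring B] [Algebra K B]
variable {𝓑 : ℤ → Submodule K B} [NonnegGraded 𝓑] {e : B} (he : e ∈ 𝓑 0) (hee : e * e = e)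

/-- The idempotent `e`, as an element of `B e`. -/
def cyclicGen : (cyclic 𝓑 e).obj 0 := ⟨⟨e, he⟩, hee⟩

/-- The class of `e` in `B e / 𝔪 e`. -/
def simpleMk : (simple 𝓑 e).obj 0 := Submodule.Quotient.mk (cyclicGen he hee)

/-- The module `B e` is generated by `e`. -/
theorem cyclic_act_gen {n : ℤ} (x : (cyclic 𝓑 e).obj n) :
    (cyclic 𝓑 e).act n 0 n (add_zero n) x.1 (cyclicGen he hee) = x :=
  Subtype.ext (Subtype.ext x.2)

include he hee in
/-- The module `B e / 𝔪 e` is concentrated in degree `0`. -/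
theorem simple_eq_zero {n : ℤ} (hn : n ≠ 0) (x : (simple 𝓑 e).obj n) : x = 0 := by
  obtain ⟨x, rfl⟩ := Submodule.Quotient.mk_surjective _ x
  rcases lt_or_gt_of_ne hn with h | h
  · have hx : x = 0 := Subtype.ext (Subtype.ext ((Submodule.mem_bot K).1
      (NonnegGraded.eq_bot (𝓑 := 𝓑) n h ▸ x.1.2)))
    rw [hx]
    rfl
  · exact (Submodule.Quotient.mk_eq_zero _).2 (Submodule.subset_span
      ⟨n, 0, add_zero n, x.1, cyclicGen he hee, by omega, (cyclic_act_gen he hee x).symm⟩)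

theorem exists_smul_simpleMk (h : ∀ a ∈ 𝓑 0, ∃ c : K, a * e = c • e) (x : (simple 𝓑 e).obj 0) :
    ∃ c : K, x = c • simpleMk he hee := by
  obtain ⟨x, rfl⟩ := Submodule.Quotient.mk_surjective _ x
  obtain ⟨c, hc⟩ := h _ x.1.2
  refine ⟨c, congrArg (Submodule.Quotient.mk (p := (rad _).carrier 0))
    (a₂ := c • cyclicGen he hee) ?_⟩
  exact Subtype.ext (Subtype.ext (Eq.trans (Eq.symm x.2) hc))

theorem act_simpleMk : (simple 𝓑 e).act 0 0 0 (zero_add 0) ⟨e, he⟩ (simpleMk he hee) =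
    simpleMk he hee :=
  congrArg (Submodule.Quotient.mk (p := (rad _).carrier 0)) (cyclic_act_gen he hee (cyclicGen he hee))

include he hee in
/-- Every component of `B e / 𝔪 e` has dimension at most one, if `B_0 e = K e`. -/
theorem exists_generator_simple (h : ∀ a ∈ 𝓑 0, ∃ c : K, a * e = c • e) (n : ℤ) :
    ∃ g : (simple 𝓑 e).obj n, ∀ x, ∃ c : K, x = c • g := by
  by_cases hn : n = 0
  · subst hn
    exact ⟨simpleMk he hee, exists_smul_simpleMk he hee h⟩
  · exact ⟨0, fun x => ⟨0, (simple_eq_zero he hee hn x).trans (zero_smul K _).symm⟩⟩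

include hee in
theorem simple_act_self (h : ∀ a ∈ 𝓑 0, ∃ c : K, a * e = c • e) (n : ℤ) (h0 : 0 + n = n)
    (x : (simple 𝓑 e).obj n) : (simple 𝓑 e).act 0 n n h0 ⟨e, he⟩ x = x := by
  by_cases hn : n = 0
  · subst hn
    obtain ⟨c, rfl⟩ := exists_smul_simpleMk he hee h x
    exact (map_smul _ _ _).trans (congrArg (c • ·) (act_simpleMk he hee))
  · exact (simple_eq_zero he hee hn _).trans (simple_eq_zero he hee hn _).symm

end Simple

end GrMod

section QuiverAlgebra

variable {K V : Type u} [Field K] [Fintype V] [Quiver.{u} V]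

section
variable (I : Ideal (PathAlg K V)) [I.IsTwoSided]

/-- The simple module `K_v = A e_v / 𝔪 e_v`. -/
abbrev vtxSimple (v : V) : GrMod (grd I) := simple (grd I) (vtx I v : PathAlg K V ⧸ I)

/-- The class of `e_v` in `K_v`. -/
def simpleGen (v : V) : (vtxSimple I v).obj 0 :=
  simpleMk (vtx I v).2 ((isComplete_vtx I).mul_self v)

theorem vtxSimple_eq_zero (v : V) {n : ℤ} (hn : n ≠ 0) (x : (vtxSimple I v).obj n) : x = 0 :=
  simple_eq_zero (vtx I v).2 ((isComplete_vtx I).mul_self v) hn x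

variable {I} in
/-- The idempotent `e_v` spans `A_0 e_v` and `e_v A_0`, and elements of `A_0` act on it from both
sides by the same scalar. -/
theorem exists_smul_of_mem_grd_zero {a : PathAlg K V ⧸ I} (ha : a ∈ grd I 0) (v : V) :
    ∃ c : K, a * vtx I v = c • (vtx I v : PathAlg K V ⧸ I) ∧
      vtx I v * a = c • (vtx I v : PathAlg K V ⧸ I) := by
  have ha : (⟨a, ha⟩ : grd I 0) ∈ Submodule.span K (Set.range (vtx I)) := by
    rw [span_vtx]
    exact Submodule.mem_top
  refine Submodule.span_induction (p := fun (a : grd I 0) _ => ∃ c : K,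
    (a : PathAlg K V ⧸ I) * vtx I v = c • (vtx I v : PathAlg K V ⧸ I) ∧
      vtx I v * (a : PathAlg K V ⧸ I) = c • (vtx I v : PathAlg K V ⧸ I)) ?_ ?_ ?_ ?_ ha
  · rintro _ ⟨w, rfl⟩
    by_cases hw : w = v
    · subst hw
      exact ⟨1, by rw [(isComplete_vtx I).mul_self, one_smul]; exact ⟨rfl, rfl⟩⟩
    · exact ⟨0, by rw [(isComplete_vtx I).mul_of_ne _ _ hw, zero_smul],
        by rw [(isComplete_vtx I).mul_of_ne _ _ (Ne.symm hw), zero_smul]⟩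
  · exact ⟨0, (zero_mul _).trans (zero_smul K _).symm, (mul_zero _).trans (zero_smul K _).symm⟩
  · rintro a b _ _ ⟨c, hc⟩ ⟨c', hc'⟩
    exact ⟨c + c', (add_mul _ _ _).trans (by rw [hc.1, hc'.1, add_smul]),
      (mul_add _ _ _).trans (by rw [hc.2, hc'.2, add_smul])⟩
  · rintro t a _ ⟨c, hc⟩
    exact ⟨t * c, (smul_mul_assoc _ _ _).trans (by rw [hc.1, mul_smul]),
      (mul_smul_comm _ _ _).trans (by rw [hc.2, mul_smul])⟩

theorem exists_smul_simpleGen (v : V) (x : (vtxSimple I v).obj 0) :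
    ∃ c : K, x = c • simpleGen I v :=
  exists_smul_simpleMk (vtx I v).2 ((isComplete_vtx I).mul_self v)
    (fun _ ha => (exists_smul_of_mem_grd_zero ha v).imp fun _ h => h.1) x

theorem act_simpleGen_self (v : V) :
    (vtxSimple I v).act 0 0 0 (zero_add 0) (vtx I v) (simpleGen I v) = simpleGen I v :=
  act_simpleMk (vtx I v).2 ((isComplete_vtx I).mul_self v)

theorem act_simpleGen_of_ne {v w : V} (h : w ≠ v) :
    (vtxSimple I v).act 0 0 0 (zero_add 0) (vtx I w) (simpleGen I v) = 0 :=
  congrArg (Submodule.Quotient.mk (p := (rad _).carrier 0))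
    (a₁ := (cyclic (grd I) (vtx I v : PathAlg K V ⧸ I)).act 0 0 0 (zero_add 0) (vtx I w)
      (cyclicGen (vtx I v).2 ((isComplete_vtx I).mul_self v))) (a₂ := 0)
    (Subtype.ext (Subtype.ext ((isComplete_vtx I).mul_of_ne w v h)))

variable {I} in
/-- The coordinate on the one-dimensional space `K_v`. -/
theorem exists_simpleCoeff (hI : IsQuiverRelations I) (v : V) :
    ∃ lam : (vtxSimple I v).obj 0 →ₗ[K] K, lam (simpleGen I v) = 1 := by
  obtain ⟨f, hf, -⟩ := exists_vtx_coeff hI.le_sq v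
  refine ⟨Submodule.liftQ _ (f ∘ₗ Submodule.subtype _) fun x hx => ?_, hf⟩
  have hx0 : x = 0 := rad_eq_zero (m := 0) (fun j hj y => Subtype.ext (Subtype.ext
    ((Submodule.mem_bot K).1 (NonnegGraded.eq_bot (𝓑 := grd I) j hj ▸ y.1.2)))) le_rfl hx
  rw [hx0]
  exact map_zero _

theorem finiteDimensional_vtxSimple (v : V) : FiniteDimensional K ((vtxSimple I v).obj 0) :=
  Module.Finite.of_surjective (LinearMap.toSpanSingleton K _ (simpleGen I v)) fun x => by
    obtain ⟨c, rfl⟩ := exists_smul_simpleGen I v x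
    exact ⟨c, rfl⟩

theorem isFG_vtxSimple (v : V) : IsFG (vtxSimple I v) := by
  refine ⟨1, fun _ => 0, fun _ => simpleGen I v, fun j => Submodule.eq_top_iff'.2 fun x => ?_⟩
  obtain ⟨x, rfl⟩ := Submodule.Quotient.mk_surjective _ x
  exact Submodule.subset_span ⟨0, j, add_zero j, x.1,
    congrArg (Submodule.Quotient.mk (p := (rad _).carrier j))
      (cyclic_act_gen (vtx I v).2 ((isComplete_vtx I).mul_self v) x).symm⟩

end

variable [∀ a b : V, Fintype (a ⟶ b)] {I : Ideal (PathAlg K V)} [I.IsTwoSided]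

/-- The simple module `K_v` is a direct summand of `A_0`, as an `A_0`-module. -/
theorem exists_equivariant_retract (hI : IsQuiverRelations I) (v : V) :
    ∃ (φ : (vtxSimple I v).obj 0 →ₗ[K] (degZero (grd I)).obj 0)
      (g : (degZero (grd I)).obj 0 →ₗ[K] (vtxSimple I v).obj 0),
      Equivariant (vtx I) φ ∧ Equivariant (vtx I) g ∧ ∀ x, g (φ x) = x := by
  classical
  obtain ⟨lam, hlam⟩ := exists_simpleCoeff hI v
  let φ : (vtxSimple I v).obj 0 →ₗ[K] (degZero (grd I)).obj 0 :=
    (LinearMap.toSpanSingleton K _ (topVtx I v rfl)) ∘ₗ lam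
  have hφ0 : ∀ c : K, φ (c • simpleGen I v) = c • topVtx I v rfl := fun c => by
    rw [map_smul]
    exact congrArg (c • ·) ((congrArg (· • topVtx I v rfl) hlam).trans (one_smul K _))
  have hφ : Equivariant (vtx I) φ := fun w x => by
    obtain ⟨c, rfl⟩ := exists_smul_simpleGen I v x
    by_cases hw : w = v
    · subst hw
      rw [map_smul, act_simpleGen_self, hφ0, map_smul]
      exact congrArg (c • ·) (act_topVtx_self w rfl).symm
    · rw [map_smul, act_simpleGen_of_ne I hw, hφ0, smul_zero, map_zero, map_smul]
      exact ((congrArg (c • ·) (act_topVtx_of_ne hw rfl)).trans (smul_zero c)).symm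
  have hinj : LinearMap.ker φ = ⊥ := (Submodule.eq_bot_iff _).2 fun x hx => by
    obtain ⟨c, rfl⟩ := exists_smul_simpleGen I v x
    have hc : ∑ w, (if w = v then c else 0) • topVtx I w rfl = 0 := by
      refine (Finset.sum_eq_single v (fun w _ hw => ?_) fun h =>
        absurd (Finset.mem_univ v) h).trans ?_
      · rw [if_neg hw, zero_smul]
      · rw [if_pos rfl, ← hφ0]
        exact hx
    have := eq_zero_of_sum_smul_topVtx hI rfl _ hc v
    rw [if_pos rfl] at this
    rw [this, zero_smul]
  obtain ⟨g, hg⟩ := φ.exists_leftInverse_of_injective hinj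
  refine ⟨φ, _, hφ, (isComplete_vtx I).equivariant_average g, fun x => ?_⟩
  rw [LinearMap.sum_apply]
  refine Eq.trans (Finset.sum_congr rfl fun w _ => ?_) ((isComplete_vtx I).sum_act _ 0 x)
  refine (congrArg (fun y => (vtxSimple I v).act 0 0 0 (zero_add 0) (vtx I w) (g y))
    (hφ w x).symm).trans ?_
  refine (congrArg ((vtxSimple I v).act 0 0 0 (zero_add 0) (vtx I w))
    (LinearMap.congr_fun hg _)).trans ?_
  exact (isComplete_vtx I).act_self _ 0 w x

/-- The Koszul complex of a simple module resolves it, and is therefore homotopy equivalent to any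
projective resolution. -/
theorem nonempty_hEquiv_koszulComplex (hI : IsQuiverRelations I) (hK : IsKoszul (grd I)) (v : V)
    {P : CochainComplex (GrMod (grd I)) ℤ} {π : P ⟶ inDegZero (vtxSimple I v)}
    (hπ : IsProjRes π) : Nonempty (HEquiv (koszulComplex (homMod (vtxSimple I v) 0)) P) := by
  have hM : ∀ j, j ≠ 0 → ∀ x : (vtxSimple I v).obj j, x = 0 := fun j => vtxSimple_eq_zero I v
  have := finiteDimensional_vtxSimple I v
  have hlin := isLin_koszulComplex (vtxSimple I v)
  obtain ⟨b, hb⟩ := hπ.bounded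
  obtain ⟨ψ, s, hs⟩ := exists_lift_of_isQuasiIso hπ.quasiIso
    (augmentation (vtxSimple I v) (hM 1 one_ne_zero)) (fun n => (hlin n).projective)
    (b := 0) fun n hn => isZero_koszulComplex _ hn
  obtain ⟨φ, g, hφ, hg, h⟩ := exists_equivariant_retract hI v
  -- The Koszul complex of `K_v` is a direct summand of that of `A_0`.
  have hex : ∀ n q, n + 1 < 0 → IsExactAt (koszulComplex (homMod (vtxSimple I v) 0)) n q :=
    fun n q hn => isExactAt_koszulComplex_of_retract (homLin φ hφ) (homLin g hg)
      (hom_ext fun i f => hval_ext fun x => h _) (isExactAt_koszulComplex_degZero hI hK hn q)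
  have hψ : IsQuasiIso ψ := (isQuasiIso_iff ψ).2 fun n q =>
    ⟨.of_homotopy hs (injAt_augmentation _ hM hI (hex n q)),
      .of_homotopy hs ((isQuasiIso_iff π).1 hπ.quasiIso n q).1 (surjAt_augmentation _ hM n q)⟩
  obtain ⟨H, -⟩ := exists_hEquiv_of_projective hψ (fun n => (hlin n).projective) hπ.projective
    (b := 0) (fun n hn => isZero_koszulComplex _ hn) hb
  exact ⟨H⟩

end QuiverAlgebra

end KoszulDuality

end

noncomputable section

namespace KoszulDuality

open GrMod

section QuiverAlgebra

variable {K V : Type u} [Field K] [Fintype V] [Quiver.{u} V]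
variable [∀ a b : V, Fintype (a ⟶ b)] {I : Ideal (PathAlg K V)} [I.IsTwoSided]

/-! ### Morphisms from the Koszul complex of a simple module to free modules -/

/-- The morphism `A ⊗ Hom_{A_0}(A^!_{-m}, K_v) ⟶ A(m)`, `a ⊗ f ↦ a λ(f(x))`. -/
def evalForm {v : V} (lam : (vtxSimple I v).obj 0 →ₗ[K] K) (m : ℤ) :
    (regular (grd (perp I))).obj (-m - 0) →ₗ[K]
      (tensMod (I := I) (homMod (vtxSimple I v) 0) m ⟶ (regular (grd I)).shift m) where
  toFun x := tcoord (lam ∘ₗ hvalLin x)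
  map_add' x y := tensMod_hom_ext fun q a f => by
    refine (app_tcoord _ q a f).trans ?_
    refine Eq.trans ?_ (congrArg₂ (· + ·) (app_tcoord (lam ∘ₗ hvalLin x) q a f)
      (app_tcoord (lam ∘ₗ hvalLin y) q a f)).symm
    refine Eq.trans (Finset.sum_congr rfl fun w _ => ?_) Finset.sum_add_distrib
    refine (congrArg (· • _) ?_).trans (add_smul _ _ _)
    exact (congrArg lam (map_add (show HomA0 I _ _ _ from (homMod (vtxSimple I v) 0).act 0 m m
      (zero_add m) (vtx (perp I) (op w)) f).1 x y)).trans (map_add lam _ _)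
  map_smul' c x := tensMod_hom_ext fun q a f => by
    refine (app_tcoord _ q a f).trans ?_
    refine Eq.trans ?_ (congrArg (c • ·) (app_tcoord (lam ∘ₗ hvalLin x) q a f)).symm
    refine Eq.trans (Finset.sum_congr rfl fun w _ => ?_)
      (map_sum (LinearMap.lsmul K ((regular (grd I)).obj (m + q)) c) _ _).symm
    refine (congrArg (· • _) ?_).trans (mul_smul c _ _)
    exact (congrArg lam (map_smul (show HomA0 I _ _ _ from (homMod (vtxSimple I v) 0).act 0 m m
      (zero_add m) (vtx (perp I) (op w)) f).1 c x)).trans (map_smul lam _ _)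

theorem app_evalForm {v : V} (lam : (vtxSimple I v).obj 0 →ₗ[K] K) {m : ℤ}
    (x : (regular (grd (perp I))).obj (-m - 0)) (q : ℤ) (a : (regular (grd I)).obj (q + m))
    (f : (homMod (vtxSimple I v) 0).obj m) :
    app (evalForm lam m x) q (tmk _ (q + m) m a f) =
      ∑ w : V, lam (hval ((homMod (vtxSimple I v) 0).act 0 m m (zero_add m)
        (vtx (perp I) (op w)) f) x) •
          degCast (add_comm q m) (rmul (grd I) (add_zero (q + m)) (vtx I w) a) :=
  app_tcoord _ q a f

/-- The value of the morphism `evalForm lam m x` at a generator `1 ⊗ f`. -/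
theorem coe_evalForm_one {v : V} (lam : (vtxSimple I v).obj 0 →ₗ[K] K) {m : ℤ}
    (x : (regular (grd (perp I))).obj (-m - 0)) (f : (homMod (vtxSimple I v) 0).obj m) :
    (show grd I (m + -m) from app (evalForm lam m x) (-m) (tmk _ (-m + m) m
      (degCast (neg_add_cancel m).symm (oneElt I)) f)).1 =
      ∑ w : V, lam (hval f (rmul (grd (perp I)) (add_zero _) (vtx (perp I) (op w)) x)) •
        (vtx I w : PathAlg K V ⧸ I) := by
  refine (congrArg (grd I (m + -m)).subtype (app_evalForm lam x (-m) _ f)).trans ?_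
  refine (map_sum (grd I (m + -m)).subtype _ _).trans (Finset.sum_congr rfl fun w _ => ?_)
  refine (map_smul (grd I (m + -m)).subtype _ _).trans ?_
  exact congrArg (_ • ·) (one_mul (vtx I w : PathAlg K V ⧸ I))

variable (I) in
/-- The element `z ↦ μ(e_v z) [e_v]` of `Hom_{A_0}(A^!_l, K_v)`. -/
def pointHom (v : V) {m : ℤ} (μ : (regular (grd (perp I))).obj (-m - 0) →ₗ[K] K) :
    (homMod (vtxSimple I v) 0).obj m :=
  (⟨LinearMap.toSpanSingleton K _ (simpleGen I v) ∘ₗ μ ∘ₗ (regular (grd (perp I))).act 0 (-m - 0)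
      (-m - 0) (zero_add _) (vtx (perp I) (op v)), fun w z => by
    by_cases hw : w = v
    · subst hw
      refine (congrArg (fun z => μ z • simpleGen I w)
        ((isComplete_vtx (perp I)).act_self (regular _) _ (op w) z)).trans ?_
      refine Eq.trans ?_ (map_smul ((vtxSimple I w).act 0 0 0 (zero_add 0) (vtx I w))
        (μ ((regular (grd (perp I))).act 0 (-m - 0) (-m - 0) (zero_add _) (vtx (perp I) (op w)) z))
        (simpleGen I w)).symm
      exact congrArg (_ • ·) (act_simpleGen_self I w).symm
    · refine (congrArg (fun z => μ z • simpleGen I v)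
        ((isComplete_vtx (perp I)).act_of_ne (regular _) _
          (fun e => hw (op_injective e).symm) z)).trans ?_
      refine Eq.trans ?_ (map_smul ((vtxSimple I v).act 0 0 0 (zero_add 0) (vtx I w))
        (μ ((regular (grd (perp I))).act 0 (-m - 0) (-m - 0) (zero_add _) (vtx (perp I) (op v)) z))
        (simpleGen I v)).symm
      refine Eq.trans ?_ (congrArg (_ • ·) (act_simpleGen_of_ne I hw)).symm
      rw [map_zero, zero_smul, smul_zero]⟩ : HomA0 I (vtxSimple I v) (-m - 0) 0)

theorem hval_pointHom (v : V) {m : ℤ} (μ : (regular (grd (perp I))).obj (-m - 0) →ₗ[K] K)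
    (z : (regular (grd (perp I))).obj (-m - 0)) : hval (pointHom I v μ) z =
      μ ((regular (grd (perp I))).act 0 (-m - 0) (-m - 0) (zero_add _) (vtx (perp I) (op v)) z) •
        simpleGen I v := rfl

theorem vtx_ne_zero (hI : IsQuiverRelations I) (v : V) : (vtx I v : PathAlg K V ⧸ I) ≠ 0 := by
  obtain ⟨f, hf, -⟩ := exists_vtx_coeff hI.le_sq v
  intro h
  have h0 : (show (regular (grd I)).obj 0 from vtx I v) = 0 := Subtype.ext h
  have := hf.symm.trans ((congrArg f h0).trans (map_zero f))
  exact one_ne_zero this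

/-- The morphism `evalForm lam m x` determines `e_v x`. -/
theorem act_eq_zero_of_evalForm (hI : IsQuiverRelations I) {v : V}
    {lam : (vtxSimple I v).obj 0 →ₗ[K] K} (hlam : lam (simpleGen I v) = 1) {m : ℤ}
    (x : (regular (grd (perp I))).obj (-m - 0)) (w : V)
    (h : ∀ f, (show grd I (m + -m) from app (evalForm lam m x) (-m) (tmk _ (-m + m) m
      (degCast (neg_add_cancel m).symm (oneElt I)) f)).1 * (vtx I w : PathAlg K V ⧸ I) = 0) :
    (regular (grd (perp I))).act 0 (-m - 0) (-m - 0) (zero_add _) (vtx (perp I) (op v))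
      (rmul (grd (perp I)) (add_zero _) (vtx (perp I) (op w)) x) = 0 := by
  refine (Module.forall_dual_apply_eq_zero_iff K _).1 fun μ => ?_
  have h1 := h (pointHom I v μ)
  rw [coe_evalForm_one, Finset.sum_mul, Finset.sum_eq_single w] at h1
  · rw [smul_mul_assoc, (isComplete_vtx I).mul_self] at h1
    have h2 := (smul_eq_zero.1 h1).resolve_right (vtx_ne_zero hI w)
    rw [hval_pointHom, map_smul, hlam, smul_eq_mul, mul_one] at h2
    exact h2
  · intro u _ hu
    rw [smul_mul_assoc, (isComplete_vtx I).mul_of_ne _ _ hu, smul_zero]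
  · exact fun h => absurd (Finset.mem_univ w) h

theorem act_eq_zero_of_evalForm_eq_zero (hI : IsQuiverRelations I) {v : V}
    {lam : (vtxSimple I v).obj 0 →ₗ[K] K} (hlam : lam (simpleGen I v) = 1) {m : ℤ}
    (x : (regular (grd (perp I))).obj (-m - 0)) (h : evalForm lam m x = 0) :
    (regular (grd (perp I))).act 0 (-m - 0) (-m - 0) (zero_add _) (vtx (perp I) (op v)) x = 0 := by
  have hx := sum_rmul_vtx (perp I) x
  refine (congrArg _ hx.symm).trans ((map_sum _ _ _).trans (Finset.sum_eq_zero fun w _ => ?_))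
  refine act_eq_zero_of_evalForm hI hlam x w.unop fun f => ?_
  rw [h]
  exact zero_mul _

/-- The morphism `evalForm lam m x` is a cocycle of the dual of the Koszul complex if the product
of `x` with every arrow vanishes. -/
theorem koszulComplex_d_evalForm {v : V} (lam : (vtxSimple I v).obj 0 →ₗ[K] K) {m' m : ℤ}
    (h : m' + 1 = m) (x : (regular (grd (perp I))).obj (-m - 0))
    (hx : ∀ α : Arrows V, rmul (grd (perp I)) (show -m - 0 + 1 = -m' - 0 by omega)
      (arr (perp I) α.2.2.op) x = 0) :
    (koszulComplex (homMod (vtxSimple I v) 0)).d m' m ≫ evalForm lam m x = 0 := by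
  refine tensMod_hom_ext (N := homMod (vtxSimple I v) 0) (j := m') fun q a f => ?_
  refine (congrArg (app (evalForm lam m x) q)
    ((koszulComplex_d_apply _ h q _).trans (td_tmk _ _ _ _ _))).trans ?_
  refine (map_sum (app (evalForm lam m x) q) _ _).trans (Finset.sum_eq_zero fun α _ => ?_)
  refine (app_evalForm lam x q _ _).trans (Finset.sum_eq_zero fun w _ => ?_)
  refine (congrArg (· • _) ?_).trans (zero_smul K _)
  refine (congrArg lam ?_).trans (map_zero lam)
  by_cases hw : w = α.2.1
  · subst hw
    refine (congrArg (fun g => hval g x) (vtx_act_arr _ α.2.2.op _ f)).trans ?_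
    exact (congrArg (hval f) (hx α)).trans (map_zero (show HomA0 I _ _ _ from f).1)
  · exact congrArg (fun g => hval g x)
      (vtx_act_arr_of_ne _ (fun e => hw (op_injective e)) α.2.2.op _ f)

end QuiverAlgebra

end KoszulDuality

end

noncomputable section

namespace KoszulDuality

open GrMod

theorem GrMod.isLin_shift_regular {K : Type u} [Field K] {B : Type u} [Ring B] [Algebra K B]
    {𝓑 : ℤ → Submodule K B} [NonnegGraded 𝓑] {m j : ℤ} (h : m = 0 - j) :
    IsLin 0 j ((regular 𝓑).shift m) := by
  subst h
  exact isLin_of_sum (n := 1) (fun _ => 𝟙 _) (fun _ => 𝟙 _) (by simp)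

theorem GrMod.dualComplex_d_apply {K : Type u} [Field K] {B : Type u} [Ring B] [Algebra K B]
    {𝓑 : ℤ → Submodule K B} [NonnegGraded 𝓑] (P : CochainComplex (GrMod 𝓑) ℤ) (n j : ℤ)
    (η : P.X (-n) ⟶ (regular 𝓑).shift j) :
    app ((dualComplex P).d n (n + 1)) j η = P.d (-(n + 1)) (-n) ≫ η :=
  congrArg (fun f : dual (P.X (-n)) ⟶ dual (P.X (-(n + 1))) => app f j η)
    (CochainComplex.of_d (fun i => dual (P.X (-i))) (fun i => dualMap (P.d (-(i + 1)) (-i))) n)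

/-- A space of dimension at most one embeds into the field. -/
theorem exists_injective_form {K E : Type*} [Field K] [AddCommGroup E] [Module K E] (g : E)
    (h : ∀ z : E, ∃ c : K, z = c • g) : ∃ f : E →ₗ[K] K, ∀ z, f z = 0 → z = 0 := by
  by_cases hg : g = 0
  · refine ⟨0, fun z _ => ?_⟩
    obtain ⟨c, rfl⟩ := h z
    rw [hg, smul_zero]
  · obtain ⟨f, hf⟩ := Module.Projective.exists_dual_eq_one K hg
    refine ⟨f, fun z hz => ?_⟩
    obtain ⟨c, rfl⟩ := h z
    rw [map_smul, hf, smul_eq_mul, mul_one] at hz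
    rw [hz, zero_smul]

section QuiverAlgebra

variable {K V : Type u} [Field K] [Fintype V] [Quiver.{u} V]
variable [∀ a b : V, Fintype (a ⟶ b)] {I : Ideal (PathAlg K V)} [I.IsTwoSided]

/-! ### Artin–Schelter regularity and the socle of the quadratic dual -/

section
variable {P C : CochainComplex (GrMod (grd I)) ℤ} (hC : ∀ n, IsLin 0 (-n) (C.X n))
  (H : HEquiv C P)

include hC in
/-- A linear complex is a direct summand of every complex homotopy equivalent to it, since a
homotopy on it vanishes for reasons of degree. -/
theorem HEquiv.f_g_of_isLin (n : ℤ) : H.f.f n ≫ H.g.f n = 𝟙 _ := by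
  obtain ⟨n, rfl⟩ : ∃ k, n = k + 1 := ⟨n - 1, by omega⟩
  have h : ∀ n, H.a n = 0 := fun n => (hC (n + 1)).hom_eq_zero (hC n) (by omega) _
  rw [H.fg, h, h, Limits.comp_zero, Limits.zero_comp, add_zero, add_zero]

include hC in
/-- A linear complex embeds its cocycles on the diagonal into the cohomology of the dual
complex. -/
theorem eq_zero_of_d_comp_eq {n : ℤ} (φ : C.X (-(n + 1)) ⟶ (regular (grd I)).shift (-(n + 1)))
    (η : P.X (-n) ⟶ (regular (grd I)).shift (-(n + 1)))
    (h : P.d (-(n + 1)) (-n) ≫ η = H.g.f (-(n + 1)) ≫ φ) : φ = 0 := by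
  have h1 : H.f.f (-n) ≫ η = 0 := (hC (-n)).hom_eq_zero
    (isLin_shift_regular (j := n + 1) (by omega)) (by omega) _
  rw [← Category.id_comp φ, ← HEquiv.f_g_of_isLin hC H, Category.assoc, ← h, ← Category.assoc,
    H.f.comm, Category.assoc, h1, Limits.comp_zero]

/-- Transport of cocycles of the dual complex along a homotopy equivalence. -/
theorem dualComplex_cocycle {n : ℤ} {φ : C.X (-(n + 1)) ⟶ (regular (grd I)).shift (-(n + 1))}
    (hφ : C.d (-(n + 1 + 1)) (-(n + 1)) ≫ φ = 0) :
    app ((dualComplex P).d (n + 1) (n + 1 + 1)) (-(n + 1)) (H.g.f (-(n + 1)) ≫ φ) = 0 := by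
  refine (dualComplex_d_apply P (n + 1) _ _).trans ?_
  rw [← Category.assoc, ← H.g.comm, Category.assoc, hφ, Limits.comp_zero]
  rfl

end

theorem isLin_koszulComplex_vtxSimple (v : V) (n : ℤ) :
    IsLin 0 (-n) ((koszulComplex (homMod (vtxSimple I v) 0)).X n) := by
  have := finiteDimensional_vtxSimple I v
  exact isLin_koszulComplex (vtxSimple I v) n

theorem eq_zero_of_forall_act {N : GrMod (grd (perp I))} {l : ℤ} (x : N.obj l)
    (h : ∀ v : V, N.act 0 l l (zero_add l) (vtx (perp I) (op v)) x = 0) : x = 0 :=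
  ((isComplete_vtx_op (perp I)).sum_act N l x).symm.trans (Finset.sum_eq_zero fun v _ => h v)

theorem eq_zero_of_grd_neg {W : Type u} [Fintype W] [Quiver.{u} W] {J : Ideal (PathAlg K W)}
    [J.IsTwoSided] {l : ℤ} (hl : l < 0) (x : (regular (grd J)).obj l) : x = 0 :=
  Subtype.ext ((Submodule.mem_bot K).1
    (NonnegGraded.eq_bot (𝓑 := grd J) l hl ▸ (show grd J l from x).2))

/-- The morphism `evalForm lam m x`, on the term of the Koszul complex. -/
def koszulForm {v : V} (lam : (vtxSimple I v).obj 0 →ₗ[K] K) (m : ℤ) :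
    (regular (grd (perp I))).obj (-m - 0) →ₗ[K]
      ((koszulComplex (homMod (vtxSimple I v) 0)).X m ⟶ (regular (grd I)).shift m) :=
  evalForm lam m

/-- The socle of the right module `A^!` is concentrated in degree `d`. -/
theorem eq_zero_of_rmul_arr_eq_zero (hI : IsQuiverRelations I) (hK : IsKoszul (grd I)) {d : ℕ}
    (hext : ∀ (v : V) (i : ℕ), i ≠ d → ExtIso (vtxSimple I v) i (zero (opGr (grd I))))
    {l l' : ℤ} (h : l + 1 = l') (hl : l ≠ d) (x : (regular (grd (perp I))).obj l)
    (hx : ∀ α : Arrows V, rmul (grd (perp I)) h (arr (perp I) α.2.2.op) x = 0) : x = 0 := by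
  rcases lt_or_ge l 0 with h0 | h0
  · exact eq_zero_of_grd_neg h0 x
  obtain ⟨i, hi⟩ := Int.eq_ofNat_of_zero_le h0
  obtain ⟨n, rfl⟩ : ∃ n, l = -(-(n + 1)) - 0 := ⟨l - 1, by omega⟩
  refine eq_zero_of_forall_act x fun v => ?_
  obtain ⟨P, π, hπ, he⟩ := hext v i (by omega)
  rw [show (i : ℤ) = n + 1 by omega] at he
  obtain ⟨e⟩ := he
  obtain ⟨H⟩ := nonempty_hEquiv_koszulComplex hI hK v hπ
  obtain ⟨lam, hlam⟩ := exists_simpleCoeff hI v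
  obtain ⟨l', rfl⟩ : ∃ k, l' = -k - 0 := ⟨-l', by omega⟩
  obtain rfl : l' = -(n + 1 + 1) := by omega
  refine act_eq_zero_of_evalForm_eq_zero hI hlam x ?_
  have hφ := koszulComplex_d_evalForm lam (show -(n + 1 + 1) + 1 = -(n + 1) by omega) x hx
  -- The element `x` gives a cocycle of the dual complex, which is a coboundary by the vanishing of
  -- `Ext`; but a coboundary on the diagonal is zero.
  have hcyc := dualComplex_cocycle H (φ := koszulForm lam (-(n + 1)) x) hφ
  have hz : app (cohMk (dualComplex P) (n + 1)) (-(n + 1)) (mkCyc _ hcyc) = 0 :=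
    (congrArg (fun f => app f _ _) e.hom_inv_id).symm.trans (map_zero (app e.inv _))
  obtain ⟨η, hη⟩ := (cohMk_eq_zero_iff _ _ n _).1 hz
  exact eq_zero_of_d_comp_eq (isLin_koszulComplex_vtxSimple v) H (koszulForm lam (-(n + 1)) x) η
    ((dualComplex_d_apply P n _ η).symm.trans hη)

/-- The quadratic dual vanishes in degrees above the global dimension, because the Koszul complex
of `K_v` is a direct summand of a projective resolution of length at most `d`. -/
theorem eq_zero_of_globalDim (hI : IsQuiverRelations I) (hK : IsKoszul (grd I)) {d : ℕ}
    (hd : HasGlobalDim (grd I) d) {l : ℤ} (hl : d < l) (x : (regular (grd (perp I))).obj l) :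
    x = 0 := by
  obtain ⟨m, rfl⟩ : ∃ m, l = -m - 0 := ⟨-l, by omega⟩
  refine eq_zero_of_forall_act x fun v => ?_
  obtain ⟨P, π, hπ, hP⟩ := hd.1 _ (isFG_vtxSimple I v)
  obtain ⟨H⟩ := nonempty_hEquiv_koszulComplex hI hK v hπ
  obtain ⟨lam, hlam⟩ := exists_simpleCoeff hI v
  refine act_eq_zero_of_evalForm_eq_zero hI hlam x ?_
  change koszulForm lam m x = 0
  rw [← Category.id_comp (koszulForm lam m x),
    ← HEquiv.f_g_of_isLin (isLin_koszulComplex_vtxSimple v) H m, Category.assoc,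
    hom_eq_of_isZero_left (hP m (by omega)) (H.g.f m ≫ _) 0, Limits.comp_zero]

theorem exists_smul_of_mem_opGr_zero {a : (PathAlg K V ⧸ I)ᵐᵒᵖ} (ha : a ∈ opGr (grd I) 0) (v : V) :
    ∃ c : K, a * MulOpposite.op (vtx I v : PathAlg K V ⧸ I) =
      c • MulOpposite.op (vtx I v : PathAlg K V ⧸ I) := by
  obtain ⟨c, -, hc⟩ := exists_smul_of_mem_grd_zero (I := I) (a := a.unop) ha v
  exact ⟨c, MulOpposite.unop_injective hc⟩

/-- The socle of the right module `A^!` is the sum of the spaces `e_v A^!_d`; these have dimension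
at most one, and `e_v A^!_d = e_v A^!_d e_{δ(v)}`. -/
theorem exists_perm_socle (hI : IsQuiverRelations I) (hK : IsKoszul (grd I)) {d : ℕ}
    (hd : HasGlobalDim (grd I) d)
    (hext : ∃ (δ : Equiv.Perm V) (n : V → ℤ), ∀ v : V, ExtIso (vtxSimple I v) d
      ((simple (opGr (grd I)) (MulOpposite.op (vtx I (δ v) : PathAlg K V ⧸ I))).shift (n v)))
    {l : ℤ} (hl : l = d) : ∃ δ : Equiv.Perm V, ∀ v,
      (∃ κ : (regular (grd (perp I))).obj l →ₗ[K] K, ∀ x, κ x = 0 →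
        (regular (grd (perp I))).act 0 l l (zero_add l) (vtx (perp I) (op v)) x = 0) ∧
      ∀ w x, w ≠ δ v → (regular (grd (perp I))).act 0 l l (zero_add l) (vtx (perp I) (op v))
        (rmul (grd (perp I)) (add_zero l) (vtx (perp I) (op w)) x) = 0 := by
  obtain ⟨δ, nv, hδ⟩ := hext
  refine ⟨δ, fun v => ?_⟩
  obtain ⟨n, rfl⟩ : ∃ n, l = -(-(n + 1)) - 0 := ⟨l - 1, by omega⟩
  obtain ⟨P, π, hπ, he⟩ := hδ v
  rw [show (d : ℤ) = n + 1 by omega] at he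
  obtain ⟨e⟩ := he
  obtain ⟨H⟩ := nonempty_hEquiv_koszulComplex hI hK v hπ
  obtain ⟨lam, hlam⟩ := exists_simpleCoeff hI v
  have hu : MulOpposite.op (vtx I (δ v) : PathAlg K V ⧸ I) ∈ opGr (grd I) 0 := (vtx I (δ v)).2
  have huu : MulOpposite.op (vtx I (δ v) : PathAlg K V ⧸ I) *
      MulOpposite.op (vtx I (δ v) : PathAlg K V ⧸ I) = MulOpposite.op (vtx I (δ v) : PathAlg K V ⧸ I) :=
    congrArg MulOpposite.op ((isComplete_vtx I).mul_self (δ v))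
  have hcyc := fun x => dualComplex_cocycle H (φ := koszulForm lam (-(n + 1)) x)
    (koszulComplex_d_evalForm lam (show -(n + 1 + 1) + 1 = -(n + 1) by omega) x fun α =>
      eq_zero_of_globalDim hI hK hd (by omega) _)
  -- As `A^!_{d+1} = 0`, every element of `A^!_d` gives a cocycle.
  let cyc : (regular (grd (perp I))).obj (-(-(n + 1)) - 0) →ₗ[K]
      (Sub.ker ((dualComplex P).d (n + 1) (n + 1 + 1))).toMod.obj (-(n + 1)) :=
    LinearMap.codRestrict _ ((Linear.leftComp K _ (H.g.f (-(n + 1)))) ∘ₗ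
      koszulForm lam (-(n + 1))) hcyc
  constructor
  -- The class of the cocycle in `Ext^d`, which has dimension at most one in each degree,
  -- determines `e_v x`.
  · obtain ⟨g, hg⟩ := exists_generator_simple hu huu
      (fun a ha => exists_smul_of_mem_opGr_zero ha (δ v)) (nv v + -(n + 1))
    obtain ⟨f, hf⟩ := exists_injective_form g hg
    refine ⟨f ∘ₗ app e.hom (-(n + 1)) ∘ₗ app (cohMk (dualComplex P) (n + 1)) (-(n + 1)) ∘ₗ cyc,
      fun x hx => act_eq_zero_of_evalForm_eq_zero hI hlam x ?_⟩
    have h1 := hf _ hx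
    have hz : app (cohMk (dualComplex P) (n + 1)) (-(n + 1)) (cyc x) = 0 :=
      (congrArg (fun f => app f _ _) e.hom_inv_id).symm.trans
        ((congrArg (app e.inv _) h1).trans (map_zero (app e.inv _)))
    obtain ⟨η, hη⟩ := (cohMk_eq_zero_iff _ _ n _).1 hz
    exact eq_zero_of_d_comp_eq (isLin_koszulComplex_vtxSimple v) H (koszulForm lam (-(n + 1)) x) η
      ((dualComplex_d_apply P n _ η).symm.trans hη)
  -- The idempotent of `δ(v)` acts as the identity on `Ext^d`, hence also on the cocycle given by
  -- `x`.
  · intro w x hw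
    have hinj : ∀ z z', app e.hom (-(n + 1)) z = app e.hom (-(n + 1)) z' → z = z' :=
      fun z z' h => (congrArg (fun f => app f (-(n + 1)) z) e.hom_inv_id).symm.trans
        ((congrArg (app e.inv _) h).trans (congrArg (fun f => app f (-(n + 1)) z') e.hom_inv_id))
    have hz : app (cohMk (dualComplex P) (n + 1)) (-(n + 1))
        ((Sub.ker ((dualComplex P).d (n + 1) (n + 1 + 1))).toMod.act 0 (-(n + 1)) (-(n + 1))
          (zero_add _) ⟨_, hu⟩ (cyc x)) =
          app (cohMk (dualComplex P) (n + 1)) (-(n + 1)) (cyc x) := by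
      refine (app_act (cohMk (dualComplex P) (n + 1)) _ _ _ _ _ _).trans ?_
      refine hinj _ _ ((app_act e.hom _ _ _ _ _ _).trans ?_)
      exact simple_act_self hu huu (fun a ha => exists_smul_of_mem_opGr_zero ha (δ v)) _ _ _
    obtain ⟨η, hη⟩ := (cohMk_eq_iff _ _ n _ _).1 hz
    let φ := koszulForm lam (-(n + 1)) x
    let φ' : (koszulComplex (homMod (vtxSimple I v) 0)).X (-(n + 1)) ⟶
        (regular (grd I)).shift (-(n + 1)) :=
      (dual _).act 0 (-(n + 1)) (-(n + 1)) (zero_add _)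
        (⟨MulOpposite.op (vtx I (δ v) : PathAlg K V ⧸ I), hu⟩ : opGr (grd I) 0) φ
    have h0 : φ' - φ = 0 := eq_zero_of_d_comp_eq (isLin_koszulComplex_vtxSimple v) H (φ' - φ) η
      ((dualComplex_d_apply P n _ η).symm.trans (hη.trans (Preadditive.comp_sub _ φ' φ).symm))
    refine act_eq_zero_of_evalForm hI hlam x w fun f => ?_
    have h1 := congrArg (fun ψ : (koszulComplex (homMod (vtxSimple I v) 0)).X (-(n + 1)) ⟶
      (regular (grd I)).shift (-(n + 1)) => (show grd I (-(n + 1) + -(-(n + 1))) from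
        app ψ (-(-(n + 1))) (tmk _ (-(-(n + 1)) + -(n + 1)) (-(n + 1))
          (degCast (neg_add_cancel (-(n + 1))).symm (oneElt I)) f)).1) (sub_eq_zero.1 h0)
    refine (congrArg (· * (vtx I w : PathAlg K V ⧸ I)) h1.symm).trans ?_
    refine (mul_assoc _ _ _).trans ?_
    refine (congrArg (_ * ·) ((isComplete_vtx I).mul_of_ne _ _ (Ne.symm hw))).trans (mul_zero _)

end QuiverAlgebra

end KoszulDuality

end

noncomputable section

namespace KoszulDuality

open GrMod

section QuiverAlgebra

variable {K V : Type u} [Field K] [Fintype V] [Quiver.{u} V]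
variable [∀ a b : V, Fintype (a ⟶ b)] {I : Ideal (PathAlg K V)} [I.IsTwoSided]

/-! ### The quadratic dual is a Frobenius algebra -/

/-- Since the socle lies in degree `d`, an element whose products with all elements of
complementary degree vanish is zero. -/
theorem eq_zero_of_forall_mul_eq_zero {d : ℕ}
    (hsoc : ∀ {l l' : ℤ} (h : l + 1 = l'), l ≠ d → ∀ x : (regular (grd (perp I))).obj l,
      (∀ α : Arrows V, rmul (grd (perp I)) h (arr (perp I) α.2.2.op) x = 0) → x = 0)
    (k : ℕ) {l m : ℤ} (hm : m = k) (h : l + m = d) (x : (regular (grd (perp I))).obj l)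
    (hx : ∀ b, (regular (grd (perp I))).act l m d h x b = 0) : x = 0 := by
  subst hm
  induction k generalizing l with
  | zero =>
    have h1 := hx (oneElt (perp I))
    exact Subtype.ext ((mul_one _).symm.trans (congrArg Subtype.val h1))
  | succ k ih =>
    refine hsoc rfl (by omega) x fun α => ?_
    have h' : l + 1 + k = d := by push_cast at h; omega
    refine ih (rmul (grd (perp I)) rfl (arr (perp I) α.2.2.op) x) h' fun b => ?_
    refine Subtype.ext ((mul_assoc _ _ _).trans (congrArg Subtype.val
      (hx ((regular (grd (perp I))).act 1 k _ (by push_cast; omega) (arr (perp I) α.2.2.op) b))))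

/-- The quadratic dual carries a linear form on `A^!_d` for which the pairings
`A^!_l × A^!_m ⟶ K`, `(x, b) ↦ τ(x b)`, `l + m = d`, are perfect. -/
theorem exists_frobenius (hI : IsQuiverRelations I) (hK : IsKoszul (grd I)) {d : ℕ}
    (hAS : IsASRegular (grd I) (fun v : V => (vtx I v : PathAlg K V ⧸ I)) d) :
    ∃ τ : (regular (grd (perp I))).obj d →ₗ[K] K, ∀ (l m : ℤ) (h : l + m = d),
      (∀ b : (regular (grd (perp I))).obj m,
        (∀ x, τ ((regular (grd (perp I))).act l m d h x b) = 0) → b = 0) ∧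
      ∃ T : ((regular (grd (perp I))).obj l →ₗ[K] K) →ₗ[K] (regular (grd (perp I))).obj m,
        ∀ φ x, τ ((regular (grd (perp I))).act l m d h x (T φ)) = φ x := by
  have hsoc : ∀ {l l' : ℤ} (h : l + 1 = l'), l ≠ d → ∀ x : (regular (grd (perp I))).obj l,
      (∀ α : Arrows V, rmul (grd (perp I)) h (arr (perp I) α.2.2.op) x = 0) → x = 0 :=
    fun h hl x => eq_zero_of_rmul_arr_eq_zero hI hK hAS.ext_left h hl x
  obtain ⟨δ, hδ⟩ := exists_perm_socle hI hK hAS.globalDim hAS.ext_top rfl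
  choose κ hκ using fun v => (hδ v).1
  have hδ := fun v => (hδ v).2
  let L : V → (regular (grd (perp I))).obj d →ₗ[K] (regular (grd (perp I))).obj d := fun v =>
    (regular (grd (perp I))).act 0 d d (zero_add _) (vtx (perp I) (op v))
  let R : V → (regular (grd (perp I))).obj d →ₗ[K] (regular (grd (perp I))).obj d := fun v =>
    rmul (grd (perp I)) (add_zero _) (vtx (perp I) (op v))
  have hLL : ∀ v x, L v (L v x) = L v x := fun v x =>
    (isComplete_vtx_op (perp I)).act_self (regular _) _ v x
  have hLne : ∀ v w, v ≠ w → ∀ x, L v (L w x) = 0 := fun v w h x =>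
    (isComplete_vtx_op (perp I)).act_of_ne (regular _) _ h x
  have hL : ∀ x, ∑ v, L v x = x := fun x => (isComplete_vtx_op (perp I)).sum_act (regular _) _ x
  have hR : ∀ x, ∑ v, R v x = x := fun x => by
    have h1 := Fintype.sum_equiv (equivToOpposite (α := V)) (fun v => R v x)
      (fun v => rmul (grd (perp I)) (add_zero (d : ℤ)) (vtx (perp I) v) x) fun _ => rfl
    exact h1.trans (sum_rmul_vtx (perp I) x)
  -- the Nakayama permutation: `e_v x = x e_{δ(v)}` for `x` in the socle
  have hLR : ∀ v x, L v x = R (δ v) x := fun v x => by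
    have h1 : L v x = L v (R (δ v) x) := by
      conv_lhs => rw [← hR x, map_sum]
      exact Finset.sum_eq_single _ (fun w _ hw => hδ v w x hw) fun h =>
        absurd (Finset.mem_univ _) h
    rw [h1]
    conv_rhs => rw [← hL (R (δ v) x)]
    exact (Finset.sum_eq_single v (fun w _ hw => hδ w _ x fun e => hw (δ.injective e).symm) fun h =>
      absurd (Finset.mem_univ _) h).symm
  -- The form `τ` is injective on each of the lines `e_v A^!_d`.
  let τ : (regular (grd (perp I))).obj d →ₗ[K] K := ∑ v, κ v ∘ₗ L v
  have hτ : ∀ v x, τ (L v x) = 0 → L v x = 0 := fun v x hx => by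
    have h1 : τ (L v x) = κ v (L v x) := by
      refine (LinearMap.sum_apply _ _ _).trans ((Finset.sum_eq_single v (fun w _ hw => ?_) fun h =>
        absurd (Finset.mem_univ _) h).trans (congrArg (κ v) (hLL v x)))
      exact (congrArg (κ w) (hLne w v hw x)).trans (map_zero _)
    exact (hLL v x).symm.trans (hκ v _ (h1.symm.trans hx))
  have hinj : ∀ (l m : ℤ) (h : l + m = d) (x : (regular (grd (perp I))).obj l),
      (∀ b, τ ((regular (grd (perp I))).act l m d h x b) = 0) → x = 0 := fun l m h x hx => by
    rcases lt_or_ge m 0 with hm | hm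
    · exact eq_zero_of_globalDim hI hK hAS.globalDim (by omega) x
    obtain ⟨k, hk⟩ := Int.eq_ofNat_of_zero_le hm
    refine eq_zero_of_forall_mul_eq_zero hsoc k hk h x fun b => eq_zero_of_forall_act _ fun v => ?_
    refine hτ v _ ((congrArg τ (hLR v _)).trans ?_)
    refine (congrArg τ (Subtype.ext (mul_assoc _ _ _))).trans
      (hx (rmul (grd (perp I)) (add_zero m) (vtx (perp I) (op (δ v))) b))
  refine ⟨τ, fun l m h => ?_⟩
  have fl : FiniteDimensional K ((regular (grd (perp I))).obj l) := finiteDimensional_grd (perp I) l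
  have fm : FiniteDimensional K ((regular (grd (perp I))).obj m) := finiteDimensional_grd (perp I) m
  let β : ∀ (l m : ℤ) (h : l + m = d), (regular (grd (perp I))).obj l →ₗ[K]
      Module.Dual K ((regular (grd (perp I))).obj m) := fun l m h =>
    ((regular (grd (perp I))).act l m d h).compr₂ τ
  have hβ : ∀ l m h, Function.Injective (β l m h) := fun l m h =>
    (injective_iff_map_eq_zero _).2 fun x hx => hinj l m h x fun b => LinearMap.congr_fun hx b
  -- The pairing is nondegenerate on the left in all degrees; exchanging `l` and `m` shows that the
  -- dimensions agree, so it is perfect.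
  have hdim : Module.finrank K ((regular (grd (perp I))).obj l) =
      Module.finrank K ((regular (grd (perp I))).obj m) :=
    le_antisymm
      ((LinearMap.finrank_le_finrank_of_injective (hβ l m h)).trans_eq Subspace.dual_finrank_eq)
      ((LinearMap.finrank_le_finrank_of_injective (hβ m l ((add_comm m l).trans h))).trans_eq
        Subspace.dual_finrank_eq)
  have hsurj : Function.Surjective (β l m h) :=
    (LinearMap.injective_iff_surjective_of_finrank_eq_finrank
      (hdim.trans Subspace.dual_finrank_eq.symm)).1 (hβ l m h)
  let γ : (regular (grd (perp I))).obj m →ₗ[K] Module.Dual K ((regular (grd (perp I))).obj l) :=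
    (β l m h).flip
  have hγ0 : ∀ b, (∀ x, τ ((regular (grd (perp I))).act l m d h x b) = 0) → b = 0 := fun b hb =>
    (Module.forall_dual_apply_eq_zero_iff K b).1 fun φ => by
      obtain ⟨x, rfl⟩ := hsurj φ
      exact hb x
  have hγ : Function.Injective γ := (injective_iff_map_eq_zero _).2 fun b hb =>
    hγ0 b fun x => LinearMap.congr_fun hb x
  have hγs : Function.Surjective γ := (LinearMap.injective_iff_surjective_of_finrank_eq_finrank
    (hdim.symm.trans Subspace.dual_finrank_eq.symm)).1 hγ
  refine ⟨hγ0, (LinearEquiv.ofBijective γ ⟨hγ, hγs⟩).symm.toLinearMap, fun φ x => ?_⟩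
  exact LinearMap.congr_fun ((LinearEquiv.ofBijective γ ⟨hγ, hγs⟩).apply_symm_apply φ) x

/-- The modules `Hom_{A_0}(A^!, M_j)` are direct summands of sums of copies of `A^!(d + j)`. -/
theorem isLin_homMod (hI : IsQuiverRelations I) (hK : IsKoszul (grd I)) {d : ℕ}
    (hAS : IsASRegular (grd I) (fun v : V => (vtx I v : PathAlg K V ⧸ I)) d)
    {M : GrMod (grd I)} {j : ℤ} [FiniteDimensional K (M.obj j)] :
    IsLin (d : ℤ) (-j) (homMod M j) := by
  obtain ⟨τ, hτ⟩ := exists_frobenius hI hK hAS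
  choose T hT using fun q : ℤ => (hτ (-q - j) (d - -j + q) (by omega)).2
  have hT0 := fun q : ℤ => (hτ (-q - j) (d - -j + q) (by omega)).1
  -- For a linear form `ψ` on `M_j`, the morphism sending `f` to the element of `A^!` that
  -- represents `ψ ∘ f` under the pairing.
  let s (ψ : M.obj j →ₗ[K] K) : homMod M j ⟶ (regular (grd (perp I))).shift (d - -j) :=
    mkHom (M := homMod M j) (N := (regular (grd (perp I))).shift (d - -j))
      (fun q => T q ∘ₗ LinearMap.compRight K ψ ∘ₗ (HomA0 I M (-q - j) j).subtype)
      fun l q q' h c f => by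
        refine sub_eq_zero.1 (hT0 q' _ fun x => ?_)
        refine (congrArg τ (map_sub ((regular (grd (perp I))).act _ _ _ _ x) _ _)).trans
          ((map_sub τ _ _).trans (sub_eq_zero.2 ((hT q' _ x).trans ?_)))
        refine (hT q (ψ ∘ₗ (show HomA0 I M (-q - j) j from f).1)
          (rmul (grd (perp I)) (by omega) c x)).symm.trans (congrArg τ ?_)
        exact Subtype.ext (mul_assoc _ _ _)
  -- For an element `w` of `M_j`, the morphism `y ↦ (b ↦ ∑_v τ(e_v b y) e_v w)`.
  let r (w : M.obj j) : (regular (grd (perp I))).shift (d - -j) ⟶ homMod M j :=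
    coind (Y := (regular (grd (perp I))).shift (d - -j)) (M := M) (j := j)
      (∑ v : V, LinearMap.toSpanSingleton K _ (M.act 0 j j (zero_add j) (vtx I v) w) ∘ₗ τ ∘ₗ
        (regular (grd (perp I))).act 0 (d - -j + -j) d (by omega) (vtx (perp I) (op v))) fun v y => by
      rw [LinearMap.sum_apply, LinearMap.sum_apply]
      refine (Finset.sum_eq_single v (fun u _ hu => ?_) fun h => absurd (Finset.mem_univ _) h).trans
        (((map_sum (M.act 0 j j (zero_add j) (vtx I v)) _ _).trans (Finset.sum_eq_single v
          (fun u _ hu => ?_) fun h => absurd (Finset.mem_univ _) h)).trans ?_).symm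
      · refine (congrArg (fun z => τ z • M.act 0 j j (zero_add j) (vtx I u) w) ?_).trans
          ((congrArg (· • _) (map_zero τ)).trans (zero_smul K _))
        exact Subtype.ext ((mul_assoc _ _ _).symm.trans ((congrArg (· * _)
          ((isComplete_vtx_op (perp I)).mul_of_ne u v hu)).trans (zero_mul _)))
      · refine (map_smul (M.act 0 j j (zero_add j) (vtx I v)) _ _).trans ?_
        exact (congrArg (_ • ·) ((isComplete_vtx I).act_of_ne M j (Ne.symm hu) w)).trans
          (smul_zero _)
      · refine (map_smul (M.act 0 j j (zero_add j) (vtx I v)) _ _).trans ?_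
        refine (congrArg (_ • ·) ((isComplete_vtx I).act_self M j v w)).trans ?_
        refine congrArg (fun z => τ z • M.act 0 j j (zero_add j) (vtx I v) w) ?_
        exact Subtype.ext ((congrArg (· * _)
          ((isComplete_vtx_op (perp I)).mul_self v)).symm.trans (mul_assoc _ _ _))
  let b := Module.finBasis K (M.obj j)
  refine isLin_of_sum (fun t => s (b.coord t)) (fun t => r (b t)) ?_
  refine hom_ext fun q f => hval_ext fun x => ?_
  -- Summed over a basis of `M_j` and its dual basis, the composites give the identity.
  have h1 : ∀ t, hval (app (s (b.coord t) ≫ r (b t)) q f) x = ∑ v : V,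
      b.coord t (hval f ((regular (grd (perp I))).act 0 (-q - j) (-q - j) (zero_add _)
        (vtx (perp I) (op v)) x)) • M.act 0 j j (zero_add j) (vtx I v) (b t) := fun t => by
    refine (LinearMap.sum_apply _ _ _).trans (Finset.sum_congr rfl fun v _ => ?_)
    refine congrArg (· • M.act 0 j j (zero_add j) (vtx I v) (b t)) (Eq.trans (congrArg τ ?_)
      (hT q (b.coord t ∘ₗ (show HomA0 I M (-q - j) j from f).1)
        ((regular (grd (perp I))).act 0 (-q - j) (-q - j) (zero_add _) (vtx (perp I) (op v)) x)))
    exact Subtype.ext (mul_assoc _ _ _).symm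
  refine (congrArg (hvalLin x) (app_sum Finset.univ (fun t => s (b.coord t) ≫ r (b t)) q f)).trans
    ((map_sum (hvalLin x) _ _).trans ((Finset.sum_congr rfl fun t _ => h1 t).trans ?_))
  refine Finset.sum_comm.trans ((Finset.sum_congr rfl fun v _ => ?_).trans
    ((isComplete_vtx I).sum_act M j (hval f x)))
  have h2 := b.sum_repr (hval f ((regular (grd (perp I))).act 0 (-q - j) (-q - j) (zero_add _)
    (vtx (perp I) (op v)) x))
  have h3 := congrArg (M.act 0 j j (zero_add j) (vtx I v)) h2
  refine Eq.trans ?_ (h3.trans ?_)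
  · refine Eq.symm ((map_sum _ _ _).trans (Finset.sum_congr rfl fun t _ => ?_))
    exact map_smul (M.act 0 j j (zero_add j) (vtx I v)) _ _
  · exact (congrArg (M.act 0 j j (zero_add j) (vtx I v))
      ((show HomA0 I M (-q - j) j from f).2 v x)).trans ((isComplete_vtx I).act_self M j v _)

end QuiverAlgebra

end KoszulDuality

end

noncomputable section

namespace KoszulDuality

namespace GrMod

section StrandIso

variable {K : Type u} [Field K] {B : Type u} [Ring B] [Algebra K B]
variable {𝓑 : ℤ → Submodule K B} [NonnegGraded 𝓑]

/-! ### Isomorphisms of linear strands with total complexes -/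

section
variable {E : BiCx 𝓑} (κ : E.Contraction) {c : ℤ} (hE : ∀ i j, IsLin c (-j) (E.T i j))
  {P : CochainComplex (GrMod 𝓑) ℤ} (hP : IsMinimal P) (D : LinDecomp c P) (Q : TotEquiv E P)

/-- The isomorphism `isoH`, on the term of index `i` of the `l`-linear strand. -/
def strandIso {l j i a : ℤ} (h : l + j = i) (ha : -j = a) : D.part i a ≅ κ.H l j :=
  eqToIso (congrArg (D.part i) ha.symm) ≪≫ isoH κ hE hP D Q h

theorem comp_strandIso {l j i a a' : ℤ} (h : l + j = i) (ha : -j = a) (ha' : -(j + 1) = a') :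
    D.comp i a a' ≫ (strandIso κ hE hP D Q (show l + (j + 1) = i + 1 by omega) ha').hom =
      l.negOnePow • ((strandIso κ hE hP D Q h ha).hom ≫ κ.tH l j) := by
  subst ha ha'
  simp only [strandIso, eqToIso_refl, Iso.refl_trans]
  exact comp_toH κ hE hP D Q h

end

theorem BiCx.tinc_tot_d (E : BiCx 𝓑) {i j p q : ℤ} (h : i + j = p) (hq : p + 1 = q) :
    E.tinc h ≫ E.tot.d p q = E.d i j ≫ E.tinc (show i + 1 + j = q by omega) +
      i.negOnePow • (E.t i j ≫ E.tinc (show i + (j + 1) = q by omega)) := by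
  subst hq
  exact (congrArg (E.tinc h ≫ ·) (E.tot_d p)).trans (E.tinc_totD h)

section
variable {c : ℤ} {P : CochainComplex (GrMod 𝓑) ℤ} (hP : IsMinimal P) (D : LinDecomp c P)

theorem strand_d (l i : ℤ) : (strand hP D l).d i (i + 1) = D.comp i (l - i) (l - (i + 1)) :=
  CochainComplex.of_d (fun i => D.part i (l - i)) (fun i => D.comp i (l - i) (l - (i + 1))) i

/-- A double complex with zero differential `d''` is isomorphic to the direct sum of the linear
strands if its terms are, compatibly with the differential `d'`. -/
theorem nonempty_sumComplex_iso {E : BiCx 𝓑} (hd : ∀ i j, E.d i j = 0)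
    (σ : ∀ {l j i a : ℤ}, l + j = i → -j = a → (D.part i a ≅ E.T l j))
    (hσ : ∀ {l j i a a' : ℤ} (h : l + j = i) (ha : -j = a) (ha' : -(j + 1) = a'),
      D.comp i a a' ≫ (σ (show l + (j + 1) = i + 1 by omega) ha').hom =
        l.negOnePow • ((σ h ha).hom ≫ E.t l j)) :
    Nonempty (sumComplex (fun l => strand hP D l) ≅ E.tot) := by
  let f (i : ℤ) : dirSum (fun l => D.part i (l - i)) ⟶ E.totX i :=
    desc _ fun l => (σ (show l + (i - l) = i by omega) (by omega)).hom ≫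
      E.tinc (show l + (i - l) = i by omega)
  let g (i : ℤ) : E.totX i ⟶ dirSum (fun l => D.part i (l - i)) :=
    desc _ fun t : Diag i => (σ t.2 (show -t.1.2 = t.1.1 - i by have := t.2; omega)).inv ≫
      incl (fun l => D.part i (l - i)) t.1.1
  have hf : ∀ {l j i : ℤ} (h : l + j = i), incl (fun l => D.part i (l - i)) l ≫ f i =
      (σ h (show -j = l - i by omega)).hom ≫ E.tinc h := fun {l j i} h => by
    obtain rfl : j = i - l := by omega
    exact incl_desc _ _ _
  have hg : ∀ {l j i : ℤ} (h : l + j = i), E.tinc h ≫ g i =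
      (σ h (show -j = l - i by omega)).inv ≫ incl (fun l => D.part i (l - i)) l :=
    fun h => incl_desc _ _ _
  let e (i : ℤ) : dirSum (fun l => D.part i (l - i)) ≅ E.totX i :=
    { hom := f i
      inv := g i
      hom_inv_id := dirSum_hom_ext fun l => by
        rw [← Category.assoc, hf (show l + (i - l) = i by omega), Category.assoc, hg,
          Iso.hom_inv_id_assoc, Category.comp_id]
      inv_hom_id := E.totX_hom_ext fun l j h => by
        rw [← Category.assoc, hg, Category.assoc, hf h, Iso.inv_hom_id_assoc, Category.comp_id] }
  have key : ∀ {l j i a a' : ℤ} (h : l + j = i) (ha : -j = a) (ha' : -(j + 1) = a'),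
      (σ h ha).hom ≫ (E.d l j ≫ E.tinc (show l + 1 + j = i + 1 by omega) +
        l.negOnePow • (E.t l j ≫ E.tinc (show l + (j + 1) = i + 1 by omega))) =
      D.comp i a a' ≫ (σ (show l + (j + 1) = i + 1 by omega) ha').hom ≫ E.tinc _ :=
    fun {l j i a a'} h ha ha' => by
      rw [← Category.assoc (D.comp i a a'), hσ h ha, hd, Limits.zero_comp, zero_add, Linear.comp_units_smul,
        Linear.units_smul_comp, Category.assoc]
  refine ⟨HomologicalComplex.Hom.isoOfComponents e fun i i' hi => ?_⟩
  obtain rfl : i + 1 = i' := hi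
  refine dirSum_hom_ext fun l => ?_
  have h : l + (i - l) = i := by omega
  have h' : l + (i - l + 1) = i + 1 := by omega
  refine (Category.assoc _ _ _).symm.trans ((congrArg (· ≫ E.tot.d i (i + 1)) (hf h)).trans ?_)
  refine (Category.assoc _ _ _).trans ((congrArg (_ ≫ ·) (E.tinc_tot_d h rfl)).trans ?_)
  refine Eq.trans ?_ (congrArg (fun u : dirSum (fun l => (strand hP D l).X i) ⟶
    dirSum (fun l => (strand hP D l).X (i + 1)) => incl (fun l => (strand hP D l).X i) l ≫ u ≫
      f (i + 1)) (CochainComplex.of_d (fun i => dirSum fun l => (strand hP D l).X i)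
        (fun i => dirSumMap fun l => (strand hP D l).d i (i + 1)) i)).symm
  refine Eq.trans ?_ (incl_desc_assoc (fun l => (strand hP D l).X i)
    (fun l => (strand hP D l).d i (i + 1) ≫ incl (fun l => (strand hP D l).X (i + 1)) l) l
    (f (i + 1))).symm
  refine Eq.trans ?_ (Category.assoc _ _ _).symm
  refine Eq.trans ?_ (congrArg₂ (· ≫ ·) (strand_d hP D l i) (hf h')).symm
  exact key h (by omega) (by omega)

/-- A double complex concentrated in one row is isomorphic to the shifted `l`-linear strand if its
terms are, compatibly with the differential `d'`. -/
theorem nonempty_strand_iso {E : BiCx 𝓑} (hE : ∀ i j, i ≠ 0 → Limits.IsZero (E.T i j))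
    (hd : ∀ i j, E.d i j = 0) {l : ℤ}
    (σ : ∀ {j i a : ℤ}, l + j = i → -j = a → (D.part i a ≅ E.T 0 j))
    (hσ : ∀ {j i a a' : ℤ} (h : l + j = i) (ha : -j = a) (ha' : -(j + 1) = a'),
      D.comp i a a' ≫ (σ (show l + (j + 1) = i + 1 by omega) ha').hom =
        l.negOnePow • ((σ h ha).hom ≫ E.t 0 j)) :
    Nonempty (strand hP D l ≅ E.tot⟦-l⟧) := by
  have hz : ∀ p, E.tprj (zero_add p) ≫ E.tinc (zero_add p) = 𝟙 _ := fun p =>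
    E.totX_hom_ext fun i j h => by
      by_cases hi : i = 0
      · subst hi
        obtain rfl : j = p := by omega
        rw [← Category.assoc, E.tinc_tprj, Category.id_comp, Category.comp_id]
      · exact hom_eq_of_isZero_left (hE i j hi) _ _
  -- The sign `(-1)^l` in the linear part of the differential of `P` is absorbed by that of the
  -- shifted differential of the total complex.
  let ρ (p : ℤ) : E.T 0 p ≅ E.totX p := ⟨E.tinc (zero_add p), E.tprj (zero_add p),
    E.tinc_tprj _, hz p⟩
  let e (i : ℤ) : D.part i (l - i) ≅ E.totX (i + -l) :=
    σ (show l + (i + -l) = i by omega) (by omega) ≪≫ ρ (i + -l)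
  have he : ∀ {i j : ℤ} (h : j = i + -l), (e i).hom =
      (σ (show l + j = i by omega) (show -j = l - i by omega)).hom ≫
        E.tinc (show 0 + j = i + -l by omega) := fun h => by
    subst h
    rfl
  have key : ∀ {j i a a' p : ℤ} (h : l + j = i) (ha : -j = a) (ha' : -(j + 1) = a')
      (hp : j + 1 = p), (-l).negOnePow • ((σ h ha).hom ≫
        (E.d 0 j ≫ E.tinc (show 0 + 1 + j = p by omega) +
          (0 : ℤ).negOnePow • (E.t 0 j ≫ E.tinc (show 0 + (j + 1) = p by omega)))) =
      D.comp i a a' ≫ (σ (show l + (j + 1) = i + 1 by omega) ha').hom ≫ E.tinc _ :=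
    fun {j i a a' p} h ha ha' hp => by
      rw [← Category.assoc (D.comp i a a'), hσ h ha, hd, Limits.zero_comp, zero_add,
        Int.negOnePow_zero, one_smul, Linear.units_smul_comp, Category.assoc, Int.negOnePow_neg]
  refine ⟨HomologicalComplex.Hom.isoOfComponents e fun i i' hi => ?_⟩
  obtain rfl : i + 1 = i' := hi
  refine (congrArg (_ ≫ ·) (CochainComplex.shiftFunctor_obj_d' E.tot (-l) i (i + 1))).trans ?_
  refine (Linear.comp_units_smul _ _ _).trans ?_
  refine (congrArg ((-l).negOnePow • ·) ((congrArg (· ≫ _) (he rfl)).trans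
    ((Category.assoc _ _ _).trans (congrArg (_ ≫ ·) (E.tinc_tot_d _
      (show i + -l + 1 = i + 1 + -l by ring)))))).trans ?_
  refine Eq.trans ?_ (congrArg₂ (· ≫ ·) (strand_d hP D l i)
    (he (show i + -l + 1 = i + 1 + -l by omega))).symm
  exact key (show l + (i + -l) = i by omega) (show -(i + -l) = l - i by ring)
    (show -(i + -l + 1) = l - (i + 1) by ring) (by ring)

end

/-! ### Finiteness of total complexes -/

/-- If only finitely many columns are nonzero, every diagonal has finitely many nonzero terms. -/
theorem exists_finset_diag {a b : ℤ} {F : ℤ → ℤ → GrMod 𝓑}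
    (hF : ∀ i j, i < a ∨ b < i → Limits.IsZero (F i j)) (p : ℤ) :
    ∃ s : Finset (Diag p), ∀ t ∉ s, Limits.IsZero (F t.1.1 t.1.2) := by
  classical
  refine ⟨(Finset.Icc a b).image fun i => ⟨(i, p - i), by simp⟩, fun t ht => hF _ _ ?_⟩
  by_contra! h
  refine ht (Finset.mem_image.2 ⟨t.1.1, Finset.mem_Icc.2 h, Subtype.ext (Prod.ext rfl ?_)⟩)
  have := t.2
  change p - t.1.1 = t.1.2
  omega

theorem BiCx.Contraction.isZero_H {E : BiCx 𝓑} (κ : E.Contraction) {i j : ℤ}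
    (h : Limits.IsZero (E.T i j)) : Limits.IsZero (κ.H i j) :=
  isZero_iff.2 fun q x => by
    have h1 := congrArg (fun f => app f q x) (κ.ι_p i j)
    refine h1.symm.trans ((congrArg (app (κ.p i j) q) (isZero_iff.1 h q _)).trans (map_zero _))

theorem exists_bound {a b : ℤ} {q : ℤ → ℤ → Prop} (h : ∀ i, ∃ m, ∀ j, m < j → q i j) :
    ∃ m, ∀ i, a ≤ i → i ≤ b → ∀ j, m < j → q i j := by
  choose m hm using h
  obtain ⟨M, hM⟩ := ((Finset.Icc a b).image m).exists_le
  exact ⟨M, fun i ha hb j hj => hm i j ((hM _ (Finset.mem_image_of_mem m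
    (Finset.mem_Icc.2 ⟨ha, hb⟩))).trans_lt hj)⟩

end StrandIso

end GrMod

end KoszulDuality

end

noncomputable section

namespace KoszulDuality

open GrMod

section QuiverAlgebra

variable {K V : Type u} [Field K] [Fintype V] [Quiver.{u} V]
variable [∀ a b : V, Fintype (a ⟶ b)] {I : Ideal (PathAlg K V)} [I.IsTwoSided]

/-! ### Linear strands of the Koszul duality functors -/

theorem cohomologyComplex_d {B : Type u} [Ring B] [Algebra K B] {𝓑 : ℤ → Submodule K B}
    [NonnegGraded 𝓑] (C : CochainComplex (GrMod 𝓑) ℤ) (i : ℤ) :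
    (show cohomology C i ⟶ cohomology C (i + 1) from (cohomologyComplex C).d i (i + 1)) = 0 :=
  CochainComplex.of_d (cohomology C) (fun _ => 0) i

theorem tensMap_zero (N N' : GrMod (grd (perp I))) (j : ℤ) :
    tensMap (I := I) (0 : N ⟶ N') j = 0 :=
  tensMod_hom_ext fun q a _ => map_zero (tmk N' (q + j) j a)

theorem homMap_zero (M M' : GrMod (grd I)) (j : ℤ) : homMap (I := I) (0 : M ⟶ M') j = 0 :=
  hom_ext fun _ _ => hval_ext fun _ => rfl

/-- The isomorphism `A ⊗ N_j ≅ A ⊗ N'_j` induced by an isomorphism. -/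
def tensIso {N N' : GrMod (grd (perp I))} (e : N ≅ N') (j : ℤ) :
    tensMod (I := I) N j ≅ tensMod N' j where
  hom := tensMap e.hom j
  inv := tensMap e.inv j
  hom_inv_id := tensMod_hom_ext fun _ a x => congrArg (tmk N _ _ a)
    (congrArg (fun f => app f j x) e.hom_inv_id)
  inv_hom_id := tensMod_hom_ext fun _ a x => congrArg (tmk N' _ _ a)
    (congrArg (fun f => app f j x) e.inv_hom_id)

/-- The isomorphism `Hom(A^!, M_j) ≅ Hom(A^!, M'_j)` induced by an isomorphism. -/
def homIso {M M' : GrMod (grd I)} (e : M ≅ M') (j : ℤ) : homMod (I := I) M j ≅ homMod M' j where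
  hom := homMap e.hom j
  inv := homMap e.inv j
  hom_inv_id := hom_ext fun _ f => hval_ext fun x =>
    congrArg (fun g => app g j (hval f x)) e.hom_inv_id
  inv_hom_id := hom_ext fun _ f => hval_ext fun x =>
    congrArg (fun g => app g j (hval f x)) e.inv_hom_id

section F
variable {N : CochainComplex (GrMod (grd (perp I))) ℤ}

/-- The linear strands of a minimal complex homotopy equivalent to `F(N)`. -/
theorem nonempty_strands_F (hN : ∀ i j, FiniteDimensional K ((N.X i).obj j))
    {P : CochainComplex (GrMod (grd I)) ℤ} (hP : IsMinimal P) (D : LinDecomp 0 P)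
    (H : HEquiv P (koszulF N)) :
    (∀ l : ℤ, Nonempty (strand hP D l ≅ (koszulF (inDegZero (cohomology N l)))⟦-l⟧)) ∧
      Nonempty (sumComplex (fun l => strand hP D l) ≅ koszulF (cohomologyComplex N)) := by
  let κ := FContraction N fun j => (exists_splitting N j (isComplete_vtx_op (perp I))).some
  have hE : ∀ i j, IsLin 0 (-j) ((FBi N).T i j) := fun i j =>
    have := hN i j
    isLin_tensMod
  let Q : TotEquiv (FBi N) P := .ofHEquiv H
  constructor
  · intro l
    let θ : ∀ j, κ.H l j ≅ (FBi (inDegZero (cohomology N l))).T 0 j :=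
      tensIso (inDegZeroIso (cohomology N l) rfl).symm
    refine nonempty_strand_iso hP D (E := FBi (inDegZero (cohomology N l))) ?_ ?_
      (fun h ha => strandIso κ hE hP D Q h ha ≪≫ θ _) ?_
    · exact fun i j hi => isZero_iff.2 fun q t => tens_eq_zero (fun x => inDegZero_eq_zero _ hi x) t
    · exact fun i j => tensMap_zero _ _ j
    · intro j i a a' h ha ha'
      have h1 : κ.tH l j ≫ (θ (j + 1)).hom =
          (θ j).hom ≫ (FBi (inDegZero (cohomology N l))).t 0 j :=
        (tensMap_tensD (inDegZeroIso (cohomology N l) rfl).inv j).symm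
      rw [Iso.trans_hom, Iso.trans_hom, ← Category.assoc, comp_strandIso κ hE hP D Q h ha ha',
        Linear.units_smul_comp, Category.assoc, Category.assoc, h1]
  · refine nonempty_sumComplex_iso hP D (E := FBi (cohomologyComplex N)) ?_
      (fun h ha => strandIso κ hE hP D Q h ha) fun h ha ha' => comp_strandIso κ hE hP D Q h ha ha'
    exact fun i j => (congrArg (fun f : cohomology N i ⟶ cohomology N (i + 1) => tensMap f j)
      (cohomologyComplex_d N i)).trans (tensMap_zero _ _ j)

end F

section G
variable {M : CochainComplex (GrMod (grd I)) ℤ}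

/-- The linear strands of a minimal complex homotopy equivalent to `G(M)`. -/
theorem nonempty_strands_G {d : ℕ} (hE : ∀ i j, IsLin (d : ℤ) (-j) ((GBi M).T i j))
    {P : CochainComplex (GrMod (grd (perp I))) ℤ} (hP : IsMinimal P) (D : LinDecomp (d : ℤ) P)
    (H : HEquiv P (koszulG M)) :
    (∀ l : ℤ, Nonempty (strand hP D l ≅ (koszulG (inDegZero (cohomology M l)))⟦-l⟧)) ∧
      Nonempty (sumComplex (fun l => strand hP D l) ≅ koszulG (cohomologyComplex M)) := by
  let κ := GContraction M fun j => (exists_splitting M j (isComplete_vtx I)).some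
  let Q : TotEquiv (GBi M) P := .ofHEquiv H
  constructor
  · intro l
    let θ : ∀ j, κ.H l j ≅ (GBi (inDegZero (cohomology M l))).T 0 j :=
      homIso (inDegZeroIso (cohomology M l) rfl).symm
    refine nonempty_strand_iso hP D (E := GBi (inDegZero (cohomology M l))) ?_ ?_
      (fun h ha => strandIso κ hE hP D Q h ha ≪≫ θ _) ?_
    · exact fun i j hi => isZero_iff.2 fun q f => hval_ext fun x =>
        (inDegZero_eq_zero _ hi _).trans (inDegZero_eq_zero _ hi _).symm
    · exact fun i j => homMap_zero _ _ j
    · intro j i a a' h ha ha'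
      have h1 : κ.tH l j ≫ (θ (j + 1)).hom =
          (θ j).hom ≫ (GBi (inDegZero (cohomology M l))).t 0 j :=
        (homMap_homD (inDegZeroIso (cohomology M l) rfl).inv j).symm
      rw [Iso.trans_hom, Iso.trans_hom, ← Category.assoc, comp_strandIso κ hE hP D Q h ha ha',
        Linear.units_smul_comp, Category.assoc, Category.assoc, h1]
  · refine nonempty_sumComplex_iso hP D (E := GBi (cohomologyComplex M)) ?_
      (fun h ha => strandIso κ hE hP D Q h ha) fun h ha ha' => comp_strandIso κ hE hP D Q h ha ha'
    exact fun i j => (congrArg (fun f : cohomology M i ⟶ cohomology M (i + 1) => homMap f j)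
      (cohomologyComplex_d M i)).trans (homMap_zero _ _ j)

end G

end QuiverAlgebra

end KoszulDuality

end

noncomputable section

namespace KoszulDuality

open GrMod

section QuiverAlgebra

variable {K V : Type u} [Field K] [Fintype V] [Quiver.{u} V]
variable [∀ a b : V, Fintype (a ⟶ b)] {I : Ideal (PathAlg K V)} [I.IsTwoSided]

/-! ### Minimal resolutions -/

theorem finiteDimensional_cohomology {B : Type u} [Ring B] [Algebra K B] {𝓑 : ℤ → Submodule K B}
    [NonnegGraded 𝓑] {C : CochainComplex (GrMod 𝓑) ℤ} {i j : ℤ}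
    [FiniteDimensional K ((C.X i).obj j)] : FiniteDimensional K ((cohomology C i).obj j) := by
  have : FiniteDimensional K ((Sub.ker (C.d i (i + 1))).toMod.obj j) :=
    inferInstanceAs (FiniteDimensional K ((Sub.ker (C.d i (i + 1))).carrier j))
  exact Module.Finite.of_surjective (app (cohMk C i) j) (cohMk_surjective C j i)

/-- Resolutions of `F(N)`, for a bounded complex `N` of finitely generated modules over the
finite-dimensional algebra `A^!`. -/
theorem exists_minimal_F {d : ℕ} (hdim : ∀ l : ℤ, d < l → ∀ x : grd (perp I) l, x = 0)
    {N : CochainComplex (GrMod (grd (perp I))) ℤ} (hN : IsBoundedFG N) :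
    (∃ (P : CochainComplex (GrMod (grd I)) ℤ) (π : P ⟶ koszulF N),
        IsProjRes π ∧ IsMinimal P ∧ Nonempty (LinDecomp 0 P)) ∧
      ∀ (P : CochainComplex (GrMod (grd I)) ℤ) (π : P ⟶ koszulF N), IsProjRes π →
        ∀ (hP : IsMinimal P) (D : LinDecomp 0 P),
          (∀ l : ℤ, Nonempty (strand hP D l ≅ (koszulF (inDegZero (cohomology N l)))⟦-l⟧)) ∧
          Nonempty (sumComplex (fun l => strand hP D l) ≅ koszulF (cohomologyComplex N)) := by
  obtain ⟨hfg, a, b, hab⟩ := hN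
  have hfd : ∀ i j, FiniteDimensional K ((N.X i).obj j) := fun i j =>
    (hfg i).finiteDimensional (finiteDimensional_grd (perp I)) j
  have hE : ∀ i j, IsLin 0 (-j) ((FBi N).T i j) := fun i j =>
    have := hfd i j
    isLin_tensMod
  obtain ⟨m, hm⟩ := exists_bound (a := a) (b := b) (q := fun i j => ∀ x : (N.X i).obj j, x = 0)
    fun i => (hfg i).exists_eq_zero_of_gt hdim
  have hT : ∀ i j, i < a ∨ b < i → Limits.IsZero ((FBi N).T i j) := fun i j h =>
    isZero_iff.2 fun q t => tens_eq_zero (fun x => isZero_iff.1 (hab i h) j x) t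
  -- The total complex is bounded above, as the terms `N^i_j` vanish for large `j`.
  have hTp : ∀ p, b + m < p → ∀ t : Diag p, Limits.IsZero ((FBi N).T t.1.1 t.1.2) := by
    rintro p hp ⟨⟨i, j⟩, h⟩
    by_cases hi : i < a ∨ b < i
    · exact hT i j hi
    · have h : i + j = p := h
      exact isZero_iff.2 fun q t => tens_eq_zero (hm i (by omega) (by omega) j (by omega)) t
  constructor
  · let κ := FContraction N fun j => (exists_splitting N j (isComplete_vtx_op (perp I))).some
    have hH : ∀ i j, IsLin 0 (-j) (κ.H i j) := fun i j =>
      have := hfd i j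
      have := finiteDimensional_cohomology (C := N) (i := i) (j := j)
      isLin_tensMod
    obtain ⟨P, H, hP, hD, hX⟩ := κ.exists_minimal hT
      (fun i j => (hE i j).isRad (hE i (j + 1)) (by omega) _) hH
    refine ⟨P, H.f, ⟨fun p => ?_, fun p => ?_, ⟨b + m, fun p hp => ?_⟩, H.isQuasiIso⟩, hP, hD⟩
    · rw [hX]
      obtain ⟨s, hs⟩ := exists_finset_diag (fun i j h => κ.isZero_H (hT i j h)) p
      exact isFG_dirSum (fun t => (hH _ _).isFG) s hs
    · rw [hX]
      exact projective_dirSum fun t => (hH _ _).projective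
    · rw [hX]
      exact isZero_dirSum fun t => κ.isZero_H (hTp p hp t)
  · intro P π hπ hP D
    obtain ⟨b', hb'⟩ := hπ.bounded
    obtain ⟨H, -⟩ := exists_hEquiv_of_projective hπ.quasiIso hπ.projective
      (fun p => projective_dirSum fun t : Diag p => (hE t.1.1 t.1.2).projective) hb'
      (b' := b + m) fun p hp => isZero_dirSum (hTp p hp)
    exact nonempty_strands_F hfd hP D H

/-- Resolutions of `G(M)`, for a bounded complex `M` of finitely generated `A`-modules. -/
theorem exists_minimal_G {d : ℕ} (hlin : ∀ (M : GrMod (grd I)) (j : ℤ),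
      FiniteDimensional K (M.obj j) → IsLin (d : ℤ) (-j) (homMod M j))
    {M : CochainComplex (GrMod (grd I)) ℤ} (hM : IsBoundedFG M) :
    (∃ (E : CochainComplex (GrMod (grd (perp I))) ℤ) (η : koszulG M ⟶ E),
        IsInjRes η ∧ IsMinimal E ∧ Nonempty (LinDecomp (d : ℤ) E)) ∧
      ∀ (E : CochainComplex (GrMod (grd (perp I))) ℤ) (η : koszulG M ⟶ E), IsInjRes η →
        ∀ (hE : IsMinimal E) (D : LinDecomp (d : ℤ) E),
          (∀ l : ℤ, Nonempty (strand hE D l ≅ (koszulG (inDegZero (cohomology M l)))⟦-l⟧)) ∧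
          Nonempty (sumComplex (fun l => strand hE D l) ≅ koszulG (cohomologyComplex M)) := by
  obtain ⟨hfg, a, b, hab⟩ := hM
  have hfd : ∀ i j, FiniteDimensional K ((M.X i).obj j) := fun i j =>
    (hfg i).finiteDimensional (finiteDimensional_grd I) j
  have hE : ∀ i j, IsLin (d : ℤ) (-j) ((GBi M).T i j) := fun i j => hlin _ j (hfd i j)
  obtain ⟨m, hm⟩ := exists_bound (a := a) (b := b) (q := fun i j => ∀ x : (M.X i).obj (-j), x = 0)
    fun i => by
      obtain ⟨m, hm⟩ := (hfg i).exists_eq_zero_of_lt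
      exact ⟨-m, fun j hj => hm (-j) (by omega)⟩
  have hhom : ∀ (M : GrMod (grd I)) (j : ℤ), (∀ x : M.obj j, x = 0) →
      Limits.IsZero (homMod (I := I) M j) := fun M j h =>
    isZero_iff.2 fun q f => hval_ext fun x => (h _).trans (h _).symm
  have hT : ∀ i j, i < a ∨ b < i → Limits.IsZero ((GBi M).T i j) := fun i j h =>
    hhom _ j fun x => isZero_iff.1 (hab i h) j x
  -- The total complex is bounded below, as the terms `M^i_j` vanish for small `j`.
  have hTp : ∀ p, p < a - m → ∀ t : Diag p, Limits.IsZero ((GBi M).T t.1.1 t.1.2) := by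
    rintro p hp ⟨⟨i, j⟩, h⟩
    by_cases hi : i < a ∨ b < i
    · exact hT i j hi
    · have h : i + j = p := h
      refine hhom _ j ?_
      have h1 := hm i (by omega) (by omega) (-j) (by omega)
      rwa [neg_neg] at h1
  constructor
  · let κ := GContraction M fun j => (exists_splitting M j (isComplete_vtx I)).some
    have hH : ∀ i j, IsLin (d : ℤ) (-j) (κ.H i j) := fun i j =>
      have := hfd i j
      hlin _ j finiteDimensional_cohomology
    obtain ⟨P, H, hP, hD, hX⟩ := κ.exists_minimal hT
      (fun i j => (hE i j).isRad (hE i (j + 1)) (by omega) _) hH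
    have hs := exists_finset_diag fun i j h => κ.isZero_H (hT i j h)
    refine ⟨P, H.g, ⟨fun p => ?_, fun p => ?_, ⟨a - m, fun p hp => ?_⟩, H.symm.isQuasiIso⟩, hP, hD⟩
    · rw [hX]
      obtain ⟨s, hs⟩ := hs p
      exact isFG_dirSum (fun t => (hH _ _).isFG) s hs
    · rw [hX]
      obtain ⟨s, hs⟩ := hs p
      exact injective_dirSum (fun t => injective_homMod _ _) s hs
    · rw [hX]
      exact isZero_dirSum fun t => κ.isZero_H (hTp p hp t)
  · intro P π hπ hP D
    obtain ⟨b', hb'⟩ := hπ.bounded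
    have hs := exists_finset_diag hT
    obtain ⟨H, -⟩ := exists_hEquiv_of_injective hπ.quasiIso
      (fun p => (hs p).elim fun s hs => injective_dirSum
        (M := fun t : Diag p => (GBi M).T t.1.1 t.1.2) (fun t => injective_homMod _ _) s hs)
      hπ.injective (b := a - m) (fun p hp => isZero_dirSum (hTp p hp)) hb'
    exact nonempty_strands_G hE hP D H.symm

end QuiverAlgebra

end KoszulDuality

end


theorem mainTheorem4 {K V : Type u} [Field K] [Fintype V] [Quiver.{u} V]
    [∀ a b : V, Fintype (a ⟶ b)]
    (I : Ideal (PathAlg K V)) [I.IsTwoSided] (hI : IsQuiverRelations I)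
    (hleft : IsNoetherianRing (PathAlg K V ⧸ I))
    (hright : IsNoetherianRing (PathAlg K V ⧸ I)ᵐᵒᵖ)
    (hKoszul : IsKoszul (grd I)) (d : ℕ)
    (hAS : IsASRegular (grd I) (fun v : V => (vtx I v : PathAlg K V ⧸ I)) d) :
    (∀ N : CochainComplex (GrMod (grd (perp I))) ℤ, IsBoundedFG N →
      (∃ (P : CochainComplex (GrMod (grd I)) ℤ) (π : P ⟶ koszulF N),
        IsProjRes π ∧ IsMinimal P ∧ Nonempty (LinDecomp 0 P)) ∧
      ∀ (P : CochainComplex (GrMod (grd I)) ℤ) (π : P ⟶ koszulF N), IsProjRes π →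
        ∀ (hP : IsMinimal P) (D : LinDecomp 0 P),
          (∀ l : ℤ, Nonempty (strand hP D l ≅ (koszulF (inDegZero (cohomology N l)))⟦-l⟧)) ∧
          Nonempty (sumComplex (fun l => strand hP D l) ≅ koszulF (cohomologyComplex N))) ∧
    (∀ M : CochainComplex (GrMod (grd I)) ℤ, IsBoundedFG M →
      (∃ (E : CochainComplex (GrMod (grd (perp I))) ℤ) (η : koszulG M ⟶ E),
        IsInjRes η ∧ IsMinimal E ∧ Nonempty (LinDecomp (d : ℤ) E)) ∧
      ∀ (E : CochainComplex (GrMod (grd (perp I))) ℤ) (η : koszulG M ⟶ E), IsInjRes η →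
        ∀ (hE : IsMinimal E) (D : LinDecomp (d : ℤ) E),
          (∀ l : ℤ, Nonempty (strand hE D l ≅ (koszulG (inDegZero (cohomology M l)))⟦-l⟧)) ∧
          Nonempty (sumComplex (fun l => strand hE D l) ≅ koszulG (cohomologyComplex M))) := by
  refine ⟨fun N hN => exists_minimal_F (d := d) (fun l hl x => ?_) hN, fun M hM =>
    exists_minimal_G (fun M j _ => isLin_homMod hI hKoszul hAS) hM⟩
  exact eq_zero_of_globalDim hI hKoszul hAS.globalDim hl x
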